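/- Let $m\ge 0$ be an integer. A pencil $L$ is given by $m\times m$ complex matrices $h_0,h_1$ and matrix functions $Q_0,Q_1$ on $(0,\infty)$, with $$\ell_\rho(Y)=Y''+(\rho^2I+2i\rho Q_1(x)+Q_0(x))Y,\quad x>0,\qquad U_\rho(Y)=Y'(0)+(i\rho h_1+h_0)Y(0),$$ where $Q_1$ is absolutely continuous on $[0,T]$ for each $T>0$, $Q_0,Q_1,Q_1'\in L^1(0,\infty)$ and $\det(I\pm h_1)\ne0$. Put $\Pi_\pm=\{\rho:\pm\operatorname{Im}\rho>0\}$, $\ell^*_\rho(Z)=Z''+Z(\rho^2I+2i\rho Q_1+Q_0)$, $U^*_\rho(Z)=Z'(0)+Z(0)(i\rho h_1+h_0)$, $\langle Z,Y\rangle=Z'Y-ZY'$. Let - $\varphi,\varphi^*$ be the matrix solutions of $\ell_\rho(\varphi)=0$, $\ell^*_\rho(\varphi^*)=0$ with $\varphi(0,\rho)=\varphi^*(0,\rho)=I$, $U_\rho(\varphi)=U^*_\rho(\varphi^*)=0$, and $D(x,\rho,\theta)=\langle\varphi^*(x,\theta),\varphi(x,\rho)\rangle/(\rho-\theta)$; -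 $P_\pm,P^*_\pm$ be the solutions of $P_\pm'=\pm Q_1P_\pm$, $P_\pm^{*\prime}=\pm P^*_\pm Q_1$, $P_\pm(0)=P^*_\pm(0)=I$; - $M(\rho)=\Phi(0,\rho)$ be the Weyl matrix, where $\ell_\rho(\Phi)=0$, $U_\rho(\Phi)=I$, $\Phi(x,\rho)=O(e^{\pm i\rho x})$ as $x\to\infty$ for $\rho\in\Pi_\pm$, and let $M_\pm(\rho)$, $\rho\in\mathbb R$, be its limit at $\rho$ from $\Pi_\pm$; - $\Lambda_\pm$ be the set of zeros of $\det U_\rho(E_\pm)$ in $\overline{\Pi_\pm}\setminus\{0\}$, where $E_\pm$ is the Jost solution: $\ell_\rho(E_\pm)=0$, $E_\pm^{(\nu)}(x,\rho)=(\pm i\rho)^\nu e^{\pm i\rho x}(P_\mp(x)+o(1))$ as $x\to\infty$, $\nu=0,1$. Let $\tilde L$ be a second such pencil (the model pencil), whose objects are marked by a tilde, such that for $\hat M=M-\tilde M$, $\hat M_\pm=M_\pm-\tilde M_\pm$ and some $\rho^*>0$ $$\int_{|\rho|>\rho^*}\|\hat M_\pm(\rho)\|^2\rho^4\,d\rho<\infty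 .$$ Let $\gamma_0$ be a piecewise smooth simple closed curve, oriented counterclockwise, whose interior contains $0$, $\Lambda_\pm$ and $\tilde\Lambda_\pm$, and which meets the real axis in exactly two points, one negative and one positive. Let $\gamma_\pm$ be the two-sided cuts along the rays $\{\rho:\pm\rho>0,\ \rho\notin\operatorname{int}\gamma_0\}$, and $\gamma=\gamma_-\cup\gamma_0\cup\gamma_+$, run through counterclockwise: on the cuts, the lower sides, where $\hat M$ stands for $\hat M_-$, run from left to right, and the upper sides, where $\hat M$ stands for $\hat M_+$, run from right to left. Let $C(\gamma;\mathbb C^m)$ be the Banach space of bounded continuous row vector functions $Y=[y_k]$ on $\gamma$ with norm $\sup_{\rho\in\gamma}\max_k|y_k(\rho)|$, and put $$\Omega(x)=\tfrac12\bigl(P_-(x)\tilde P^*_+(x)+P_+(x)\tilde P^*_-(x)\bigr).$$ **Theorem.** For each fixed $x\ge0$ the formula $$Y(\rho)\tilde A=Y(\rho)+\frac1{2\pi i}\int_\gamma Y(\theta)\hat M(\theta)\tilde D(x,\rho,\theta)\,d\theta,\qquad\rho\in\gamma,$$ whose integral converges absolutely, defines a bounded linear operator $\tilde A$ in $C(\gamma;\mathbb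 C^m)$, and the space of solutions $Y\in C(\gamma;\mathbb C^m)$ of the homogeneous equation $Y\tilde A=0$ has dimension $m-\operatorname{rank}\Omega(x)$. In particular, if $\det\Omega(x)\ne0$, this equation has only the trivial solution. -/

import Mathlib

open Set Filter Topology MeasureTheory

/-- Complex `m × m` matrices. -/
abbrev CMat (m : ℕ) : Type := Matrix (Fin m) (Fin m) ℂ

/-- The maximal row sum `max_j ∑_k |a_jk|`. -/
noncomputable def rowSumNorm {m : ℕ} (A : CMat m) : ℝ := ⨆ j, ∑ k, ‖A j k‖

/-- The data of the pencil `ℓ_ρ(Y) = Y'' + (ρ² I + 2 i ρ Q₁(x) + Q₀(x)) Y`, `x > 0`,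
`U_ρ(Y) = Y'(0) + (i ρ h₁ + h₀) Y(0)`. -/
structure QuadPencil (m : ℕ) where
  Q0 : ℝ → CMat m
  Q1 : ℝ → CMat m
  h0 : CMat m
  h1 : CMat m

namespace QuadPencil

variable {m : ℕ}

/-- The class `𝒱`: the entries of `Q₁` are absolutely continuous on `[0, T]` for every `T > 0`, and
the entries of `Q₀`, `Q₁`, `Q₁'` are integrable on `(0, ∞)`. -/
structure ClassV (L : QuadPencil m) : Prop where
  absCont : ∀ j k, ∀ T > 0, AbsolutelyContinuousOnInterval (fun x => L.Q1 x j k) 0 T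
  integrable_Q0 : ∀ j k, IntegrableOn (fun x => L.Q0 x j k) (Ioi 0)
  integrable_Q1 : ∀ j k, IntegrableOn (fun x => L.Q1 x j k) (Ioi 0)
  integrable_deriv_Q1 : ∀ j k, IntegrableOn (deriv fun x => L.Q1 x j k) (Ioi 0)

/-- The condition `det (I ± h₁) ≠ 0`. -/
def Regular (L : QuadPencil m) : Prop := (1 + L.h1).det ≠ 0 ∧ (1 - L.h1).det ≠ 0

/-- The matrix `ρ² I + 2 i ρ Q₁(x) + Q₀(x)`. -/
noncomputable def coef (L : QuadPencil m) (ρ : ℂ) (x : ℝ) : CMat m :=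
  ρ ^ 2 • (1 : CMat m) + (2 * Complex.I * ρ) • L.Q1 x + L.Q0 x

/-- The matrix `i ρ h₁ + h₀`. -/
noncomputable def bc (L : QuadPencil m) (ρ : ℂ) : CMat m := (Complex.I * ρ) • L.h1 + L.h0

/-- `Y` is a matrix solution of `ℓ_ρ(Y) = 0` on `[0, ∞)` with derivative `Y'`, in the sense of
Carathéodory: `Y'` is absolutely continuous on bounded intervals and the equation holds almost
everywhere, which is expressed by integrating the equation once. -/
structure IsSol (L : QuadPencil m) (ρ : ℂ) (Y Y' : ℝ → CMat m) : Prop where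
  deriv_eq : ∀ x, 0 ≤ x → ∀ j k,
    HasDerivWithinAt (fun t => Y t j k) (Y' x j k) (Ici 0) x
  eqn : ∀ x, 0 ≤ x → ∀ j k,
    Y' x j k = Y' 0 j k - ∫ t in (0 : ℝ)..x, (L.coef ρ t * Y t) j k

/-- The same for the equation `ℓ*_ρ(Z) = Z'' + Z (ρ² I + 2 i ρ Q₁(x) + Q₀(x)) = 0`. -/
structure IsSolStar (L : QuadPencil m) (ρ : ℂ) (Z Z' : ℝ → CMat m) : Prop where
  deriv_eq : ∀ x, 0 ≤ x → ∀ j k,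
    HasDerivWithinAt (fun t => Z t j k) (Z' x j k) (Ici 0) x
  eqn : ∀ x, 0 ≤ x → ∀ j k,
    Z' x j k = Z' 0 j k - ∫ t in (0 : ℝ)..x, (Z t * L.coef ρ t) j k

/-- `U_ρ(Y)`, for a function with derivative `Y'`. -/
noncomputable def U (L : QuadPencil m) (ρ : ℂ) (Y Y' : ℝ → CMat m) : CMat m :=
  Y' 0 + L.bc ρ * Y 0

/-- `U*_ρ(Z)`, for a function with derivative `Z'`. -/
noncomputable def UStar (L : QuadPencil m) (ρ : ℂ) (Z Z' : ℝ → CMat m) : CMat m :=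
  Z' 0 + Z 0 * L.bc ρ

/-- The solution `φ(·, ρ)` of `ℓ_ρ(φ) = 0`, `φ(0, ρ) = I`, `U_ρ(φ) = 0`, as the pair `(φ, φ')`. -/
noncomputable def phi (L : QuadPencil m) (ρ : ℂ) : (ℝ → CMat m) × (ℝ → CMat m) :=
  Classical.epsilon fun p => L.IsSol ρ p.1 p.2 ∧ p.1 0 = 1 ∧ L.U ρ p.1 p.2 = 0

/-- The solution `φ*(·, ρ)` of `ℓ*_ρ(φ*) = 0`, `φ*(0, ρ) = I`, `U*_ρ(φ*) = 0`, as the pair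
`(φ*, φ*')`. -/
noncomputable def phiStar (L : QuadPencil m) (ρ : ℂ) : (ℝ → CMat m) × (ℝ → CMat m) :=
  Classical.epsilon fun p => L.IsSolStar ρ p.1 p.2 ∧ p.1 0 = 1 ∧ L.UStar ρ p.1 p.2 = 0

/-- `D(x, ρ, θ) = ⟨φ*(x, θ), φ(x, ρ)⟩ / (ρ - θ)` with `⟨Z, Y⟩ = Z' Y - Z Y'`. It is only used under
integrals in `θ` along curves that pass at most twice through any given point, so its value at the
removable singularity `θ = ρ` does not matter. -/
noncomputable def D (L : QuadPencil m) (x : ℝ) (ρ θ : ℂ) : CMat m :=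
  (ρ - θ)⁻¹ • ((L.phiStar θ).2 x * (L.phi ρ).1 x - (L.phiStar θ).1 x * (L.phi ρ).2 x)

/-- For `s = ±1`: the solution `P_±` on `[0, ∞)` of `P' = ± Q₁ P`, `P(0) = I`. -/
noncomputable def P (L : QuadPencil m) (s : ℝ) : ℝ → CMat m :=
  Classical.epsilon fun P => P 0 = 1 ∧ ∀ x, 0 ≤ x → ∀ j k,
    HasDerivWithinAt (fun t => P t j k) (s * (L.Q1 x * P x) j k) (Ici 0) x

/-- For `s = ±1`: the solution `P*_±` on `[0, ∞)` of `P*' = ± P* Q₁`, `P*(0) = I`. -/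
noncomputable def PStar (L : QuadPencil m) (s : ℝ) : ℝ → CMat m :=
  Classical.epsilon fun P => P 0 = 1 ∧ ∀ x, 0 ≤ x → ∀ j k,
    HasDerivWithinAt (fun t => P t j k) (s * (P x * L.Q1 x) j k) (Ici 0) x

/-- For `s = ±1`: the open half-plane `Π_± = {ρ : ± Im ρ > 0}`. -/
def halfPlane (s : ℝ) : Set ℂ := {ρ | 0 < s * ρ.im}

/-- `Φ` (with derivative `Φ'`) is a Weyl solution at `ρ ∈ Π_±`: `ℓ_ρ(Φ) = 0`, `U_ρ(Φ) = I` and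
`Φ = O(exp(± i ρ x))` as `x → ∞`. -/
def IsWeylSol (L : QuadPencil m) (ρ : ℂ) (Φ Φ' : ℝ → CMat m) : Prop :=
  L.IsSol ρ Φ Φ' ∧ L.U ρ Φ Φ' = 1 ∧
    ∀ s : ℝ, (s = 1 ∨ s = -1) → ρ ∈ halfPlane s → ∀ j k,
      (fun x : ℝ => Φ x j k) =O[atTop] fun x : ℝ => Complex.exp (s * Complex.I * ρ * x)

/-- The Weyl solution at `ρ ∈ Π_±`, as the pair `(Φ, Φ')`. -/
noncomputable def weylSol (L : QuadPencil m) (ρ : ℂ) : (ℝ → CMat m) × (ℝ → CMat m) :=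
  Classical.epsilon fun p => L.IsWeylSol ρ p.1 p.2

/-- The Weyl matrix `M(ρ) = Φ(0, ρ)`. -/
noncomputable def weyl (L : QuadPencil m) (ρ : ℂ) : CMat m := (L.weylSol ρ).1 0

/-- For `s = ±1` and real `ρ`: the boundary value `M_±(ρ)`, the limit of `M` at `ρ` from `Π_±`. -/
noncomputable def weylSide (L : QuadPencil m) (s : ℝ) (ρ : ℝ) : CMat m :=
  limUnder (𝓝[halfPlane s] (ρ : ℂ)) L.weyl

/-- For `s = ±1`: `E` (with derivative `E'`) is the Jost solution `E_±(·, ρ)`, that is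
`ℓ_ρ(E) = 0` and `E^(ν)(x) = (± i ρ)^ν exp(± i ρ x) (P_∓(x) + o(1))`, `x → ∞`, `ν = 0, 1`. -/
def IsJost (L : QuadPencil m) (s : ℝ) (ρ : ℂ) (E E' : ℝ → CMat m) : Prop :=
  L.IsSol ρ E E' ∧
    Tendsto (fun x : ℝ => Complex.exp (-(s * Complex.I * ρ * x)) • E x - L.P (-s) x)
      atTop (𝓝 0) ∧
    Tendsto (fun x : ℝ => Complex.exp (-(s * Complex.I * ρ * x)) • E' x
      - (s * Complex.I * ρ) • L.P (-s) x) atTop (𝓝 0)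

/-- For `s = ±1`: the set `Λ_±` of zeros of `det U_ρ(E_±)` in the closed half-plane
`± Im ρ ≥ 0`, `ρ ≠ 0`. -/
def singSet (L : QuadPencil m) (s : ℝ) : Set ℂ :=
  {ρ | 0 ≤ s * ρ.im ∧ ρ ≠ 0 ∧ ∃ E E', L.IsJost s ρ E E' ∧ (L.U ρ E E').det = 0}

/-- `M̂ = M - M̃` off the real axis. -/
noncomputable def Mhat (L Lt : QuadPencil m) (θ : ℂ) : CMat m := L.weyl θ - Lt.weyl θ

/-- `M̂_± = M_± - M̃_±` on the real axis, for `s = ±1`. -/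
noncomputable def MhatSide (L Lt : QuadPencil m) (s : ℝ) (θ : ℝ) : CMat m :=
  L.weylSide s θ - Lt.weylSide s θ

/-- `Lt` is a model pencil for `L`: for sufficiently large `ρ*`,
`∫_{|ρ| > ρ*} ‖M_±(ρ) - M̃_±(ρ)‖² ρ⁴ dρ < ∞`. -/
def IsModel (L Lt : QuadPencil m) : Prop :=
  ∃ R : ℝ, 0 < R ∧ ∀ s : ℝ, (s = 1 ∨ s = -1) →
    IntegrableOn (fun ρ : ℝ => rowSumNorm (MhatSide L Lt s ρ) ^ 2 * ρ ^ 4) {ρ | R < |ρ|}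

/-- `Ω(x) = (P_-(x) P̃*_+(x) + P_+(x) P̃*_-(x)) / 2`. -/
noncomputable def Omega (L Lt : QuadPencil m) (x : ℝ) : CMat m :=
  (1 / 2 : ℂ) • (L.P (-1) x * Lt.PStar 1 x + L.P 1 x * Lt.PStar (-1) x)

end QuadPencil

/-- A piecewise continuously differentiable function on `[0, 1]`. -/
def PiecewiseC1 (c : ℝ → ℂ) : Prop :=
  ∃ (n : ℕ) (τ : Fin (n + 1) → ℝ), StrictMono τ ∧ τ 0 = 0 ∧ τ (Fin.last n) = 1 ∧
    ∀ i : Fin n, ContDiffOn ℝ 1 c (Icc (τ i.castSucc) (τ i.succ))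

/-- The winding number of the closed curve `c` about `w`. -/
noncomputable def windingNum (c : ℝ → ℂ) (w : ℂ) : ℂ :=
  (2 * Real.pi * Complex.I)⁻¹ * ∫ t in (0 : ℝ)..1, deriv c t / (c t - w)

/-- The contour `γ = γ₋ ∪ γ₀ ∪ γ₊`. The curve `γ₀` is a piecewise smooth simple closed curve, running
counterclockwise around `0`. The parts of the positive and of the negative real axis outside `γ₀`
are rays, from `right` and from `-left`; both are taken as two-sided cuts. -/
structure CutContour where
  c : ℝ → ℂ
  piecewiseC1 : PiecewiseC1 c
  closed : c 0 = c 1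
  simple : InjOn c (Ico 0 1)
  left : ℝ
  right : ℝ
  left_pos : 0 < left
  right_pos : 0 < right
  meets_real : {z ∈ c '' Icc 0 1 | z.im = 0} = {-(left : ℂ), (right : ℂ)}
  winding_zero : windingNum c 0 = 1

namespace CutContour

/-- The interior `int γ₀` of the curve `γ₀`. -/
def interior (Γ : CutContour) : Set ℂ := {w | w ∉ Γ.c '' Icc 0 1 ∧ windingNum Γ.c w = 1}

/-- The two cut rays, as a set of real numbers. -/
def cut (Γ : CutContour) : Set ℝ := Iic (-Γ.left) ∪ Ici Γ.right

/-- The contour `γ` as a set of points of the plane. -/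
def carrier (Γ : CutContour) : Set ℂ := Γ.c '' Icc 0 1 ∪ (fun t : ℝ => (t : ℂ)) '' Γ.cut

/-- The contour encloses the singular sets `Λ_±` of `L` (and `0`, by definition). -/
def Encloses {m : ℕ} (Γ : CutContour) (L : QuadPencil m) : Prop :=
  L.singSet 1 ⊆ Γ.interior ∧ L.singSet (-1) ⊆ Γ.interior

/-- `∫_γ F(θ) dθ`, where the integrand is `F` on `γ₀` and has the values `Fp` on the upper and `Fm` on
the lower side of the cuts. Counterclockwise, the lower sides run from left to right and the upper
sides from right to left. -/
noncomputable def integral {V : Type*} [NormedAddCommGroup V] [NormedSpace ℂ V] (Γ : CutContour)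
    (F : ℂ → V) (Fp Fm : ℝ → V) : V :=
  (∫ t in (0 : ℝ)..1, deriv Γ.c t • F (Γ.c t)) + ((∫ θ in Γ.cut, Fm θ) - ∫ θ in Γ.cut, Fp θ)

/-- Absolute convergence of the integral along `γ`. -/
def IntegrableAlong {V : Type*} [NormedAddCommGroup V] [NormedSpace ℂ V] (Γ : CutContour)
    (F : ℂ → V) (Fp Fm : ℝ → V) : Prop :=
  IntervalIntegrable (fun t => deriv Γ.c t • F (Γ.c t)) volume 0 1 ∧
    IntegrableOn Fp Γ.cut ∧ IntegrableOn Fm Γ.cut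

/-- The Banach space `C(γ; ℂ^m)` of (bounded) continuous row vector functions on `γ` with the norm
`sup_{ρ ∈ γ} max_k |y_k(ρ)|`. -/
abbrev Space (Γ : CutContour) (m : ℕ) : Type := BoundedContinuousFunction Γ.carrier (Fin m → ℂ)

open Classical in
/-- The value of `Y` at a point of `γ` (and `0` elsewhere). -/
noncomputable def val {m : ℕ} {Γ : CutContour} (Y : Γ.Space m) (θ : ℂ) : Fin m → ℂ :=
  if h : θ ∈ Γ.carrier then Y ⟨θ, h⟩ else 0

/-- `Y(θ) r̃(x, ρ, θ)`, `r̃(x, ρ, θ) = M̂(θ) D̃(x, ρ, θ)`, on `γ₀`. -/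
noncomputable def kernel {m : ℕ} {Γ : CutContour} (L Lt : QuadPencil m) (x : ℝ) (Y : Γ.Space m)
    (ρ θ : ℂ) : Fin m → ℂ :=
  Matrix.vecMul (val Y θ) (QuadPencil.Mhat L Lt θ * Lt.D x ρ θ)

/-- `Y(θ) r̃(x, ρ, θ)` on the upper (`s = 1`) and on the lower (`s = -1`) side of the cuts. -/
noncomputable def kernelSide {m : ℕ} {Γ : CutContour} (L Lt : QuadPencil m) (s x : ℝ)
    (Y : Γ.Space m) (ρ : ℂ) (θ : ℝ) : Fin m → ℂ :=
  Matrix.vecMul (val Y θ) (QuadPencil.MhatSide L Lt s θ * Lt.D x ρ θ)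

/-- `A` is the operator `Ã`: for all `Y ∈ C(γ; ℂ^m)` and `ρ ∈ γ` the integral converges absolutely and
`Y(ρ) Ã = Y(ρ) + (2 π i)⁻¹ ∫_γ Y(θ) r̃(x, ρ, θ) dθ`. -/
def IsModelOperator {m : ℕ} (Γ : CutContour) (L Lt : QuadPencil m) (x : ℝ)
    (A : Γ.Space m →L[ℂ] Γ.Space m) : Prop :=
  ∀ (Y : Γ.Space m) (ρ : Γ.carrier),
    Γ.IntegrableAlong (kernel L Lt x Y ρ) (kernelSide L Lt 1 x Y ρ)
      (kernelSide L Lt (-1) x Y ρ) ∧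
    A Y ρ = Y ρ + (2 * Real.pi * Complex.I : ℂ)⁻¹ •
      Γ.integral (kernel L Lt x Y ρ) (kernelSide L Lt 1 x Y ρ) (kernelSide L Lt (-1) x Y ρ)

end CutContour

/-!
The null space of `Ã` is computed exactly: it consists of the functions `w φ(x, ·)`, where `w` is a
row vector with `w Ω(x) = 0`. Since the rows of `φ(x, ·)` are linearly independent
(`ClassV.eq_zero_of_vecMul_phi`), its dimension is that of the left null space of `Ω(x)`.

*Solutions at a fixed point.* Let `S`, `S*` be the solutions with the initial values `0`, `I`. Then
`Φ = S + φ M` and `Φ* = S* + M φ*`, and the Wronskian relations make the matrices formed from `φ, S`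
and from `φ*, S*` inverse to each other. The Jost solutions (`Potential.exists_jost`) are found from
a Volterra equation on the half-line for the coefficients of the two exponentials; for large `ρ`
the leading coefficient is `P_∓`. They give the Weyl matrix up to the real axis, off a closed set inside `γ₀`
(`ClassV.exists_isWeylFunction`), and the growth of all the solutions: for large `ρ` in
`± Im ρ ≥ 0`, `φ` is of the order of `exp(∓ i ρ x)` and `ρ Φ` of that of `exp(± i ρ x)`. These facts
are collected in `Frame.IsRegular`. In the mixed expression `φ Φ̃*' - Φ φ̃*'` the exponentials
cancel, and deep inside the half-planes it tends to `Ω(x)` (`tendsto_omega`).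

*The contour.* The real axis cuts `γ₀` into two arcs, and the side on which each of them runs is
found from the winding number (`CutContour.exists_isCrossing`). In each half-plane, an arc, the two
pieces of the cuts up to distance `R` and a half-circle form a closed chain, which has winding
number zero about the points inside `γ₀` and the points of the other half-plane. By the homology
version of Cauchy's theorem, proved with Dixon's argument, the integral over it vanishes for
functions holomorphic in the half-plane outside `γ₀` (`halfChain_integral_eq_zero`). Hence a Cauchy
integral along `γ` with such a density continues to an entire function (`Density.exists_entire`),
and it can be computed by letting the half-circles grow (`Density.cauchyIntegral_eq`).

*Solutions of the homogeneous equation.* Let `Y Ã = 0`. As the kernel `D̃(x, ρ, θ)` is entire in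
`ρ`, the equation itself extends `Y` to an entire function `Z`. Off the contour
`Z = I₁ φ̃ - I₂ φ̃'`, where `I₁` and `I₂` are the Cauchy integrals of `Y M̂ φ̃*'` and `Y M̂ φ̃*`.
Let `F` and `G` be the entire functions which `I₁` and `I₂` become after the residue `Z M̂ φ̃*'` or
`Z M̂ φ̃*` is added; with `N = F S̃ - G S̃'` one has `N + Z M = I₁ Φ̃ - I₂ Φ̃'`, so that in both
half-planes the pair `(Z, N)` is governed by `I₁` and `I₂`. The combinations `Z S*' - N φ*'` and
`ρ (Z S* - N φ*)` are entire and, as the exponentials cancel, bounded up to a factor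
`1 + 1 / |Im ρ|`. By a Liouville theorem they are constant. The second one vanishes at `0`; if `w`
is the value of the first one, the Wronskian relations give `Z = w φ`. Finally `I₁` tends to `0`
along the imaginary axis, and is also `w (φ Φ̃*' - Φ φ̃*')`, which tends to `w Ω(x)`. Hence
`w Ω(x) = 0` (`ModelPair.exists_eq_vecMul`).

*The converse.* If `w Ω(x) = 0`, the densities `w φ M̂ φ̃*'` and `w φ M̂ φ̃*` are entire up to terms
which decay deep inside the half-planes, because `φ M = Φ - S`. So their Cauchy integrals can
be evaluated inside `γ₀`, and show that `w φ` solves the equation (`ModelPair.transform_vecMul`).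

The convergence of the integrals and the boundedness of `Ã` come from the integrability of
`M̂(θ) (1 + |θ|)` on the cuts (`IsModel.integrableOn_cut`) and the bound `D̃(x, ρ, θ) = O(1 + |θ|)`
(`IsRegular.exists_dreg_bound`).
-/

open Complex (I exp norm_real exp_add norm_I ofReal_im continuous_ofReal abs_im_le_norm ofReal_zero
  log exp_zero im_ofReal_mul I_im continuous_im add_im norm_ofNat differentiableOn_dslope slitPlane
  ofReal_sub sub_im)
open Matrix (vecMul single transpose_mul cons_val_zero transpose_smul transpose_add
  frobenius_norm_transpose vecMul_smul cons_val_one det_smul smul_single transpose_transpose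
  transpose_one det_mul mul_nonsing_inv smul_vecMul)
open scoped Real
open Real (exp_pos norm_of_nonneg pi_pos exp_le_exp norm_eq_abs)
open Metric (ball isOpen_ball closedBall mem_ball ball_mem_nhds mem_closedBall)
open intervalIntegral (integral_of_le integral_congr integral_interval_sub_left integral_same
  integral_add_adjacent_intervals)
open Classical (epsilon_spec)
open Finset (sum_le_sum sum_congr)
open Fin (mk_one zero_eta)

/-! ### Primitives of locally integrable functions -/

lemma AbsolutelyContinuousOnInterval.of_dist_le {E : Type*} [NormedAddCommGroup E]
    {h : ℝ → E} {g : ℝ → ℝ} {a b : ℝ}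
    (hg : AbsolutelyContinuousOnInterval g a b)
    (hh : ∀ x ∈ uIcc a b, ∀ y ∈ uIcc a b, ‖h x - h y‖ ≤ |g x - g y|) :
    AbsolutelyContinuousOnInterval h a b := by
  rw [absolutelyContinuousOnInterval_iff] at hg ⊢
  intro ε hε
  obtain ⟨δ, hδ, H⟩ := hg ε hε
  refine ⟨δ, hδ, fun I hI hd => lt_of_le_of_lt (sum_le_sum fun i hi => ?_) (H I hI hd)⟩
  have := hI.1 i hi
  rw [dist_eq_norm, Real.dist_eq]
  exact hh _ this.1 _ this.2

lemma uIcc_subset_Ici {x : ℝ} (hx : 0 ≤ x) : uIcc 0 x ⊆ Ici 0 := by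
  rw [uIcc_of_le hx]; exact Icc_subset_Ici_self

lemma ae_restrict_Ioi {a : ℝ} {p : ℝ → Prop} (h : ∀ t, a < t → p t) :
    ∀ᵐ t ∂volume.restrict (Ioi a), p t := ae_restrict_of_forall_mem measurableSet_Ioi h

section Primitive

variable {E F G : Type*} [NormedAddCommGroup E] [NormedSpace ℝ E]
  [NormedAddCommGroup F] [NormedSpace ℝ F] [NormedAddCommGroup G] [NormedSpace ℝ G]

/-- `f` is, on `[0, ∞)`, a primitive of the locally integrable function `f'`; equivalently, `f` is
locally absolutely continuous there with `f'` as its almost everywhere derivative. -/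
structure IsPrimitive (f f' : ℝ → E) : Prop where
  intervalIntegrable : ∀ x, 0 ≤ x → IntervalIntegrable f' volume 0 x
  eq_add : ∀ x, 0 ≤ x → f x = f 0 + ∫ t in (0 : ℝ)..x, f' t

namespace IsPrimitive

variable {f f' : ℝ → E}

lemma sub_eq (h : IsPrimitive f f') {a b : ℝ} (ha : 0 ≤ a) (hb : 0 ≤ b) :
    f b - f a = ∫ t in a..b, f' t := by
  rw [h.eq_add a ha, h.eq_add b hb,
    ← integral_interval_sub_left (h.intervalIntegrable b hb)
      (h.intervalIntegrable a ha)]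
  abel

lemma continuousOn (h : IsPrimitive f f') : ContinuousOn f (Ici 0) := by
  intro x hx
  have hx0 : (0 : ℝ) ≤ x := hx
  have h1 : ContinuousOn f (Icc 0 (x + 1)) := by
    have := intervalIntegral.continuousOn_primitive_interval (μ := volume) (f := f') (a := 0)
      (b := x + 1) (by
        have := h.intervalIntegrable (x + 1) (by linarith)
        rwa [intervalIntegrable_iff_integrableOn_Icc_of_le (by linarith),
          ← uIcc_of_le (by linarith)] at this)
    rw [uIcc_of_le (by linarith)] at this
    exact (continuousOn_const.add this).congr fun y hy => h.eq_add y hy.1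
  refine (h1 x ⟨hx, by linarith⟩).mono_of_mem_nhdsWithin ?_
  filter_upwards [self_mem_nhdsWithin, mem_nhdsWithin_of_mem_nhds
    (Iic_mem_nhds (show x < x + 1 by linarith))] with y hy hy'
  exact ⟨hy, hy'⟩

lemma ae_hasDerivAt [CompleteSpace E] (h : IsPrimitive f f') (T : ℝ) (hT : 0 ≤ T) :
    ∀ᵐ x, x ∈ Icc 0 T → HasDerivAt f (f' x) x := by
  have h0 : ∀ᵐ x : ℝ, x ≠ 0 := by simp [ae_iff]
  filter_upwards [(h.intervalIntegrable T hT).ae_hasDerivAt_integral, h0] with x hx hx0 hxT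
  have h1 := (hx (by rwa [uIcc_of_le hT]) 0 left_mem_uIcc).const_add (f 0)
  refine h1.congr_of_eventuallyEq ?_
  filter_upwards [Ioi_mem_nhds (lt_of_le_of_ne hxT.1 hx0.symm)] with y hy
  exact h.eq_add y (le_of_lt hy)

lemma norm_sub_le (h : IsPrimitive f f') {a b : ℝ} (ha : 0 ≤ a) (hb : 0 ≤ b) :
    ‖f a - f b‖ ≤ |(∫ t in (0 : ℝ)..a, ‖f' t‖) - ∫ t in (0 : ℝ)..b, ‖f' t‖| := by
  rw [h.sub_eq hb ha, integral_interval_sub_left (h.intervalIntegrable a ha).norm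
      (h.intervalIntegrable b hb).norm]
  exact intervalIntegral.norm_integral_le_abs_integral_norm

lemma absolutelyContinuous_norm (h : IsPrimitive f f') {T : ℝ} (hT : 0 ≤ T) :
    AbsolutelyContinuousOnInterval (fun x => ∫ t in (0 : ℝ)..x, ‖f' t‖) 0 T :=
  (h.intervalIntegrable T hT).norm.absolutelyContinuousOnInterval_intervalIntegral left_mem_uIcc

end IsPrimitive

/-- A function whose increments are dominated by those of an absolutely continuous function is a
primitive of its almost everywhere derivative. -/
lemma IsPrimitive.of_ae_hasDerivAt [CompleteSpace E] {h h' : ℝ → E} (g : ℝ → ℝ)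
    (hg : ∀ T, 0 ≤ T → AbsolutelyContinuousOnInterval g 0 T)
    (hle : ∀ T, 0 ≤ T → ∃ C : ℝ, ∀ x ∈ Icc 0 T, ∀ y ∈ Icc 0 T, ‖h x - h y‖ ≤ C * |g x - g y|)
    (hi : ∀ x, 0 ≤ x → IntervalIntegrable h' volume 0 x)
    (hd : ∀ T, 0 ≤ T → ∀ᵐ x, x ∈ Icc 0 T → HasDerivAt h (h' x) x) : IsPrimitive h h' := by
  refine ⟨hi, fun T hT => ?_⟩
  obtain ⟨C, hC⟩ := hle T hT
  have hprim : IsPrimitive (fun x => ∫ t in (0 : ℝ)..x, h' t) h' :=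
    ⟨hi, fun x hx => by simp⟩
  have e : uIcc 0 T = Icc 0 T := uIcc_of_le hT
  have ac1 : AbsolutelyContinuousOnInterval h 0 T :=
    ((hg T hT).const_mul C).of_dist_le fun x hx y hy => by
      rw [e] at hx hy
      refine (hC x hx y hy).trans ?_
      rw [← mul_sub, abs_mul]
      exact mul_le_mul_of_nonneg_right (le_abs_self C) (abs_nonneg _)
  have ac2 : AbsolutelyContinuousOnInterval (fun x => ∫ t in (0 : ℝ)..x, h' t) 0 T :=
    (hprim.absolutelyContinuous_norm hT).of_dist_le fun x hx y hy => by
      rw [e] at hx hy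
      exact hprim.norm_sub_le hx.1 hy.1
  obtain ⟨C, hC⟩ := (ac1.sub ac2).const_of_ae_hasDerivAt_zero (by
    filter_upwards [hd T hT, hprim.ae_hasDerivAt T hT] with x hx hx' hxT
    rw [e] at hxT
    simpa using (hx hxT).sub (hx' hxT))
  have h1 := hC T right_mem_uIcc
  have h2 := hC 0 left_mem_uIcc
  simp only [Pi.sub_apply, integral_same, sub_zero] at h1 h2
  rw [h2, ← h1]; abel

lemma ContinuousOn.intervalIntegrable_clm_apply {A : ℝ → E →L[ℝ] F} {v : ℝ → E} {a b : ℝ}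
    (hA : ContinuousOn A (uIcc a b)) (hv : IntervalIntegrable v volume a b) :
    IntervalIntegrable (fun t => A t (v t)) volume a b := by
  obtain ⟨M, hM⟩ := isCompact_uIcc.exists_bound_of_continuousOn hA
  rw [intervalIntegrable_iff] at hv ⊢
  have hAm : AEStronglyMeasurable A (volume.restrict (uIoc a b)) :=
    (hA.mono uIoc_subset_uIcc).aestronglyMeasurable measurableSet_uIoc
  refine Integrable.mono' (hv.norm.const_mul M) ?_ ?_
  · exact (ContinuousLinearMap.apply ℝ F).flip.aestronglyMeasurable_comp₂ hAm hv.1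
  · rw [ae_restrict_iff' measurableSet_uIoc]
    refine ae_of_all _ fun t ht => ?_
    exact ((A t).le_opNorm _).trans
      (mul_le_mul_of_nonneg_right (hM t (uIoc_subset_uIcc ht)) (norm_nonneg _))

namespace IsPrimitive

variable {f f' : ℝ → E}

lemma congr_ae {g' : ℝ → E} (h : IsPrimitive f f') (he : ∀ᵐ t, 0 ≤ t → f' t = g' t) :
    IsPrimitive f g' := by
  have key : ∀ x, 0 ≤ x → f' =ᵐ[volume.restrict (uIoc 0 x)] g' := fun x hx => by
    rw [uIoc_of_le hx, Filter.EventuallyEq, ae_restrict_iff' measurableSet_Ioc]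
    filter_upwards [he] with t ht ht' using ht ht'.1.le
  refine ⟨fun x hx => (h.intervalIntegrable x hx).congr_ae (key x hx), fun x hx => ?_⟩
  rw [h.eq_add x hx]
  congr 1
  refine intervalIntegral.integral_congr_ae ?_
  filter_upwards [he] with t ht ht'
  rw [uIoc_of_le hx] at ht'
  exact ht ht'.1.le

lemma congr {g' : ℝ → E} (h : IsPrimitive f f') (he : ∀ t, 0 ≤ t → f' t = g' t) :
    IsPrimitive f g' := h.congr_ae (ae_of_all _ he)

lemma congr_left {g : ℝ → E} (h : IsPrimitive f f') (he : ∀ t, 0 ≤ t → f t = g t) :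
    IsPrimitive g f' :=
  ⟨h.intervalIntegrable, fun x hx => by rw [← he x hx, ← he 0 le_rfl, h.eq_add x hx]⟩

lemma const (c : E) : IsPrimitive (fun _ => c) (fun _ => 0) :=
  ⟨fun _ _ => by simp, fun _ _ => by simp⟩

lemma add {g g' : ℝ → E} (hf : IsPrimitive f f') (hg : IsPrimitive g g') :
    IsPrimitive (fun x => f x + g x) (fun x => f' x + g' x) := by
  refine ⟨fun x hx => (hf.intervalIntegrable x hx).add (hg.intervalIntegrable x hx), fun x hx => ?_⟩
  rw [intervalIntegral.integral_add (hf.intervalIntegrable x hx) (hg.intervalIntegrable x hx),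
    hf.eq_add x hx, hg.eq_add x hx]
  abel

lemma neg (hf : IsPrimitive f f') :
    IsPrimitive (fun x => -f x) (fun x => -f' x) := by
  refine ⟨fun x hx => (hf.intervalIntegrable x hx).neg, fun x hx => ?_⟩
  rw [intervalIntegral.integral_neg, hf.eq_add x hx]
  abel

lemma sub {g g' : ℝ → E} (hf : IsPrimitive f f') (hg : IsPrimitive g g') :
    IsPrimitive (fun x => f x - g x) (fun x => f' x - g' x) := by
  simpa only [sub_eq_add_neg] using hf.add hg.neg

lemma clm [CompleteSpace E] [CompleteSpace F] (L : E →L[ℝ] F) (hf : IsPrimitive f f') :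
    IsPrimitive (fun x => L (f x)) (fun x => L (f' x)) := by
  refine ⟨fun x hx => ?_, fun x hx => ?_⟩
  · have := hf.intervalIntegrable x hx
    rw [intervalIntegrable_iff] at this ⊢
    exact L.integrable_comp this
  · rw [L.intervalIntegral_comp_comm (hf.intervalIntegrable x hx), hf.eq_add x hx, map_add]

/-- The product rule, for a continuous bilinear map. -/
lemma bilin [CompleteSpace E] [CompleteSpace F] [CompleteSpace G] (B : E →L[ℝ] F →L[ℝ] G)
    {g g' : ℝ → F} (hf : IsPrimitive f f') (hg : IsPrimitive g g') :
    IsPrimitive (fun x => B (f x) (g x)) (fun x => B (f' x) (g x) + B (f x) (g' x)) := by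
  have hfc := hf.continuousOn
  have hgc := hg.continuousOn
  refine IsPrimitive.of_ae_hasDerivAt
    (fun x => (∫ t in (0 : ℝ)..x, ‖f' t‖) + ∫ t in (0 : ℝ)..x, ‖g' t‖)
    (fun T hT => (hf.absolutelyContinuous_norm hT).add (hg.absolutelyContinuous_norm hT))
    (fun T hT => ?_) (fun x hx => ?_) (fun T hT => ?_)
  · obtain ⟨Mf, hMf⟩ := isCompact_Icc.exists_bound_of_continuousOn
      (hfc.mono (Icc_subset_Ici_self : Icc 0 T ⊆ Ici 0))
    obtain ⟨Mg, hMg⟩ := isCompact_Icc.exists_bound_of_continuousOn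
      (hgc.mono (Icc_subset_Ici_self : Icc 0 T ⊆ Ici 0))
    refine ⟨‖B‖ * (Mf + Mg), ?_⟩
    have key : ∀ x ∈ Icc 0 T, ∀ y ∈ Icc 0 T, y ≤ x → ‖B (f x) (g x) - B (f y) (g y)‖ ≤
        ‖B‖ * (Mf + Mg) * |((∫ t in (0 : ℝ)..x, ‖f' t‖) + ∫ t in (0 : ℝ)..x, ‖g' t‖) -
        ((∫ t in (0 : ℝ)..y, ‖f' t‖) + ∫ t in (0 : ℝ)..y, ‖g' t‖)| := by
      intro x hx y hy hyx
      have e1 := hf.norm_sub_le hx.1 hy.1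
      have e2 := hg.norm_sub_le hx.1 hy.1
      have d1 := integral_interval_sub_left (hf.intervalIntegrable x hx.1).norm
        (hf.intervalIntegrable y hy.1).norm
      have d2 := integral_interval_sub_left (hg.intervalIntegrable x hx.1).norm
        (hg.intervalIntegrable y hy.1).norm
      rw [d1] at e1
      rw [d2] at e2
      rw [add_sub_add_comm, d1, d2]
      have p1 : 0 ≤ ∫ t in y..x, ‖f' t‖ :=
        intervalIntegral.integral_nonneg hyx fun _ _ => norm_nonneg _
      have p2 : 0 ≤ ∫ t in y..x, ‖g' t‖ :=
        intervalIntegral.integral_nonneg hyx fun _ _ => norm_nonneg _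
      rw [abs_of_nonneg p1] at e1
      rw [abs_of_nonneg p2] at e2
      rw [abs_of_nonneg (add_nonneg p1 p2)]
      have : B (f x) (g x) - B (f y) (g y) = B (f x - f y) (g x) + B (f y) (g x - g y) := by
        simp only [map_sub, _root_.sub_apply]; abel
      rw [this]
      have hb := norm_nonneg B
      have m1 := (norm_nonneg _).trans (hMf x hx)
      have m2 := (norm_nonneg _).trans (hMg x hx)
      calc _ ≤ ‖B (f x - f y) (g x)‖ + ‖B (f y) (g x - g y)‖ := norm_add_le _ _
        _ ≤ ‖B‖ * ‖f x - f y‖ * ‖g x‖ + ‖B‖ * ‖f y‖ * ‖g x - g y‖ :=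
          add_le_add (B.le_opNorm₂ _ _) (B.le_opNorm₂ _ _)
        _ ≤ ‖B‖ * (∫ t in y..x, ‖f' t‖) * Mg + ‖B‖ * Mf * (∫ t in y..x, ‖g' t‖) := by
          gcongr
          exacts [hMg x hx, hMf y hy]
        _ ≤ _ := by nlinarith [mul_nonneg (mul_nonneg hb m1) p1, mul_nonneg (mul_nonneg hb m2) p2]
    intro x hx y hy
    rcases le_total y x with h | h
    · exact key x hx y hy h
    · rw [norm_sub_rev, abs_sub_comm]; exact key y hy x hx h
  · have hc1 : ContinuousOn (fun x => B.flip (g x)) (uIcc 0 x) :=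
      B.flip.continuous.comp_continuousOn (hgc.mono (uIcc_subset_Ici hx))
    have hc2 : ContinuousOn (fun x => B (f x)) (uIcc 0 x) :=
      B.continuous.comp_continuousOn (hfc.mono (uIcc_subset_Ici hx))
    exact (hc1.intervalIntegrable_clm_apply (hf.intervalIntegrable x hx)).add
      (hc2.intervalIntegrable_clm_apply (hg.intervalIntegrable x hx))
  · filter_upwards [hf.ae_hasDerivAt T hT, hg.ae_hasDerivAt T hT] with x hx hx' hxT
    have := B.hasFDerivAt_of_bilinear (hx hxT).hasFDerivAt (hx' hxT).hasFDerivAt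
    have := this.hasDerivAt
    simpa [add_comm] using this

/-- The exponential of a real primitive. -/
lemma exp {g g' : ℝ → ℝ} (hg : IsPrimitive g g') :
    IsPrimitive (fun x => Real.exp (g x)) (fun x => g' x * Real.exp (g x)) := by
  have hgc := hg.continuousOn
  refine IsPrimitive.of_ae_hasDerivAt (fun x => ∫ t in (0 : ℝ)..x, ‖g' t‖)
    (fun T hT => hg.absolutelyContinuous_norm hT) (fun T hT => ?_) (fun x hx => ?_)
    (fun T hT => ?_)
  · obtain ⟨M, hM⟩ := isCompact_Icc.exists_bound_of_continuousOn
      (hgc.mono (Icc_subset_Ici_self : Icc 0 T ⊆ Ici 0))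
    refine ⟨Real.exp M, fun x hx y hy => ?_⟩
    refine le_trans ?_ (mul_le_mul_of_nonneg_left (hg.norm_sub_le hx.1 hy.1) (exp_pos _).le)
    refine Convex.norm_image_sub_le_of_norm_deriv_le (s := Iic M) (f := Real.exp)
      (fun z _ => Real.differentiableAt_exp) (fun z hz => ?_) (convex_Iic _) ?_ ?_
    · rw [Real.deriv_exp, norm_eq_abs, abs_of_pos (exp_pos _)]
      exact exp_le_exp.2 hz
    · exact (le_abs_self _).trans (hM y hy)
    · exact (le_abs_self _).trans (hM x hx)
  · exact (hg.intervalIntegrable x hx).mul_continuousOn (Real.continuous_exp.comp_continuousOn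
      (hgc.mono (uIcc_subset_Ici hx)))
  · filter_upwards [hg.ae_hasDerivAt T hT] with x hx hxT
    simpa [mul_comm] using (hx hxT).exp

lemma of_hasDerivAt [CompleteSpace E]
    (hf : ∀ x, 0 ≤ x → HasDerivWithinAt f (f' x) (Ici 0) x)
    (hc : ContinuousOn f' (Ici 0)) : IsPrimitive f f' := by
  have hi : ∀ x, 0 ≤ x → IntervalIntegrable f' volume 0 x := fun x hx =>
    (hc.mono (uIcc_subset_Ici hx)).intervalIntegrable
  refine ⟨hi, fun x hx => ?_⟩
  rw [intervalIntegral.integral_eq_sub_of_hasDeriv_right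
    (f := f) (fun t ht => ?_) (fun t ht => ?_) (hi x hx)]
  · abel
  · rw [uIcc_of_le hx] at ht ⊢
    exact (hf t ht.1).continuousWithinAt.mono Icc_subset_Ici_self
  · rw [min_eq_left hx] at ht
    exact (hf t ht.1.le).mono fun y (hy : t < y) => (ht.1.trans hy).le

lemma hasDerivWithinAt [CompleteSpace E] (h : IsPrimitive f f')
    (hc : ContinuousOn f' (Ici 0)) {x : ℝ} (hx : 0 ≤ x) :
    HasDerivWithinAt f (f' x) (Ici 0) x := by
  -- extend `f'` to the left by a constant, so that the primitive becomes differentiable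
  have hc' : Continuous fun t => f' (max t 0) :=
    hc.comp_continuous (by fun_prop) fun t => mem_Ici.2 (le_max_right _ _)
  have h1 : HasDerivAt (fun x => f 0 + ∫ t in (0 : ℝ)..x, f' (max t 0)) (f' (max x 0)) x :=
    (hc'.integral_hasStrictDerivAt 0 x).hasDerivAt.const_add _
  rw [max_eq_left hx] at h1
  refine h1.hasDerivWithinAt.congr_of_mem (fun y (hy : 0 ≤ y) => ?_) hx
  rw [h.eq_add y hy]
  congr 1
  refine integral_congr fun t ht => ?_
  rw [uIcc_of_le hy] at ht
  simp [max_eq_left ht.1]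

section Algebra

variable {A : Type*} [NormedRing A] [NormedAlgebra ℂ A] [CompleteSpace A]

lemma mul {f f' g g' : ℝ → A} (hf : IsPrimitive f f') (hg : IsPrimitive g g') :
    IsPrimitive (fun x => f x * g x) (fun x => f' x * g x + f x * g' x) :=
  hf.bilin (ContinuousLinearMap.mul ℝ A) hg

lemma smul [NormedSpace ℂ E] [IsScalarTower ℝ ℂ E] [CompleteSpace E] {f f' : ℝ → ℂ} {g g' : ℝ → E}
    (hf : IsPrimitive f f') (hg : IsPrimitive g g') :
    IsPrimitive (fun x => f x • g x) (fun x => f' x • g x + f x • g' x) :=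
  hf.bilin (ContinuousLinearMap.lsmul ℝ ℂ) hg

lemma const_mul (c : A) {g g' : ℝ → A} (hg : IsPrimitive g g') :
    IsPrimitive (fun x => c * g x) (fun x => c * g' x) :=
  hg.clm (ContinuousLinearMap.mul ℝ A c)

lemma mul_const {g g' : ℝ → A} (hg : IsPrimitive g g') (c : A) :
    IsPrimitive (fun x => g x * c) (fun x => g' x * c) :=
  hg.clm ((ContinuousLinearMap.mul ℝ A).flip c)

lemma const_smul [NormedSpace ℂ E] [IsScalarTower ℝ ℂ E] [CompleteSpace E] (c : ℂ) {g g' : ℝ → E}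
    (hg : IsPrimitive g g') :
    IsPrimitive (fun x => c • g x) (fun x => c • g' x) :=
  hg.clm (ContinuousLinearMap.lsmul ℝ ℂ c)

lemma cexp (c : ℂ) : IsPrimitive (fun x : ℝ => Complex.exp (c * x))
    (fun x => c * Complex.exp (c * x)) := by
  refine IsPrimitive.of_hasDerivAt (fun x _ => HasDerivAt.hasDerivWithinAt ?_)
    (by fun_prop)
  have := ((hasDerivAt_id (x : ℂ)).const_mul c).cexp.comp_ofReal
  simpa [mul_comm] using this

end Algebra

end IsPrimitive

end Primitive

/-! ### Gronwall inequalities with integrable coefficients -/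

section Gronwall

variable {k : ℝ → ℝ}

lemma isPrimitive_integral (hk : ∀ x, 0 ≤ x → IntervalIntegrable k volume 0 x) :
    IsPrimitive (fun x => ∫ t in (0 : ℝ)..x, k t) k := ⟨hk, fun _ _ => by simp⟩

lemma IsPrimitive.le_of_nonneg {f f' : ℝ → ℝ} (h : IsPrimitive f f') (h0 : ∀ t, 0 ≤ t → 0 ≤ f' t)
    {a b : ℝ} (ha : 0 ≤ a) (hab : a ≤ b) : f a ≤ f b := by
  have := h.sub_eq ha (ha.trans hab)
  have h2 : 0 ≤ ∫ t in a..b, f' t :=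
    intervalIntegral.integral_nonneg hab fun t ht => h0 t (ha.trans ht.1)
  linarith

lemma gronwall_forward {u : ℝ → ℝ} {C : ℝ} (hk0 : ∀ t, 0 ≤ t → 0 ≤ k t)
    (hk : ∀ x, 0 ≤ x → IntervalIntegrable k volume 0 x) (hu : ContinuousOn u (Ici 0))
    (h : ∀ x, 0 ≤ x → u x ≤ C + ∫ t in (0 : ℝ)..x, k t * u t) {x : ℝ} (hx : 0 ≤ x) :
    u x ≤ C * Real.exp (∫ t in (0 : ℝ)..x, k t) := by
  have hku : ∀ x, 0 ≤ x → IntervalIntegrable (fun t => k t * u t) volume 0 x := fun x hx =>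
    (hk x hx).mul_continuousOn (hu.mono (uIcc_subset_Ici hx))
  have hv := (IsPrimitive.const C).add (isPrimitive_integral hku)
  have hE := (isPrimitive_integral hk).neg.exp
  have hp := (hv.bilin (ContinuousLinearMap.mul ℝ ℝ) hE).neg
  have key := hp.le_of_nonneg (fun t ht => ?_) le_rfl hx
  · simp only [ContinuousLinearMap.mul_apply', integral_same, neg_zero,
      Real.exp_zero, add_zero, mul_one, neg_le_neg_iff] at key
    have h1 := h x hx
    rw [Real.exp_neg, ← div_eq_mul_inv, div_le_iff₀ (exp_pos _)] at key
    linarith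
  · simp only [ContinuousLinearMap.mul_apply', zero_add]
    have h1 := mul_le_mul_of_nonneg_left (h t ht) (hk0 t ht)
    have h2 := mul_le_mul_of_nonneg_right h1 (exp_pos (-∫ s in (0 : ℝ)..t, k s)).le
    nlinarith [h2]

lemma integral_Ioi_eq_sub {E : Type*} [NormedAddCommGroup E] [NormedSpace ℝ E] {g : ℝ → E}
    (hg : IntegrableOn g (Ioi 0)) {x : ℝ} (hx : 0 ≤ x) :
    ∫ t in Ioi x, g t = (∫ t in Ioi 0, g t) - ∫ t in (0 : ℝ)..x, g t := by
  rw [eq_sub_iff_add_eq, add_comm]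
  exact intervalIntegral.integral_interval_add_Ioi hg (hg.mono_set (Ioi_subset_Ioi hx))

lemma intervalIntegrable_of_Ioi {E : Type*} [NormedAddCommGroup E] {g : ℝ → E}
    (hg : IntegrableOn g (Ioi 0)) {x : ℝ} (hx : 0 ≤ x) : IntervalIntegrable g volume 0 x := by
  rw [intervalIntegrable_iff_integrableOn_Ioc_of_le hx]
  exact hg.mono_set Ioc_subset_Ioi_self

lemma intervalIntegral_le_Ioi (hk0 : ∀ t, 0 ≤ t → 0 ≤ k t) (hk : IntegrableOn k (Ioi 0))
    {x : ℝ} (hx : 0 ≤ x) : ∫ t in (0 : ℝ)..x, k t ≤ ∫ t in Ioi 0, k t := by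
  rw [integral_of_le hx]
  refine setIntegral_mono_set hk ?_ (LE.le.eventuallyLE Ioc_subset_Ioi_self)
  exact ae_restrict_Ioi fun t ht => hk0 t ht.le

lemma gronwall_backward {u : ℝ → ℝ} {C M : ℝ} (hC : 0 ≤ C) (hk0 : ∀ t, 0 ≤ t → 0 ≤ k t)
    (hk : IntegrableOn k (Ioi 0)) (hu : ContinuousOn u (Ici 0)) (hM : ∀ x, 0 ≤ x → |u x| ≤ M)
    (h : ∀ x, 0 ≤ x → u x ≤ C + ∫ t in Ioi x, k t * u t) {x : ℝ} (hx : 0 ≤ x) :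
    u x ≤ C * Real.exp (∫ t in Ioi 0, k t) := by
  have hki := fun x hx => intervalIntegrable_of_Ioi hk (x := x) hx
  have hku : IntegrableOn (fun t => k t * u t) (Ioi 0) := by
    refine Integrable.mono' (hk.norm.mul_const M) (hk.1.mul
      ((hu.mono Ioi_subset_Ici_self).aestronglyMeasurable measurableSet_Ioi)) ?_
    refine ae_restrict_Ioi fun t ht => ?_
    rw [norm_mul]
    exact mul_le_mul_of_nonneg_left (hM t ht.le) (norm_nonneg _)
  set v : ℝ → ℝ := fun x => C + ∫ t in Ioi x, k t * u t with hvdef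
  have hv : IsPrimitive v (fun t => -(k t * u t)) := by
    have := (IsPrimitive.const (C + ∫ t in Ioi 0, k t * u t)).sub
      (isPrimitive_integral fun x hx => intervalIntegrable_of_Ioi hku (x := x) hx)
    refine (this.congr fun t _ => by ring).congr_left fun t ht => ?_
    rw [hvdef]; simp only
    rw [integral_Ioi_eq_sub hku ht]; ring
  have hE := (isPrimitive_integral hki).exp
  have hp := hv.bilin (ContinuousLinearMap.mul ℝ ℝ) hE
  have mono : ∀ T, x ≤ T → v x * Real.exp (∫ t in (0 : ℝ)..x, k t) ≤
      v T * Real.exp (∫ t in (0 : ℝ)..T, k t) := fun T hT => by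
    have := hp.le_of_nonneg (fun t ht => ?_) hx hT
    · simpa using this
    · simp only [ContinuousLinearMap.mul_apply']
      have h1 := mul_le_mul_of_nonneg_left (h t ht) (hk0 t ht)
      have h2 := mul_le_mul_of_nonneg_right h1 (exp_pos (∫ s in (0 : ℝ)..t, k s)).le
      simp only [hvdef]
      nlinarith [h2]
  have lim : Tendsto (fun T => v T * Real.exp (∫ t in (0 : ℝ)..T, k t)) atTop
      (𝓝 ((C + ((∫ t in Ioi 0, k t * u t) - ∫ t in Ioi 0, k t * u t)) *
        Real.exp (∫ t in Ioi 0, k t))) := by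
    refine Tendsto.mul ?_ ((Real.continuous_exp.tendsto _).comp
      (intervalIntegral_tendsto_integral_Ioi 0 hk tendsto_id))
    refine Tendsto.congr' ?_ (tendsto_const_nhds.add (tendsto_const_nhds.sub
      (intervalIntegral_tendsto_integral_Ioi 0 hku tendsto_id)))
    filter_upwards [eventually_ge_atTop 0] with T hT
    rw [hvdef]; simp only [id]
    rw [integral_Ioi_eq_sub hku hT]
  have h1 := ge_of_tendsto lim ((eventually_ge_atTop x).mono mono)
  rw [sub_self, add_zero] at h1
  have h2 : u x ≤ v x := h x hx
  rcases le_total 0 (v x) with h3 | h3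
  · have : 1 ≤ Real.exp (∫ t in (0 : ℝ)..x, k t) := by
      rw [Real.one_le_exp_iff]
      exact intervalIntegral.integral_nonneg hx fun t ht => hk0 t ht.1
    nlinarith
  · exact (h2.trans h3).trans (by positivity)

lemma integral_mul_exp_le (hk : ∀ x, 0 ≤ x → IntervalIntegrable k volume 0 x)
    {x : ℝ} (hx : 0 ≤ x) :
    ∫ t in (0 : ℝ)..x, k t * Real.exp (2 * ∫ s in (0 : ℝ)..t, k s) ≤
      Real.exp (2 * ∫ s in (0 : ℝ)..x, k s) / 2 := by
  have := ((isPrimitive_integral hk).bilin (ContinuousLinearMap.mul ℝ ℝ)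
    (IsPrimitive.const (2 : ℝ))).exp.sub_eq le_rfl hx
  simp only [ContinuousLinearMap.mul_apply', mul_zero, add_zero, integral_same,
    zero_mul, Real.exp_zero] at this
  have e : ∀ t, k t * 2 * Real.exp ((∫ s in (0 : ℝ)..t, k s) * 2) =
      2 * (k t * Real.exp (2 * ∫ s in (0 : ℝ)..t, k s)) := fun t => by
    rw [mul_comm (∫ s in (0 : ℝ)..t, k s) 2]; ring
  simp_rw [e, intervalIntegral.integral_const_mul] at this
  rw [mul_comm _ (2 : ℝ)] at this
  linarith

lemma integral_Ioi_mul_exp_le (hk0 : ∀ t, 0 ≤ t → 0 ≤ k t) (hk : IntegrableOn k (Ioi 0))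
    {x : ℝ} (hx : 0 ≤ x) :
    ∫ t in Ioi x, k t * Real.exp (2 * ∫ s in Ioi t, k s) ≤
      Real.exp (2 * ∫ s in Ioi x, k s) / 2 := by
  have hki := fun x hx => intervalIntegrable_of_Ioi hk (x := x) hx
  have hW : IsPrimitive (fun x => Real.exp (2 * ∫ s in Ioi x, k s))
      (fun t => -2 * (k t * Real.exp (2 * ∫ s in Ioi t, k s))) := by
    have := ((IsPrimitive.const (2 * ∫ s in Ioi 0, k s)).sub ((isPrimitive_integral hki).bilin
      (ContinuousLinearMap.mul ℝ ℝ) (IsPrimitive.const (2 : ℝ)))).exp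
    have e : ∀ t, 0 ≤ t → 2 * (∫ s in Ioi 0, k s) - (ContinuousLinearMap.mul ℝ ℝ)
        (∫ s in (0 : ℝ)..t, k s) 2 = 2 * ∫ s in Ioi t, k s := fun t ht => by
      rw [integral_Ioi_eq_sub hk ht]; simp; ring
    refine (this.congr fun t ht => ?_).congr_left fun t ht => by rw [e t ht]
    rw [e t ht]; simp; ring
  have hint : IntegrableOn (fun t => k t * Real.exp (2 * ∫ s in Ioi t, k s)) (Ioi 0) := by
    refine Integrable.mono' (hk.norm.mul_const (Real.exp (2 * ∫ s in Ioi 0, k s))) (hk.1.mul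
      ((hW.continuousOn.mono Ioi_subset_Ici_self).aestronglyMeasurable measurableSet_Ioi)) ?_
    refine ae_restrict_Ioi fun t ht => ?_
    rw [norm_mul, norm_of_nonneg (exp_pos _).le]
    refine mul_le_mul_of_nonneg_left (exp_le_exp.2 ?_) (norm_nonneg _)
    rw [integral_Ioi_eq_sub hk ht.le]
    have : 0 ≤ ∫ s in (0 : ℝ)..t, k s :=
      intervalIntegral.integral_nonneg ht.le fun s hs => hk0 s hs.1
    linarith
  have hint' := hint.mono_set (Ioi_subset_Ioi hx)
  refine le_of_tendsto (intervalIntegral_tendsto_integral_Ioi x hint' tendsto_id) ?_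
  filter_upwards [eventually_ge_atTop x] with T hT
  have := hW.sub_eq hx (hx.trans hT)
  rw [intervalIntegral.integral_const_mul] at this
  simp only [id]
  have := exp_pos (2 * ∫ s in Ioi T, k s)
  linarith

end Gronwall

/-! ### Integrals depending holomorphically on a parameter -/

section Parameter

variable {α : Type*} [MeasurableSpace α] {μ : Measure α}
  {E : Type*} [NormedAddCommGroup E] [NormedSpace ℂ E]

lemma differentiableOn_integral_of_dominated {U : Set ℂ} (hU : IsOpen U) {F : ℂ → α → E}
    {b : α → ℝ} (hm : ∀ z ∈ U, AEStronglyMeasurable (F z) μ)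
    (hd : ∀ᵐ t ∂μ, DifferentiableOn ℂ (fun z => F z t) U)
    (hb : ∀ᵐ t ∂μ, ∀ z ∈ U, ‖F z t‖ ≤ b t) (hi : Integrable b μ) :
    DifferentiableOn ℂ (fun z => ∫ t, F z t ∂μ) U := by
  intro z₀ hz₀
  obtain ⟨r, hr, hball⟩ := Metric.isOpen_iff.1 hU z₀ hz₀
  have hr2 : 0 < r / 2 := by positivity
  have hsub : ∀ z ∈ ball z₀ (r / 2), closedBall z (r / 4) ⊆ U := fun z hz w hw =>
    hball (by
      rw [mem_ball] at hz ⊢; rw [mem_closedBall] at hw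
      linarith [dist_triangle w z z₀])
  have hderiv : ∀ᵐ t ∂μ, ∀ z ∈ ball z₀ (r / 2),
      HasDerivAt (fun z => F z t) (deriv (fun z => F z t) z) z := by
    filter_upwards [hd] with t ht z hz
    exact ((ht z (hsub z hz (Metric.mem_closedBall_self (by positivity)))).differentiableAt
      (hU.mem_nhds (hsub z hz (Metric.mem_closedBall_self (by positivity))))).hasDerivAt
  -- the derivative in the parameter is measurable as a limit of difference quotients
  have hmeas : AEStronglyMeasurable (fun t => deriv (fun z => F z t) z₀) μ := by
    classical
    refine aestronglyMeasurable_of_tendsto_ae (𝓝[≠] z₀)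
      (f := fun w t => if w ∈ U then slope (fun z => F z t) z₀ w else 0) (fun w => ?_) ?_
    · split_ifs with h
      · simp only [slope, vsub_eq_sub]
        exact ((hm w h).sub (hm z₀ hz₀)).const_smul _
      · exact aestronglyMeasurable_const
    · filter_upwards [hderiv] with t ht
      refine (ht z₀ (Metric.mem_ball_self hr2)).tendsto_slope.congr' ?_
      filter_upwards [mem_nhdsWithin_of_mem_nhds (hU.mem_nhds hz₀)] with w hw
      rw [if_pos hw]
  have hbd : ∀ᵐ t ∂μ, ∀ z ∈ ball z₀ (r / 2),
      ‖deriv (fun z => F z t) z‖ ≤ b t / (r / 4) := by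
    filter_upwards [hd, hb] with t ht hbt z hz
    refine Complex.norm_deriv_le_of_forall_mem_sphere_norm_le (by positivity) ?_ fun w hw =>
      hbt w (hsub z hz (Metric.sphere_subset_closedBall hw))
    refine DifferentiableOn.diffContOnCl ?_
    rw [closure_ball _ (by positivity)]
    exact ht.mono (hsub z hz)
  refine (hasDerivAt_integral_of_dominated_loc_of_deriv_le (ball_mem_nhds z₀ hr2)
    (F' := fun z t => deriv (fun z => F z t) z) (bound := fun t => b t / (r / 4))
    ?_ ?_ hmeas hbd (hi.div_const _) hderiv).2.differentiableAt.differentiableWithinAt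
  · filter_upwards [hU.mem_nhds hz₀] with z hz using hm z hz
  · refine hi.mono' (hm z₀ hz₀) ?_
    filter_upwards [hb] with t ht using ht z₀ hz₀

end Parameter

/-! ### Volterra equations depending on a parameter -/

section Volterra

variable {E : Type*} [NormedAddCommGroup E] [NormedSpace ℂ E]

/-- The kernel data of a linear Volterra equation `u(z, x) = f(z, x) + ∫ N(z, x, t) u(z, t) dμ(t)`
with parameter `z ∈ Ω`, whose kernel is dominated by `k` and is holomorphic in `z ∈ O`. The weight
`W` makes the integral operator a contraction with constant `1/2`. -/
structure VolterraKernel (Ω O : Set ℂ) (S : Set ℝ) (μ : Measure ℝ) (N : ℂ → ℝ → ℝ → E →L[ℂ] E)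
    (k : ℝ → ℝ → ℝ) (k₁ W : ℝ → ℝ) (B : ℝ) : Prop where
  isOpen : IsOpen O
  subset : O ⊆ Ω
  measurableSet : MeasurableSet S
  ae_mem : ∀ᵐ t ∂μ, t ∈ S
  aestronglyMeasurable : ∀ z ∈ Ω, ∀ x ∈ S, AEStronglyMeasurable (N z x) μ
  norm_le : ∀ x ∈ S, ∀ᵐ t ∂μ, ∀ z ∈ Ω, ‖N z x t‖ ≤ k x t
  le_bound : ∀ x ∈ S, ∀ᵐ t ∂μ, k x t ≤ k₁ t
  integrable : ∀ x ∈ S, Integrable (k x) μ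
  integrable_bound : Integrable k₁ μ
  continuousWithinAt : ∀ p ∈ Ω ×ˢ S, ∀ᵐ t ∂μ,
    ContinuousWithinAt (fun p : ℂ × ℝ => N p.1 p.2 t) (Ω ×ˢ S) p
  differentiableOn : ∀ x ∈ S, ∀ᵐ t ∂μ, DifferentiableOn ℂ (fun z => N z x t) O
  weight_continuousOn : ContinuousOn W S
  one_le_weight : ∀ x ∈ S, 1 ≤ W x
  weight_le : ∀ x ∈ S, W x ≤ B
  contraction : ∀ x ∈ S, ∫ t, k x t * W t ∂μ ≤ W x / 2

namespace VolterraKernel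

variable {Ω O : Set ℂ} {S : Set ℝ} {μ : Measure ℝ} {N : ℂ → ℝ → ℝ → E →L[ℂ] E}
  {k : ℝ → ℝ → ℝ} {k₁ W : ℝ → ℝ} {B : ℝ}

lemma aestronglyMeasurable_apply (K : VolterraKernel Ω O S μ N k k₁ W B) {v : ℝ → E}
    (hv : ContinuousOn v S) {z : ℂ} (hz : z ∈ Ω) {x : ℝ} (hx : x ∈ S) :
    AEStronglyMeasurable (fun t => N z x t (v t)) μ := by
  have h1 : AEStronglyMeasurable v μ := by
    have := hv.aestronglyMeasurable (μ := μ) K.measurableSet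
    rwa [Measure.restrict_eq_self_of_ae_mem K.ae_mem] at this
  exact (ContinuousLinearMap.apply ℂ E).flip.aestronglyMeasurable_comp₂
    (K.aestronglyMeasurable z hz x hx) h1

lemma norm_apply_le (K : VolterraKernel Ω O S μ N k k₁ W B) {v : ℝ → E} {D : ℝ}
    (hD : ∀ t ∈ S, ‖v t‖ ≤ D * W t) {z : ℂ} (hz : z ∈ Ω) {x : ℝ} (hx : x ∈ S) :
    ∀ᵐ t ∂μ, ‖N z x t (v t)‖ ≤ D * (k x t * W t) := by
  filter_upwards [K.ae_mem, K.norm_le x hx] with t ht hN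
  replace hN := hN z hz
  calc _ ≤ ‖N z x t‖ * ‖v t‖ := (N z x t).le_opNorm _
    _ ≤ k x t * (D * W t) := mul_le_mul hN (hD t ht) (norm_nonneg _) ((norm_nonneg _).trans hN)
    _ = _ := by ring

lemma integrable_mul_weight (K : VolterraKernel Ω O S μ N k k₁ W B) {x : ℝ} (hx : x ∈ S) :
    Integrable (fun t => k x t * W t) μ := by
  have h1 : AEStronglyMeasurable W μ := by
    have := K.weight_continuousOn.aestronglyMeasurable (μ := μ) K.measurableSet
    rwa [Measure.restrict_eq_self_of_ae_mem K.ae_mem] at this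
  refine Integrable.mono' ((K.integrable x hx).norm.mul_const B) ((K.integrable x hx).1.mul h1) ?_
  filter_upwards [K.ae_mem] with t ht
  rw [norm_mul, norm_of_nonneg (zero_le_one.trans (K.one_le_weight t ht))]
  exact mul_le_mul_of_nonneg_left (K.weight_le t ht) (norm_nonneg _)

lemma integrable_apply (K : VolterraKernel Ω O S μ N k k₁ W B) {v : ℝ → E}
    (hv : ContinuousOn v S) {D : ℝ}
    (hD : ∀ t ∈ S, ‖v t‖ ≤ D * W t) {z : ℂ} (hz : z ∈ Ω) {x : ℝ} (hx : x ∈ S) :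
    Integrable (fun t => N z x t (v t)) μ :=
  ((K.integrable_mul_weight hx).const_mul D).mono' (K.aestronglyMeasurable_apply hv hz hx)
    (K.norm_apply_le hD hz hx)

lemma norm_integral_le (K : VolterraKernel Ω O S μ N k k₁ W B) {v : ℝ → E} {D : ℝ} (hD0 : 0 ≤ D)
    (hD : ∀ t ∈ S, ‖v t‖ ≤ D * W t) {z : ℂ} (hz : z ∈ Ω) {x : ℝ} (hx : x ∈ S) :
    ‖∫ t, N z x t (v t) ∂μ‖ ≤ D / 2 * W x := by
  refine (norm_integral_le_of_norm_le ((K.integrable_mul_weight hx).const_mul D)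
    (K.norm_apply_le hD hz hx)).trans ?_
  rw [integral_const_mul]
  nlinarith [K.contraction x hx]

lemma continuousOn_integral (K : VolterraKernel Ω O S μ N k k₁ W B) {v : ℂ → ℝ → E} {D : ℝ}
    (hD0 : 0 ≤ D) (hv : ContinuousOn (fun p : ℂ × ℝ => v p.1 p.2) (Ω ×ˢ S))
    (hD : ∀ z ∈ Ω, ∀ t ∈ S, ‖v z t‖ ≤ D * W t) :
    ContinuousOn (fun p : ℂ × ℝ => ∫ t, N p.1 p.2 t (v p.1 t) ∂μ) (Ω ×ˢ S) := by
  have hv1 : ∀ z ∈ Ω, ContinuousOn (v z) S := fun z hz =>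
    hv.comp (f := fun t => (z, t)) (by fun_prop) fun t ht => ⟨hz, ht⟩
  intro p hp
  refine continuousWithinAt_of_dominated (bound := fun t => D * (k₁ t * B)) ?_ ?_
    ((K.integrable_bound.mul_const B).const_mul D) ?_
  · filter_upwards [self_mem_nhdsWithin] with q hq
    exact K.aestronglyMeasurable_apply (hv1 _ hq.1) hq.1 hq.2
  · filter_upwards [self_mem_nhdsWithin] with q hq
    filter_upwards [K.norm_apply_le (hD _ hq.1) hq.1 hq.2, K.le_bound _ hq.2, K.ae_mem,
      K.norm_le _ hq.2] with t h1 h2 h3 h4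
    replace h4 := h4 _ hq.1
    refine h1.trans (mul_le_mul_of_nonneg_left ?_ hD0)
    exact mul_le_mul h2 (K.weight_le t h3) (zero_le_one.trans (K.one_le_weight t h3))
      (((norm_nonneg _).trans h4).trans h2)
  · filter_upwards [K.continuousWithinAt p hp, K.ae_mem] with t h1 h2
    refine h1.clm_apply ?_
    exact (hv (p.1, t) ⟨hp.1, h2⟩).comp (f := fun q : ℂ × ℝ => (q.1, t))
      (by fun_prop) fun q hq => ⟨hq.1, h2⟩

lemma differentiableOn_integral (K : VolterraKernel Ω O S μ N k k₁ W B) {v : ℂ → ℝ → E} {D : ℝ}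
    (hv : ContinuousOn (fun p : ℂ × ℝ => v p.1 p.2) (Ω ×ˢ S))
    (hvd : ∀ x ∈ S, DifferentiableOn ℂ (fun z => v z x) O)
    (hD : ∀ z ∈ Ω, ∀ t ∈ S, ‖v z t‖ ≤ D * W t)
    {x : ℝ} (hx : x ∈ S) :
    DifferentiableOn ℂ (fun z => ∫ t, N z x t (v z t) ∂μ) O := by
  have hv1 : ∀ z ∈ Ω, ContinuousOn (v z) S := fun z hz =>
    hv.comp (f := fun t => (z, t)) (by fun_prop) fun t ht => ⟨hz, ht⟩
  refine differentiableOn_integral_of_dominated K.isOpen (b := fun t => D * (k x t * W t))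
    (fun z hz => K.aestronglyMeasurable_apply (hv1 z (K.subset hz)) (K.subset hz) hx) ?_ ?_
    ((K.integrable_mul_weight hx).const_mul D)
  · filter_upwards [K.differentiableOn x hx, K.ae_mem] with t h1 h2
    exact h1.clm_apply (hvd t h2)
  · filter_upwards [K.norm_le x hx, K.ae_mem] with t h1 h2 z hz
    replace h1 := fun z hz => h1 z (K.subset hz)
    calc _ ≤ ‖N z x t‖ * ‖v z t‖ := (N z x t).le_opNorm _
      _ ≤ k x t * (D * W t) := mul_le_mul (h1 z hz) (hD z (K.subset hz) t h2) (norm_nonneg _)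
        ((norm_nonneg _).trans (h1 z hz))
      _ = _ := by ring

end VolterraKernel

/-- The Picard iterates of the equation `u(z, x) = f(z, x) + J(z, x, u(z, ·))`. -/
def picard (J : ℂ → ℝ → (ℝ → E) → E) (f : ℂ → ℝ → E) (n : ℕ) : ℂ → ℝ → E :=
  (fun v z x => f z x + J z x (v z))^[n] 0

/-- The limit of the Picard iterates. It does not depend on the domain on which the convergence is
established, so that local results need not be glued. -/
noncomputable def picardLim (J : ℂ → ℝ → (ℝ → E) → E) (f : ℂ → ℝ → E) (z : ℂ) (x : ℝ) : E :=
  limUnder atTop fun n => picard J f n z x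

/-- The Picard limit of a Volterra equation is a bounded solution, jointly continuous, and
holomorphic in the parameter. -/
theorem VolterraKernel.picardLim_spec [CompleteSpace E] (K : VolterraKernel Ω O S μ N k k₁ W B)
    {J : ℂ → ℝ → (ℝ → E) → E} (hJ : ∀ z ∈ Ω, ∀ x ∈ S, ∀ v, J z x v = ∫ t, N z x t (v t) ∂μ)
    {f : ℂ → ℝ → E} {C : ℝ}
    (hC : 0 ≤ C) (hfc : ContinuousOn (fun p : ℂ × ℝ => f p.1 p.2) (Ω ×ˢ S))
    (hfd : ∀ x ∈ S, DifferentiableOn ℂ (fun z => f z x) O)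
    (hfb : ∀ z ∈ Ω, ∀ x ∈ S, ‖f z x‖ ≤ C) :
    ContinuousOn (fun p : ℂ × ℝ => picardLim J f p.1 p.2) (Ω ×ˢ S) ∧
      (∀ x ∈ S, DifferentiableOn ℂ (fun z => picardLim J f z x) O) ∧
      (∀ z ∈ Ω, ∀ x ∈ S, ‖picardLim J f z x‖ ≤ 2 * C * B) ∧
      ∀ z ∈ Ω, ∀ x ∈ S, picardLim J f z x = f z x + J z x (picardLim J f z) := by
  set v := picard J f
  have hv0 : ∀ z x, v 0 z x = 0 := fun _ _ => rfl
  have hv_succ : ∀ n, ∀ z ∈ Ω, ∀ x ∈ S, v (n + 1) z x = f z x + ∫ t, N z x t (v n z t) ∂μ :=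
    fun n z hz x hx => by
      simp only [v, picard, Function.iterate_succ_apply', hJ z hz x hx]
  have hprop : ∀ n, ContinuousOn (fun p : ℂ × ℝ => v n p.1 p.2) (Ω ×ˢ S) ∧
      (∀ x ∈ S, DifferentiableOn ℂ (fun z => v n z x) O) ∧
      (∀ z ∈ Ω, ∀ x ∈ S, ‖v n z x‖ ≤ 2 * C * W x) := by
    intro n
    induction n with
    | zero =>
      refine ⟨continuousOn_const, fun x _ => differentiableOn_const _, fun z _ x hx => ?_⟩
      have := K.one_le_weight x hx
      rw [hv0, norm_zero]
      positivity
    | succ n ih =>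
      obtain ⟨h1, h2, h3⟩ := ih
      refine ⟨(hfc.add (K.continuousOn_integral (by positivity) h1 h3)).congr
          fun p hp => hv_succ n _ hp.1 _ hp.2,
        fun x hx => ((hfd x hx).add (K.differentiableOn_integral h1 h2 h3 hx)).congr
          fun z hz => hv_succ n z (K.subset hz) x hx, fun z hz x hx => ?_⟩
      have a1 := K.norm_integral_le (by positivity) (h3 z hz) hz hx
      have a2 := hfb z hz x hx
      have a3 := K.one_le_weight x hx
      rw [hv_succ n z hz x hx]
      refine (norm_add_le _ _).trans ?_
      nlinarith
  have hvc : ∀ n, ∀ z ∈ Ω, ContinuousOn (v n z) S := fun n z hz =>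
    (hprop n).1.comp (f := fun t => (z, t)) (by fun_prop) fun t ht => ⟨hz, ht⟩
  have hdist : ∀ n, ∀ z ∈ Ω, ∀ x ∈ S, ‖v (n + 1) z x - v n z x‖ ≤ C * (1 / 2) ^ n * W x := by
    intro n
    induction n with
    | zero =>
      intro z hz x hx
      have := K.one_le_weight x hx
      have := hfb z hz x hx
      rw [hv_succ 0 z hz x hx]
      simp only [hv0, map_zero, integral_zero, add_zero, sub_zero, pow_zero, mul_one]
      nlinarith
    | succ n ih =>
      intro z hz x hx
      rw [hv_succ (n + 1) z hz x hx, hv_succ n z hz x hx, add_sub_add_left_eq_sub,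
        ← integral_sub (K.integrable_apply (hvc _ z hz) ((hprop _).2.2 z hz) hz hx)
          (K.integrable_apply (hvc _ z hz) ((hprop _).2.2 z hz) hz hx)]
      simp_rw [← map_sub]
      refine (K.norm_integral_le (by positivity) (ih z hz) hz hx).trans (le_of_eq ?_)
      rw [pow_succ]; ring
  have hB : ∀ z ∈ Ω, ∀ x ∈ S, ∀ n, dist (v n z x) (v (n + 1) z x) ≤ C * B * (1 / 2) ^ n := by
    intro z hz x hx n
    rw [dist_comm, dist_eq_norm]
    refine (hdist n z hz x hx).trans ?_
    have := K.weight_le x hx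
    have h2 : 0 ≤ C * (1 / 2 : ℝ) ^ n := by positivity
    nlinarith
  set u := picardLim J f
  have hu : ∀ z ∈ Ω, ∀ x ∈ S, Tendsto (fun n => v n z x) atTop (𝓝 (u z x)) := fun z hz x hx =>
    (cauchySeq_of_le_geometric _ _ (by norm_num) (hB z hz x hx)).tendsto_limUnder
  have hunif : TendstoUniformlyOn (fun n (p : ℂ × ℝ) => v n p.1 p.2) (fun p => u p.1 p.2) atTop
      (Ω ×ˢ S) := by
    rw [Metric.tendstoUniformlyOn_iff]
    intro ε hε
    have h0 : Tendsto (fun n : ℕ => C * B * (1 / 2 : ℝ) ^ n / (1 - 1 / 2)) atTop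
        (𝓝 (C * B * 0 / (1 - 1 / 2))) :=
      ((tendsto_pow_atTop_nhds_zero_of_lt_one (by norm_num) (by norm_num)).const_mul _).div_const _
    rw [mul_zero, zero_div] at h0
    filter_upwards [h0.eventually (gt_mem_nhds hε)] with n hn p hp
    rw [dist_comm]
    exact (dist_le_of_le_geometric_of_tendsto _ _ (by norm_num) (hB _ hp.1 _ hp.2)
      (hu _ hp.1 _ hp.2) n).trans_lt hn
  have hub : ∀ z ∈ Ω, ∀ x ∈ S, ‖u z x‖ ≤ 2 * C * W x := fun z hz x hx =>
    le_of_tendsto (hu z hz x hx).norm (Eventually.of_forall fun n => (hprop n).2.2 z hz x hx)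
  refine ⟨hunif.continuousOn (Frequently.of_forall fun n => (hprop n).1), fun x hx => ?_,
    fun z hz x hx => (hub z hz x hx).trans
    (mul_le_mul_of_nonneg_left (K.weight_le x hx) (by positivity)), fun z hz x hx => ?_⟩
  · refine TendstoLocallyUniformlyOn.differentiableOn (F := fun n z => v n z x) (φ := atTop) ?_
      (Eventually.of_forall fun n => (hprop n).2.1 x hx) K.isOpen
    refine TendstoUniformlyOn.tendstoLocallyUniformlyOn ?_
    rw [Metric.tendstoUniformlyOn_iff] at hunif ⊢
    intro ε hε
    filter_upwards [hunif ε hε] with n hn z hz using hn (z, x) ⟨K.subset hz, hx⟩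
  · have h1 : Tendsto (fun n => v (n + 1) z x) atTop (𝓝 (u z x)) :=
      (hu z hz x hx).comp (tendsto_add_atTop_nat 1)
    refine tendsto_nhds_unique h1 ?_
    simp_rw [hv_succ _ z hz x hx]
    rw [hJ z hz x hx]
    refine tendsto_const_nhds.add ?_
    refine tendsto_integral_of_dominated_convergence (fun t => 2 * C * (k x t * W t))
      (fun n => K.aestronglyMeasurable_apply (hvc n z hz) hz hx)
      ((K.integrable_mul_weight hx).const_mul _)
      (fun n => K.norm_apply_le ((hprop n).2.2 z hz) hz hx) ?_
    filter_upwards [K.ae_mem] with t ht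
    exact ((N z x t).continuous.tendsto _).comp (hu z hz t ht)

end Volterra

/-! ### Linear systems with integrable coefficients -/

section LinearSystem

variable {E : Type*} [NormedAddCommGroup E] [NormedSpace ℂ E]

/-- The Volterra kernel of a linear system on `[0, T]`. -/
lemma volterraKernel_linear {L : ℂ → ℝ → E →L[ℂ] E}
    (hm : ∀ z, AEStronglyMeasurable (L z) (volume.restrict (Ioi 0)))
    (hd : ∀ t, Differentiable ℂ fun z => L z t) {R : ℝ} {k : ℝ → ℝ} (hk0 : ∀ t, 0 ≤ k t)
    (hk : ∀ x, 0 ≤ x → IntervalIntegrable k volume 0 x)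
    (hb : ∀ z ∈ ball (0 : ℂ) R, ∀ t, ‖L z t‖ ≤ k t) {T : ℝ} (hT : 0 ≤ T) :
    VolterraKernel (ball (0 : ℂ) R) (ball (0 : ℂ) R) (Icc 0 T)
      (volume.restrict (Ioc 0 T)) (fun z x t => (Iic x).indicator (L z) t)
      (fun x t => (Iic x).indicator k t) k
      (fun x => Real.exp (2 * ∫ t in (0 : ℝ)..x, k t))
      (Real.exp (2 * ∫ t in (0 : ℝ)..T, k t)) where
  isOpen := isOpen_ball
  subset := subset_rfl
  measurableSet := measurableSet_Icc
  ae_mem := ae_restrict_of_forall_mem measurableSet_Ioc fun t ht => Ioc_subset_Icc_self ht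
  aestronglyMeasurable z _ x _ :=
    ((hm z).mono_measure (Measure.restrict_mono Ioc_subset_Ioi_self le_rfl)).indicator
      measurableSet_Iic
  norm_le x _ := ae_of_all _ fun t z hz => by
    by_cases h : t ∈ Iic x
    · simp only [indicator_of_mem h]; exact hb z hz t
    · simp [indicator_of_notMem h]
  le_bound x _ := ae_of_all _ fun t => indicator_le_self' (fun _ _ => hk0 _) t
  integrable x _ := ((intervalIntegrable_iff_integrableOn_Ioc_of_le hT).1 (hk T hT)).indicator
    measurableSet_Iic
  integrable_bound := (intervalIntegrable_iff_integrableOn_Ioc_of_le hT).1 (hk T hT)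
  continuousWithinAt p _ := by
    have h0 : ∀ᵐ t ∂(volume.restrict (Ioc 0 T)), t ≠ p.2 := by
      refine ae_restrict_of_ae ?_
      simp [ae_iff]
    filter_upwards [h0] with t ht
    rcases lt_or_gt_of_ne ht with h | h
    · have : (fun q : ℂ × ℝ => (Iic q.2).indicator (L q.1) t) =ᶠ[𝓝 p] fun q => L q.1 t := by
        filter_upwards [continuous_snd.continuousAt.eventually (lt_mem_nhds h)] with q hq
        exact indicator_of_mem (by exact hq.le) _
      exact (((hd t).continuous.comp continuous_fst).continuousAt.congr
        this.symm).continuousWithinAt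
    · have : (fun q : ℂ × ℝ => (Iic q.2).indicator (L q.1) t) =ᶠ[𝓝 p] fun q => 0 := by
        filter_upwards [continuous_snd.continuousAt.eventually (gt_mem_nhds h)] with q hq
        exact indicator_of_notMem (by simpa using hq) _
      exact (continuousAt_const.congr this.symm).continuousWithinAt
  differentiableOn x _ := ae_of_all _ fun t => by
    by_cases h : t ∈ Iic x
    · simp only [indicator_of_mem h]; exact (hd t).differentiableOn
    · simp only [indicator_of_notMem h]; exact differentiableOn_const _
  weight_continuousOn := ((isPrimitive_integral hk).continuousOn.const_smul (2 : ℝ)).rexp.mono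
    Icc_subset_Ici_self
  one_le_weight x hx := Real.one_le_exp (mul_nonneg zero_le_two
    (intervalIntegral.integral_nonneg hx.1 fun t _ => hk0 t))
  weight_le x hx := by
    refine exp_le_exp.2 (mul_le_mul_of_nonneg_left ?_ zero_le_two)
    exact (isPrimitive_integral hk).le_of_nonneg (fun t _ => hk0 t) hx.1 hx.2
  contraction x hx := by
    refine le_trans (le_of_eq ?_) (integral_mul_exp_le hk hx.1)
    rw [integral_of_le hx.1]
    have : (fun t => (Iic x).indicator k t * Real.exp (2 * ∫ s in (0 : ℝ)..t, k s)) =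
        (Iic x).indicator (fun t => k t * Real.exp (2 * ∫ s in (0 : ℝ)..t, k s)) := by
      ext t; by_cases h : t ∈ Iic x <;> simp [h]
    rw [this, setIntegral_indicator measurableSet_Iic, Ioc_inter_Iic, min_eq_right hx.2]

lemma setIntegral_indicator_Iic (g : ℝ → E →L[ℂ] E) (v : ℝ → E) {x T : ℝ} (hx : x ∈ Icc 0 T) :
    ∫ t in Ioc 0 T, (Iic x).indicator g t (v t) = ∫ t in (0 : ℝ)..x, g t (v t) := by
  have : (fun t => (Iic x).indicator g t (v t)) = (Iic x).indicator fun t => g t (v t) := by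
    ext t; by_cases h : t ∈ Iic x <;> simp [h]
  rw [this, setIntegral_indicator measurableSet_Iic, Ioc_inter_Iic, min_eq_right hx.2,
    integral_of_le hx.1]

/-- A linear system whose coefficients and initial value are entire in a parameter has a solution on
`[0, ∞)` which is entire in the parameter. -/
theorem exists_linear_system [CompleteSpace E] {L : ℂ → ℝ → E →L[ℂ] E}
    (hm : ∀ z, AEStronglyMeasurable (L z) (volume.restrict (Ioi 0)))
    (hd : ∀ t, Differentiable ℂ fun z => L z t)
    (hb : ∀ R, ∃ k : ℝ → ℝ, (∀ t, 0 ≤ k t) ∧ (∀ x, 0 ≤ x → IntervalIntegrable k volume 0 x) ∧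
      ∀ z ∈ ball (0 : ℂ) R, ∀ t, ‖L z t‖ ≤ k t)
    {f : ℂ → E} (hf : Differentiable ℂ f) :
    ∃ u : ℂ → ℝ → E, (∀ x, 0 ≤ x → Differentiable ℂ fun z => u z x) ∧
      ∀ z, ContinuousOn (u z) (Ici 0) ∧
        ∀ x, 0 ≤ x → u z x = f z + ∫ t in (0 : ℝ)..x, L z t (u z t) := by
  set J : ℂ → ℝ → (ℝ → E) → E := fun z x v => ∫ t in (0 : ℝ)..x, L z t (v t)
  set u := picardLim J fun z _ => f z
  have spec : ∀ R T : ℝ, 0 ≤ T →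
      ContinuousOn (fun p : ℂ × ℝ => u p.1 p.2) (ball (0 : ℂ) R ×ˢ Icc 0 T) ∧
      (∀ x ∈ Icc 0 T, DifferentiableOn ℂ (fun z => u z x) (ball (0 : ℂ) R)) ∧
      ∀ z ∈ ball (0 : ℂ) R, ∀ x ∈ Icc 0 T, u z x = f z + J z x (u z) := fun R T hT => by
    obtain ⟨k, hk0, hk, hkb⟩ := hb R
    obtain ⟨C, hC⟩ := (isCompact_closedBall (0 : ℂ) R).exists_bound_of_continuousOn
      hf.continuous.continuousOn
    obtain ⟨h1, h2, -, h3⟩ := (volterraKernel_linear hm hd hk0 hk hkb hT).picardLim_spec (J := J)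
      (fun z _ x hx v => (setIntegral_indicator_Iic _ _ hx).symm) (f := fun z _ => f z)
      (abs_nonneg C) (hf.continuous.comp continuous_fst).continuousOn (fun _ _ =>
        hf.differentiableOn)
      fun z hz _ _ => (hC z (Metric.ball_subset_closedBall hz)).trans (le_abs_self _)
    exact ⟨h1, h2, h3⟩
  have mem : ∀ z : ℂ, z ∈ ball (0 : ℂ) (‖z‖ + 1) := fun z => by simp
  refine ⟨u, fun x hx z => ?_, fun z => ⟨fun x hx => ?_, fun x hx => ?_⟩⟩
  · exact ((spec (‖z‖ + 1) x hx).2.1 x (right_mem_Icc.2 hx)).differentiableAt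
      (isOpen_ball.mem_nhds (mem z))
  · have hx0 : (0 : ℝ) ≤ x := hx
    have c1 := (spec (‖z‖ + 1) (x + 1) (by linarith)).1.comp (f := fun t => (z, t))
      (s := Icc 0 (x + 1)) (by fun_prop) fun t ht => ⟨mem z, ht⟩
    refine (c1 x ⟨hx0, by linarith⟩).mono_of_mem_nhdsWithin ?_
    filter_upwards [self_mem_nhdsWithin, mem_nhdsWithin_of_mem_nhds
      (Iic_mem_nhds (show x < x + 1 by linarith))] with y hy hy'
    exact ⟨hy, hy'⟩
  · exact (spec (‖z‖ + 1) x hx).2.2 z (mem z) x (right_mem_Icc.2 hx)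

lemma intervalIntegrable_clm_apply_of_le {L : ℝ → E →L[ℂ] E} {k : ℝ → ℝ} {v : ℝ → E}
    (hm : AEStronglyMeasurable L (volume.restrict (Ioi 0)))
    (hk : ∀ x, 0 ≤ x → IntervalIntegrable k volume 0 x) (hb : ∀ t, ‖L t‖ ≤ k t)
    (hv : ContinuousOn v (Ici 0)) {x : ℝ} (hx : 0 ≤ x) :
    IntervalIntegrable (fun t => L t (v t)) volume 0 x := by
  obtain ⟨D, hD⟩ := isCompact_Icc.exists_bound_of_continuousOn
    (hv.mono (Icc_subset_Ici_self : Icc 0 x ⊆ Ici 0))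
  rw [intervalIntegrable_iff_integrableOn_Ioc_of_le hx]
  refine Integrable.mono' (((intervalIntegrable_iff_integrableOn_Ioc_of_le hx).1
    (hk x hx)).mul_const D) ?_ ?_
  · exact (ContinuousLinearMap.apply ℂ E).flip.aestronglyMeasurable_comp₂
      (hm.mono_measure (Measure.restrict_mono Ioc_subset_Ioi_self le_rfl))
      ((hv.mono (Ioc_subset_Icc_self.trans Icc_subset_Ici_self)).aestronglyMeasurable
        measurableSet_Ioc)
  · refine ae_restrict_of_forall_mem measurableSet_Ioc fun t ht => ?_
    exact ((L t).le_opNorm _).trans (mul_le_mul (hb t) (hD t (Ioc_subset_Icc_self ht))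
      (norm_nonneg _) ((norm_nonneg _).trans (hb t)))

/-- Uniqueness for a homogeneous linear system. -/
lemma IsPrimitive.eq_zero_of_linear {v g : ℝ → E} (h : IsPrimitive v g) {k : ℝ → ℝ}
    (hk0 : ∀ t, 0 ≤ t → 0 ≤ k t)
    (hk : ∀ x, 0 ≤ x → IntervalIntegrable k volume 0 x) (hb : ∀ t, 0 ≤ t → ‖g t‖ ≤ k t * ‖v t‖)
    (h0 : v 0 = 0) {x : ℝ} (hx : 0 ≤ x) : v x = 0 := by
  have hc := h.continuousOn.norm
  have := gronwall_forward (u := fun t => ‖v t‖) (C := 0) hk0 hk hc (fun y hy => ?_) hx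
  · simpa using this
  · rw [h.eq_add y hy, h0, zero_add, zero_add]
    refine intervalIntegral.norm_integral_le_of_norm_le hy (ae_of_all _ fun t ht => hb t ht.1.le) ?_
    exact (hk y hy).mul_continuousOn (hc.mono (uIcc_subset_Ici hy))

end LinearSystem

/-! ### Block operators on pairs -/

section Block

variable {A : Type*} [NormedRing A] [NormedAlgebra ℂ A]

/-- The map `(a, b, c, d) ↦ B₁ a + B₂ b + B₃ c + B₄ d`. -/
noncomputable def sumProd {V : Type*} [NormedAddCommGroup V] [NormedSpace ℂ V]
    (B₁ B₂ B₃ B₄ : A →L[ℂ] V) : A × A × A × A →L[ℂ] V :=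
  B₁.coprod (B₂.coprod (B₃.coprod B₄))

/-- The operator `p ↦ i (a * e p)` on pairs, as a continuous linear function of `a`. -/
noncomputable def blockEntry (i : A →L[ℂ] A × A) (e : A × A →L[ℂ] A) :
    A →L[ℂ] A × A →L[ℂ] A × A :=
  ((ContinuousLinearMap.compL ℂ (A × A) A (A × A) i).comp
    ((ContinuousLinearMap.compL ℂ (A × A) A A).flip e)).comp (ContinuousLinearMap.mul ℂ A)

open ContinuousLinearMap in
/-- The operator `(u, v) ↦ (a u + b v, c u + d v)` on pairs, as a continuous linear function of
`(a, b, c, d)`. -/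
noncomputable def blockLinear : A × A × A × A →L[ℂ] A × A →L[ℂ] A × A :=
  sumProd (V := A × A →L[ℂ] A × A) (blockEntry (inl ℂ A A) (fst ℂ A A))
    (blockEntry (inl ℂ A A) (snd ℂ A A)) (blockEntry (inr ℂ A A) (fst ℂ A A))
    (blockEntry (inr ℂ A A) (snd ℂ A A))

/-- The operator `(u, v) ↦ (a u + b v, c u + d v)` on pairs. -/
noncomputable def blockCLM (a b c d : A) : A × A →L[ℂ] A × A := blockLinear (a, b, c, d)

lemma blockCLM_apply (a b c d : A) (p : A × A) :
    blockCLM a b c d p = (a * p.1 + b * p.2, c * p.1 + d * p.2) := by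
  simp [blockCLM, blockLinear, sumProd, blockEntry]

lemma norm_blockCLM_le (a b c d : A) : ‖blockCLM a b c d‖ ≤ ‖a‖ + ‖b‖ + ‖c‖ + ‖d‖ := by
  refine ContinuousLinearMap.opNorm_le_bound _ (by positivity) fun p => ?_
  have h1 := norm_fst_le p
  have h2 := norm_snd_le p
  have key : ∀ a b : A, ‖a * p.1 + b * p.2‖ ≤ (‖a‖ + ‖b‖) * ‖p‖ := fun a b => by
    refine (norm_add_le _ _).trans ?_
    have := (norm_mul_le a p.1).trans (mul_le_mul_of_nonneg_left h1 (norm_nonneg a))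
    have := (norm_mul_le b p.2).trans (mul_le_mul_of_nonneg_left h2 (norm_nonneg b))
    linarith
  rw [blockCLM_apply, Prod.norm_def]
  have e1 := key a b
  have e2 := key c d
  have := mul_nonneg (add_nonneg (norm_nonneg a) (norm_nonneg b)) (norm_nonneg p)
  have := mul_nonneg (add_nonneg (norm_nonneg c) (norm_nonneg d)) (norm_nonneg p)
  refine max_le ?_ ?_ <;> simp only <;> linarith

lemma DifferentiableOn.clm_const_apply {V W : Type*} [NormedAddCommGroup V] [NormedSpace ℂ V]
    [NormedAddCommGroup W] [NormedSpace ℂ W] (L : V →L[ℂ] W) {a : ℂ → V} {s : Set ℂ}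
    (ha : DifferentiableOn ℂ a s) : DifferentiableOn ℂ (fun z => L (a z)) s :=
  L.differentiable.comp_differentiableOn ha

lemma DifferentiableOn.blockCLM {a b c d : ℂ → A} {s : Set ℂ} (ha : DifferentiableOn ℂ a s)
    (hb : DifferentiableOn ℂ b s) (hc : DifferentiableOn ℂ c s) (hd : DifferentiableOn ℂ d s) :
    DifferentiableOn ℂ (fun z => blockCLM (a z) (b z) (c z) (d z)) s :=
  DifferentiableOn.clm_const_apply (W := A × A →L[ℂ] A × A) blockLinear
    (ha.prodMk (hb.prodMk (hc.prodMk hd)))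

lemma ContinuousAt.blockCLM {X : Type*} [TopologicalSpace X] {a b c d : X → A} {x : X}
    (ha : ContinuousAt a x) (hb : ContinuousAt b x) (hc : ContinuousAt c x)
    (hd : ContinuousAt d x) :
    ContinuousAt (fun z => blockCLM (a z) (b z) (c z) (d z)) x :=
  ContinuousAt.comp (f := fun z => (a z, b z, c z, d z))
    blockLinear.continuous.continuousAt
    (ha.prodMk (hb.prodMk (hc.prodMk hd)))

lemma MeasureTheory.AEStronglyMeasurable.blockCLM {α : Type*} [MeasurableSpace α] {μ : Measure α}
    {a b c d : α → A} (ha : AEStronglyMeasurable a μ) (hb : AEStronglyMeasurable b μ)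
    (hc : AEStronglyMeasurable c μ) (hd : AEStronglyMeasurable d μ) :
    AEStronglyMeasurable (fun t => blockCLM (a t) (b t) (c t) (d t)) μ :=
  blockLinear.continuous.comp_aestronglyMeasurable
    (ha.prodMk (hb.prodMk (hc.prodMk hd)))

end Block

/-! ### The equation `y'' = (λ² - 2 λ Q - Q₀) y` in a Banach algebra -/

section Equation

variable {A : Type*} [NormedRing A] [NormedAlgebra ℂ A]

lemma IsPrimitive.prodMk {E F : Type*} [NormedAddCommGroup E] [NormedSpace ℝ E] [CompleteSpace E]
    [NormedAddCommGroup F] [NormedSpace ℝ F] [CompleteSpace F] {f f' : ℝ → E} {g g' : ℝ → F}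
    (hf : IsPrimitive f f') (hg : IsPrimitive g g') :
    IsPrimitive (fun x => (f x, g x)) (fun x => (f' x, g' x)) := by
  have := (hf.clm (ContinuousLinearMap.inl ℝ E F)).add (hg.clm (ContinuousLinearMap.inr ℝ E F))
  refine (this.congr fun t _ => ?_).congr_left fun t _ => ?_ <;> simp

/-- Coefficients `Q` (locally absolutely continuous, with derivative `Q'`) and `Q₀` on `[0, ∞)`, all
of them integrable together with `Q'`. -/
structure Potential (Q Q' Q₀ : ℝ → A) : Prop where
  integrable_Q : IntegrableOn Q (Ioi 0)
  integrable_Q' : IntegrableOn Q' (Ioi 0)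
  integrable_Q₀ : IntegrableOn Q₀ (Ioi 0)
  isPrimitive : IsPrimitive Q Q'

/-- `y` is a solution of `y'' = (λ² - 2 λ Q - Q₀) y` on `[0, ∞)` with derivative `y'`. -/
structure IsSolution (Q Q₀ : ℝ → A) (lam : ℂ) (y y' : ℝ → A) : Prop where
  deriv : IsPrimitive y y'
  eqn : IsPrimitive y' fun t => (lam ^ 2 • (1 : A) - (2 * lam) • Q t - Q₀ t) * y t

/-- The coefficient `Q' - Q₀ - Q²` that remains after the leading terms of the equation have been
removed. -/
def remCoef (Q Q' Q₀ : ℝ → A) (t : ℝ) : A := Q' t - Q₀ t - Q t * Q t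

variable {Q Q' Q₀ : ℝ → A}

namespace Potential

lemma exists_bound (h : Potential Q Q' Q₀) : ∃ C, 0 ≤ C ∧ ∀ x, 0 ≤ x → ‖Q x‖ ≤ C := by
  refine ⟨‖Q 0‖ + ∫ t in Ioi 0, ‖Q' t‖, add_nonneg (norm_nonneg _)
    (integral_nonneg fun _ => norm_nonneg _), fun x hx => ?_⟩
  rw [h.isPrimitive.eq_add x hx]
  refine (norm_add_le _ _).trans (add_le_add le_rfl ?_)
  exact (intervalIntegral.norm_integral_le_integral_norm hx).trans
    (intervalIntegral_le_Ioi (fun _ _ => norm_nonneg _) h.integrable_Q'.norm hx)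

lemma integrable_remCoef (h : Potential Q Q' Q₀) :
    IntegrableOn (remCoef Q Q' Q₀) (Ioi 0) := by
  obtain ⟨C, _, hC⟩ := h.exists_bound
  refine (h.integrable_Q'.sub h.integrable_Q₀).sub ?_
  refine (h.integrable_Q.norm.const_mul C).mono' (h.integrable_Q.1.mul h.integrable_Q.1)
    (ae_restrict_Ioi fun t ht => (norm_mul_le _ _).trans
      (mul_le_mul_of_nonneg_right (hC t ht.le) (norm_nonneg _)))

end Potential

/-- The coefficient `λ² - 2 λ Q - Q₀`. -/
noncomputable def eqCoef (Q Q₀ : ℝ → A) (lam : ℂ) (t : ℝ) : A :=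
  lam ^ 2 • (1 : A) - (2 * lam) • Q t - Q₀ t

lemma norm_eqCoef_le {R : ℝ} {lam : ℂ} (hl : ‖lam‖ ≤ R) (t : ℝ) :
    ‖eqCoef Q Q₀ lam t‖ ≤ R ^ 2 * ‖(1 : A)‖ + 2 * R * ‖Q t‖ + ‖Q₀ t‖ := by
  have hR : 0 ≤ R := (norm_nonneg _).trans hl
  refine (norm_sub_le _ _).trans (add_le_add ((norm_sub_le _ _).trans (add_le_add ?_ ?_)) le_rfl)
  · refine (norm_smul_le _ _).trans (mul_le_mul_of_nonneg_right ?_ (norm_nonneg _))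
    rw [norm_pow]; gcongr
  · refine (norm_smul_le _ _).trans (mul_le_mul_of_nonneg_right ?_ (norm_nonneg _))
    rw [norm_mul]; simpa using hl

/-- The coefficient that bounds the first-order system of the equation for `|λ| ≤ R`. -/
noncomputable def systemBound (Q Q₀ : ℝ → A) (R t : ℝ) : ℝ :=
  ‖(1 : A)‖ + (R ^ 2 * ‖(1 : A)‖ + 2 * R * ‖Q t‖ + ‖Q₀ t‖)

lemma Potential.intervalIntegrable_systemBound (h : Potential Q Q' Q₀) (R x : ℝ) (hx : 0 ≤ x) :
    IntervalIntegrable (systemBound Q Q₀ R) volume 0 x :=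
  intervalIntegrable_const.add ((intervalIntegrable_const.add
    ((intervalIntegrable_of_Ioi h.integrable_Q hx).norm.const_mul _)).add
    (intervalIntegrable_of_Ioi h.integrable_Q₀ hx).norm)

lemma norm_system_le {R : ℝ} {lam : ℂ} (hl : ‖lam‖ ≤ R) (t : ℝ) :
    ‖blockCLM (0 : A) 1 (eqCoef Q Q₀ lam t) 0‖ ≤ systemBound Q Q₀ R t := by
  have h1 := norm_blockCLM_le (0 : A) 1 (eqCoef Q Q₀ lam t) 0
  have h2 := norm_eqCoef_le (Q := Q) (Q₀ := Q₀) hl t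
  rw [norm_zero] at h1
  unfold systemBound
  linarith

variable [CompleteSpace A]

/-- The first-order equation `P' = Q P`. -/
lemma exists_first_order (hQ : IntegrableOn Q (Ioi 0)) :
    ∃ P : ℝ → A, IsPrimitive P (fun t => Q t * P t) ∧ P 0 = 1 := by
  obtain ⟨u, -, hu⟩ := exists_linear_system (E := A)
    (L := fun _ t => ContinuousLinearMap.mul ℂ A (Q t))
    (fun _ => (ContinuousLinearMap.mul ℂ A).continuous.comp_aestronglyMeasurable hQ.1)
    (fun _ => differentiable_const _)
    (fun R => ⟨fun t => ‖Q t‖, fun _ => norm_nonneg _, fun x hx =>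
      (intervalIntegrable_of_Ioi hQ hx).norm, fun _ _ t =>
        ContinuousLinearMap.opNorm_mul_apply_le ℂ A _⟩)
    (f := fun _ => 1) (differentiable_const _)
  obtain ⟨hc, he⟩ := hu 0
  have h0 : u 0 0 = 1 := by simpa using he 0 le_rfl
  refine ⟨u 0, ⟨fun x hx => ?_, fun x hx => ?_⟩, h0⟩
  · exact (intervalIntegrable_of_Ioi hQ hx).mul_continuousOn
      (hc.mono (uIcc_subset_Ici hx))
  · rw [h0, he x hx]; rfl

lemma first_order_unique {P₁ P₂ : ℝ → A} (hQ : IntegrableOn Q (Ioi 0))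
    (h₁ : IsPrimitive P₁ (fun t => Q t * P₁ t)) (h₂ : IsPrimitive P₂ (fun t => Q t * P₂ t))
    (h0 : P₁ 0 = P₂ 0) {x : ℝ} (hx : 0 ≤ x) : P₁ x = P₂ x := by
  refine sub_eq_zero.1 ((h₁.sub h₂).eq_zero_of_linear (k := fun t => ‖Q t‖)
    (fun _ _ => norm_nonneg _) (fun x hx => (intervalIntegrable_of_Ioi hQ hx).norm)
    (fun t _ => ?_) (sub_eq_zero.2 h0) hx)
  rw [← mul_sub]; exact norm_mul_le _ _

/-- Solutions with initial values entire in `λ`. -/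
theorem Potential.exists_solution (h : Potential Q Q' Q₀) {a b : ℂ → A} (ha : Differentiable ℂ a)
    (hb : Differentiable ℂ b) :
    ∃ y y' : ℂ → ℝ → A, (∀ x, 0 ≤ x → Differentiable ℂ fun z => y z x) ∧
      (∀ x, 0 ≤ x → Differentiable ℂ fun z => y' z x) ∧
      ∀ z, IsSolution Q Q₀ z (y z) (y' z) ∧ y z 0 = a z ∧ y' z 0 = b z := by
  have hm : ∀ z : ℂ, AEStronglyMeasurable (fun t => blockCLM (0 : A) 1 (eqCoef Q Q₀ z t) 0)
      (volume.restrict (Ioi 0)) := fun z =>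
    AEStronglyMeasurable.blockCLM aestronglyMeasurable_const aestronglyMeasurable_const
      ((aestronglyMeasurable_const.sub (h.integrable_Q.1.const_smul _)).sub h.integrable_Q₀.1)
      aestronglyMeasurable_const
  obtain ⟨u, hd, hu⟩ := exists_linear_system (E := A × A)
    (L := fun z t => blockCLM (0 : A) 1 (eqCoef Q Q₀ z t) 0) hm
    (fun t => by
      rw [← differentiableOn_univ]
      refine DifferentiableOn.blockCLM (differentiableOn_const _) (differentiableOn_const _) ?_
        (differentiableOn_const _)
      unfold eqCoef
      fun_prop)
    (fun R => ⟨systemBound Q Q₀ |R|, fun t => by unfold systemBound; positivity,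
      h.intervalIntegrable_systemBound |R|, fun z hz t => norm_system_le
        ((mem_ball_zero_iff.1 hz).le.trans (le_abs_self R)) t⟩)
    (f := fun z => (a z, b z)) (ha.prodMk hb)
  refine ⟨fun z x => (u z x).1, fun z x => (u z x).2, fun x hx => (hd x hx).fst,
    fun x hx => (hd x hx).snd, fun z => ?_⟩
  obtain ⟨hc, he⟩ := hu z
  have h0 : u z 0 = (a z, b z) := by simpa using he 0 le_rfl
  have hp : IsPrimitive (u z) (fun t => blockCLM (0 : A) 1 (eqCoef Q Q₀ z t) 0 (u z t)) := by
    refine ⟨fun x hx => intervalIntegrable_clm_apply_of_le (hm z)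
      (h.intervalIntegrable_systemBound ‖z‖) (norm_system_le le_rfl) hc hx, fun x hx => ?_⟩
    rw [h0, he x hx]
  refine ⟨⟨(hp.clm (ContinuousLinearMap.fst ℝ A A)).congr fun t _ => ?_,
    (hp.clm (ContinuousLinearMap.snd ℝ A A)).congr fun t _ => ?_⟩, congrArg Prod.fst h0,
      congrArg Prod.snd h0⟩
  · simp [blockCLM_apply]
  · simp [blockCLM_apply, eqCoef]

namespace IsSolution

variable {lam : ℂ} {y y' z z' : ℝ → A}

lemma mul_const (h : IsSolution Q Q₀ lam y y') (c : A) :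
    IsSolution Q Q₀ lam (fun x => y x * c) (fun x => y' x * c) :=
  ⟨h.deriv.mul_const c, (h.eqn.mul_const c).congr fun t _ => by rw [mul_assoc]⟩

lemma add (h : IsSolution Q Q₀ lam y y') (h₂ : IsSolution Q Q₀ lam z z') :
    IsSolution Q Q₀ lam (fun x => y x + z x) (fun x => y' x + z' x) :=
  ⟨h.deriv.add h₂.deriv, (h.eqn.add h₂.eqn).congr fun t _ => by rw [mul_add]⟩

lemma sub (h : IsSolution Q Q₀ lam y y') (h₂ : IsSolution Q Q₀ lam z z') :
    IsSolution Q Q₀ lam (fun x => y x - z x) (fun x => y' x - z' x) :=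
  ⟨h.deriv.sub h₂.deriv, (h.eqn.sub h₂.eqn).congr fun t _ => by rw [mul_sub]⟩

lemma eq_zero (hp : Potential Q Q' Q₀) (h : IsSolution Q Q₀ lam y y') (h0 : y 0 = 0)
    (h0' : y' 0 = 0) {x : ℝ} (hx : 0 ≤ x) : y x = 0 ∧ y' x = 0 := by
  have := (h.deriv.prodMk h.eqn).eq_zero_of_linear
    (fun t _ => by unfold systemBound; positivity) (hp.intervalIntegrable_systemBound ‖lam‖)
    (fun t _ => ?_) (by simp [h0, h0']) hx
  · simpa using this
  · refine le_trans (le_of_eq ?_) (ContinuousLinearMap.le_of_opNorm_le _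
      (norm_system_le (Q := Q) (Q₀ := Q₀) le_rfl t) (y t, y' t))
    simp [blockCLM_apply, eqCoef]

lemma unique (hp : Potential Q Q' Q₀) (h : IsSolution Q Q₀ lam y y')
    (h₂ : IsSolution Q Q₀ lam z z') (h0 : y 0 = z 0)
    (h0' : y' 0 = z' 0) {x : ℝ} (hx : 0 ≤ x) : y x = z x ∧ y' x = z' x := by
  have := (h.sub h₂).eq_zero hp (sub_eq_zero.2 h0) (sub_eq_zero.2 h0') hx
  exact ⟨sub_eq_zero.1 this.1, sub_eq_zero.1 this.2⟩

end IsSolution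

/-! ### Splitting a solution into exponentials -/

/-- The part of `e^{λx} y` that belongs to the exponential `e^{λx}`. -/
noncomputable def growPart (Q : ℝ → A) (lam : ℂ) (y y' : ℝ → A) (x : ℝ) : A :=
  exp (lam * x) • ((1 / 2 : ℂ) • (y x + lam⁻¹ • (y' x + Q x * y x)))

/-- The part of `e^{λx} y` that belongs to the exponential `e^{-λx}`. -/
noncomputable def decayPart (Q : ℝ → A) (lam : ℂ) (y y' : ℝ → A) (x : ℝ) : A :=
  exp (lam * x) • ((1 / 2 : ℂ) • (y x - lam⁻¹ • (y' x + Q x * y x)))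

lemma grow_add_decay (lam : ℂ) (y y' : ℝ → A) (x : ℝ) :
    growPart Q lam y y' x + decayPart Q lam y y' x = exp (lam * x) • y x := by
  unfold growPart decayPart
  module

lemma grow_sub_decay {lam : ℂ} (y y' : ℝ → A) (x : ℝ) :
    growPart Q lam y y' x - decayPart Q lam y y' x =
      exp (lam * x) • (lam⁻¹ • (y' x + Q x * y x)) := by
  unfold growPart decayPart
  module

/-- The remainder term `(2 λ)⁻¹ (Q' - Q₀ - Q²) e^{λx} y` of the equations for the two parts. -/
noncomputable def remTerm (Q Q' Q₀ : ℝ → A) (lam : ℂ) (y : ℝ → A) (t : ℝ) : A :=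
  (2 * lam)⁻¹ • (remCoef Q Q' Q₀ t * (exp (lam * t) • y t))

/-- The inhomogeneity of the equation for the growing part. -/
noncomputable def growRem (Q Q' Q₀ : ℝ → A) (lam : ℂ) (y y' : ℝ → A) (t : ℝ) : A :=
  -(Q t * growPart Q lam y y' t) - (2 : ℂ) • (Q t * decayPart Q lam y y' t) +
    remTerm Q Q' Q₀ lam y t

namespace IsSolution

variable {lam : ℂ} {y y' : ℝ → A}

lemma isPrimitive_quasi (hp : Potential Q Q' Q₀) (h : IsSolution Q Q₀ lam y y') :
    IsPrimitive (fun x => y' x + Q x * y x) (fun t => lam ^ 2 • y t - (2 * lam) • (Q t * y t)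
      + Q t * (y' t + Q t * y t) + remCoef Q Q' Q₀ t * y t) := by
  refine (h.eqn.add (hp.isPrimitive.mul h.deriv)).congr fun t _ => ?_
  simp only [remCoef, sub_mul, mul_add, smul_mul_assoc, one_mul, mul_assoc]
  abel

lemma isPrimitive_decayPart (hp : Potential Q Q' Q₀) (h : IsSolution Q Q₀ lam y y')
    (hl : lam ≠ 0) : IsPrimitive (decayPart Q lam y y') (fun t =>
      Q t * decayPart Q lam y y' t - remTerm Q Q' Q₀ lam y t) := by
  have h1 := (IsPrimitive.cexp lam).smul ((h.deriv.sub
    ((h.isPrimitive_quasi hp).const_smul lam⁻¹)).const_smul (1 / 2 : ℂ))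
  refine h1.congr fun t _ => ?_
  have e : y' t = (y' t + Q t * y t) - Q t * y t := by abel
  unfold remTerm decayPart
  rw [e]
  generalize y' t + Q t * y t = p
  rw [sub_add_cancel]
  simp only [mul_smul_comm, mul_sub]
  generalize exp (lam * t) = w
  generalize remCoef Q Q' Q₀ t * y t = r
  match_scalars <;> field_simp <;> ring

lemma isPrimitive_growPart (hp : Potential Q Q' Q₀) (h : IsSolution Q Q₀ lam y y')
    (hl : lam ≠ 0) : IsPrimitive (fun x : ℝ => exp (-(2 * lam) * x) • growPart Q lam y y' x)
      (fun t : ℝ => exp (-(2 * lam) * t) • growRem Q Q' Q₀ lam y y' t) := by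
  have h1 := (IsPrimitive.cexp (-(2 * lam))).smul ((IsPrimitive.cexp lam).smul ((h.deriv.add
    ((h.isPrimitive_quasi hp).const_smul lam⁻¹)).const_smul (1 / 2 : ℂ)))
  refine h1.congr fun t _ => ?_
  have e : y' t = (y' t + Q t * y t) - Q t * y t := by abel
  unfold growRem remTerm decayPart growPart
  rw [e]
  generalize y' t + Q t * y t = p
  rw [sub_add_cancel]
  simp only [mul_smul_comm, mul_sub, mul_add]
  generalize exp (lam * t) = w
  generalize exp (-(2 * lam) * t) = w'
  generalize remCoef Q Q' Q₀ t * y t = r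
  match_scalars <;> field_simp <;> ring

end IsSolution

/-! ### Growth and large-parameter asymptotics of regular solutions -/

/-- The coefficient `3 ‖Q‖ + ‖Q' - Q₀ - Q²‖` which controls the solutions uniformly in `|λ| ≥ 1`. -/
def controlCoef (Q Q' Q₀ : ℝ → A) (t : ℝ) : ℝ := 3 * ‖Q t‖ + ‖remCoef Q Q' Q₀ t‖

lemma controlCoef_nonneg (t : ℝ) : 0 ≤ controlCoef Q Q' Q₀ t := by
  unfold controlCoef; positivity

lemma Potential.integrable_controlCoef (hp : Potential Q Q' Q₀) :
    IntegrableOn (controlCoef Q Q' Q₀) (Ioi 0) :=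
  (hp.integrable_Q.norm.const_mul 3).add hp.integrable_remCoef.norm

lemma norm_exp_eq (lam : ℂ) (x : ℝ) : ‖exp (lam * x)‖ = Real.exp (lam.re * x) := by
  rw [Complex.norm_exp]; simp

lemma norm_inv_two_mul_le {lam : ℂ} (hl : 1 ≤ ‖lam‖) : ‖(2 * lam)⁻¹‖ ≤ 1 / 2 := by
  rw [norm_inv, norm_mul, mul_inv]
  have : ‖lam‖⁻¹ ≤ 1 := inv_le_one_of_one_le₀ hl
  norm_num; linarith

namespace IsSolution

variable {lam : ℂ} {y y' : ℝ → A}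

lemma norm_grow_integrand_le (hl : 1 ≤ ‖lam‖) (t : ℝ) :
    ‖growRem Q Q' Q₀ lam y y' t‖ +
    ‖Q t * decayPart Q lam y y' t - remTerm Q Q' Q₀ lam y t‖ ≤
      controlCoef Q Q' Q₀ t * (‖growPart Q lam y y' t‖ + ‖decayPart Q lam y y' t‖) := by
  have hk := norm_inv_two_mul_le hl
  unfold growRem remTerm
  rw [← grow_add_decay (Q := Q) lam y y' t]
  set a := growPart Q lam y y' t
  set b := decayPart Q lam y y' t
  set q := remCoef Q Q' Q₀ t
  have h1 : ‖(2 * lam)⁻¹ • (q * (a + b))‖ ≤ 1 / 2 * (‖q‖ * (‖a‖ + ‖b‖)) := by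
    refine (norm_smul_le _ _).trans (mul_le_mul hk ?_ (norm_nonneg _) (by norm_num))
    exact (norm_mul_le _ _).trans (mul_le_mul_of_nonneg_left (norm_add_le _ _) (norm_nonneg _))
  have h2 : ‖-(Q t * a)‖ ≤ ‖Q t‖ * ‖a‖ := by rw [norm_neg]; exact norm_mul_le _ _
  have h3 : ‖(2 : ℂ) • (Q t * b)‖ ≤ 2 * (‖Q t‖ * ‖b‖) := by
    refine (norm_smul_le _ _).trans ?_
    rw [norm_ofNat]
    exact mul_le_mul_of_nonneg_left (norm_mul_le _ _) (by norm_num)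
  have h4 := norm_mul_le (Q t) b
  have e1 := norm_add_le (-(Q t * a) - (2 : ℂ) • (Q t * b)) ((2 * lam)⁻¹ • (q * (a + b)))
  have e2 := norm_sub_le (-(Q t * a)) ((2 : ℂ) • (Q t * b))
  have e3 := norm_sub_le (Q t * b) ((2 * lam)⁻¹ • (q * (a + b)))
  unfold controlCoef
  have p1 := mul_nonneg (norm_nonneg (Q t)) (norm_nonneg a)
  nlinarith

lemma growPart_eq (hp : Potential Q Q' Q₀) (h : IsSolution Q Q₀ lam y y') (hl : lam ≠ 0) {x : ℝ}
    (hx : 0 ≤ x) : growPart Q lam y y' x = exp (2 * lam * x) • growPart Q lam y y' 0 +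
      ∫ t in (0 : ℝ)..x, exp (2 * lam * (x - t)) • growRem Q Q' Q₀ lam y y' t := by
  have h1 := (h.isPrimitive_growPart hp hl).eq_add x hx
  have h2 := congrArg (fun v => exp (2 * lam * x) • v) h1
  beta_reduce at h2
  rw [smul_add, smul_smul, ← exp_add] at h2
  rw [show 2 * lam * (x : ℂ) + -(2 * lam) * (x : ℂ) = 0 by ring, exp_zero, one_smul] at h2
  rw [h2, ← intervalIntegral.integral_smul]
  congr 1
  · simp
  · refine integral_congr fun t _ => ?_
    change exp (2 * lam * x) • (exp (-(2 * lam) * t) • (_ : A)) = _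
    rw [smul_smul, ← exp_add]
    congr 2; ring

lemma norm_grow_add_decay_le (hp : Potential Q Q' Q₀) (h : IsSolution Q Q₀ lam y y')
    (hl : 1 ≤ ‖lam‖) (hre : lam.re ≤ 0) {x : ℝ} (hx : 0 ≤ x) :
    ‖growPart Q lam y y' x‖ + ‖decayPart Q lam y y' x‖ ≤
      (‖growPart Q lam y y' 0‖ + ‖decayPart Q lam y y' 0‖) *
        Real.exp (∫ t in Ioi 0, controlCoef Q Q' Q₀ t) := by
  have hl0 : lam ≠ 0 := norm_pos_iff.1 (zero_lt_one.trans_le hl)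
  have hk := fun x hx => intervalIntegrable_of_Ioi hp.integrable_controlCoef (x := x) hx
  have hA := h.isPrimitive_growPart hp hl0
  have hB := h.isPrimitive_decayPart hp hl0
  have hcA : ContinuousOn (growPart Q lam y y') (Ici 0) := by
    have : ContinuousOn (fun x : ℝ => exp ((2 * lam) * x) •
        (exp (-(2 * lam) * x) • growPart Q lam y y' x)) (Ici 0) :=
      (by fun_prop : Continuous fun x : ℝ => exp ((2 * lam) * x)).continuousOn.smul
        hA.continuousOn
    refine this.congr fun t _ => ?_
    change _ = exp (2 * lam * t) • (exp (-(2 * lam) * t) • _)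
    rw [smul_smul, ← exp_add]
    simp
  have hcn := hcA.norm.fun_add hB.continuousOn.norm
  refine (gronwall_forward (fun t _ => controlCoef_nonneg t) hk hcn (fun v hv => ?_) hx).trans
    (mul_le_mul_of_nonneg_left (exp_le_exp.2 (intervalIntegral_le_Ioi
      (fun t _ => controlCoef_nonneg t) hp.integrable_controlCoef hx)) (by positivity))
  have hki : IntervalIntegrable (fun t => controlCoef Q Q' Q₀ t *
      (‖growPart Q lam y y' t‖ + ‖decayPart Q lam y y' t‖)) volume 0 v :=
    (hk v hv).mul_continuousOn (hcn.mono (uIcc_subset_Ici hv))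
  have iB := (hB.intervalIntegrable v hv).norm
  have iA : IntervalIntegrable (fun t => ‖growRem Q Q' Q₀ lam y y' t‖) volume 0 v := by
    have := ((hA.intervalIntegrable v hv).continuousOn_smul (f := fun t : ℝ =>
      exp ((2 * lam) * t)) (by fun_prop)).norm
    refine this.congr fun t _ => ?_
    simp [smul_smul, ← exp_add]
  have bA : ‖growPart Q lam y y' v‖ ≤ ‖growPart Q lam y y' 0‖ + ∫ t in (0 : ℝ)..v,
      ‖growRem Q Q' Q₀ lam y y' t‖ := by
    rw [h.growPart_eq hp hl0 hv]
    have ee : ∀ s : ℝ, 0 ≤ s → ‖exp (2 * lam * s)‖ ≤ 1 := fun s hs => by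
      rw [norm_exp_eq, Real.exp_le_one_iff]
      have : (2 * lam).re = 2 * lam.re := by simp
      rw [this]; nlinarith
    refine (norm_add_le _ _).trans (add_le_add ?_ ?_)
    · refine (norm_smul_le _ _).trans ?_
      exact mul_le_of_le_one_left (norm_nonneg _) (ee v hv)
    · refine intervalIntegral.norm_integral_le_of_norm_le hv (ae_of_all _ fun t ht => ?_) iA
      refine (norm_smul_le _ _).trans (mul_le_of_le_one_left (norm_nonneg _) ?_)
      rw [← ofReal_sub]
      exact ee _ (sub_nonneg.2 ht.2)
  have bB : ‖decayPart Q lam y y' v‖ ≤ ‖decayPart Q lam y y' 0‖ + ∫ t in (0 : ℝ)..v,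
      ‖Q t * decayPart Q lam y y' t - remTerm Q Q' Q₀ lam y t‖ := by
    rw [hB.eq_add v hv]
    exact (norm_add_le _ _).trans (add_le_add le_rfl
      (intervalIntegral.norm_integral_le_integral_norm hv))
  have := intervalIntegral.integral_mono_on hv (iA.add iB) hki
    fun t _ => norm_grow_integrand_le (Q := Q) (Q' := Q') (Q₀ := Q₀) (y := y) (y' := y') hl t
  rw [intervalIntegral.integral_add iA iB] at this
  linarith

lemma norm_decayPart_sub_le (hp : Potential Q Q' Q₀) (h : IsSolution Q Q₀ lam y y')
    (hl : 1 ≤ ‖lam‖) (hre : lam.re ≤ 0) {R : ℝ → A} (hR : IsPrimitive R fun t => Q t * R t)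
    (hR0 : R 0 = 1) {x : ℝ} (hx : 0 ≤ x) :
    ‖decayPart Q lam y y' x - R x * decayPart Q lam y y' 0‖ ≤
      ‖lam‖⁻¹ * ((‖growPart Q lam y y' 0‖ + ‖decayPart Q lam y y' 0‖) *
        Real.exp (∫ t in Ioi 0, controlCoef Q Q' Q₀ t) * (∫ t in Ioi 0, controlCoef Q Q' Q₀ t) *
        Real.exp (∫ t in Ioi 0, controlCoef Q Q' Q₀ t)) := by
  have hl0 : lam ≠ 0 := norm_pos_iff.1 (zero_lt_one.trans_le hl)
  set K := ∫ t in Ioi 0, controlCoef Q Q' Q₀ t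
  set c := (‖growPart Q lam y y' 0‖ + ‖decayPart Q lam y y' 0‖) * Real.exp K
  have hk := fun x hx => intervalIntegrable_of_Ioi hp.integrable_controlCoef (x := x) hx
  have hd := (h.isPrimitive_decayPart hp hl0).sub (hR.mul_const (decayPart Q lam y y' 0))
  have hdc := hd.continuousOn.norm
  have hI : 0 ≤ K := integral_nonneg controlCoef_nonneg
  have hc0 : 0 ≤ c := by positivity
  refine (gronwall_forward (C := ‖lam‖⁻¹ * (c * K))
    (fun t _ => controlCoef_nonneg t) hk hdc (fun v hv => ?_) hx).trans ?_
  · rw [hd.eq_add v hv, hR0, one_mul, sub_self, zero_add]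
    have i1 : IntervalIntegrable (fun t => ‖lam‖⁻¹ * (c * controlCoef Q Q' Q₀ t)) volume 0 v :=
      ((hk v hv).const_mul c).const_mul _
    have i2 : IntervalIntegrable (fun t => controlCoef Q Q' Q₀ t * ‖decayPart Q lam y y' t -
        R t * decayPart Q lam y y' 0‖) volume 0 v :=
      (hk v hv).mul_continuousOn (hdc.mono (uIcc_subset_Ici hv))
    refine (intervalIntegral.norm_integral_le_of_norm_le hv (ae_of_all _ fun t ht => ?_)
      (i1.add i2)).trans ?_
    · have e : Q t * decayPart Q lam y y' t - remTerm Q Q' Q₀ lam y t - Q t * R t *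
        decayPart Q lam y y' 0 =
          Q t * (decayPart Q lam y y' t - R t * decayPart Q lam y y' 0) -
            remTerm Q Q' Q₀ lam y t := by
        rw [mul_sub, mul_assoc]; abel
      rw [e, remTerm, ← grow_add_decay (Q := Q) lam y y' t]
      have b0 := h.norm_grow_add_decay_le hp hl hre ht.1.le
      refine (norm_sub_le _ _).trans ?_
      have b1 := norm_mul_le (Q t) (decayPart Q lam y y' t - R t * decayPart Q lam y y' 0)
      have b2 : ‖(2 * lam)⁻¹ • (remCoef Q Q' Q₀ t *
          (growPart Q lam y y' t + decayPart Q lam y y' t))‖ ≤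
          ‖lam‖⁻¹ * (‖remCoef Q Q' Q₀ t‖ * c) := by
        refine (norm_smul_le _ _).trans (mul_le_mul ?_ ?_ (norm_nonneg _) (by positivity))
        · rw [norm_inv, norm_mul, mul_inv]
          have : 0 ≤ ‖lam‖⁻¹ := by positivity
          norm_num; linarith
        · exact (norm_mul_le _ _).trans (mul_le_mul_of_nonneg_left ((norm_add_le _ _).trans b0)
            (norm_nonneg _))
      have p1 := norm_nonneg (Q t)
      have p2 := norm_nonneg (remCoef Q Q' Q₀ t)
      have k1 : ‖Q t‖ ≤ controlCoef Q Q' Q₀ t := by unfold controlCoef; linarith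
      have k2 : ‖remCoef Q Q' Q₀ t‖ ≤ controlCoef Q Q' Q₀ t := by unfold controlCoef; linarith
      have k3 := mul_le_mul_of_nonneg_right k1
        (norm_nonneg (decayPart Q lam y y' t - R t * decayPart Q lam y y' 0))
      have k4 : ‖lam‖⁻¹ * (‖remCoef Q Q' Q₀ t‖ * c) ≤ ‖lam‖⁻¹ * (c * controlCoef Q Q' Q₀ t) := by
        rw [mul_comm c]; gcongr
      linarith
    · rw [intervalIntegral.integral_add i1 i2, intervalIntegral.integral_const_mul,
        intervalIntegral.integral_const_mul]
      refine add_le_add ?_ le_rfl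
      have := intervalIntegral_le_Ioi (fun t _ => controlCoef_nonneg t)
        hp.integrable_controlCoef hv
      gcongr
  · have := exp_le_exp.2 (intervalIntegral_le_Ioi (fun t _ => controlCoef_nonneg t)
      hp.integrable_controlCoef hx)
    rw [mul_assoc]
    gcongr

lemma norm_growPart_le (hp : Potential Q Q' Q₀) (h : IsSolution Q Q₀ lam y y')
    (hl : 1 ≤ ‖lam‖) (hre : lam.re ≤ 0) {x : ℝ} (hx : 0 ≤ x) :
    ‖growPart Q lam y y' x‖ ≤ (‖growPart Q lam y y' 0‖ + ‖decayPart Q lam y y' 0‖) *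
      (Real.exp (2 * lam.re * x) + Real.exp (∫ t in Ioi 0, controlCoef Q Q' Q₀ t) *
        ∫ t in (0 : ℝ)..x, Real.exp (2 * lam.re * (x - t)) * controlCoef Q Q' Q₀ t) := by
  have hl0 : lam ≠ 0 := norm_pos_iff.1 (zero_lt_one.trans_le hl)
  have ee : ∀ s : ℝ, ‖exp (2 * lam * s)‖ = Real.exp (2 * lam.re * s) := fun s => by
    rw [norm_exp_eq]; simp
  rw [h.growPart_eq hp hl0 hx, mul_add]
  refine (norm_add_le _ _).trans (add_le_add ?_ ?_)
  · refine (norm_smul_le _ _).trans ?_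
    rw [ee, mul_comm]
    gcongr
    linarith [norm_nonneg (decayPart Q lam y y' 0)]
  · rw [← mul_assoc, ← intervalIntegral.integral_const_mul]
    refine intervalIntegral.norm_integral_le_of_norm_le hx (ae_of_all _ fun t ht => ?_) ?_
    · refine (norm_smul_le _ _).trans ?_
      rw [← ofReal_sub, ee]
      have h1 := norm_grow_integrand_le (Q := Q) (Q' := Q') (Q₀ := Q₀) (y := y) (y' := y') hl t
      have h2 := h.norm_grow_add_decay_le hp hl hre ht.1.le
      have h3 := mul_le_mul_of_nonneg_left h2 (controlCoef_nonneg (Q := Q) (Q' := Q') (Q₀ := Q₀) t)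
      have h4 := norm_nonneg (Q t * decayPart Q lam y y' t - remTerm Q Q' Q₀ lam y t)
      have h5 : ‖growRem Q Q' Q₀ lam y y' t‖ ≤ _ :=
        (le_trans (by linarith) h1).trans h3
      refine (mul_le_mul_of_nonneg_left h5 (exp_pos _).le).trans (le_of_eq ?_)
      ring
    · exact ((intervalIntegrable_of_Ioi hp.integrable_controlCoef hx).continuousOn_mul
        (by fun_prop)).const_mul _

end IsSolution

lemma tendsto_integral_exp_mul {k : ℝ → ℝ} {x : ℝ} (hx : 0 ≤ x)
    (hk : IntervalIntegrable k volume 0 x) :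
    Tendsto (fun s : ℝ => ∫ t in (0 : ℝ)..x, Real.exp (2 * s * (x - t)) * k t) atBot (𝓝 0) := by
  suffices h : Tendsto (fun s : ℝ => ∫ t in (0 : ℝ)..x, Real.exp (2 * s * (x - t)) * k t) atBot
      (𝓝 (∫ _ in (0 : ℝ)..x, (0 : ℝ))) by simpa using h
  refine intervalIntegral.tendsto_integral_filter_of_dominated_convergence (fun t => ‖k t‖)
    ?_ ?_ hk.norm ?_
  · refine Eventually.of_forall fun s => ?_
    exact ((by fun_prop : Continuous fun t : ℝ =>
      Real.exp (2 * s * (x - t))).aestronglyMeasurable).mul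
      (by simpa [uIoc_of_le hx] using hk.1.aestronglyMeasurable)
  · filter_upwards [eventually_le_atBot 0] with s hs
    refine ae_of_all _ fun t ht => ?_
    rw [uIoc_of_le hx] at ht
    rw [norm_mul, norm_of_nonneg (exp_pos _).le]
    refine mul_le_of_le_one_left (norm_nonneg _) (Real.exp_le_one_iff.2 ?_)
    nlinarith [ht.2]
  · have h0 : ∀ᵐ t : ℝ, t ≠ x := by simp [ae_iff]
    filter_upwards [h0] with t htx ht
    rw [uIoc_of_le hx] at ht
    have hpos : 0 < x - t := sub_pos.2 (lt_of_le_of_ne ht.2 htx)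
    have : Tendsto (fun s : ℝ => Real.exp (2 * s * (x - t)) * k t) atBot (𝓝 (0 * k t)) := by
      refine Tendsto.mul_const _ (Real.tendsto_exp_atBot.comp ?_)
      exact (tendsto_id.const_mul_atBot (by norm_num : (0 : ℝ) < 2)).atBot_mul_const hpos
    simpa using this

end Equation

section RegularAsymptotics

variable {A : Type*} [NormedRing A] [NormedAlgebra ℂ A] [CompleteSpace A] {Q Q' Q₀ : ℝ → A}

lemma norm_grow_decay_zero_le {lam : ℂ} (hl : 1 ≤ ‖lam‖) {y y' : ℝ → A} {a b₁ b₀ : A}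
    (h0 : y 0 = a) (h1 : y' 0 = lam • b₁ + b₀) :
    ‖growPart Q lam y y' 0‖ + ‖decayPart Q lam y y' 0‖ ≤
      ‖a‖ + ‖b₁‖ + ‖b₀‖ + ‖Q 0‖ * ‖a‖ := by
  have hl0 : lam ≠ 0 := norm_pos_iff.1 (zero_lt_one.trans_le hl)
  have hi : ‖lam⁻¹‖ ≤ 1 := by rw [norm_inv]; exact inv_le_one_of_one_le₀ hl
  have e : ‖lam⁻¹ • (y' 0 + Q 0 * y 0)‖ ≤ ‖b₁‖ + ‖b₀‖ + ‖Q 0‖ * ‖a‖ := by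
    rw [h1, h0, add_assoc, smul_add, smul_smul, inv_mul_cancel₀ hl0, one_smul]
    refine (norm_add_le _ _).trans ?_
    have := (norm_smul_le lam⁻¹ (b₀ + Q 0 * a)).trans (mul_le_of_le_one_left (norm_nonneg _) hi)
    have := norm_add_le b₀ (Q 0 * a)
    have := norm_mul_le (Q 0) a
    linarith
  have h2 : ∀ v : A, ‖(1 / 2 : ℂ) • v‖ = 1 / 2 * ‖v‖ := fun v => by
    rw [norm_smul]; norm_num
  unfold growPart decayPart
  simp only [ofReal_zero, mul_zero, exp_zero, one_smul, h2]
  have := norm_add_le (y 0) (lam⁻¹ • (y' 0 + Q 0 * y 0))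
  have := norm_sub_le (y 0) (lam⁻¹ • (y' 0 + Q 0 * y 0))
  rw [h0] at *
  linarith

lemma exp_smul_deriv_eq {lam : ℂ} (y y' : ℝ → A) (x : ℝ) :
    exp (lam * x) • (lam⁻¹ • y' x) = growPart Q lam y y' x - decayPart Q lam y y' x -
      lam⁻¹ • (Q x * (growPart Q lam y y' x + decayPart Q lam y y' x)) := by
  rw [grow_sub_decay, grow_add_decay, mul_smul_comm]
  module

/-- Solutions whose initial values are at most linear in `λ` grow at most like `e^{-Re λ x}`. -/
lemma Potential.exists_growth_bound (hp : Potential Q Q' Q₀) (a b₁ b₀ : A) {x : ℝ} (hx : 0 ≤ x) :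
    ∃ C, 0 ≤ C ∧ ∀ (lam : ℂ) (y y' : ℝ → A), 1 ≤ ‖lam‖ → lam.re ≤ 0 → IsSolution Q Q₀ lam y y' →
      y 0 = a → y' 0 = lam • b₁ + b₀ → ‖exp (lam * x) • y x‖ ≤ C ∧
        ‖exp (lam * x) • (lam⁻¹ • y' x)‖ ≤ C := by
  set K := (‖a‖ + ‖b₁‖ + ‖b₀‖ + ‖Q 0‖ * ‖a‖) * Real.exp (∫ t in Ioi 0, controlCoef Q Q' Q₀ t)
  have hK : 0 ≤ K := by positivity
  refine ⟨K + ‖Q x‖ * K, by positivity, fun lam y y' hl hre h h0 h1 => ?_⟩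
  have hi : ‖lam⁻¹‖ ≤ 1 := by rw [norm_inv]; exact inv_le_one_of_one_le₀ hl
  have b : ‖growPart Q lam y y' x‖ + ‖decayPart Q lam y y' x‖ ≤ K :=
    (h.norm_grow_add_decay_le hp hl hre hx).trans
      (mul_le_mul_of_nonneg_right (norm_grow_decay_zero_le hl h0 h1) (exp_pos _).le)
  have b2 := norm_add_le (growPart Q lam y y' x) (decayPart Q lam y y' x)
  have hQK : 0 ≤ ‖Q x‖ * K := by positivity
  constructor
  · rw [← grow_add_decay (Q := Q)]; linarith
  · rw [exp_smul_deriv_eq (Q := Q)]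
    refine (norm_sub_le _ _).trans ?_
    have b3 := norm_sub_le (growPart Q lam y y' x) (decayPart Q lam y y' x)
    have b4 : ‖lam⁻¹ • (Q x * (growPart Q lam y y' x + decayPart Q lam y y' x))‖ ≤ ‖Q x‖ * K := by
      refine (norm_smul_le _ _).trans ((mul_le_of_le_one_left (norm_nonneg _) hi).trans ?_)
      exact (norm_mul_le _ _).trans (mul_le_mul_of_nonneg_left (b2.trans b) (norm_nonneg _))
    linarith

/-- The leading behaviour of the regular solutions as `Re λ → -∞`. -/
lemma Potential.tendsto_regular (hp : Potential Q Q' Q₀) {R : ℝ → A}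
    (hR : IsPrimitive R fun t => Q t * R t) (hR0 : R 0 = 1) {a b₁ b₀ : A} {x : ℝ} (hx : 0 < x)
    {ι : Type*} {l : Filter ι} {lam : ι → ℂ} (hlam : Tendsto (fun i => (lam i).re) l atBot)
    {y y' : ι → ℝ → A} (h : ∀ i, IsSolution Q Q₀ (lam i) (y i) (y' i)) (h0 : ∀ i, y i 0 = a)
    (h1 : ∀ i, y' i 0 = lam i • b₁ + b₀) :
    Tendsto (fun i => exp (lam i * x) • y i x) l
        (𝓝 (R x * ((1 / 2 : ℂ) • (a - b₁)))) ∧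
      Tendsto (fun i => exp (lam i * x) • ((lam i)⁻¹ • y' i x)) l
        (𝓝 (-(R x * ((1 / 2 : ℂ) • (a - b₁))))) := by
  set I := ∫ t in Ioi 0, controlCoef Q Q' Q₀ t
  set K := ‖a‖ + ‖b₁‖ + ‖b₀‖ + ‖Q 0‖ * ‖a‖
  have hI : 0 ≤ I := integral_nonneg controlCoef_nonneg
  have hnorm : Tendsto (fun i => ‖lam i‖) l atTop :=
    tendsto_atTop_mono (fun i => (neg_le_abs _).trans (Complex.abs_re_le_norm (lam i)))
      (tendsto_neg_atBot_atTop.comp hlam)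
  have hl1 : ∀ᶠ i in l, 1 ≤ ‖lam i‖ := hnorm.eventually_ge_atTop 1
  have hre : ∀ᶠ i in l, (lam i).re ≤ 0 := hlam.eventually_le_atBot 0
  have hinvn : Tendsto (fun i => ‖lam i‖⁻¹) l (𝓝 0) := hnorm.inv_tendsto_atTop
  have hinv : Tendsto (fun i => (lam i)⁻¹) l (𝓝 0) := by
    rw [tendsto_zero_iff_norm_tendsto_zero]
    simpa only [norm_inv] using hinvn
  have hg : Tendsto (fun i => growPart Q (lam i) (y i) (y' i) x) l (𝓝 0) := by
    have t1 : Tendsto (fun s : ℝ => Real.exp (2 * s * x)) atBot (𝓝 0) :=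
      Real.tendsto_exp_atBot.comp
        ((tendsto_id.const_mul_atBot (by norm_num : (0 : ℝ) < 2)).atBot_mul_const hx)
    have t2 := tendsto_integral_exp_mul hx.le
      (intervalIntegrable_of_Ioi hp.integrable_controlCoef hx.le)
    have t3 := ((t1.add (t2.const_mul (Real.exp I))).const_mul K).comp hlam
    refine squeeze_zero_norm' ?_ (by simpa using t3)
    filter_upwards [hl1, hre] with i hi hi'
    refine ((h i).norm_growPart_le hp hi hi' hx.le).trans ?_
    refine mul_le_mul_of_nonneg_right (norm_grow_decay_zero_le hi (h0 i) (h1 i)) ?_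
    refine add_nonneg (exp_pos _).le (mul_nonneg (exp_pos _).le ?_)
    exact intervalIntegral.integral_nonneg hx.le fun t _ =>
      mul_nonneg (exp_pos _).le (controlCoef_nonneg t)
  have hd0 : Tendsto (fun i => decayPart Q (lam i) (y i) (y' i) 0) l
      (𝓝 ((1 / 2 : ℂ) • (a - b₁))) := by
    have t1 : Tendsto (fun i => (1 / 2 : ℂ) • (a - b₁ - (lam i)⁻¹ • (b₀ + Q 0 * a))) l
        (𝓝 ((1 / 2 : ℂ) • (a - b₁ - (0 : ℂ) • (b₀ + Q 0 * a)))) :=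
      ((tendsto_const_nhds).sub (hinv.smul_const _)).const_smul _
    rw [zero_smul, sub_zero] at t1
    refine t1.congr' ?_
    filter_upwards [hl1] with i hi
    have hl0 : lam i ≠ 0 := norm_pos_iff.1 (zero_lt_one.trans_le hi)
    unfold decayPart
    rw [h0, h1, ofReal_zero, mul_zero, exp_zero, one_smul, add_assoc,
      smul_add (lam i)⁻¹ (lam i • b₁), smul_smul, inv_mul_cancel₀ hl0, one_smul, sub_sub]
  have hd : Tendsto (fun i => decayPart Q (lam i) (y i) (y' i) x) l
      (𝓝 (R x * ((1 / 2 : ℂ) • (a - b₁)))) := by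
    have t1 : Tendsto (fun i => decayPart Q (lam i) (y i) (y' i) x -
        R x * decayPart Q (lam i) (y i) (y' i) 0) l (𝓝 0) := by
      have t2 := hinvn.mul_const (K * Real.exp I * I * Real.exp I)
      rw [zero_mul] at t2
      refine squeeze_zero_norm' ?_ t2
      filter_upwards [hl1, hre] with i hi hi'
      refine ((h i).norm_decayPart_sub_le hp hi hi' hR hR0 hx.le).trans ?_
      have := norm_grow_decay_zero_le (Q := Q) hi (h0 i) (h1 i)
      gcongr
    simpa using t1.add (hd0.const_mul (R x))
  constructor
  · simpa [grow_add_decay] using hg.add hd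
  · simpa using ((hg.sub hd).sub (hinv.smul ((hg.add hd).const_mul (Q x)))).congr fun i =>
      (exp_smul_deriv_eq _ _ _).symm

end RegularAsymptotics

/-! ### Jost solutions -/

section Jost

variable {A : Type*} [NormedRing A] [NormedAlgebra ℂ A]

/-- The kernel of the integral equation for the components of the Jost solution. -/
noncomputable def jostKernel (Q q : ℝ → A) (lam : ℂ) (x t : ℝ) : A × A →L[ℂ] A × A :=
  blockCLM (Q t - (2 * lam)⁻¹ • q t) (-(2 : ℂ) • Q t + (2 * lam)⁻¹ • q t)
    (-exp (2 * lam * (t - x)) • ((2 * lam)⁻¹ • q t))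
    (-exp (2 * lam * (t - x)) • (Q t - (2 * lam)⁻¹ • q t))

lemma norm_exp_two_mul_le {lam : ℂ} (hre : lam.re ≤ 0) {x t : ℝ} (h : x ≤ t) :
    ‖exp (2 * lam * (t - x))‖ ≤ 1 := by
  rw [← ofReal_sub, norm_exp_eq, Real.exp_le_one_iff]
  have : (2 * lam).re = 2 * lam.re := by simp
  rw [this]
  nlinarith

lemma norm_jostKernel_le {Q q : ℝ → A} {r : ℝ} (hr : 0 < r) {lam : ℂ} (hre : lam.re ≤ 0)
    (hl : r ≤ ‖lam‖) {x t : ℝ} (h : x ≤ t) :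
    ‖jostKernel Q q lam x t‖ ≤ 4 * ‖Q t‖ + 2 / r * ‖q t‖ := by
  have hκ : ‖(2 * lam)⁻¹‖ ≤ 1 / (2 * r) := by
    rw [norm_inv, norm_mul, norm_ofNat, ← one_div]
    gcongr
  have h1 : ‖(2 * lam)⁻¹ • q t‖ ≤ 1 / (2 * r) * ‖q t‖ :=
    (norm_smul_le _ _).trans (mul_le_mul_of_nonneg_right hκ (norm_nonneg _))
  have he : ‖-exp (2 * lam * (t - x))‖ ≤ 1 := by
    rw [norm_neg]; exact norm_exp_two_mul_le hre h
  have h2 := norm_sub_le (Q t) ((2 * lam)⁻¹ • q t)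
  have h3 : ‖-(2 : ℂ) • Q t + (2 * lam)⁻¹ • q t‖ ≤ 2 * ‖Q t‖ + 1 / (2 * r) * ‖q t‖ := by
    refine (norm_add_le _ _).trans (add_le_add ?_ h1)
    refine (norm_smul_le _ _).trans (le_of_eq ?_)
    simp
  have h4 := (norm_smul_le (-exp (2 * lam * (t - x))) ((2 * lam)⁻¹ • q t)).trans
    (mul_le_of_le_one_left (norm_nonneg _) he)
  have h5 := (norm_smul_le (-exp (2 * lam * (t - x))) (Q t - (2 * lam)⁻¹ • q t)).trans
    (mul_le_of_le_one_left (norm_nonneg _) he)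
  have h6 := norm_blockCLM_le (Q t - (2 * lam)⁻¹ • q t) (-(2 : ℂ) • Q t + (2 * lam)⁻¹ • q t)
    (-exp (2 * lam * (t - x)) • ((2 * lam)⁻¹ • q t))
    (-exp (2 * lam * (t - x)) • (Q t - (2 * lam)⁻¹ • q t))
  unfold jostKernel
  have e : 2 / r * ‖q t‖ = 4 * (1 / (2 * r) * ‖q t‖) := by ring
  rw [e]
  linarith

lemma volterraKernel_jost {Q q : ℝ → A} (hQ : IntegrableOn Q (Ioi 0)) (hq : IntegrableOn q (Ioi 0))
    {r : ℝ} (hr : 0 < r) :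
    VolterraKernel {z : ℂ | z.re ≤ 0 ∧ r ≤ ‖z‖} {z : ℂ | z.re < 0 ∧ r < ‖z‖} (Ici 0)
      (volume.restrict (Ioi 0)) (fun z x t => (Ioi x).indicator (jostKernel Q q z x) t)
      (fun x t => (Ioi x).indicator (fun t => 4 * ‖Q t‖ + 2 / r * ‖q t‖) t)
      (fun t => 4 * ‖Q t‖ + 2 / r * ‖q t‖)
      (fun x => Real.exp (2 * ∫ t in Ioi x, (4 * ‖Q t‖ + 2 / r * ‖q t‖)))
      (Real.exp (2 * ∫ t in Ioi 0, (4 * ‖Q t‖ + 2 / r * ‖q t‖))) := by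
  have hk0 : ∀ t, 0 ≤ 4 * ‖Q t‖ + 2 / r * ‖q t‖ := fun t => by positivity
  have hk : IntegrableOn (fun t => 4 * ‖Q t‖ + 2 / r * ‖q t‖) (Ioi 0) :=
    (hQ.norm.const_mul _).add (hq.norm.const_mul _)
  set k : ℝ → ℝ := fun t => 4 * ‖Q t‖ + 2 / r * ‖q t‖ with hkdef
  have hne : ∀ z : ℂ, r ≤ ‖z‖ → z ≠ 0 := fun z hz => norm_pos_iff.1 (hr.trans_le hz)
  exact
  { isOpen := (isOpen_lt Complex.continuous_re continuous_const).inter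
      (isOpen_lt continuous_const continuous_norm)
    subset := fun z hz => ⟨hz.1.le, hz.2.le⟩
    measurableSet := measurableSet_Ici
    ae_mem := ae_restrict_Ioi fun t ht => ht.le
    aestronglyMeasurable := fun z _ x _ => by
      have hκ := hq.1.const_smul (2 * z)⁻¹
      have he : AEStronglyMeasurable (fun t : ℝ => -exp (2 * z * (t - x)))
          (volume.restrict (Ioi 0)) := (by fun_prop : Continuous _).aestronglyMeasurable
      exact (AEStronglyMeasurable.blockCLM (hQ.1.sub hκ) ((hQ.1.const_smul _).add hκ)
        (he.smul hκ) (he.smul (hQ.1.sub hκ))).indicator measurableSet_Ioi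
    norm_le := fun x _ => ae_of_all _ fun t z hz => by
      by_cases h : t ∈ Ioi x
      · simp only [indicator_of_mem h]
        exact norm_jostKernel_le hr hz.1 hz.2 (le_of_lt h)
      · simp [indicator_of_notMem h]
    le_bound := fun x _ => ae_of_all _ fun t => indicator_le_self' (fun _ _ => hk0 _) t
    integrable := fun x _ => hk.indicator measurableSet_Ioi
    integrable_bound := hk
    continuousWithinAt := fun p hp => by
      have hp0 : p.1 ≠ 0 := hne _ hp.1.2
      have h0 : ∀ᵐ t ∂(volume.restrict (Ioi (0 : ℝ))), t ≠ p.2 := by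
        refine ae_restrict_of_ae ?_
        simp [ae_iff]
      filter_upwards [h0] with t ht
      rcases lt_or_gt_of_ne ht with h | h
      · have : (fun q' : ℂ × ℝ => (Ioi q'.2).indicator (jostKernel Q q q'.1 q'.2) t)
            =ᶠ[𝓝 p] fun _ => 0 := by
          filter_upwards [continuous_snd.continuousAt.eventually (lt_mem_nhds h)] with q' hq'
          exact indicator_of_notMem (by simpa using hq'.le) _
        exact (continuousAt_const.congr this.symm).continuousWithinAt
      · have : (fun q' : ℂ × ℝ => (Ioi q'.2).indicator (jostKernel Q q q'.1 q'.2) t)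
            =ᶠ[𝓝 p] fun q' => jostKernel Q q q'.1 q'.2 t := by
          filter_upwards [continuous_snd.continuousAt.eventually (gt_mem_nhds h)] with q' hq'
          exact indicator_of_mem (by exact hq') _
        refine (ContinuousAt.congr ?_ this.symm).continuousWithinAt
        have hκ : ContinuousAt (fun z : ℂ × ℝ => (2 * z.1)⁻¹) p :=
          ContinuousAt.inv₀ (by fun_prop) (by simpa using hp0)
        have he : ContinuousAt (fun z : ℂ × ℝ => -exp (2 * z.1 * (t - z.2))) p := by
          fun_prop
        have hκq := hκ.smul (continuousAt_const (y := q t))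
        exact ContinuousAt.blockCLM (continuousAt_const.sub hκq) (continuousAt_const.add hκq)
          (he.smul hκq) (he.smul (continuousAt_const.sub hκq))
    differentiableOn := fun x _ => ae_of_all _ fun t => by
      by_cases h : t ∈ Ioi x
      · simp only [indicator_of_mem h]
        have hκ : DifferentiableOn ℂ (fun z : ℂ => (2 * z)⁻¹) {z : ℂ | z.re < 0 ∧ r < ‖z‖} :=
          DifferentiableOn.inv (by fun_prop) fun z hz => by simpa using hne z hz.2.le
        have he : DifferentiableOn ℂ (fun z : ℂ => -exp (2 * z * (t - x)))
            {z : ℂ | z.re < 0 ∧ r < ‖z‖} := by fun_prop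
        have hκq := hκ.smul_const (q t)
        exact DifferentiableOn.blockCLM ((differentiableOn_const _).sub hκq)
          ((differentiableOn_const _).add hκq) (he.smul hκq)
          (he.smul ((differentiableOn_const _).sub hκq))
      · simp only [indicator_of_notMem h]; exact differentiableOn_const _
    weight_continuousOn := by
      have : ContinuousOn (fun x => Real.exp (2 * ((∫ t in Ioi 0, k t) - ∫ t in (0 : ℝ)..x, k t)))
          (Ici 0) := ((continuousOn_const.sub (isPrimitive_integral
            fun x hx => intervalIntegrable_of_Ioi hk hx).continuousOn).const_smul (2 : ℝ)).rexp
      exact this.congr fun x hx => by rw [integral_Ioi_eq_sub hk hx]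
    one_le_weight := fun x _ => Real.one_le_exp (mul_nonneg zero_le_two
      (integral_nonneg fun t => hk0 t))
    weight_le := fun x hx => by
      refine exp_le_exp.2 (mul_le_mul_of_nonneg_left ?_ zero_le_two)
      exact setIntegral_mono_set hk (ae_of_all _ hk0) (LE.le.eventuallyLE (Ioi_subset_Ioi hx))
    contraction := fun x hx => by
      refine le_trans (le_of_eq ?_) (integral_Ioi_mul_exp_le (fun t _ => hk0 t) hk hx)
      have : (fun t => (Ioi x).indicator k t * Real.exp (2 * ∫ s in Ioi t, k s)) =
          (Ioi x).indicator (fun t => k t * Real.exp (2 * ∫ s in Ioi t, k s)) := by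
        ext t; by_cases h : t ∈ Ioi x <;> simp [h]
      rw [this, setIntegral_indicator measurableSet_Ioi, inter_eq_right.2 (Ioi_subset_Ioi hx)] }

lemma setIntegral_indicator_Ioi {E : Type*} [NormedAddCommGroup E] [NormedSpace ℂ E]
    (g : ℝ → E →L[ℂ] E) (v : ℝ → E) {x : ℝ} (hx : 0 ≤ x) :
    ∫ t in Ioi 0, (Ioi x).indicator g t (v t) = ∫ t in Ioi x, g t (v t) := by
  have : (fun t => (Ioi x).indicator g t (v t)) = (Ioi x).indicator fun t => g t (v t) := by
    ext t; by_cases h : t ∈ Ioi x <;> simp [h]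
  rw [this, setIntegral_indicator measurableSet_Ioi, inter_eq_right.2 (Ioi_subset_Ioi hx)]

/-- The components of the Jost solution, for all `λ ≠ 0` in the closed left half-plane. -/
theorem exists_jost_components [CompleteSpace A] {Q q : ℝ → A} (hQ : IntegrableOn Q (Ioi 0))
    (hq : IntegrableOn q (Ioi 0)) (p : A) :
    ∃ u : ℂ → ℝ → A × A,
      (∀ x, 0 ≤ x → ContinuousOn (fun z => u z x) {z : ℂ | z.re ≤ 0 ∧ z ≠ 0}) ∧
      (∀ x, 0 ≤ x → DifferentiableOn ℂ (fun z => u z x) {z : ℂ | z.re < 0}) ∧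
      (∀ r, 0 < r → ∃ C, ∀ z : ℂ, z.re ≤ 0 → r ≤ ‖z‖ → ∀ x, 0 ≤ x → ‖u z x‖ ≤ C) ∧
      ∀ z : ℂ, z.re ≤ 0 → z ≠ 0 → ContinuousOn (u z) (Ici 0) ∧ ∀ x, 0 ≤ x →
        u z x = (p, 0) + ∫ t in Ioi x, jostKernel Q q z x t (u z t) := by
  set J : ℂ → ℝ → (ℝ → A × A) → A × A := fun z x v => ∫ t in Ioi x, jostKernel Q q z x t (v t)
  have spec := fun (r : ℝ) (hr : 0 < r) => (volterraKernel_jost hQ hq hr).picardLim_spec (J := J)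
    (f := fun _ _ => ((p, 0) : A × A))
    (fun z _ x hx v => (setIntegral_indicator_Ioi _ _ hx).symm) (norm_nonneg _) continuousOn_const
    (fun _ _ => differentiableOn_const _) (fun _ _ _ _ => le_rfl)
  refine ⟨picardLim J fun _ _ => (p, 0), fun x hx z hz => ?_, fun x hx z hz => ?_,
    fun r hr => ⟨_, fun z hz h x hx => (spec r hr).2.2.1 z ⟨hz, h⟩ x hx⟩, fun z hz hz0 => ⟨?_,
    fun x hx => (spec _ (norm_pos_iff.2 hz0)).2.2.2 z ⟨hz, le_rfl⟩ x hx⟩⟩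
  · have hn := norm_pos_iff.2 hz.2
    have h1 := (spec (‖z‖ / 2) (half_pos hn)).1.comp (f := fun w : ℂ => (w, x)) (by fun_prop)
      (fun w hw => ⟨hw, hx⟩) z ⟨hz.1, (half_lt_self hn).le⟩
    refine h1.mono_of_mem_nhdsWithin ?_
    filter_upwards [self_mem_nhdsWithin, mem_nhdsWithin_of_mem_nhds
      (continuous_norm.continuousAt.eventually (lt_mem_nhds (half_lt_self hn)))] with w hw hw'
    exact ⟨hw.1, hw'.le⟩
  · have hn : 0 < ‖z‖ := norm_pos_iff.2 fun h => by simp [h] at hz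
    exact (((spec (‖z‖ / 2) (half_pos hn)).2.1 x hx).differentiableAt
      ((volterraKernel_jost hQ hq (half_pos hn)).isOpen.mem_nhds
        ⟨hz, half_lt_self hn⟩)).differentiableWithinAt
  · exact (spec ‖z‖ (norm_pos_iff.2 hz0)).1.comp (f := fun t => (z, t)) (by fun_prop)
      fun t ht => ⟨⟨hz, le_rfl⟩, ht⟩

end Jost

section JostSolution

variable {E : Type*} [NormedAddCommGroup E] [NormedSpace ℝ E] {f g : ℝ → E}

lemma tendsto_integral_Ioi_zero (hg : IntegrableOn g (Ioi 0)) :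
    Tendsto (fun x => ∫ t in Ioi x, g t) atTop (𝓝 0) := by
  have h := (tendsto_const_nhds (x := ∫ t in Ioi 0, g t)).sub
    (intervalIntegral_tendsto_integral_Ioi 0 hg tendsto_id)
  rw [sub_self] at h
  refine h.congr' ?_
  filter_upwards [eventually_ge_atTop 0] with x hx
  rw [integral_Ioi_eq_sub hg hx]; rfl

lemma IsPrimitive.of_integral_Ioi (hg : IntegrableOn g (Ioi 0)) {c : E}
    (h : ∀ x, 0 ≤ x → f x = c + ∫ t in Ioi x, g t) : IsPrimitive f fun t => -g t := by
  refine ⟨fun x hx => (intervalIntegrable_of_Ioi hg hx).neg, fun x hx => ?_⟩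
  rw [h x hx, h 0 le_rfl, integral_Ioi_eq_sub hg hx, intervalIntegral.integral_neg]
  abel

lemma IsPrimitive.tendsto_atTop {f' : ℝ → E} (h : IsPrimitive f f') (hi : IntegrableOn f' (Ioi 0)) :
    Tendsto f atTop (𝓝 (f 0 + ∫ t in Ioi 0, f' t)) := by
  refine ((intervalIntegral_tendsto_integral_Ioi 0 hi tendsto_id).const_add (f 0)).congr' ?_
  filter_upwards [eventually_ge_atTop 0] with x hx
  exact (h.eq_add x hx).symm

lemma IsPrimitive.eq_lim_sub {f' : ℝ → E} (h : IsPrimitive f f') (hi : IntegrableOn f' (Ioi 0))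
    {p : E}
    (hp : Tendsto f atTop (𝓝 p)) {x : ℝ} (hx : 0 ≤ x) : f x = p - ∫ t in Ioi x, f' t := by
  rw [tendsto_nhds_unique hp (h.tendsto_atTop hi), h.eq_add x hx, integral_Ioi_eq_sub hi hx]
  abel

lemma IsPrimitive.norm_le_of_linear [CompleteSpace E] {v : ℝ → E} (h : IsPrimitive v g)
    {k : ℝ → ℝ} (hk0 : ∀ t, 0 ≤ t → 0 ≤ k t)
    (hk : IntegrableOn k (Ioi 0)) (hb : ∀ t, 0 ≤ t → ‖g t‖ ≤ k t * ‖v t‖) {x : ℝ}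
    (hx : 0 ≤ x) : ‖v x‖ ≤ ‖v 0‖ * Real.exp (∫ t in Ioi 0, k t) := by
  have hki := fun x hx => intervalIntegrable_of_Ioi hk (x := x) hx
  have hc := h.continuousOn.norm
  refine (gronwall_forward (u := fun t => ‖v t‖) (C := ‖v 0‖) hk0 hki hc (fun y hy => ?_) hx).trans
    (mul_le_mul_of_nonneg_left (exp_le_exp.2 (intervalIntegral_le_Ioi hk0 hk hx))
      (norm_nonneg _))
  rw [h.eq_add y hy]
  refine (norm_add_le _ _).trans (add_le_add le_rfl ?_)
  refine intervalIntegral.norm_integral_le_of_norm_le hy (ae_of_all _ fun t ht => hb t ht.1.le) ?_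
  exact (hki y hy).mul_continuousOn (hc.mono (uIcc_subset_Ici hy))

lemma IsPrimitive.aestronglyMeasurable (h : IsPrimitive f g) :
    AEStronglyMeasurable g (volume.restrict (Ioi 0)) := by
  have : Ioi (0 : ℝ) = ⋃ n : ℕ, Ioc (0 : ℝ) n := by
    ext t
    simp only [mem_Ioi, mem_iUnion, mem_Ioc]
    exact ⟨fun ht => (exists_nat_ge t).imp fun n hn => ⟨ht, hn⟩, fun ⟨n, hn⟩ => hn.1⟩
  rw [this, aestronglyMeasurable_iUnion_iff]
  exact fun n => (h.intervalIntegrable n n.cast_nonneg).1.aestronglyMeasurable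

/-- Solutions of a linear equation with integrable coefficients have integrable derivatives. -/
lemma IsPrimitive.integrable_of_linear [CompleteSpace E] {v : ℝ → E} (h : IsPrimitive v g)
    {k : ℝ → ℝ} (hk0 : ∀ t, 0 ≤ t → 0 ≤ k t)
    (hk : IntegrableOn k (Ioi 0)) (hb : ∀ t, 0 ≤ t → ‖g t‖ ≤ k t * ‖v t‖) :
    IntegrableOn g (Ioi 0) := by
  refine Integrable.mono' (hk.mul_const (‖v 0‖ * Real.exp (∫ t in Ioi 0, k t)))
    h.aestronglyMeasurable ?_
  refine ae_restrict_Ioi fun t ht => ?_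
  have ht0 := ht.le
  exact (hb t ht0).trans (mul_le_mul_of_nonneg_left (h.norm_le_of_linear hk0 hk hb ht0) (hk0 t ht0))

variable {A : Type*} [NormedRing A] [NormedAlgebra ℂ A] [CompleteSpace A] {Q Q' Q₀ : ℝ → A}

lemma Potential.tendsto_zero (hp : Potential Q Q' Q₀) : Tendsto Q atTop (𝓝 0) := by
  have h := hp.isPrimitive.tendsto_atTop hp.integrable_Q'
  have : Q 0 + ∫ t in Ioi 0, Q' t = 0 :=
    IntegrableAtFilter.eq_zero_of_tendsto ⟨Ioi 0, Ioi_mem_atTop 0, hp.integrable_Q⟩ (fun s hs => by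
      obtain ⟨a, ha⟩ := mem_atTop_sets.1 hs
      rw [← top_le_iff, ← Real.volume_Ici (a := a)]
      exact measure_mono ha) h
  rwa [this] at h

/-- Jost solutions: solutions of the equation for `λ ≠ 0` in the closed left half-plane with
`E ~ e^{λx} p`, `E' ~ λ e^{λx} p` as `x → ∞`, where `p = P(∞)`, `P' = -Q P`; for large `λ` they are
`e^{λx} (P(x) + O(1/λ))`. -/
theorem Potential.exists_jost (hp : Potential Q Q' Q₀) {P : ℝ → A} {p : A}
    (hP : IsPrimitive P fun t => -(Q t * P t)) (hlim : Tendsto P atTop (𝓝 p)) :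
    ∃ E E' : ℂ → ℝ → A,
      (∀ x, 0 ≤ x → ContinuousOn (fun z => E z x) {z : ℂ | z.re ≤ 0 ∧ z ≠ 0} ∧
        ContinuousOn (fun z => E' z x) {z : ℂ | z.re ≤ 0 ∧ z ≠ 0} ∧
        DifferentiableOn ℂ (fun z => E z x) {z : ℂ | z.re < 0} ∧
        DifferentiableOn ℂ (fun z => E' z x) {z : ℂ | z.re < 0}) ∧
      (∀ z : ℂ, z.re ≤ 0 → z ≠ 0 → IsSolution Q Q₀ z (E z) (E' z) ∧
        Tendsto (fun x : ℝ => exp (-z * x) • E z x) atTop (𝓝 p) ∧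
        Tendsto (fun x : ℝ => exp (-z * x) • E' z x) atTop (𝓝 (z • p))) ∧
      ∀ x : ℝ, 0 ≤ x → ∃ C : ℝ, 0 ≤ C ∧ ∀ z : ℂ, z.re ≤ 0 → 1 ≤ ‖z‖ →
        ‖exp (-z * x) • E z x - P x‖ ≤ C / ‖z‖ ∧
        ‖exp (-z * x) • (z⁻¹ • E' z x) - P x‖ ≤ C / ‖z‖ := by
  set q := remCoef Q Q' Q₀ with hqdef
  have hq : IntegrableOn q (Ioi 0) := hp.integrable_remCoef
  have hQ := hp.integrable_Q
  obtain ⟨u, huc, hud, hub, hu⟩ := exists_jost_components hQ hq p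
  -- the solution is `e^{zx} (s - w)`; the remainder `r` is of order `1 / z`
  obtain ⟨s, w, rfl⟩ : ∃ s w : ℂ → ℝ → A, u = fun z t => (s z t, w z t) :=
    ⟨fun z t => (u z t).1, fun z t => (u z t).2, rfl⟩
  obtain ⟨r, hr⟩ : ∃ r : ℂ → ℝ → A, ∀ z t, r z t = (2 * z)⁻¹ • (q t * (s z t - w z t)) :=
    ⟨_, fun _ _ => rfl⟩
  obtain ⟨g, hg⟩ : ∃ g : ℂ → ℝ → A, ∀ z t, g z t = Q t * s z t - (2 : ℂ) • (Q t * w z t) - r z t :=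
    ⟨_, fun _ _ => rfl⟩
  have hcancel : ∀ (z : ℂ) (x : ℝ) (v : A), exp (-z * x) • (exp (z * x) • v) = v :=
    fun z x v => by rw [smul_smul, ← exp_add]; simp
  have hker : ∀ (z : ℂ) (x t : ℝ), jostKernel Q q z x t (s z t, w z t) =
      (g z t, -exp (2 * z * (t - x)) • (Q t * w z t + r z t)) := fun z x t => by
    rw [hg, hr, jostKernel, blockCLM_apply]
    refine Prod.ext ?_ ?_
    · simp only [sub_mul, add_mul, smul_mul_assoc, mul_sub, neg_smul, neg_mul, smul_sub]; abel
    · simp only [sub_mul, smul_mul_assoc, mul_sub, ← smul_add]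
      congr 1; module
  have hbd : ∀ z : ℂ, z.re ≤ 0 → z ≠ 0 → ∃ C, 0 ≤ C ∧ ∀ x, 0 ≤ x → ‖(s z x, w z x)‖ ≤ C :=
    fun z hz hz0 => by
      obtain ⟨C, hC⟩ := hub ‖z‖ (norm_pos_iff.2 hz0)
      exact ⟨C, (norm_nonneg _).trans (hC z hz le_rfl 0 le_rfl), fun x hx => hC z hz le_rfl x hx⟩
  have hint : ∀ z : ℂ, z.re ≤ 0 → z ≠ 0 → ∀ x : ℝ, 0 ≤ x → IntegrableOn (fun t : ℝ =>
      (g z t, -exp (2 * z * (t - x)) • (Q t * w z t + r z t))) (Ioi x) := by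
    intro z hz hz0 x hx
    obtain ⟨C, hC0, hC⟩ := hbd z hz hz0
    have K := volterraKernel_jost hQ hq (norm_pos_iff.2 hz0)
    have h1 := K.integrable_apply (hu z hz hz0).1 (D := C) (fun t ht => by
      have := hC t ht
      have := K.one_le_weight t ht
      nlinarith) (z := z) ⟨hz, le_rfl⟩ (x := x) hx
    have h2 : (fun t => (Ioi x).indicator (jostKernel Q q z x) t (s z t, w z t)) =
        (Ioi x).indicator fun t => jostKernel Q q z x t (s z t, w z t) := by
      ext1 t; by_cases h : t ∈ Ioi x <;> simp [h]
    rw [h2, integrable_indicator_iff measurableSet_Ioi, IntegrableOn,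
      Measure.restrict_restrict measurableSet_Ioi, inter_eq_left.2 (Ioi_subset_Ioi hx)] at h1
    simp only [hker] at h1
    exact h1
  simp only [hker] at hu
  have hs : ∀ z : ℂ, z.re ≤ 0 → z ≠ 0 → ∀ x, 0 ≤ x → s z x = p + ∫ t in Ioi x, g z t :=
    fun z hz hz0 x hx => by
      simpa only [Prod.fst_add, fst_integral (hint z hz hz0 x hx)] using
        congrArg Prod.fst ((hu z hz hz0).2 x hx)
  have hw : ∀ z : ℂ, z.re ≤ 0 → z ≠ 0 → ∀ x : ℝ, 0 ≤ x → w z x = ∫ t in Ioi x,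
      -exp (2 * z * (t - x)) • (Q t * w z t + r z t) := fun z hz hz0 x hx => by
    simpa only [Prod.snd_add, zero_add, snd_integral (hint z hz hz0 x hx)] using
      congrArg Prod.snd ((hu z hz hz0).2 x hx)
  have hlimu : ∀ z : ℂ, z.re ≤ 0 → z ≠ 0 →
      Tendsto (s z) atTop (𝓝 p) ∧ Tendsto (w z) atTop (𝓝 0) := by
    intro z hz hz0
    obtain ⟨C, hC0, hC⟩ := hbd z hz hz0
    have hk : IntegrableOn (fun t => (4 * ‖Q t‖ + 2 / ‖z‖ * ‖q t‖) * C) (Ioi 0) :=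
      ((hQ.norm.const_mul _).add (hq.norm.const_mul _)).mul_const _
    have h : Tendsto (fun t => (s z t, w z t)) atTop (𝓝 (p, 0)) := by
      rw [tendsto_iff_norm_sub_tendsto_zero]
      refine squeeze_zero' (Eventually.of_forall fun _ => norm_nonneg _) ?_
        (tendsto_integral_Ioi_zero hk)
      filter_upwards [eventually_ge_atTop 0] with x hx
      rw [(hu z hz hz0).2 x hx, add_sub_cancel_left]
      refine norm_integral_le_of_norm_le (hk.mono_set (Ioi_subset_Ioi hx))
        (ae_restrict_Ioi fun t ht => ?_)
      rw [← hker]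
      exact (ContinuousLinearMap.le_opNorm _ _).trans (mul_le_mul
        (norm_jostKernel_le (norm_pos_iff.2 hz0) hz le_rfl ht.le)
        (hC t (hx.trans ht.le)) (norm_nonneg _) (by positivity))
    exact ⟨(continuous_fst.tendsto _).comp h, (continuous_snd.tendsto _).comp h⟩
  refine ⟨fun z x => exp (z * x) • (s z x - w z x),
    fun z x => exp (z * x) • (z • (s z x + w z x) - Q x * (s z x - w z x)),
    fun x hx => ?_, fun z hz hz0 => ⟨?_, ?_, ?_⟩, fun x hx => ?_⟩
  · have c1 := (huc x hx).fst
    have c2 := (huc x hx).snd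
    have d1 := (hud x hx).fst
    have d2 := (hud x hx).snd
    have hd : ∀ O, DifferentiableOn ℂ (fun z : ℂ => exp (z * x)) O := fun O => by fun_prop
    exact ⟨(hd _).continuousOn.smul (c1.sub c2), (hd _).continuousOn.smul
      ((continuousOn_id.smul (c1.add c2)).sub (continuousOn_const.mul (c1.sub c2))),
      DifferentiableOn.smul (hd _) (d1.sub d2), DifferentiableOn.smul (hd _)
      ((differentiableOn_id.smul (d1.add d2)).sub ((differentiableOn_const _).mul (d1.sub d2)))⟩
  · have p1 : IsPrimitive (s z) fun t => -g z t := .of_integral_Ioi (hint z hz hz0 0 le_rfl).fst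
      (hs z hz hz0)
    have p2 : IsPrimitive (fun x : ℝ => exp (2 * z * x) • w z x)
        (fun t : ℝ => exp (2 * z * t) • (Q t * w z t + r z t)) := by
      have h1 := (hint z hz hz0 0 le_rfl).snd
      simp only [ofReal_zero, sub_zero] at h1
      refine (IsPrimitive.of_integral_Ioi (f := fun x : ℝ => exp (2 * z * x) • w z x)
        (c := 0) h1 fun x hx => ?_).congr fun t _ => by rw [neg_smul, neg_neg]
      rw [hw z hz hz0 x hx, zero_add, ← integral_smul]
      refine setIntegral_congr_fun measurableSet_Ioi fun t _ => ?_
      rw [neg_smul, smul_neg, smul_smul, ← exp_add, neg_smul]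
      congr 3; ring
    have p2' : IsPrimitive (w z) (fun t => -(2 * z) • w z t + (Q t * w z t + r z t)) := by
      refine (((IsPrimitive.cexp (-(2 * z))).smul p2).congr fun t _ => ?_).congr_left fun t _ => ?_
      · rw [smul_smul, smul_smul, mul_assoc, ← exp_add]
        simp [add_comm]
      · rw [smul_smul, ← exp_add]; simp
    have d1 := p1.sub p2'
    have e1 := (IsPrimitive.cexp z).smul d1
    have e2 := (IsPrimitive.cexp z).smul
      (((p1.add p2').const_smul z).sub (hp.isPrimitive.mul d1))
    refine ⟨e1.congr fun t _ => ?_, e2.congr fun t _ => ?_⟩ <;> beta_reduce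
    · rw [hg, mul_sub]
      match_scalars <;> ring
    · have hr' : Q₀ t * (s z t - w z t) = Q' t * (s z t - w z t) -
          Q t * (Q t * (s z t - w z t)) - (2 * z) • r z t := by
        rw [hr, smul_inv_smul₀ (mul_ne_zero two_ne_zero hz0), hqdef]
        simp only [remCoef, sub_mul, mul_assoc]; abel
      simp only [sub_mul (z ^ 2 • (1 : A) - (2 * z) • Q t), sub_mul (z ^ 2 • (1 : A)),
        mul_smul_comm, smul_mul_assoc, one_mul, hr', hg]
      generalize Q' t * (s z t - w z t) = r'
      simp only [mul_sub, mul_add, mul_neg, mul_smul_comm]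
      match_scalars <;> ring
  · have h1 := (hlimu z hz hz0).1.sub (hlimu z hz hz0).2
    rw [sub_zero] at h1
    exact h1.congr fun x => (hcancel z x _).symm
  · obtain ⟨h1, h2⟩ := hlimu z hz hz0
    have h3 := ((h1.add h2).const_smul z).sub (hp.tendsto_zero.mul (h1.sub h2))
    simp only [add_zero, sub_zero, zero_mul] at h3
    exact h3.congr fun x => (hcancel z x _).symm
  · obtain ⟨C, hC⟩ := hub 1 one_pos
    have hC0 : 0 ≤ C := (norm_nonneg _).trans (hC (-1) (by simp) (by simp) 0 le_rfl)
    have hPb : ∀ t, 0 ≤ t → ‖-(Q t * P t)‖ ≤ ‖Q t‖ * ‖P t‖ :=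
      fun t _ => by rw [norm_neg]; exact norm_mul_le _ _
    have hPi : IntegrableOn (fun t => -(Q t * P t)) (Ioi 0) :=
      hP.integrable_of_linear (fun _ _ => norm_nonneg _) hQ.norm hPb
    set G := 2 * C * (∫ t in Ioi 0, ‖q t‖) * Real.exp (∫ t in Ioi 0, 3 * ‖Q t‖) with hG
    have hG0 : 0 ≤ G := mul_nonneg (mul_nonneg (by positivity)
      (integral_nonneg fun _ => norm_nonneg _)) (exp_pos _).le
    refine ⟨G + ‖Q x‖ * (2 * C), by positivity, fun z hz hl => ?_⟩
    have hz0 : z ≠ 0 := norm_pos_iff.1 (zero_lt_one.trans_le hl)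
    have hu1 : ∀ t, 0 ≤ t → ‖s z t‖ ≤ C := fun t ht => (norm_fst_le _).trans (hC z hz hl t ht)
    have hu2 : ∀ t, 0 ≤ t → ‖w z t‖ ≤ C := fun t ht => (norm_snd_le _).trans (hC z hz hl t ht)
    have hu3 : ∀ t, 0 ≤ t → ‖s z t - w z t‖ ≤ 2 * C := fun t ht =>
      (norm_sub_le _ _).trans (by linarith [hu1 t ht, hu2 t ht])
    have hκ : ∀ t, 0 ≤ t → ‖r z t‖ ≤ C / ‖z‖ * ‖q t‖ := by
      intro t ht
      rw [hr]
      refine (norm_smul_le _ _).trans ((mul_le_mul_of_nonneg_left ((norm_mul_le _ _).trans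
        (mul_le_mul_of_nonneg_left (hu3 t ht) (norm_nonneg _))) (norm_nonneg _)).trans_eq ?_)
      rw [norm_inv, norm_mul, norm_ofNat]
      ring
    -- Gronwall's inequality is applied to the distance `d` of `(s, w)` from `(P, 0)`
    obtain ⟨d, hd⟩ : ∃ d : ℝ → ℝ, ∀ t, d t = ‖s z t - P t‖ + ‖w z t‖ := ⟨_, fun _ => rfl⟩
    have hd0 : ∀ t, 0 ≤ d t := fun t => by rw [hd]; positivity
    have hdc : ContinuousOn d (Ici 0) := (((hu z hz hz0).1.fst.sub hP.continuousOn).norm.add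
      (hu z hz hz0).1.snd.norm).congr fun t _ => hd t
    have hdb : ∀ t, 0 ≤ t → |d t| ≤ 2 * C + ‖P 0‖ * Real.exp (∫ t in Ioi 0, ‖Q t‖) :=
      fun t ht => by
        rw [abs_of_nonneg (hd0 t), hd]
        linarith [hu1 t ht, hu2 t ht, norm_sub_le (s z t) (P t),
          hP.norm_le_of_linear (fun _ _ => norm_nonneg _) hQ.norm hPb ht]
    have key : ∀ y : ℝ, 0 ≤ y → d y ≤
        2 * C * (∫ t in Ioi 0, ‖q t‖) / ‖z‖ + ∫ t in Ioi y, (3 * ‖Q t‖) * d t := by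
      intro y hy
      have hyi := Ioi_subset_Ioi hy
      have iq : IntegrableOn (fun t => C / ‖z‖ * ‖q t‖) (Ioi y) :=
        IntegrableOn.mono_set (hq.norm.const_mul _) hyi
      have iQ : IntegrableOn (fun t => ‖Q t‖ * d t) (Ioi y) :=
        IntegrableOn.mono_set (hQ.norm.mul_bdd
          ((hdc.mono Ioi_subset_Ici_self).aestronglyMeasurable measurableSet_Ioi)
          (ae_restrict_Ioi fun t ht => hdb t ht.le)) hyi
      have b1 : ‖s z y - P y‖ ≤ ∫ t in Ioi y, (2 * (‖Q t‖ * d t) + C / ‖z‖ * ‖q t‖) := by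
        rw [hs z hz hz0 y hy, hP.eq_lim_sub hPi hlim hy, add_sub_sub_cancel,
          ← integral_add (hint z hz hz0 y hy).fst (hPi.mono_set hyi)]
        refine norm_integral_le_of_norm_le ((iQ.const_mul 2).add iq)
          (ae_restrict_Ioi fun t ht => ?_)
        rw [show g z t + -(Q t * P t) = Q t * (s z t - P t) - (2 : ℂ) • (Q t * w z t) - r z t by
          rw [hg, mul_sub (Q t) _ (P t)]; abel, hd]
        refine (norm_sub_le _ _).trans (add_le_add ((norm_sub_le _ _).trans ?_)
          (hκ t (hy.trans ht.le)))
        rw [norm_smul, norm_ofNat]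
        nlinarith [norm_mul_le (Q t) (s z t - P t), norm_mul_le (Q t) (w z t),
          mul_nonneg (norm_nonneg (Q t)) (norm_nonneg (s z t - P t))]
      have b2 : ‖w z y‖ ≤ ∫ t in Ioi y, (‖Q t‖ * d t + C / ‖z‖ * ‖q t‖) := by
        rw [hw z hz hz0 y hy]
        refine norm_integral_le_of_norm_le (iQ.add iq)
          (ae_restrict_Ioi fun t ht => ?_)
        refine (norm_smul_le _ _).trans ((mul_le_of_le_one_left (norm_nonneg _) ?_).trans
          ((norm_add_le _ _).trans (add_le_add ((norm_mul_le _ _).trans ?_)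
            (hκ t (hy.trans ht.le)))))
        · rw [norm_neg]
          exact norm_exp_two_mul_le hz ht.le
        · rw [hd]; gcongr; exact le_add_of_nonneg_left (norm_nonneg _)
      have b3 : ∫ t in Ioi y, ‖q t‖ ≤ ∫ t in Ioi 0, ‖q t‖ :=
        setIntegral_mono_set hq.norm (ae_of_all _ fun _ => norm_nonneg _) hyi.eventuallyLE
      rw [integral_add (iQ.const_mul 2) iq, integral_const_mul, integral_const_mul] at b1
      rw [integral_add iQ iq, integral_const_mul] at b2
      simp only [mul_assoc (3 : ℝ), integral_const_mul]
      have b5 := mul_le_mul_of_nonneg_left b3 (div_nonneg hC0 (norm_nonneg z))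
      rw [show 2 * C * (∫ t in Ioi 0, ‖q t‖) / ‖z‖ = 2 * (C / ‖z‖ * ∫ t in Ioi 0, ‖q t‖) by ring,
        hd y]
      linarith
    have main : ‖s z x - P x‖ + ‖w z x‖ ≤ G / ‖z‖ := by
      rw [← hd, hG, mul_div_right_comm]
      exact gronwall_backward (k := fun t => 3 * ‖Q t‖) (by positivity)
        (fun t _ => by positivity) (hQ.norm.const_mul 3) hdc hdb key hx
    have hle : G / ‖z‖ ≤ (G + ‖Q x‖ * (2 * C)) / ‖z‖ := by
      gcongr; exact le_add_of_nonneg_right (by positivity)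
    constructor
    · rw [hcancel, sub_right_comm]
      exact ((norm_sub_le _ _).trans main).trans hle
    · rw [smul_comm z⁻¹, hcancel, smul_sub, inv_smul_smul₀ hz0, sub_right_comm,
        add_sub_right_comm, add_div]
      refine (norm_sub_le _ _).trans (add_le_add ((norm_add_le _ _).trans main) ?_)
      refine (norm_smul_le _ _).trans ?_
      rw [norm_inv, inv_mul_eq_div]
      gcongr
      exact (norm_mul_le _ _).trans (mul_le_mul_of_nonneg_left (hu3 x hx) (norm_nonneg _))

end JostSolution

/-! ### Solutions of a quadratic pencil -/

namespace FrobeniusTopology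

open scoped Matrix.Norms.Frobenius

/-- The topology of the Frobenius norm. It is definitionally the product topology, but the equality
is not visible to instance search, so this instance is preferred where the norm is used. -/
noncomputable scoped instance (priority := 2000) instTopologicalSpace (m : ℕ) :
    TopologicalSpace (CMat m) :=
  (Matrix.frobeniusNormedAddCommGroup : NormedAddCommGroup
    (CMat m)).toMetricSpace.toPseudoMetricSpace.toUniformSpace.toTopologicalSpace

end FrobeniusTopology

open scoped Matrix.Norms.Frobenius FrobeniusTopology

variable {m : ℕ} {L Lt : QuadPencil m}

section MatrixPrimitive

/-- The `(j, k)` entry of a matrix as a continuous linear function. -/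
noncomputable def entryCLM (m : ℕ) (j k : Fin m) : CMat m →L[ℝ] ℂ :=
  LinearMap.toContinuousLinearMap
    { toFun := fun A => A j k, map_add' := fun _ _ => rfl, map_smul' := fun _ _ => rfl }

/-- Multiplication of a fixed matrix by a complex scalar as a continuous linear function. -/
noncomputable def smulMatrixCLM (A : CMat m) : ℂ →L[ℝ] CMat m :=
  (ContinuousLinearMap.id ℝ ℂ).smulRight A

lemma sum_smul_single (A : CMat m) : ∑ j, ∑ k, A j k • single j k (1 : ℂ) = A := by
  conv_rhs => rw [Matrix.matrix_eq_sum_single A]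
  simp [smul_single]

lemma IsPrimitive.sum {ι E : Type*} [NormedAddCommGroup E] [NormedSpace ℝ E] (s : Finset ι)
    {f f' : ι → ℝ → E} (h : ∀ i ∈ s, IsPrimitive (f i) (f' i)) :
    IsPrimitive (fun x => ∑ i ∈ s, f i x) (fun x => ∑ i ∈ s, f' i x) := by
  classical
  induction s using Finset.induction_on with
  | empty => simpa using IsPrimitive.const (0 : E)
  | insert a s ha ih =>
    simp only [Finset.sum_insert ha]
    exact (h a (Finset.mem_insert_self a s)).add
      (ih fun i hi => h i (Finset.mem_insert_of_mem hi))

lemma isPrimitive_matrix_iff {F F' : ℝ → CMat m} :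
    IsPrimitive F F' ↔ ∀ j k, IsPrimitive (fun x => F x j k) (fun x => F' x j k) := by
  refine ⟨fun h j k => h.clm (entryCLM m j k), fun h => ?_⟩
  have key : IsPrimitive (fun x => ∑ j, ∑ k, F x j k • single j k (1 : ℂ))
      (fun x => ∑ j, ∑ k, F' x j k • single j k (1 : ℂ)) :=
    IsPrimitive.sum _ fun j _ => IsPrimitive.sum _ fun k _ =>
      (h j k).clm (smulMatrixCLM (single j k (1 : ℂ)))
  simpa only [sum_smul_single] using key

lemma integrableOn_matrix_iff {F : ℝ → CMat m} {s : Set ℝ} :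
    IntegrableOn F s ↔ ∀ j k, IntegrableOn (fun x => F x j k) s := by
  refine ⟨fun h j k => (entryCLM m j k).integrable_comp h, fun h => ?_⟩
  have key : IntegrableOn (fun x => ∑ j, ∑ k, F x j k • single j k (1 : ℂ)) s :=
    integrable_finsetSum _ fun j _ => integrable_finsetSum _ fun k _ =>
      (smulMatrixCLM (single j k (1 : ℂ))).integrable_comp (h j k)
  simpa only [sum_smul_single] using key

lemma hasDerivWithinAt_matrix_iff {F : ℝ → CMat m} {F' : CMat m} {s : Set ℝ} {x : ℝ} :
    HasDerivWithinAt F F' s x ↔ ∀ j k, HasDerivWithinAt (fun t => F t j k) (F' j k) s x := by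
  refine ⟨fun h j k => (entryCLM m j k).hasFDerivAt.comp_hasDerivWithinAt x h, fun h => ?_⟩
  have key : HasDerivWithinAt (fun x => ∑ j, ∑ k, F x j k • single j k (1 : ℂ))
      (∑ j, ∑ k, F' j k • single j k (1 : ℂ)) s x :=
    HasDerivWithinAt.fun_sum fun j _ => HasDerivWithinAt.fun_sum fun k _ =>
      (smulMatrixCLM (single j k (1 : ℂ))).hasFDerivAt.comp_hasDerivWithinAt x (h j k)
  simpa only [sum_smul_single] using key

/-- A complex function which is absolutely continuous on bounded intervals is a primitive of its
derivative. -/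
lemma IsPrimitive.of_absolutelyContinuous {f : ℝ → ℂ}
    (h : ∀ T > 0, AbsolutelyContinuousOnInterval f 0 T) : IsPrimitive f (deriv f) := by
  have hac : ∀ g : ℂ → ℝ, (∀ z w, |g z - g w| ≤ ‖z - w‖) → ∀ T, 0 ≤ T →
      AbsolutelyContinuousOnInterval (fun x => g (f x)) 0 T := by
    intro g hg T hT
    have h1 := (h (T + 1) (by linarith)).mono (c := 0) (d := T)
      (by rw [uIcc_of_le hT, uIcc_of_le (by linarith)]; exact Icc_subset_Icc_right (by linarith))
    rw [absolutelyContinuousOnInterval_iff] at h1 ⊢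
    intro ε hε
    obtain ⟨δ, hδ, H⟩ := h1 ε hε
    refine ⟨δ, hδ, fun I hI hd => lt_of_le_of_lt (sum_le_sum fun i _ => ?_) (H I hI hd)⟩
    rw [dist_eq_norm, dist_eq_norm]
    exact hg _ _
  have hprim : ∀ g : ℂ → ℝ, (∀ z w, |g z - g w| ≤ ‖z - w‖) →
      IsPrimitive (fun x => g (f x)) (deriv fun x => g (f x)) := fun g hg =>
    ⟨fun x hx => (hac g hg x hx).intervalIntegrable_deriv, fun x hx => by
      rw [(hac g hg x hx).integral_deriv_eq_sub]; ring⟩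
  have hre := hprim Complex.re fun z w => by
    rw [← Complex.sub_re]; exact Complex.abs_re_le_norm _
  have him := hprim Complex.im fun z w => by
    rw [← sub_im]; exact abs_im_le_norm _
  have key := (hre.clm Complex.ofRealCLM).add
    ((him.clm Complex.ofRealCLM).mul_const I)
  simp only [Complex.ofRealCLM_apply, Complex.re_add_im] at key
  refine key.congr_ae ?_
  have hd : ∀ n : ℕ, ∀ᵐ t : ℝ, t ∈ Icc (0 : ℝ) n →
      (((deriv (fun x => (f x).re) t : ℝ) : ℂ) + ((deriv (fun x => (f x).im) t : ℝ) : ℂ) *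
        I) = deriv f t := fun n => by
    filter_upwards [key.ae_hasDerivAt n n.cast_nonneg] with t ht htn
    exact (ht htn).deriv.symm
  filter_upwards [ae_all_iff.2 hd] with t ht ht0
  obtain ⟨n, hn⟩ := exists_nat_ge t
  exact ht n ⟨ht0, hn⟩

end MatrixPrimitive

namespace QuadPencil

/-- The entrywise derivative of `Q₁`. -/
noncomputable def derivQ1 (L : QuadPencil m) (x : ℝ) : CMat m :=
  Matrix.of fun j k => deriv (fun t => L.Q1 t j k) x

/-- In the half-plane `Π_σ` the pencil equation is `y'' = (λ² - 2 λ σ Q₁ - Q₀) y` with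
`λ = σ i ρ`. -/
lemma ClassV.potential (hL : L.ClassV) (s : ℂ) :
    Potential (fun t => s • L.Q1 t) (fun t => s • L.derivQ1 t) L.Q0 where
  integrable_Q := (integrableOn_matrix_iff.2 hL.integrable_Q1).smul s
  integrable_Q' := (integrableOn_matrix_iff.2 hL.integrable_deriv_Q1).smul s
  integrable_Q₀ := integrableOn_matrix_iff.2 hL.integrable_Q0
  isPrimitive := (isPrimitive_matrix_iff.2 fun j k =>
    IsPrimitive.of_absolutelyContinuous (hL.absCont j k)).const_smul s

lemma neg_coef_eq {s : ℂ} (hs : s ^ 2 = 1) (ρ : ℂ) (t : ℝ) :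
    -L.coef ρ t = (s * I * ρ) ^ 2 • (1 : CMat m) - (2 * (s * I * ρ)) • (s • L.Q1 t)
      - L.Q0 t := by
  have h1 : (s * I * ρ) ^ 2 = -ρ ^ 2 := by
    rw [mul_pow, mul_pow, hs, Complex.I_sq]; ring
  have h2 : 2 * (s * I * ρ) * s = 2 * I * ρ := by
    linear_combination (2 * I * ρ) * hs
  rw [coef, h1, smul_smul, h2]
  module

lemma ClassV.intervalIntegrable_coef (hL : L.ClassV) (ρ : ℂ) {x : ℝ} (hx : 0 ≤ x) :
    IntervalIntegrable (L.coef ρ) volume 0 x := by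
  have h0 : IntervalIntegrable (fun _ : ℝ => ρ ^ 2 • (1 : CMat m)) volume 0 x :=
    intervalIntegrable_const
  have h1 : IntervalIntegrable (fun t : ℝ => (2 * I * ρ) • L.Q1 t) volume 0 x :=
    intervalIntegrable_of_Ioi (hL.potential (2 * I * ρ)).integrable_Q hx
  have h2 : IntervalIntegrable L.Q0 volume 0 x :=
    intervalIntegrable_of_Ioi (hL.potential 1).integrable_Q₀ hx
  exact (h0.add h1).add h2

lemma ClassV.continuousOn_Q1_mul (hL : L.ClassV) (s : ℂ) {p : ℝ → CMat m}
    (hp : ContinuousOn p (Ici 0)) : ContinuousOn (fun t => (s • L.Q1 t) * p t) (Ici 0) := by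
  have h1 : ContinuousOn (fun t => s • L.Q1 t) (Ici 0) := (hL.potential s).isPrimitive.continuousOn
  exact h1.mul hp

lemma ClassV.isSol_iff (hL : L.ClassV) {s : ℂ} (hs : s ^ 2 = 1) {ρ : ℂ} {Y Y' : ℝ → CMat m} :
    L.IsSol ρ Y Y' ↔ IsSolution (fun t => s • L.Q1 t) L.Q0 (s * I * ρ) Y Y' := by
  have hci : ∀ x, 0 ≤ x → IntervalIntegrable (L.coef ρ) volume 0 x := fun x hx =>
    hL.intervalIntegrable_coef ρ hx
  constructor
  · intro h
    have hY : ∀ x, 0 ≤ x → HasDerivWithinAt Y (Y' x) (Ici 0) x := fun x hx =>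
      hasDerivWithinAt_matrix_iff.2 (h.deriv_eq x hx)
    have hYc : ContinuousOn Y (Ici 0) := fun x hx => (hY x hx).continuousWithinAt
    have hi : ∀ x, 0 ≤ x → IntervalIntegrable (fun t => L.coef ρ t * Y t) volume 0 x :=
      fun x hx => (hci x hx).mul_continuousOn
        (hYc.mono (uIcc_subset_Ici hx))
    have h2 : IsPrimitive Y' fun t => -(L.coef ρ t * Y t) := by
      refine ⟨fun x hx => (hi x hx).neg, fun x hx => ?_⟩
      ext j k
      rw [h.eqn x hx j k, Matrix.add_apply, intervalIntegral.integral_neg, sub_eq_add_neg,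
        Matrix.neg_apply]
      congr 2
      exact (entryCLM m j k).intervalIntegral_comp_comm (hi x hx)
    exact ⟨IsPrimitive.of_hasDerivAt hY h2.continuousOn,
      h2.congr fun t _ => by rw [← neg_mul, neg_coef_eq hs]⟩
  · intro h
    have h2 : IsPrimitive Y' fun t => -(L.coef ρ t * Y t) :=
      h.eqn.congr fun t _ => by rw [← neg_mul, neg_coef_eq hs]
    refine ⟨fun x hx => hasDerivWithinAt_matrix_iff.1 (h.deriv.hasDerivWithinAt h2.continuousOn hx),
      fun x hx j k => ?_⟩
    have := (isPrimitive_matrix_iff.1 h2 j k).eq_add x hx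
    rw [this, sub_eq_add_neg, ← intervalIntegral.integral_neg]
    rfl

lemma ClassV.isSol_one (hL : L.ClassV) {ρ : ℂ} {Y Y' : ℝ → CMat m} :
    L.IsSol ρ Y Y' ↔ IsSolution (fun t => (1 : ℂ) • L.Q1 t) L.Q0 (1 * I * ρ) Y Y' :=
  hL.isSol_iff (one_pow 2)

/-- Two solutions with the same initial values agree. -/
lemma ClassV.isSol_unique (hL : L.ClassV) {ρ : ℂ} {Y Y' Z Z' : ℝ → CMat m} (hY : L.IsSol ρ Y Y')
    (hZ : L.IsSol ρ Z Z') (h0 : Y 0 = Z 0) (h1 : Y' 0 = Z' 0) {x : ℝ} (hx : 0 ≤ x) :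
    Y x = Z x ∧ Y' x = Z' x :=
  (hL.isSol_one.1 hY).unique (hL.potential 1) (hL.isSol_one.1 hZ) h0 h1
    hx

/-- The pencil with transposed coefficients, whose solutions are the transposed solutions of the
equation `ℓ*_ρ(Z) = 0`. -/
def transpose (L : QuadPencil m) : QuadPencil m where
  Q0 x := (L.Q0 x).transpose
  Q1 x := (L.Q1 x).transpose
  h0 := L.h0.transpose
  h1 := L.h1.transpose

lemma ClassV.transpose (hL : L.ClassV) : L.transpose.ClassV where
  absCont j k := hL.absCont k j
  integrable_Q0 j k := hL.integrable_Q0 k j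
  integrable_Q1 j k := hL.integrable_Q1 k j
  integrable_deriv_Q1 j k := hL.integrable_deriv_Q1 k j

lemma Regular.transpose (hL : L.Regular) : L.transpose.Regular := by
  have h1 : (1 + L.transpose.h1) = (1 + L.h1).transpose := by simp [QuadPencil.transpose]
  have h2 : (1 - L.transpose.h1) = (1 - L.h1).transpose := by simp [QuadPencil.transpose]
  rw [Regular, h1, h2, Matrix.det_transpose, Matrix.det_transpose]
  exact hL

lemma transpose_coef (ρ : ℂ) (x : ℝ) : L.transpose.coef ρ x = (L.coef ρ x).transpose := by
  simp [coef, transpose, transpose_add, transpose_smul]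

lemma transpose_bc (ρ : ℂ) : L.transpose.bc ρ = (L.bc ρ).transpose := by
  simp [bc, transpose, transpose_add, transpose_smul]

lemma isSolStar_iff {ρ : ℂ} {Z Z' : ℝ → CMat m} :
    L.IsSolStar ρ Z Z' ↔
      L.transpose.IsSol ρ (fun t => (Z t).transpose) (fun t => (Z' t).transpose) := by
  have e : ∀ t j k, (L.transpose.coef ρ t * (Z t).transpose) j k = (Z t * L.coef ρ t) k j := by
    intro t j k
    rw [transpose_coef, ← transpose_mul, Matrix.transpose_apply]
  constructor
  · intro h
    exact ⟨fun x hx j k => h.deriv_eq x hx k j, fun x hx j k => by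
      simp only [e]; exact h.eqn x hx k j⟩
  · intro h
    refine ⟨fun x hx j k => h.deriv_eq x hx k j, fun x hx j k => ?_⟩
    have := h.eqn x hx k j
    simp only [e] at this
    exact this

/-- The solution with `S(0) = 0`, `S'(0) = I`, as the pair `(S, S')`. -/
noncomputable def sine (L : QuadPencil m) (ρ : ℂ) : (ℝ → CMat m) × (ℝ → CMat m) :=
  Classical.epsilon fun p => L.IsSol ρ p.1 p.2 ∧ p.1 0 = 0 ∧ p.2 0 = 1

lemma ClassV.exists_isSol (hL : L.ClassV) {a b : ℂ → CMat m} (ha : Differentiable ℂ a)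
    (hb : Differentiable ℂ b) :
    ∃ y y' : ℂ → ℝ → CMat m, (∀ x, 0 ≤ x → Differentiable ℂ fun z => y z x) ∧
      (∀ x, 0 ≤ x → Differentiable ℂ fun z => y' z x) ∧
      ∀ z, L.IsSol z (y z) (y' z) ∧ y z 0 = a z ∧ y' z 0 = b z := by
  have hI : ∀ z : ℂ, -I * (1 * I * z) = z := fun z => by
    linear_combination (-z) * Complex.I_mul_I
  obtain ⟨y, y', h1, h2, h3⟩ := (hL.potential 1).exists_solution
    (a := fun w => a (-I * w)) (b := fun w => b (-I * w))
    (ha.comp (by fun_prop)) (hb.comp (by fun_prop))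
  refine ⟨fun z => y (1 * I * z), fun z => y' (1 * I * z),
    fun x hx => (h1 x hx).comp (by fun_prop), fun x hx => (h2 x hx).comp (by fun_prop), fun z => ?_⟩
  obtain ⟨s1, s2, s3⟩ := h3 (1 * I * z)
  rw [hI] at s2 s3
  exact ⟨hL.isSol_one.2 s1, s2, s3⟩

lemma ClassV.sine_spec (hL : L.ClassV) (ρ : ℂ) :
    L.IsSol ρ (L.sine ρ).1 (L.sine ρ).2 ∧ (L.sine ρ).1 0 = 0 ∧ (L.sine ρ).2 0 = 1 := by
  obtain ⟨y, y', -, -, h⟩ := hL.exists_isSol (differentiable_const 0) (differentiable_const 1)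
  exact epsilon_spec (p := fun p : (ℝ → CMat m) × (ℝ → CMat m) =>
    L.IsSol ρ p.1 p.2 ∧ p.1 0 = 0 ∧ p.2 0 = 1) ⟨(y ρ, y' ρ), h ρ⟩

lemma ClassV.phi_spec (hL : L.ClassV) (ρ : ℂ) :
    L.IsSol ρ (L.phi ρ).1 (L.phi ρ).2 ∧ (L.phi ρ).1 0 = 1 ∧ (L.phi ρ).2 0 = -L.bc ρ := by
  obtain ⟨y, y', -, -, h⟩ := hL.exists_isSol (differentiable_const 1)
    (differentiable_const (-L.bc ρ))
  have := epsilon_spec (p := fun p : (ℝ → CMat m) × (ℝ → CMat m) =>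
    L.IsSol ρ p.1 p.2 ∧ p.1 0 = 1 ∧ L.U ρ p.1 p.2 = 0) ⟨(y ρ, y' ρ), (h ρ).1, (h ρ).2.1, by
      change y' ρ 0 + L.bc ρ * y ρ 0 = 0
      rw [(h ρ).2.1, (h ρ).2.2, mul_one, neg_add_cancel]⟩
  refine ⟨this.1, this.2.1, ?_⟩
  have h3 : L.U ρ (L.phi ρ).1 (L.phi ρ).2 = 0 := this.2.2
  have h2 : (L.phi ρ).1 0 = 1 := this.2.1
  rw [U, h2, mul_one] at h3
  exact eq_neg_of_add_eq_zero_left h3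

lemma ClassV.phiStar_spec (hL : L.ClassV) (ρ : ℂ) :
    L.IsSolStar ρ (L.phiStar ρ).1 (L.phiStar ρ).2 ∧ (L.phiStar ρ).1 0 = 1 ∧
      (L.phiStar ρ).2 0 = -L.bc ρ := by
  obtain ⟨s1, s2, s3⟩ := hL.transpose.phi_spec ρ
  have := epsilon_spec (p := fun p : (ℝ → CMat m) × (ℝ → CMat m) =>
    L.IsSolStar ρ p.1 p.2 ∧ p.1 0 = 1 ∧ L.UStar ρ p.1 p.2 = 0)
    ⟨(fun t => ((L.transpose.phi ρ).1 t).transpose, fun t => ((L.transpose.phi ρ).2 t).transpose),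
      isSolStar_iff.2 (by simpa using s1), by simp [s2], by
        simp [UStar, s2, s3, transpose_bc]⟩
  refine ⟨this.1, this.2.1, ?_⟩
  have h3 : L.UStar ρ (L.phiStar ρ).1 (L.phiStar ρ).2 = 0 := this.2.2
  have h2 : (L.phiStar ρ).1 0 = 1 := this.2.1
  rw [UStar, h2, one_mul] at h3
  exact eq_neg_of_add_eq_zero_left h3

lemma ClassV.phiStar_eq (hL : L.ClassV) (ρ : ℂ) {x : ℝ} (hx : 0 ≤ x) :
    (L.phiStar ρ).1 x = ((L.transpose.phi ρ).1 x).transpose ∧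
      (L.phiStar ρ).2 x = ((L.transpose.phi ρ).2 x).transpose := by
  obtain ⟨s1, s2, s3⟩ := hL.transpose.phi_spec ρ
  obtain ⟨t1, t2, t3⟩ := hL.phiStar_spec ρ
  have := hL.transpose.isSol_unique (isSolStar_iff.1 t1) s1 (by simp [t2, s2])
    (by simp [t3, s3, transpose_bc]) hx
  exact ⟨by rw [← this.1, transpose_transpose],
    by rw [← this.2, transpose_transpose]⟩

lemma differentiable_bc : Differentiable ℂ L.bc := by
  unfold bc
  exact ((differentiable_id.const_mul I).smul_const L.h1).add_const _

/-- Solutions depend analytically on `ρ` if their initial values do. -/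
lemma ClassV.differentiable_sol (hL : L.ClassV) {F : ℂ → (ℝ → CMat m) × (ℝ → CMat m)}
    {a b : ℂ → CMat m} (ha : Differentiable ℂ a) (hb : Differentiable ℂ b)
    (hF : ∀ ρ, L.IsSol ρ (F ρ).1 (F ρ).2 ∧ (F ρ).1 0 = a ρ ∧ (F ρ).2 0 = b ρ) {x : ℝ} (hx : 0 ≤ x) :
    Differentiable ℂ (fun ρ => (F ρ).1 x) ∧ Differentiable ℂ (fun ρ => (F ρ).2 x) := by
  obtain ⟨y, y', h1, h2, h⟩ := hL.exists_isSol ha hb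
  have e : ∀ ρ, (F ρ).1 x = y ρ x ∧ (F ρ).2 x = y' ρ x := fun ρ =>
    hL.isSol_unique (hF ρ).1 (h ρ).1 ((hF ρ).2.1.trans (h ρ).2.1.symm)
      ((hF ρ).2.2.trans (h ρ).2.2.symm) hx
  simp only [fun ρ => (e ρ).1, fun ρ => (e ρ).2]
  exact ⟨h1 x hx, h2 x hx⟩

lemma ClassV.differentiable_phi (hL : L.ClassV) {x : ℝ} (hx : 0 ≤ x) :
    Differentiable ℂ (fun ρ => (L.phi ρ).1 x) ∧ Differentiable ℂ (fun ρ => (L.phi ρ).2 x) :=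
  hL.differentiable_sol (differentiable_const 1) L.differentiable_bc.neg hL.phi_spec hx

lemma ClassV.differentiable_sine (hL : L.ClassV) {x : ℝ} (hx : 0 ≤ x) :
    Differentiable ℂ (fun ρ => (L.sine ρ).1 x) ∧ Differentiable ℂ (fun ρ => (L.sine ρ).2 x) :=
  hL.differentiable_sol (differentiable_const 0) (differentiable_const 1) hL.sine_spec hx

lemma ClassV.P_spec (hL : L.ClassV) (s : ℝ) :
    IsPrimitive (L.P s) (fun t => ((s : ℂ) • L.Q1 t) * L.P s t) ∧ L.P s 0 = 1 := by
  obtain ⟨p, hp, hp0⟩ := exists_first_order (hL.potential s).integrable_Q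
  have hpc : ContinuousOn (fun t => ((s : ℂ) • L.Q1 t) * p t) (Ici 0) :=
    hL.continuousOn_Q1_mul _ hp.continuousOn
  have e : ∀ (P : ℝ → CMat m) x j k, (((s : ℂ) • L.Q1 x) * P x) j k = s * (L.Q1 x * P x) j k :=
    fun P x j k => by simp
  have := epsilon_spec (p := fun P : ℝ → CMat m => P 0 = 1 ∧ ∀ x, 0 ≤ x → ∀ j k,
    HasDerivWithinAt (fun t => P t j k) (s * (L.Q1 x * P x) j k) (Ici 0) x) ⟨p, hp0,
      fun x hx j k => by
        rw [← e]; exact hasDerivWithinAt_matrix_iff.1 (hp.hasDerivWithinAt hpc hx) j k⟩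
  have h2 : ∀ x, 0 ≤ x → HasDerivWithinAt (L.P s) (((s : ℂ) • L.Q1 x) * L.P s x) (Ici 0) x :=
    fun x hx => hasDerivWithinAt_matrix_iff.2 fun j k => by
      rw [e]; exact this.2 x hx j k
  exact ⟨IsPrimitive.of_hasDerivAt h2 (hL.continuousOn_Q1_mul _ fun x hx =>
    (h2 x hx).continuousWithinAt), this.1⟩

lemma ClassV.PStar_eq (hL : L.ClassV) (s : ℝ) {x : ℝ} (hx : 0 ≤ x) :
    L.PStar s x = (L.transpose.P s x).transpose := by
  obtain ⟨p, p0⟩ := hL.transpose.P_spec s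
  have e : ∀ (P : ℝ → CMat m) x j k, (((s : ℂ) • L.transpose.Q1 x) * (P x).transpose) k j =
      s * (P x * L.Q1 x) j k := fun P x j k => by
    rw [smul_mul_assoc, Matrix.smul_apply, QuadPencil.transpose, ← transpose_mul,
      Matrix.transpose_apply, smul_eq_mul]
  have hpd : ∀ x, 0 ≤ x → HasDerivWithinAt (L.transpose.P s)
      (((s : ℂ) • L.transpose.Q1 x) * L.transpose.P s x) (Ici 0) x := fun x hx =>
    p.hasDerivWithinAt (hL.transpose.continuousOn_Q1_mul _ p.continuousOn) hx
  have := epsilon_spec (p := fun P : ℝ → CMat m => P 0 = 1 ∧ ∀ x, 0 ≤ x → ∀ j k,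
    HasDerivWithinAt (fun t => P t j k) (s * (P x * L.Q1 x) j k) (Ici 0) x)
    ⟨fun t => (L.transpose.P s t).transpose, by simp [p0], fun x hx j k => by
      rw [← e (fun t => (L.transpose.P s t).transpose)]
      simpa using hasDerivWithinAt_matrix_iff.1 (hpd x hx) k j⟩
  have h2 : ∀ x, 0 ≤ x → HasDerivWithinAt (fun t => (L.PStar s t).transpose)
      (((s : ℂ) • L.transpose.Q1 x) * (L.PStar s x).transpose) (Ici 0) x :=
    fun x hx => hasDerivWithinAt_matrix_iff.2 fun j k => by
      rw [e]; exact this.2 x hx k j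
  have h3 : IsPrimitive (fun t => (L.PStar s t).transpose) fun t =>
      ((s : ℂ) • L.transpose.Q1 t) * (L.PStar s t).transpose :=
    IsPrimitive.of_hasDerivAt h2 (hL.transpose.continuousOn_Q1_mul _ fun x hx =>
      (h2 x hx).continuousWithinAt)
  have h0 : L.PStar s 0 = 1 := this.1
  have := first_order_unique (hL.transpose.potential s).integrable_Q h3 p (by simp [h0, p0]) hx
  rw [← this, transpose_transpose]

/-! ### Wronskians -/

/-- `⟨Z, Y⟩ = Z' Y - Z Y'` is constant. -/
lemma wronskian_eq (hL : L.ClassV) {ρ : ℂ} {Z Z' Y Y' : ℝ → CMat m} (hZ : L.IsSolStar ρ Z Z')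
    (hY : L.IsSol ρ Y Y') {x : ℝ} (hx : 0 ≤ x) :
    Z' x * Y x - Z x * Y' x = Z' 0 * Y 0 - Z 0 * Y' 0 := by
  have hy := hL.isSol_one.1 hY
  have hz := hL.transpose.isSol_one.1 (isSolStar_iff.1 hZ)
  have tr : ∀ {F F' : ℝ → CMat m}, IsPrimitive (fun t => (F t).transpose) F' →
      IsPrimitive F fun t => (F' t).transpose := fun {F F'} h =>
    isPrimitive_matrix_iff.2 fun j k => isPrimitive_matrix_iff.1 h k j
  have hz1 := tr hz.deriv
  have hz2 := tr hz.eqn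
  have h := (hz2.mul hy.deriv).sub (hz1.mul hy.eqn)
  have h0 := h.congr (g' := fun _ => 0) fun t _ => by
    rw [← neg_coef_eq (one_pow 2), ← neg_coef_eq (one_pow 2), transpose_coef]
    simp only [transpose_mul, Matrix.transpose_neg, transpose_transpose,
      mul_neg, neg_mul, mul_assoc]
    abel
  simpa using h0.eq_add x hx

end QuadPencil

/-! ### Weyl solutions of a pencil -/

/-- `s` is one of the two signs `±1`. -/
abbrev IsSign (s : ℝ) : Prop := s = 1 ∨ s = -1

section

variable {A : Type*} [NormedRing A] [NormedAlgebra ℂ A] [CompleteSpace A] {Q Q' Q₀ : ℝ → A}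

/-- The derivative of an exponentially decaying solution has a limit. -/
lemma IsSolution.exists_tendsto_deriv (hp : Potential Q Q' Q₀) {lam : ℂ} {Y Y' : ℝ → A}
    (hs : IsSolution Q Q₀ lam Y Y') {μ : ℝ} (hμ : μ < 0)
    (hY : Y =O[atTop] fun x : ℝ => Real.exp (μ * x)) : ∃ q, Tendsto Y' atTop (𝓝 q) := by
  obtain ⟨C, hC0, hC⟩ := hY.exists_nonneg
  obtain ⟨X, hX⟩ := eventually_atTop.1 (hC.bound.and (eventually_ge_atTop 0))
  refine ⟨_, hs.eqn.tendsto_atTop ?_⟩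
  rw [← Ioc_union_Ioi_eq_Ioi (hX X le_rfl).2]
  refine (hs.eqn.intervalIntegrable X (hX X le_rfl).2).1.union ?_
  have hsub := Ioi_subset_Ioi (hX X le_rfl).2
  refine Integrable.mono' (g := fun t => ‖lam‖ ^ 2 * ‖(1 : A)‖ * (C * Real.exp (μ * t)) +
    (2 * ‖lam‖ * ‖Q t‖ + ‖Q₀ t‖) * C) (Integrable.add
      (((integrableOn_exp_mul_Ioi hμ X).const_mul _).const_mul _) (IntegrableOn.mono_set
        (((hp.integrable_Q.norm.const_mul _).add hp.integrable_Q₀.norm).mul_const C) hsub))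
    (hs.eqn.aestronglyMeasurable.mono_measure (Measure.restrict_mono hsub le_rfl))
    (ae_restrict_Ioi fun t ht => ?_)
  obtain ⟨h1, h0⟩ := hX t ht.le
  rw [norm_of_nonneg (exp_pos _).le] at h1
  have h2 : Real.exp (μ * t) ≤ 1 := Real.exp_le_one_iff.2 (by nlinarith)
  refine (norm_mul_le _ _).trans ((mul_le_mul_of_nonneg_right (norm_eqCoef_le le_rfl t)
    (norm_nonneg _)).trans ?_)
  rw [add_assoc, add_mul]
  gcongr
  exact h1.trans (mul_le_of_le_one_right hC0 h2)

end

namespace QuadPencil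

/-- The closed half-plane `± Im ρ ≥ 0`. -/
def closedHalfPlane (s : ℝ) : Set ℂ := {ρ | 0 ≤ s * ρ.im}

lemma halfPlane_subset_closed (s : ℝ) : halfPlane s ⊆ closedHalfPlane s :=
  fun ρ (h : 0 < s * ρ.im) => h.le

lemma im_ne_zero_of_mem {s : ℝ} {ρ : ℂ} (hρ : ρ ∈ halfPlane s) : ρ.im ≠ 0 :=
  right_ne_zero_of_mul hρ.ne'

lemma isClosed_closedHalfPlane (s : ℝ) : IsClosed (closedHalfPlane s) :=
  isClosed_le continuous_const (continuous_const.mul continuous_im)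

lemma isOpen_halfPlane (s : ℝ) : IsOpen (halfPlane s) :=
  isOpen_lt continuous_const (continuous_const.mul continuous_im)

lemma sign_sq {s : ℝ} (hs : IsSign s) : (s : ℂ) ^ 2 = 1 := by
  rcases hs with rfl | rfl <;> norm_num

lemma sign_mul_self {s : ℝ} (hs : IsSign s) : s * s = 1 := by
  rcases hs with rfl | rfl <;> norm_num

lemma norm_lam {s : ℝ} (hs : IsSign s) (ρ : ℂ) : ‖(s : ℂ) * I * ρ‖ = ‖ρ‖ := by
  rcases hs with rfl | rfl <;> simp

lemma re_lam (s : ℝ) (ρ : ℂ) : ((s : ℂ) * I * ρ).re = -(s * ρ.im) := by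
  simp

lemma sign_mul_lam {s : ℝ} (hs : IsSign s) (ρ : ℂ) :
    I * ρ = (s : ℂ) * ((s : ℂ) * I * ρ) := by
  rcases hs with rfl | rfl <;> simp

lemma ClassV.P_neg (hL : L.ClassV) (s : ℝ) :
    IsPrimitive (L.P (-s)) (fun t => -(((s : ℂ) • L.Q1 t) * L.P (-s) t)) :=
  (hL.P_spec (-s)).1.congr fun t _ => by
    rw [Complex.ofReal_neg, neg_smul, neg_mul]

lemma ClassV.PStar_spec (hL : L.ClassV) (s : ℝ) :
    IsPrimitive (L.PStar s) (fun t => L.PStar s t * ((s : ℂ) • L.Q1 t)) ∧ L.PStar s 0 = 1 := by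
  obtain ⟨p, p0⟩ := hL.transpose.P_spec s
  constructor
  · have h : IsPrimitive (fun t => (L.transpose.P s t).transpose)
        (fun t => (((s : ℂ) • L.transpose.Q1 t) * L.transpose.P s t).transpose) :=
      isPrimitive_matrix_iff.2 fun j k => isPrimitive_matrix_iff.1 p k j
    refine (h.congr fun t ht => ?_).congr_left fun t ht => (hL.PStar_eq s ht).symm
    rw [hL.PStar_eq s ht, transpose_mul, transpose_smul]
    rfl
  · rw [hL.PStar_eq s le_rfl, p0, transpose_one]

lemma ClassV.PStar_mul_P (hL : L.ClassV) (s : ℝ) {x : ℝ} (hx : 0 ≤ x) :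
    L.PStar s x * L.P (-s) x = 1 := by
  have h := ((hL.PStar_spec s).1.mul (hL.P_neg s)).congr (g' := fun _ => 0) fun t _ => by
    rw [mul_neg, mul_assoc, add_neg_cancel]
  have := h.eq_add x hx
  rw [(hL.PStar_spec s).2, (hL.P_spec (-s)).2] at this
  simpa using this

lemma ClassV.exists_tendsto_P (hL : L.ClassV) (s : ℝ) :
    ∃ p : CMat m, Tendsto (L.P s) atTop (𝓝 p) ∧ p.det ≠ 0 := by
  have hQ := (hL.potential s).integrable_Q
  have h1 := (hL.P_spec s).1.tendsto_atTop ((hL.P_spec s).1.integrable_of_linear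
    (fun _ _ => norm_nonneg _) hQ.norm fun t _ => norm_mul_le _ _)
  have hQ' := (hL.potential ((-s : ℝ) : ℂ)).integrable_Q
  have h2 := (hL.PStar_spec (-s)).1.tendsto_atTop ((hL.PStar_spec (-s)).1.integrable_of_linear
    (fun _ _ => norm_nonneg _) hQ'.norm fun t _ => (norm_mul_le _ _).trans_eq (mul_comm _ _))
  have h3 := (h2.mul h1).congr' (f₂ := fun _ => (1 : CMat m)) (by
    filter_upwards [eventually_ge_atTop 0] with x hx
    have := hL.PStar_mul_P (-s) hx
    rwa [neg_neg] at this)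
  have h4 := tendsto_nhds_unique h3 tendsto_const_nhds
  refine ⟨_, h1, fun h0 => ?_⟩
  have h5 := congrArg Matrix.det h4
  rw [det_mul, h0, mul_zero, Matrix.det_one] at h5
  exact zero_ne_one h5

/-- The value of the Weyl solution `Φ = S + φ M` at `x`. -/
noncomputable def weylComb (L : QuadPencil m) (M : ℂ → CMat m) (x : ℝ) (ρ : ℂ) : CMat m :=
  (L.sine ρ).1 x + (L.phi ρ).1 x * M ρ

/-- The derivative of the Weyl solution `Φ = S + φ M` at `x`. -/
noncomputable def weylComb' (L : QuadPencil m) (M : ℂ → CMat m) (x : ℝ) (ρ : ℂ) : CMat m :=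
  (L.sine ρ).2 x + (L.phi ρ).2 x * M ρ

lemma neBot_nhdsWithin_halfPlane {s : ℝ} (hs : IsSign s) {ρ : ℂ} (hρ : ρ ∈ closedHalfPlane s) :
    (𝓝[halfPlane s] ρ).NeBot := by
  rw [← mem_closure_iff_nhdsWithin_neBot, Metric.mem_closure_iff]
  intro ε hε
  refine ⟨ρ + (s * (ε / 2) : ℝ) * I, ?_, ?_⟩
  · change 0 < s * _
    rw [add_im, im_ofReal_mul, I_im, mul_one, mul_add, ← mul_assoc, sign_mul_self hs]
    have : 0 ≤ s * ρ.im := hρ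
    linarith
  · rw [dist_eq_norm, sub_add_cancel_left, norm_neg, norm_mul, norm_I, mul_one, norm_real, norm_mul,
      norm_of_nonneg (half_pos hε).le]
    rcases hs with rfl | rfl <;> simp [hε]

/-- The filter `|ρ| → ∞` in the closed half-plane `± Im ρ ≥ 0`. -/
noncomputable def farFilter (s : ℝ) : Filter ℂ := Bornology.cobounded ℂ ⊓ 𝓟 (closedHalfPlane s)

/-- `M` is the Weyl matrix on the closed half-plane `± Im ρ ≥ 0`, outside a closed exceptional set
`K` which consists of `0` and of points of `Λ_±`. -/
structure IsWeylFunction (L : QuadPencil m) (s : ℝ) (M : ℂ → CMat m) (K : Set ℂ) : Prop where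
  isClosed : IsClosed K
  subset : K ⊆ insert 0 (L.singSet s)
  continuousOn : ContinuousOn M (closedHalfPlane s \ K)
  differentiableOn : DifferentiableOn ℂ M (halfPlane s \ K)
  weyl_eq : ∀ ρ ∈ halfPlane s \ K, L.weyl ρ = M ρ
  weylSide_eq : ∀ ρ : ℝ, (ρ : ℂ) ∉ K → L.weylSide s ρ = M ρ
  decay : ∀ ρ ∈ halfPlane s \ K, Tendsto (fun x => L.weylComb M x ρ) atTop (𝓝 0) ∧
    Tendsto (fun x => L.weylComb' M x ρ) atTop (𝓝 0)
  eventually_notMem : ∀ᶠ ρ in farFilter s, ρ ∉ K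
  asymp : ∀ x : ℝ, 0 ≤ x →
    Tendsto (fun ρ => exp (-((s : ℂ) * I * ρ) * x) •
      (((s : ℂ) * I * ρ) • L.weylComb M x ρ)) (farFilter s)
      (𝓝 (L.P (-s) x * (1 + (s : ℂ) • L.h1)⁻¹)) ∧
    Tendsto (fun ρ => exp (-((s : ℂ) * I * ρ) * x) • L.weylComb' M x ρ)
      (farFilter s) (𝓝 (L.P (-s) x * (1 + (s : ℂ) • L.h1)⁻¹))

lemma Regular.det_ne_zero (hL : L.Regular) {s : ℝ} (hs : IsSign s) :
    (1 + (s : ℂ) • L.h1).det ≠ 0 := by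
  rcases hs with rfl | rfl
  · simpa using hL.1
  · simpa [← sub_eq_add_neg] using hL.2

lemma tendsto_norm_farFilter (s : ℝ) : Tendsto (fun ρ : ℂ => ‖ρ‖) (farFilter s) atTop :=
  tendsto_norm_cobounded_atTop.mono_left inf_le_left

lemma eventually_farFilter (s : ℝ) : ∀ᶠ ρ in farFilter s, ρ ∈ closedHalfPlane s ∧ 1 ≤ ‖ρ‖ :=
  Filter.Eventually.and (mem_inf_of_right (mem_principal_self _))
    ((tendsto_norm_farFilter s).eventually_ge_atTop 1)

lemma tendsto_bc (L : QuadPencil m) {s : ℝ} (hs : IsSign s) :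
    Tendsto (fun ρ => ((s : ℂ) * I * ρ)⁻¹ • L.bc ρ) (farFilter s) (𝓝 ((s : ℂ) • L.h1)) := by
  have hlinv : Tendsto (fun ρ => ((s : ℂ) * I * ρ)⁻¹) (farFilter s) (𝓝 0) := by
    rw [tendsto_zero_iff_norm_tendsto_zero]
    simp only [norm_inv, norm_lam hs]
    exact (tendsto_norm_farFilter s).inv_tendsto_atTop
  have h := (hlinv.smul_const L.h0).const_add ((s : ℂ) • L.h1)
  rw [zero_smul, add_zero] at h
  refine h.congr' ?_
  filter_upwards [eventually_farFilter s] with ρ hρ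
  have : (s : ℂ) * I * ρ ≠ 0 := norm_pos_iff.1 (by rw [norm_lam hs]; linarith)
  rw [bc, smul_add, smul_smul, sign_mul_lam hs, mul_left_comm, inv_mul_cancel₀ this, mul_one]

lemma tendsto_matrix_inv {ι : Type*} {l : Filter ι} {V : ι → CMat m} {W : CMat m}
    (h : Tendsto V l (𝓝 W)) (hW : W.det ≠ 0) :
    (∀ᶠ i in l, (V i).det ≠ 0) ∧ Tendsto (fun i => (V i)⁻¹) l (𝓝 W⁻¹) := by
  constructor
  · have : Tendsto (fun i => (V i).det) l (𝓝 W.det) :=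
      (Continuous.matrix_det continuous_id).continuousAt.tendsto.comp h
    exact this.eventually_ne hW
  · have hu : IsUnit W := (Matrix.isUnit_iff_isUnit_det W).2 (isUnit_iff_ne_zero.2 hW)
    obtain ⟨u, rfl⟩ := hu
    simp only [Matrix.nonsing_inv_eq_ringInverse]
    exact (NormedRing.inverse_continuousAt u).tendsto.comp h

lemma ClassV.weylComb_isSol (hL : L.ClassV) (M : ℂ → CMat m) (ρ : ℂ) :
    L.IsSol ρ (fun x => L.weylComb M x ρ) (fun x => L.weylComb' M x ρ) := by
  refine hL.isSol_one.2 ?_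
  exact (hL.isSol_one.1 (hL.sine_spec ρ).1).add
    ((hL.isSol_one.1 (hL.phi_spec ρ).1).mul_const (M ρ))

lemma ClassV.weylComb_zero (hL : L.ClassV) (M : ℂ → CMat m) (ρ : ℂ) :
    L.weylComb M 0 ρ = M ρ ∧ L.weylComb' M 0 ρ = 1 - L.bc ρ * M ρ := by
  obtain ⟨-, h1, h2⟩ := hL.sine_spec ρ
  obtain ⟨-, h3, h4⟩ := hL.phi_spec ρ
  constructor
  · rw [weylComb, h1, h3, zero_add, one_mul]
  · rw [weylComb', h2, h4, neg_mul, sub_eq_add_neg]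

/-- The Jost solutions of a pencil in a closed half-plane. -/
lemma ClassV.exists_jost_family (hL : L.ClassV) {s : ℝ} (hs : IsSign s) :
    ∃ (E E' : ℂ → ℝ → CMat m) (p : CMat m), p.det ≠ 0 ∧
      (∀ x, 0 ≤ x → ContinuousOn (fun z => E z x) (closedHalfPlane s \ {0}) ∧
        ContinuousOn (fun z => E' z x) (closedHalfPlane s \ {0}) ∧
        DifferentiableOn ℂ (fun z => E z x) (halfPlane s) ∧
        DifferentiableOn ℂ (fun z => E' z x) (halfPlane s)) ∧
      (∀ ρ ∈ closedHalfPlane s, ρ ≠ 0 → L.IsSol ρ (E ρ) (E' ρ) ∧ L.IsJost s ρ (E ρ) (E' ρ) ∧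
        Tendsto (fun x : ℝ => exp (-((s : ℂ) * I * ρ) * x) • E ρ x) atTop (𝓝 p) ∧
        Tendsto (fun x : ℝ => exp (-((s : ℂ) * I * ρ) * x) • E' ρ x) atTop
          (𝓝 (((s : ℂ) * I * ρ) • p))) ∧
      ∀ x : ℝ, 0 ≤ x → Tendsto (fun ρ => exp (-((s : ℂ) * I * ρ) * x) • E ρ x)
          (farFilter s) (𝓝 (L.P (-s) x)) ∧
        Tendsto (fun ρ => exp (-((s : ℂ) * I * ρ) * x) •
          (((s : ℂ) * I * ρ)⁻¹ • E' ρ x)) (farFilter s) (𝓝 (L.P (-s) x)) := by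
  obtain ⟨p, hp, hpd⟩ := hL.exists_tendsto_P (-s)
  obtain ⟨E, E', hE, hsol, has⟩ := (hL.potential s).exists_jost (hL.P_neg s) hp
  have hs0 : s ≠ 0 := by rcases hs with rfl | rfl <;> norm_num
  set lam : ℂ → ℂ := fun ρ => (s : ℂ) * I * ρ with hlam
  have hlc : Continuous lam := by fun_prop
  have hld : Differentiable ℂ lam := by fun_prop
  have m1 : MapsTo lam (closedHalfPlane s \ {0}) {z | z.re ≤ 0 ∧ z ≠ 0} := fun ρ hρ => by
    refine ⟨?_, by simpa [hlam, hs0] using hρ.2⟩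
    rw [re_lam]; exact neg_nonpos.2 hρ.1
  have m2 : MapsTo lam (halfPlane s) {z | z.re < 0} := fun ρ hρ => by
    change (lam ρ).re < 0
    rw [re_lam]; exact neg_lt_zero.2 hρ
  refine ⟨fun ρ => E (lam ρ), fun ρ => E' (lam ρ), p, hpd, fun x hx => ?_, fun ρ hρ hρ0 => ?_,
    fun x hx => ?_⟩
  · obtain ⟨h1, h2, h3, h4⟩ := hE x hx
    exact ⟨h1.comp hlc.continuousOn m1, h2.comp hlc.continuousOn m1,
      h3.comp hld.differentiableOn m2, h4.comp hld.differentiableOn m2⟩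
  · obtain ⟨h1, h2, h3⟩ := hsol (lam ρ) (m1 ⟨hρ, hρ0⟩).1 (m1 ⟨hρ, hρ0⟩).2
    have hi := (hL.isSol_iff (sign_sq hs)).2 h1
    refine ⟨hi, ⟨hi, ?_, ?_⟩, h2, h3⟩
    · have := h2.sub hp
      rw [sub_self] at this
      simp only [neg_mul] at this
      exact this
    · have := h3.sub (hp.const_smul (lam ρ))
      rw [sub_self] at this
      simp only [neg_mul] at this
      exact this
  · obtain ⟨C, hC0, hC⟩ := has x hx
    have key : ∀ F : ℂ → CMat m, (∀ᶠ ρ in farFilter s, ‖F ρ - L.P (-s) x‖ ≤ C / ‖ρ‖) →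
        Tendsto F (farFilter s) (𝓝 (L.P (-s) x)) := fun F h =>
      tendsto_iff_norm_sub_tendsto_zero.2 (squeeze_zero' (Eventually.of_forall fun _ =>
        norm_nonneg _) h ((tendsto_norm_farFilter s).const_div_atTop C))
    have hev := (eventually_farFilter s).mono fun ρ hρ => hC (lam ρ)
      (by rw [re_lam]; exact neg_nonpos.2 hρ.1) (by rw [norm_lam hs]; exact hρ.2)
    simp only [hlam, norm_lam hs] at hev
    exact ⟨key _ (hev.mono fun _ h => h.1), key _ (hev.mono fun _ h => h.2)⟩

lemma isBigO_of_tendsto {z : ℂ} {F : ℝ → CMat m} {p : CMat m}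
    (h : Tendsto (fun x : ℝ => exp (-z * x) • F x) atTop (𝓝 p)) :
    F =O[atTop] fun x : ℝ => exp (z * x) := by
  have h1 := (Asymptotics.isBigO_refl (fun x : ℝ => exp (z * x)) atTop).smul (h.isBigO_one ℂ)
  simpa [smul_smul, ← exp_add] using h1

lemma tendsto_zero_of_isBigO {z : ℂ} (hz : z.re < 0) {F : ℝ → CMat m}
    (h : F =O[atTop] fun x : ℝ => exp (z * x)) : Tendsto F atTop (𝓝 0) := by
  refine h.trans_tendsto (tendsto_zero_iff_norm_tendsto_zero.2 ?_)
  simp only [norm_exp_eq]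
  exact Real.tendsto_exp_atBot.comp ((tendsto_const_mul_atBot_of_neg hz).2 tendsto_id)

/-- The Wronskian of two decaying solutions vanishes. -/
lemma wronskian_eq_zero (hL : L.ClassV) {ρ : ℂ} {Z Z' Y Y' : ℝ → CMat m} (hZ : L.IsSolStar ρ Z Z')
    (hY : L.IsSol ρ Y Y') (z : Tendsto Z atTop (𝓝 0)) (z' : Tendsto Z' atTop (𝓝 0))
    (y : Tendsto Y atTop (𝓝 0)) {q : CMat m} (y' : Tendsto Y' atTop (𝓝 q)) {x : ℝ} (hx : 0 ≤ x) :
    Z' x * Y x - Z x * Y' x = 0 := by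
  have h := (z'.mul y).sub (z.mul y')
  rw [mul_zero, zero_mul, sub_zero] at h
  refine tendsto_nhds_unique (tendsto_const_nhds.congr' ?_) h
  filter_upwards [eventually_ge_atTop 0] with t ht
  rw [wronskian_eq hL hZ hY hx, wronskian_eq hL hZ hY ht]

lemma tendsto_transpose {ι : Type*} {l : Filter ι} {F : ι → CMat m} {A : CMat m}
    (h : Tendsto F l (𝓝 A)) : Tendsto (fun i => (F i).transpose) l (𝓝 A.transpose) := by
  rw [tendsto_iff_norm_sub_tendsto_zero] at h ⊢
  simpa only [← Matrix.transpose_sub, frobenius_norm_transpose] using h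

lemma ClassV.isSolStar_sine (hL : L.ClassV) (ρ : ℂ) :
    L.IsSolStar ρ (fun x => ((L.transpose.sine ρ).1 x).transpose)
      (fun x => ((L.transpose.sine ρ).2 x).transpose) :=
  isSolStar_iff.2 (by simpa using (hL.transpose.sine_spec ρ).1)

/-- Solutions of order `O(e^{λx})` with `U(Y) = 0` vanish, unless `ρ` is an exceptional point. -/
lemma ClassV.eq_zero_of_decay (hL : L.ClassV) {s : ℝ} (hs : IsSign s) {ρ : ℂ}
    (hρ : ρ ∈ halfPlane s) {E E' : ℝ → CMat m} {p : CMat m} (hp : p.det ≠ 0) (hE : L.IsSol ρ E E')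
    (h1 : Tendsto (fun x : ℝ => exp (-((s : ℂ) * I * ρ) * x) • E x) atTop (𝓝 p))
    (h2 : Tendsto (fun x : ℝ => exp (-((s : ℂ) * I * ρ) * x) • E' x) atTop
      (𝓝 (((s : ℂ) * I * ρ) • p))) (hU : (L.U ρ E E').det ≠ 0) {Y Y' : ℝ → CMat m}
    (hY : L.IsSol ρ Y Y') (hYU : L.U ρ Y Y' = 0)
    (hYb : Y =O[atTop] fun x : ℝ => exp ((s : ℂ) * I * ρ * x)) : Y 0 = 0 := by
  have hμ : ((s : ℂ) * I * ρ).re < 0 := by rw [re_lam]; exact neg_lt_zero.2 hρ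
  have hρ0 : ρ ≠ 0 := fun h => by simp [halfPlane, h] at hρ
  -- a Jost solution of the adjoint equation
  obtain ⟨F, F', q, hq, -, hF, -⟩ := hL.transpose.exists_jost_family hs
  obtain ⟨f1, -, f2, f3⟩ := hF ρ (halfPlane_subset_closed s hρ) hρ0
  have hstar : L.IsSolStar ρ (fun x => (F ρ x).transpose) (fun x => (F' ρ x).transpose) :=
    isSolStar_iff.2 (by simpa using f1)
  obtain ⟨q', hq'⟩ := (hL.isSol_one.1 hY).exists_tendsto_deriv (hL.potential 1) hμ
    (by simpa only [norm_exp_eq] using hYb.norm_right)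
  have decay := fun {F : ℝ → CMat m} {p : CMat m} h =>
    tendsto_zero_of_isBigO hμ (isBigO_of_tendsto (F := F) (p := p) h)
  have tF := tendsto_transpose (decay f2)
  have tF' := tendsto_transpose (decay f3)
  rw [Matrix.transpose_zero] at tF tF'
  have wY := fun x hx => wronskian_eq_zero hL hstar hY tF tF' (tendsto_zero_of_isBigO hμ hYb) hq'
    (x := x) hx
  have wE := fun x hx => wronskian_eq_zero hL hstar hE tF tF' (decay h1) (decay h2) (x := x) hx
  -- a point where both Jost solutions are invertible
  obtain ⟨x, ⟨d1, d2⟩, hx⟩ := (((tendsto_matrix_inv f2 hq).1.and (tendsto_matrix_inv h1 hp).1).and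
    (eventually_ge_atTop (0 : ℝ))).exists
  have unit : ∀ {c : ℂ} {A : CMat m}, (c • A).det ≠ 0 → IsUnit A.det := fun h =>
    isUnit_iff_ne_zero.2 fun h0 => h (by rw [det_smul, h0, mul_zero])
  have uF : IsUnit (F ρ x).transpose.det := by rw [Matrix.det_transpose]; exact unit d1
  have uE := unit d2
  obtain ⟨K, hK⟩ : ∃ K, K = (E x)⁻¹ * Y x := ⟨_, rfl⟩
  have k1 : Y x = E x * K := by rw [hK, ← mul_assoc, mul_nonsing_inv _ uE, one_mul]
  have k2 : Y' x = E' x * K := by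
    have e1 := sub_eq_zero.1 (wY x hx)
    have e2 := sub_eq_zero.1 (wE x hx)
    have e3 : (F ρ x).transpose * Y' x = (F ρ x).transpose * (E' x * K) := by
      rw [← e1, k1, ← mul_assoc, e2, mul_assoc]
    have := congrArg (fun A => ((F ρ x).transpose)⁻¹ * A) e3
    simpa only [← mul_assoc, Matrix.nonsing_inv_mul _ uF, one_mul] using this
  have k3 : K = 0 := by
    obtain ⟨p1, p2, p3⟩ := hL.phiStar_spec ρ
    have a1 := wronskian_eq hL p1 hY hx
    have a2 := wronskian_eq hL p1 hE hx
    rw [p2, p3, one_mul] at a1 a2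
    have u1 : -L.bc ρ * Y 0 - Y' 0 = 0 := by
      rw [← neg_eq_zero, ← hYU, U, neg_mul]; abel
    have u2 : -L.bc ρ * E 0 - E' 0 = -L.U ρ E E' := by rw [U, neg_mul]; abel
    rw [u1, k1, k2, ← mul_assoc, ← mul_assoc, ← Matrix.sub_mul, a2, u2] at a1
    have a3 : L.U ρ E E' * K = 0 := by simpa using a1
    have := congrArg (fun A => (L.U ρ E E')⁻¹ * A) a3
    simpa only [← mul_assoc, Matrix.nonsing_inv_mul _ (isUnit_iff_ne_zero.2 hU), one_mul,
      Matrix.mul_zero] using this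
  rw [k3, Matrix.mul_zero] at k1 k2
  have a4 := wronskian_eq hL (hL.isSolStar_sine ρ) hY hx
  obtain ⟨-, q2, q3⟩ := hL.transpose.sine_spec ρ
  rw [k1, k2, q2, q3] at a4
  simpa using a4.symm

lemma norm_entry_le (A : CMat m) (j k : Fin m) : ‖A j k‖ ≤ ‖A‖ :=
  (PiLp.norm_apply_le (WithLp.toLp 2 (A j)) k).trans
    (PiLp.norm_apply_le (WithLp.toLp 2 fun i => WithLp.toLp 2 (A i)) j)

lemma norm_le_sum_entries (A : CMat m) : ‖A‖ ≤ ∑ j, ∑ k, ‖A j k‖ := by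
  conv_lhs => rw [Matrix.matrix_eq_sum_single A]
  refine (norm_sum_le _ _).trans (sum_le_sum fun j _ => (norm_sum_le _ _).trans
    (sum_le_sum fun k _ => ?_))
  have : single j k (A j k) = A j k • single j k (1 : ℂ) := by
    simp [smul_single]
  rw [this]
  refine (norm_smul_le _ _).trans (mul_le_of_le_one_right (norm_nonneg _) (le_of_eq ?_))
  rw [Matrix.frobenius_norm_def, ← Real.sqrt_eq_rpow]
  have : ∀ i l, ‖single j k (1 : ℂ) i l‖ ^ (2 : ℝ) = if i = j then (if l = k then 1 else 0)
      else (0 : ℝ) := fun i l => by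
    by_cases h1 : j = i <;> by_cases h2 : k = l <;>
      simp [h1, h2, eq_comm]
  simp [this]

/-- The Weyl matrix in a closed half-plane, `M = E(0) U(E)⁻¹` with the Jost solution `E`. -/
theorem ClassV.exists_isWeylFunction (hL : L.ClassV) (hreg : L.Regular) {s : ℝ}
    (hs : IsSign s) : ∃ M K, L.IsWeylFunction s M K := by
  obtain ⟨E, E', p, hp, hreg', hsol, hasy⟩ := hL.exists_jost_family hs
  set lam : ℂ → ℂ := fun ρ => (s : ℂ) * I * ρ with hlam
  set V : ℂ → CMat m := fun ρ => L.U ρ (E ρ) (E' ρ) with hV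
  have hs0 : s ≠ 0 := by rcases hs with rfl | rfl <;> norm_num
  have hl0 : ∀ ρ, ρ ≠ 0 → lam ρ ≠ 0 := fun ρ hρ => by simpa [hlam, hs0] using hρ
  have hVc : ContinuousOn V (closedHalfPlane s \ {0}) :=
    (hreg' 0 le_rfl).2.1.add ((L.differentiable_bc.continuous.continuousOn).mul (hreg' 0 le_rfl).1)
  have hVd : DifferentiableOn ℂ V (halfPlane s) :=
    (hreg' 0 le_rfl).2.2.2.add ((L.differentiable_bc.differentiableOn).mul (hreg' 0 le_rfl).2.2.1)
  have hdc : ContinuousOn (fun ρ => (V ρ).det) (closedHalfPlane s \ {0}) :=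
    (Continuous.matrix_det continuous_id).comp_continuousOn hVc
  set K : Set ℂ := insert 0 {ρ | ρ ∈ closedHalfPlane s ∧ ρ ≠ 0 ∧ (V ρ).det = 0} with hK
  set M : ℂ → CMat m := fun ρ => E ρ 0 * (V ρ)⁻¹ with hM
  have hK0 : ∀ ρ, ρ ∉ K → ρ ≠ 0 := fun ρ hρ h => hρ (.inl h)
  have hKd : ∀ ρ ∈ closedHalfPlane s, ρ ∉ K → (V ρ).det ≠ 0 := fun ρ h hρ h' =>
    hρ (.inr ⟨h, hK0 ρ hρ, h'⟩)
  have hsub : closedHalfPlane s \ K ⊆ closedHalfPlane s \ {0} := fun ρ hρ => ⟨hρ.1, hK0 ρ hρ.2⟩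
  have hclosed : IsClosed K := by
    obtain ⟨u, hu, hu'⟩ := continuousOn_iff'.1 hdc {0}ᶜ isOpen_compl_singleton
    have e : Kᶜ = {0}ᶜ ∩ ((closedHalfPlane s)ᶜ ∪ u) := by
      ext ρ
      have hρ := Set.ext_iff.1 hu' ρ
      simp only [mem_inter_iff, mem_preimage, mem_compl_iff, mem_singleton_iff, Set.mem_sdiff] at hρ
      simp only [hK, mem_compl_iff, mem_insert_iff, mem_ofPred_eq, mem_inter_iff, mem_singleton_iff,
        mem_union]
      tauto
    rw [← isOpen_compl_iff, e]
    exact isOpen_compl_singleton.inter ((isClosed_closedHalfPlane s).isOpen_compl.union hu)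
  have hinv : ContinuousOn (fun ρ => (V ρ)⁻¹) (closedHalfPlane s \ K) := fun ρ hρ =>
    (tendsto_matrix_inv ((hVc ρ (hsub hρ)).mono hsub) (hKd ρ hρ.1 hρ.2)).2
  have hMc : ContinuousOn M (closedHalfPlane s \ K) :=
    ((hreg' 0 le_rfl).1.mono hsub).mul hinv
  have hMd : DifferentiableOn ℂ M (halfPlane s \ K) := by
    have hinvd : DifferentiableOn ℂ (fun ρ => (V ρ)⁻¹) (halfPlane s \ K) := fun ρ hρ => by
      have hu : IsUnit (V ρ) := (Matrix.isUnit_iff_isUnit_det _).2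
        (isUnit_iff_ne_zero.2 (hKd ρ (halfPlane_subset_closed s hρ.1) hρ.2))
      obtain ⟨u, hu⟩ := hu
      simp only [Matrix.nonsing_inv_eq_ringInverse]
      have h1 : DifferentiableAt ℂ (Ring.inverse : CMat m → CMat m) (V ρ) := by
        rw [← hu]; exact (hasFDerivAt_ringInverse u).differentiableAt
      exact h1.comp_differentiableWithinAt ρ ((hVd ρ hρ.1).mono sdiff_subset)
    exact ((hreg' 0 le_rfl).2.2.1.mono sdiff_subset).mul hinvd
  -- the Weyl solution is `E U(E)⁻¹`
  have hcomb : ∀ ρ ∈ closedHalfPlane s, ρ ∉ K → ∀ x, 0 ≤ x → L.weylComb M x ρ = E ρ x * (V ρ)⁻¹ ∧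
      L.weylComb' M x ρ = E' ρ x * (V ρ)⁻¹ := by
    intro ρ hρ hρK x hx
    have h2 := hL.isSol_one.2 ((hL.isSol_one.1 (hsol ρ hρ (hK0 ρ hρK)).1).mul_const (V ρ)⁻¹)
    refine hL.isSol_unique (hL.weylComb_isSol M ρ) h2 (hL.weylComb_zero M ρ).1 ?_ hx
    have hE' : E' ρ 0 = V ρ - L.bc ρ * E ρ 0 := by simp [hV, U]
    rw [(hL.weylComb_zero M ρ).2, hE', Matrix.sub_mul,
      mul_nonsing_inv _ (isUnit_iff_ne_zero.2 (hKd ρ hρ hρK)), mul_assoc]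
  have hbig : ∀ ρ ∈ halfPlane s \ K,
      ((fun x => L.weylComb M x ρ) =O[atTop] fun x : ℝ => exp (lam ρ * x)) ∧
      (fun x => L.weylComb' M x ρ) =O[atTop] fun x : ℝ => exp (lam ρ * x) := by
    intro ρ hρ
    obtain ⟨-, -, t1, t2⟩ := hsol ρ (halfPlane_subset_closed s hρ.1) (hK0 ρ hρ.2)
    have hc := (eventually_ge_atTop (0 : ℝ)).mono
      (hcomb ρ (halfPlane_subset_closed s hρ.1) hρ.2)
    refine ⟨isBigO_of_tendsto ((t1.mul_const (V ρ)⁻¹).congr' (hc.mono fun x hx => ?_)),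
      isBigO_of_tendsto ((t2.mul_const (V ρ)⁻¹).congr' (hc.mono fun x hx => ?_))⟩
    · beta_reduce
      rw [hx.1, smul_mul_assoc]
    · beta_reduce
      rw [hx.2, smul_mul_assoc]
  have hweyl : ∀ ρ ∈ halfPlane s \ K, L.weyl ρ = M ρ := by
    intro ρ hρ
    have hρc := halfPlane_subset_closed s hρ.1
    have hW : L.IsWeylSol ρ (fun x => L.weylComb M x ρ) (fun x => L.weylComb' M x ρ) := by
      refine ⟨hL.weylComb_isSol M ρ, ?_, fun t ht htρ j k => ?_⟩
      · rw [U, (hL.weylComb_zero M ρ).1, (hL.weylComb_zero M ρ).2, sub_add_cancel]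
      · have hts : t = s := by
          have h1 : 0 < s * ρ.im := hρ.1
          have h2 : 0 < t * ρ.im := htρ
          rcases ht with rfl | rfl <;> rcases hs with rfl | rfl <;> first | rfl | linarith
        rw [hts]
        exact ((entryCLM m j k).isBigO_comp _ _).trans (hbig ρ hρ).1
    obtain ⟨w1, w2, w3⟩ : L.IsWeylSol ρ (L.weylSol ρ).1 (L.weylSol ρ).2 :=
      epsilon_spec (p := fun p : (ℝ → CMat m) × (ℝ → CMat m) =>
        L.IsWeylSol ρ p.1 p.2) ⟨(_, _), hW⟩
    -- the entrywise bounds give a bound for the norm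
    have hwb : (L.weylSol ρ).1 =O[atTop] fun x : ℝ => exp (lam ρ * x) := by
      have h := Asymptotics.IsBigO.fun_sum (s := Finset.univ) fun j _ =>
        Asymptotics.IsBigO.fun_sum (s := Finset.univ) fun k _ =>
          ((smulMatrixCLM (single j k (1 : ℂ))).isBigO_comp _ _).trans (w3 s hs hρ.1 j k)
      exact h.congr_left fun x => sum_smul_single _
    obtain ⟨s1, -, s2, s3⟩ := hsol ρ hρc (hK0 ρ hρ.2)
    have hd := hL.isSol_one.2 ((hL.isSol_one.1 w1).sub (hL.isSol_one.1 hW.1))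
    have hdU : L.U ρ (fun x => (L.weylSol ρ).1 x - L.weylComb M x ρ)
        (fun x => (L.weylSol ρ).2 x - L.weylComb' M x ρ) = 0 := by
      have h1 := w2
      have h2 := hW.2.1
      simp only [U] at h1 h2 ⊢
      rw [Matrix.mul_sub, sub_add_sub_comm, h1, h2, sub_self]
    have h0 := sub_eq_zero.1 (hL.eq_zero_of_decay hs hρ.1 hp s1 s2 s3 (hKd ρ hρc hρ.2) hd hdU
      (hwb.sub (hbig ρ hρ).1))
    rwa [(hL.weylComb_zero M ρ).1] at h0
  -- the leading term of `U(E)`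
  have hone : L.P (-s) 0 = 1 := (hL.P_spec (-s)).2
  have hfar := eventually_farFilter s
  have t0 := hasy 0 le_rfl
  simp only [ofReal_zero, mul_zero, exp_zero, one_smul, hone] at t0
  have tV : Tendsto (fun ρ => (lam ρ)⁻¹ • V ρ) (farFilter s) (𝓝 (1 + (s : ℂ) • L.h1)) := by
    have h1 := t0.2.add ((L.tendsto_bc hs).mul t0.1)
    rw [mul_one] at h1
    exact h1.congr fun ρ => by simp only [hV, U, smul_add, smul_mul_assoc, hlam]
  obtain ⟨hdet, tinv⟩ := tendsto_matrix_inv tV (hreg.det_ne_zero hs)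
  have hev : ∀ᶠ ρ in farFilter s, ρ ∈ closedHalfPlane s ∧ ρ ∉ K ∧
      lam ρ ≠ 0 ∧ ((lam ρ)⁻¹ • V ρ)⁻¹ = lam ρ • (V ρ)⁻¹ := by
    filter_upwards [hdet, hfar] with ρ hd hρ
    have hρ0 : ρ ≠ 0 := norm_pos_iff.1 (zero_lt_one.trans_le hρ.2)
    have hdV : (V ρ).det ≠ 0 := fun h => hd (by rw [det_smul, h, mul_zero])
    refine ⟨hρ.1, fun h => h.elim hρ0 fun h' => hdV h'.2.2, hl0 ρ hρ0, ?_⟩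
    refine Matrix.inv_eq_right_inv ?_
    rw [smul_mul_smul_comm, inv_mul_cancel₀ (hl0 ρ hρ0),
      mul_nonsing_inv _ (isUnit_iff_ne_zero.2 hdV), one_smul]
  refine ⟨M, K, hclosed, ?_, hMc, hMd, hweyl, ?_, ?_, hev.mono fun ρ hρ => hρ.2.1, ?_⟩
  · refine insert_subset_insert fun ρ hρ => ⟨hρ.1, hρ.2.1, E ρ, E' ρ, (hsol ρ hρ.1 hρ.2.1).2.1,
      hρ.2.2⟩
  · intro ρ hρ
    have hmem : (ρ : ℂ) ∈ closedHalfPlane s := by simp [closedHalfPlane]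
    have hev : ∀ᶠ z in 𝓝[halfPlane s] (ρ : ℂ), z ∈ halfPlane s \ K :=
      (eventually_mem_nhdsWithin (s := halfPlane s)).and
        (mem_nhdsWithin_of_mem_nhds (hclosed.isOpen_compl.mem_nhds hρ))
    have h3 : Tendsto L.weyl (𝓝[halfPlane s] (ρ : ℂ)) (𝓝 (M ρ)) :=
      (Tendsto.mono_left (hMc ρ ⟨hmem, hρ⟩) (nhdsWithin_le_iff.2 (hev.mono fun z hz =>
        ⟨halfPlane_subset_closed s hz.1, hz.2⟩))).congr' (hev.mono fun z hz => (hweyl z hz).symm)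
    have := neBot_nhdsWithin_halfPlane hs hmem
    exact h3.limUnder_eq
  · intro ρ hρ
    have hμ : (lam ρ).re < 0 := by rw [re_lam]; exact neg_lt_zero.2 hρ.1
    exact ⟨tendsto_zero_of_isBigO hμ (hbig ρ hρ).1, tendsto_zero_of_isBigO hμ (hbig ρ hρ).2⟩
  · intro x hx
    refine ⟨((hasy x hx).1.mul tinv).congr' (hev.mono fun ρ hρ => ?_),
      ((hasy x hx).2.mul tinv).congr' (hev.mono fun ρ hρ => ?_)⟩
    · beta_reduce
      rw [(hcomb ρ hρ.1 hρ.2.1 x hx).1, hρ.2.2.2, smul_mul_assoc, mul_smul_comm]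
    · beta_reduce
      rw [(hcomb ρ hρ.1 hρ.2.1 x hx).2, hρ.2.2.2, smul_mul_assoc, mul_smul_comm, smul_mul_assoc,
        smul_inv_smul₀ hρ.2.2.1]

/-- The Weyl matrices of a pencil and of its transpose are transposes of each other. -/
theorem IsWeylFunction.transpose_eq (hL : L.ClassV) {s : ℝ} {M N : ℂ → CMat m}
    {K J : Set ℂ} (hM : L.IsWeylFunction s M K) (hN : L.transpose.IsWeylFunction s N J) {ρ : ℂ}
    (hρ : ρ ∈ halfPlane s) (hK : ρ ∉ K) (hJ : ρ ∉ J) : (N ρ).transpose = M ρ := by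
  have hst : L.IsSolStar ρ (fun x => (L.transpose.weylComb N x ρ).transpose)
      (fun x => (L.transpose.weylComb' N x ρ).transpose) :=
    isSolStar_iff.2 (by simpa using hL.transpose.weylComb_isSol N ρ)
  have h := wronskian_eq_zero hL hst (hL.weylComb_isSol M ρ)
    (by simpa using tendsto_transpose (hN.decay ρ ⟨hρ, hJ⟩).1)
    (by simpa using tendsto_transpose (hN.decay ρ ⟨hρ, hJ⟩).2)
    (hM.decay ρ ⟨hρ, hK⟩).1 (hM.decay ρ ⟨hρ, hK⟩).2 (le_refl (0 : ℝ))
  rw [(hL.weylComb_zero M ρ).1, (hL.weylComb_zero M ρ).2, (hL.transpose.weylComb_zero N ρ).1,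
    (hL.transpose.weylComb_zero N ρ).2, transpose_bc, Matrix.transpose_sub, transpose_mul,
    transpose_transpose, transpose_one, Matrix.sub_mul, Matrix.mul_sub, one_mul,
    mul_one, mul_assoc] at h
  have : M ρ - (N ρ).transpose = 0 := by rw [← h]; abel
  exact (sub_eq_zero.1 this).symm

end QuadPencil

/-! ### The homology version of Cauchy's theorem -/

section DSlope

variable {E : Type*} [NormedAddCommGroup E] [NormedSpace ℂ E]

lemma dslope_comm {f : ℂ → E} (z w : ℂ) : dslope f z w = dslope f w z := by
  rcases eq_or_ne z w with rfl | h
  · rfl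
  · rw [dslope_of_ne _ h.symm, dslope_of_ne _ h, slope_comm]

/-- The maximum principle bounds the divided difference near the diagonal. -/
lemma norm_dslope_le [CompleteSpace E] {f : ℂ → E} {z w : ℂ} {r B : ℝ} (hr : 0 < r)
    (hf : DifferentiableOn ℂ f (closedBall z r))
    (hB : ∀ ζ ∈ closedBall z r, ‖f ζ‖ ≤ B) (hw : ‖f w‖ ≤ B) :
    ‖dslope f z w‖ ≤ 2 * B / r := by
  have key : ∀ ζ, r ≤ ‖ζ - z‖ → ‖f ζ‖ ≤ B → ‖dslope f z ζ‖ ≤ 2 * B / r := fun ζ h1 h2 => by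
    have h0 : 0 < ‖ζ - z‖ := hr.trans_le h1
    rw [dslope_of_ne _ (sub_ne_zero.1 (norm_pos_iff.1 h0)), slope, vsub_eq_sub, norm_smul,
      norm_inv, ← div_eq_inv_mul]
    have h3 : ‖f ζ - f z‖ ≤ 2 * B :=
      (norm_sub_le _ _).trans (by linarith [hB z (Metric.mem_closedBall_self hr.le)])
    have h4 : 0 ≤ 2 * B := (norm_nonneg _).trans h3
    gcongr
  rcases le_or_gt r ‖w - z‖ with h | h
  · exact key w h hw
  · refine Complex.norm_le_of_forall_mem_frontier_norm_le (U := ball z r)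
      Metric.isBounded_ball ?_ (fun ζ hζ => ?_) (subset_closure (by rwa [mem_ball_iff_norm]))
    · refine DifferentiableOn.diffContOnCl ?_
      rw [closure_ball _ hr.ne']
      exact (differentiableOn_dslope (Metric.closedBall_mem_nhds z hr)).2 hf
    · rw [frontier_ball _ hr.ne', mem_sphere_iff_norm] at hζ
      exact key ζ hζ.ge (hB ζ (by rw [mem_closedBall_iff_norm, hζ]))

end DSlope

/-- A closed chain of paths in the plane: a finite formal linear combination of paths whose boundary
vanishes. The function `v i` is the derivative of the path `c i`. -/
structure ClosedChain (n : ℕ) where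
  k : Fin n → ℂ
  a : Fin n → ℝ
  b : Fin n → ℝ
  c : Fin n → ℝ → ℂ
  v : Fin n → ℝ → ℂ
  le : ∀ i, a i ≤ b i
  cont : ∀ i, ContinuousOn (c i) (Icc (a i) (b i))
  hasDerivAt : ∀ i, ∃ S : Set ℝ, S.Countable ∧
    ∀ t ∈ Ioo (a i) (b i) \ S, HasDerivAt (c i) (v i t) t
  integrable : ∀ i, IntervalIntegrable (v i) volume (a i) (b i)
  closed : ∀ F : ℂ → ℂ, ∑ i, k i * (F (c i (b i)) - F (c i (a i))) = 0

namespace ClosedChain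

variable {n : ℕ} (X : ClosedChain n) {E : Type*} [NormedAddCommGroup E] [NormedSpace ℂ E]

/-- The integral of `f` along the chain. -/
noncomputable def integral (f : ℂ → E) : E :=
  ∑ i, X.k i • ∫ t in X.a i..X.b i, X.v i t • f (X.c i t)

/-- The set of points on the chain. -/
def carrier : Set ℂ := ⋃ i, X.c i '' Icc (X.a i) (X.b i)

lemma isCompact_carrier : IsCompact X.carrier :=
  isCompact_iUnion fun i => isCompact_Icc.image_of_continuousOn (X.cont i)

lemma mem_carrier {i : Fin n} {t : ℝ} (ht : t ∈ Icc (X.a i) (X.b i)) : X.c i t ∈ X.carrier :=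
  mem_iUnion.2 ⟨i, t, ht, rfl⟩

lemma intervalIntegrable_smul {f : ℂ → E} (hf : ContinuousOn f X.carrier) (i : Fin n) :
    IntervalIntegrable (fun t => X.v i t • f (X.c i t)) volume (X.a i) (X.b i) := by
  refine (X.integrable i).smul_continuousOn ?_
  rw [uIcc_of_le (X.le i)]
  exact hf.comp (X.cont i) fun t ht => X.mem_carrier ht

lemma integral_congr {f g : ℂ → E} (h : EqOn f g X.carrier) : X.integral f = X.integral g := by
  refine sum_congr rfl fun i _ => ?_
  rw [intervalIntegral.integral_congr fun t ht => ?_]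
  rw [uIcc_of_le (X.le i)] at ht
  simp only [h (X.mem_carrier ht)]

lemma integral_sub {f g : ℂ → E} (hf : ContinuousOn f X.carrier) (hg : ContinuousOn g X.carrier) :
    X.integral (fun z => f z - g z) = X.integral f - X.integral g := by
  simp only [integral, smul_sub, ← Finset.sum_sub_distrib]
  refine sum_congr rfl fun i _ => ?_
  rw [← smul_sub, ← intervalIntegral.integral_sub (X.intervalIntegrable_smul hf i)
    (X.intervalIntegrable_smul hg i)]

lemma integral_smul_const [CompleteSpace E] (f : ℂ → ℂ) (e : E) :
    X.integral (fun z => f z • e) = X.integral f • e := by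
  simp only [integral, ← smul_assoc, Finset.sum_smul]
  refine sum_congr rfl fun i _ => ?_
  rw [intervalIntegral.integral_smul_const, smul_assoc]

lemma norm_integral_le {f : ℂ → E} {B : ℝ} (hB : ∀ z ∈ X.carrier, ‖f z‖ ≤ B) :
    ‖X.integral f‖ ≤ (∑ i, ‖X.k i‖ * ∫ t in X.a i..X.b i, ‖X.v i t‖) * B := by
  rw [Finset.sum_mul]
  refine (norm_sum_le _ _).trans (sum_le_sum fun i _ => ?_)
  rw [norm_smul, mul_assoc, ← intervalIntegral.integral_mul_const]
  refine mul_le_mul_of_nonneg_left ?_ (norm_nonneg _)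
  refine intervalIntegral.norm_integral_le_of_norm_le (X.le i) (ae_of_all _ fun t ht => ?_)
    ((X.integrable i).norm.mul_const B)
  rw [norm_smul]
  exact mul_le_mul_of_nonneg_left (hB _ (X.mem_carrier (Ioc_subset_Icc_self ht))) (norm_nonneg _)

/-- A function with a primitive has integral zero along a closed chain. -/
lemma integral_eq_zero_of_hasDerivAt {F F' : ℂ → ℂ} (hF : ∀ z ∈ X.carrier, HasDerivAt F (F' z) z)
    (hc : ContinuousOn F' X.carrier) : X.integral F' = 0 := by
  rw [← X.closed F]
  refine sum_congr rfl fun i _ => ?_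
  obtain ⟨S, hS, hd⟩ := X.hasDerivAt i
  rw [smul_eq_mul, integral_eq_of_hasDerivAt_off_countable_of_le (fun t => F (X.c i t)) _ (X.le i)
    hS ?_ (fun t ht => ?_) (X.intervalIntegrable_smul hc i)]
  · have h : ContinuousOn F X.carrier := fun z hz => (hF z hz).continuousAt.continuousWithinAt
    exact h.comp (X.cont i) fun t ht => X.mem_carrier ht
  · have := (hF _ (X.mem_carrier (Ioo_subset_Icc_self ht.1))).scomp t (hd t ht)
    exact this

/-- `2 π i` times the winding number of the chain about `w`. -/
noncomputable def winding (w : ℂ) : ℂ := X.integral fun z => (z - w)⁻¹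

lemma continuousOn_inv_sub {w : ℂ} (hw : w ∉ X.carrier) :
    ContinuousOn (fun z => (z - w)⁻¹) X.carrier :=
  (continuousOn_id.sub continuousOn_const).inv₀ fun z hz =>
    sub_ne_zero.2 fun (h : z = w) => hw (h ▸ hz)

lemma winding_eq_zero_of_norm_lt {w : ℂ} (h : ∀ z ∈ X.carrier, ‖z‖ < ‖w‖) : X.winding w = 0 := by
  have hw : w ∉ X.carrier := fun h' => lt_irrefl _ (h w h')
  refine X.integral_eq_zero_of_hasDerivAt (F := fun z => log (1 - z / w)) (fun z hz => ?_)
    (X.continuousOn_inv_sub hw)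
  have h0 : 0 < ‖w‖ := (norm_nonneg z).trans_lt (h z hz)
  have hw0 : w ≠ 0 := norm_pos_iff.1 h0
  have hs : 1 - z / w ∈ slitPlane := by
    refine Complex.mem_slitPlane_of_norm_lt_one (z := -(z / w)) ?_ |> fun h => by
      simpa [sub_eq_add_neg] using h
    rw [norm_neg, norm_div, div_lt_one h0]
    exact h z hz
  have hd := (((hasDerivAt_id z).div_const w).const_sub 1).clog hs
  refine hd.congr_deriv ?_
  have hz : w - z ≠ 0 := sub_ne_zero.2 fun e => (h z hz).ne (by rw [e])
  have hz' : z - w ≠ 0 := by rw [← neg_sub]; exact neg_ne_zero.2 hz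
  have : 1 - z / w ≠ 0 := Complex.slitPlane_ne_zero hs
  simp only [id]
  field_simp
  ring

lemma winding_eq_of_dist_lt {w w' : ℂ} (h : ∀ z ∈ X.carrier, ‖w' - w‖ < ‖z - w‖) :
    X.winding w' = X.winding w := by
  have hne : ∀ z ∈ X.carrier, z - w ≠ 0 := fun z hz =>
    norm_pos_iff.1 ((norm_nonneg _).trans_lt (h z hz))
  have hne' : ∀ z ∈ X.carrier, z - w' ≠ 0 := fun z hz h0 => by
    have := h z hz
    rw [sub_eq_zero.1 h0] at this
    exact lt_irrefl _ this
  have hw : w ∉ X.carrier := fun h' => hne w h' (sub_self w)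
  have hw' : w' ∉ X.carrier := fun h' => hne' w' h' (sub_self w')
  have hc : ContinuousOn (fun z => (z - w')⁻¹ - (z - w)⁻¹) X.carrier :=
    (X.continuousOn_inv_sub hw').sub (X.continuousOn_inv_sub hw)
  have := X.integral_eq_zero_of_hasDerivAt
    (F := fun z => log (1 - (w' - w) * (z - w)⁻¹)) (fun z hz => ?_) hc
  · rw [X.integral_sub (X.continuousOn_inv_sub hw') (X.continuousOn_inv_sub hw)] at this
    exact sub_eq_zero.1 this
  · have h0 := hne z hz
    have h0' := hne' z hz
    have hs : 1 - (w' - w) * (z - w)⁻¹ ∈ slitPlane := by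
      refine Complex.mem_slitPlane_of_norm_lt_one (z := -((w' - w) * (z - w)⁻¹)) ?_ |> fun h => by
        simpa [sub_eq_add_neg] using h
      rw [norm_neg, norm_mul, norm_inv, ← div_eq_mul_inv, div_lt_one (norm_pos_iff.2 h0)]
      exact h z hz
    have hi : HasDerivAt (fun z => (z - w)⁻¹) (-1 / (z - w) ^ 2) z :=
      ((hasDerivAt_id z).sub_const w).inv h0
    refine (((hi.const_mul (w' - w)).const_sub 1).clog hs).congr_deriv ?_
    have h2 : 1 - (w' - w) * (z - w)⁻¹ = (z - w') * (z - w)⁻¹ := by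
      field_simp; ring
    rw [h2]
    field_simp
    ring

lemma eventually_winding_eq {w : ℂ} (hw : w ∉ X.carrier) :
    ∀ᶠ w' in 𝓝 w, X.winding w' = X.winding w := by
  obtain ⟨ε, hε, hb⟩ := Metric.isOpen_iff.1 X.isCompact_carrier.isClosed.isOpen_compl w hw
  filter_upwards [ball_mem_nhds w hε] with w' hw'
  refine X.winding_eq_of_dist_lt fun z hz => ?_
  rw [mem_ball_iff_norm] at hw'
  refine hw'.trans_le ?_
  by_contra! hlt
  exact hb (by rwa [mem_ball_iff_norm] : z ∈ ball w ε) hz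

lemma exists_norm_lt : ∃ R : ℝ, 0 < R ∧ ∀ z ∈ X.carrier, ‖z‖ < R := by
  obtain ⟨R, hR⟩ := X.isCompact_carrier.isBounded.exists_norm_le
  exact ⟨max R 0 + 1, by positivity, fun z hz =>
    (hR z hz).trans_lt ((le_max_left _ _).trans_lt (lt_add_one _))⟩

lemma differentiableOn_integral {U : Set ℂ} (hU : IsOpen U) {G : ℂ → ℂ → E} {B : ℝ}
    (hm : ∀ z ∈ U, ContinuousOn (G z) X.carrier)
    (hd : ∀ w ∈ X.carrier, DifferentiableOn ℂ (fun z => G z w) U)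
    (hB : ∀ w ∈ X.carrier, ∀ z ∈ U, ‖G z w‖ ≤ B) :
    DifferentiableOn ℂ (fun z => X.integral (G z)) U := by
  refine DifferentiableOn.fun_sum fun i _ => DifferentiableOn.fun_const_smul ?_ _
  simp only [integral_of_le (X.le i)]
  refine differentiableOn_integral_of_dominated hU (b := fun t => ‖X.v i t‖ * B)
    (fun z hz => ?_) ?_ ?_ ?_
  · exact ((intervalIntegrable_iff_integrableOn_Ioc_of_le (X.le i)).1
      (X.intervalIntegrable_smul (hm z hz) i)).aestronglyMeasurable
  · filter_upwards [ae_restrict_mem measurableSet_Ioc] with t ht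
    exact (hd _ (X.mem_carrier (Ioc_subset_Icc_self ht))).fun_const_smul _
  · filter_upwards [ae_restrict_mem measurableSet_Ioc] with t ht z hz
    rw [norm_smul]
    exact mul_le_mul_of_nonneg_left (hB _ (X.mem_carrier (Ioc_subset_Icc_self ht)) z hz)
      (norm_nonneg _)
  · exact (((intervalIntegrable_iff_integrableOn_Ioc_of_le (X.le i)).1
      (X.integrable i)).norm).mul_const B

lemma differentiableAt_cauchy {f : ℂ → E} (hf : ContinuousOn f X.carrier) {w : ℂ}
    (hw : w ∉ X.carrier) : DifferentiableAt ℂ (fun z => X.integral fun ζ => (ζ - z)⁻¹ • f ζ) w := by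
  obtain ⟨ε, hε, hb⟩ := Metric.isOpen_iff.1 X.isCompact_carrier.isClosed.isOpen_compl w hw
  obtain ⟨B, hB⟩ := X.isCompact_carrier.exists_bound_of_continuousOn hf
  have hfar : ∀ ζ ∈ X.carrier, ∀ z ∈ ball w (ε / 2), ε / 2 ≤ ‖ζ - z‖ := fun ζ hζ z hz => by
    by_contra! h
    rw [← dist_eq_norm] at h
    rw [mem_ball] at hz
    exact hb (mem_ball.2 (by linarith [dist_triangle ζ z w])) hζ
  have hne : ∀ ζ ∈ X.carrier, ∀ z ∈ ball w (ε / 2), ζ - z ≠ 0 := fun ζ hζ z hz =>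
    norm_pos_iff.1 ((half_pos hε).trans_le (hfar ζ hζ z hz))
  refine (X.differentiableOn_integral (B := (ε / 2)⁻¹ * B) isOpen_ball (fun z hz => ?_)
    (fun ζ hζ => ?_) fun ζ hζ z hz => ?_).differentiableAt (ball_mem_nhds w (half_pos hε))
  · exact ((continuousOn_id.sub continuousOn_const).inv₀ fun ζ hζ => hne ζ hζ z hz).smul hf
  · exact (((differentiableOn_const ζ).sub differentiableOn_id).inv fun z hz =>
      hne ζ hζ z hz).smul_const _
  · rw [norm_smul, norm_inv]
    have := hfar ζ hζ z hz
    have h2 := hB ζ hζ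
    gcongr

/-- **Cauchy's theorem**, after Dixon: the integral of a holomorphic function along a closed chain
vanishes if the chain does not wind about points outside the domain. -/
theorem integral_eq_zero [CompleteSpace E] {U : Set ℂ} (hU : IsOpen U) (hX : X.carrier ⊆ U)
    (hw : ∀ w, w ∉ U → X.winding w = 0) {f : ℂ → E} (hf : DifferentiableOn ℂ f U) :
    X.integral f = 0 := by
  obtain ⟨R, hR0, hR⟩ := X.exists_norm_lt
  -- it suffices to consider a function with a zero off the chain
  set w₁ : ℂ := (R : ℂ) with hw₁
  have hRn : ‖w₁‖ = R := by rw [hw₁, norm_real, norm_of_nonneg hR0.le]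
  have hw₁X : w₁ ∉ X.carrier := fun h => (hR _ h).ne hRn
  set g : ℂ → E := fun z => (z - w₁) • f z with hg
  have hgd : DifferentiableOn ℂ g U := (differentiableOn_id.sub_const w₁).smul hf
  have hgc : ContinuousOn g X.carrier := hgd.continuousOn.mono hX
  classical
  set h : ℂ → E := fun z => if z ∈ U then X.integral (dslope g z)
    else X.integral fun ζ => (ζ - z)⁻¹ • g ζ with hh
  -- off the chain, the two definitions differ by a multiple of the winding number
  have key : ∀ z, z ∉ X.carrier → X.winding z = 0 →
      h z = X.integral fun ζ => (ζ - z)⁻¹ • g ζ := by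
    intro z hz hz0
    by_cases hzU : z ∈ U
    · have e : EqOn (dslope g z) (fun ζ => (ζ - z)⁻¹ • g ζ - (ζ - z)⁻¹ • g z) X.carrier :=
        fun ζ hζ => by
          rw [dslope_of_ne _ fun (h : ζ = z) => hz (h ▸ hζ), slope, vsub_eq_sub, smul_sub]
      have hi := X.continuousOn_inv_sub hz
      have h1 : ContinuousOn (fun ζ => (ζ - z)⁻¹ • g ζ) X.carrier := hi.smul hgc
      have h2 : ContinuousOn (fun ζ => (ζ - z)⁻¹ • g z) X.carrier := hi.smul continuousOn_const
      simp only [hh, if_pos hzU]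
      rw [X.integral_congr e, X.integral_sub h1 h2,
        X.integral_smul_const, ← winding, hz0, zero_smul, sub_zero]
    · simp only [hh, if_neg hzU]
  have hdiff : Differentiable ℂ h := by
    intro z
    by_cases hzU : z ∈ U
    · obtain ⟨ε, hε, hb⟩ := Metric.isOpen_iff.1 hU z hzU
      set r := ε / 4 with hr
      have hr0 : 0 < r := by positivity
      have hsub : closedBall z (2 * r) ⊆ U := fun w hw => hb (by
        rw [mem_closedBall] at hw; rw [mem_ball]; linarith)
      obtain ⟨B1, hB1⟩ := (isCompact_closedBall z (2 * r)).exists_bound_of_continuousOn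
        (hgd.continuousOn.mono hsub)
      obtain ⟨B2, hB2⟩ := X.isCompact_carrier.exists_bound_of_continuousOn hgc
      have hsub' : ∀ w ∈ ball z r, closedBall w r ⊆ closedBall z (2 * r) :=
        fun w hw ζ hζ => by
          rw [mem_closedBall] at hζ ⊢; rw [mem_ball] at hw
          linarith [dist_triangle ζ w z]
      have hUw : ∀ w ∈ ball z r, w ∈ U := fun w hw =>
        hsub (hsub' w hw (Metric.mem_closedBall_self hr0.le))
      have h1 := X.differentiableOn_integral (U := ball z r) (G := fun w => dslope g w)
        (B := 2 * max B1 B2 / r) isOpen_ball (fun w hw => ?_) (fun ζ hζ => ?_)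
        fun ζ hζ w hw => ?_
      · refine (h1.differentiableAt (ball_mem_nhds z hr0)).congr_of_eventuallyEq ?_
        filter_upwards [ball_mem_nhds z hr0] with w hw
        simp only [hh, if_pos (hUw w hw)]
      · exact ((differentiableOn_dslope (hU.mem_nhds (hUw w hw))).2 hgd).continuousOn.mono hX
      · simp only [fun w => dslope_comm (f := g) w ζ]
        exact ((differentiableOn_dslope (hU.mem_nhds (hX hζ))).2 hgd).mono fun w hw =>
          hUw w hw
      · exact norm_dslope_le hr0 (hgd.mono ((hsub' w hw).trans hsub))
          (fun ξ hξ => (hB1 ξ (hsub' w hw hξ)).trans (le_max_left _ _))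
          ((hB2 ζ hζ).trans (le_max_right _ _))
    · have hzX : z ∉ X.carrier := fun h => hzU (hX h)
      refine (X.differentiableAt_cauchy hgc hzX).congr_of_eventuallyEq ?_
      filter_upwards [X.eventually_winding_eq hzX,
        X.isCompact_carrier.isClosed.isOpen_compl.mem_nhds hzX] with w hw hwX
      exact key w hwX (by rw [hw, ‹∀ w, w ∉ U → X.winding w = 0› z hzU])
  have hlim : Tendsto h (cocompact ℂ) (𝓝 0) := by
    obtain ⟨B, hB⟩ := X.isCompact_carrier.exists_bound_of_continuousOn hgc
    set V := ∑ i, ‖X.k i‖ * ∫ t in X.a i..X.b i, ‖X.v i t‖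
    have hz : Tendsto (fun z : ℂ => V * ((‖z‖ - R)⁻¹ * |B|)) (cocompact ℂ) (𝓝 0) := by
      have h1 : Tendsto (fun z : ℂ => ‖z‖ - R) (cocompact ℂ) atTop :=
        tendsto_atTop_add_const_right _ _ (tendsto_norm_cocompact_atTop)
      simpa using (h1.inv_tendsto_atTop.mul_const |B|).const_mul V
    refine squeeze_zero_norm' ?_ hz
    filter_upwards [tendsto_norm_cocompact_atTop.eventually_gt_atTop R] with z hz
    have hzX : ∀ ζ ∈ X.carrier, ‖ζ‖ < ‖z‖ := fun ζ hζ => (hR ζ hζ).trans hz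
    rw [key z (fun h => lt_irrefl _ (hzX z h)) (X.winding_eq_zero_of_norm_lt hzX)]
    refine X.norm_integral_le fun ζ hζ => ?_
    rw [norm_smul, norm_inv]
    have h1 : ‖z‖ - R ≤ ‖ζ - z‖ := by
      rw [norm_sub_rev]
      linarith [norm_sub_norm_le z ζ, hR ζ hζ]
    have h2 : 0 < ‖z‖ - R := sub_pos.2 hz
    have h3 := (hB ζ hζ).trans (le_abs_self B)
    gcongr
  have h0 := hdiff.apply_eq_of_tendsto_cocompact w₁ hlim
  rw [key w₁ hw₁X (X.winding_eq_zero_of_norm_lt fun z hz => (hR z hz).trans_eq hRn.symm)] at h0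
  rw [← h0]
  refine X.integral_congr fun ζ hζ => ?_
  have : ζ - w₁ ≠ 0 := sub_ne_zero.2 fun (e : ζ = w₁) => hw₁X (e ▸ hζ)
  simp only [hg, smul_smul, inv_mul_cancel₀ this, one_smul]

end ClosedChain

/-! ### The curve `γ₀` and its two arcs -/

lemma exists_sign_of_ne_zero {S : Set ℝ} (hS : IsPreconnected S) {g : ℝ → ℝ}
    (hg : ContinuousOn g S) (h0 : ∀ t ∈ S, g t ≠ 0) :
    ∃ s, IsSign s ∧ ∀ t ∈ S, 0 < s * g t := by
  by_cases h : ∃ t ∈ S, 0 < g t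
  · obtain ⟨t, ht, htp⟩ := h
    refine ⟨1, Or.inl rfl, fun u hu => ?_⟩
    by_contra! hc
    rw [one_mul] at hc
    obtain ⟨v, hv, hv0⟩ := hS.intermediate_value hu ht hg ⟨hc, htp.le⟩
    exact h0 v hv hv0
  · push Not at h
    refine ⟨-1, Or.inr rfl, fun u hu => ?_⟩
    have := lt_of_le_of_ne (h u hu) (h0 u hu)
    linarith

lemma PiecewiseC1.regular {c : ℝ → ℂ} (hc : PiecewiseC1 c) :
    ContinuousOn c (Icc 0 1) ∧ IntervalIntegrable (deriv c) volume 0 1 ∧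
      ∃ S : Set ℝ, S.Countable ∧ ∀ t ∈ Ioo 0 1 \ S, HasDerivAt c (deriv c t) t := by
  obtain ⟨n, τ, hτ, h0, h1, hd⟩ := hc
  have key : ∀ i : Fin (n + 1), ContinuousOn c (Icc 0 (τ i)) ∧
      IntervalIntegrable (deriv c) volume 0 (τ i) ∧
      ∃ S : Set ℝ, S.Countable ∧ ∀ t ∈ Ioo 0 (τ i) \ S, HasDerivAt c (deriv c t) t := by
    intro i
    induction i using Fin.induction with
    | zero =>
      refine ⟨?_, by rw [h0], ∅, countable_empty, fun t ht => ?_⟩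
      · rw [h0, Icc_self]; exact continuousOn_singleton _ _
      · rw [h0, Ioo_self] at ht; exact absurd ht.1 (notMem_empty t)
    | succ i ih =>
      obtain ⟨ih1, ih2, S, hS, ih3⟩ := ih
      have hlt : τ i.castSucc < τ i.succ := hτ i.castSucc_lt_succ
      have hle : 0 ≤ τ i.castSucc := h0 ▸ hτ.monotone (Fin.zero_le _)
      have hdi : ∀ t ∈ Ioo (τ i.castSucc) (τ i.succ), HasDerivAt c (deriv c t) t := fun t ht =>
        (((hd i).differentiableOn one_ne_zero t (Ioo_subset_Icc_self ht)).differentiableAt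
          (Icc_mem_nhds ht.1 ht.2)).hasDerivAt
      refine ⟨?_, ih2.trans ?_, insert (τ i.castSucc) S, hS.insert _, fun t ht => ?_⟩
      · rw [← Icc_union_Icc_eq_Icc hle hlt.le]
        exact ih1.union_of_isClosed (hd i).continuousOn isClosed_Icc isClosed_Icc
      · have h2 : ContinuousOn (derivWithin c (Icc (τ i.castSucc) (τ i.succ)))
            (Icc (τ i.castSucc) (τ i.succ)) :=
          (hd i).continuousOn_derivWithin (uniqueDiffOn_Icc hlt) le_rfl
        refine (h2.intervalIntegrable_of_Icc hlt.le).congr_ae ?_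
        rw [uIoc_of_le hlt.le, ← restrict_Ioo_eq_restrict_Ioc]
        filter_upwards [ae_restrict_mem measurableSet_Ioo] with t ht
        exact derivWithin_of_mem_nhds (Icc_mem_nhds ht.1 ht.2)
      · rcases lt_trichotomy t (τ i.castSucc) with h | h | h
        · exact ih3 t ⟨⟨ht.1.1, h⟩, fun h' => ht.2 (.inr h')⟩
        · exact absurd (.inl h) ht.2
        · exact hdi t ⟨h, ht.1.2⟩
  have := key (Fin.last n)
  rwa [h1] at this

open QuadPencil in
lemma log_rotated {s e r : ℝ} (hs : IsSign s) (he : IsSign e) (hr : 0 < r) :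
    log (-(s : ℂ) * I * ((e * r : ℝ) : ℂ)) =
      Real.log r - ((s * e * (π / 2) : ℝ) : ℂ) * I := by
  have h : -(s : ℂ) * I * ((e * r : ℝ) : ℂ) = (r : ℂ) * (-(s * e : ℝ) * I) := by
    push_cast; ring
  have h0 : (-(s * e : ℝ) * I : ℂ) ≠ 0 := by
    rcases hs with rfl | rfl <;> rcases he with rfl | rfl <;> simp
  rw [h, Complex.log_ofReal_mul hr h0]
  rcases hs with rfl | rfl <;> rcases he with rfl | rfl <;>
    simp [Complex.log_I, Complex.log_neg_I, sub_eq_add_neg]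

namespace CutContour

open QuadPencil

variable (Γ : CutContour)

lemma ftc {F F' : ℂ → ℂ} {a b : ℝ} (ha : 0 ≤ a) (hab : a ≤ b) (hb : b ≤ 1)
    (hF : ∀ t ∈ Icc a b, HasDerivAt F (F' (Γ.c t)) (Γ.c t))
    (hc : ContinuousOn (fun t => F' (Γ.c t)) (Icc a b)) :
    ∫ t in a..b, deriv Γ.c t * F' (Γ.c t) = F (Γ.c b) - F (Γ.c a) := by
  obtain ⟨h1, h2, S, hS, h3⟩ := Γ.piecewiseC1.regular
  refine integral_eq_of_hasDerivAt_off_countable_of_le (fun t => F (Γ.c t)) _ hab hS ?_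
    (fun t ht => ?_) ?_
  · exact fun t ht => (hF t ht).continuousAt.comp_continuousWithinAt
      ((h1 t ⟨ha.trans ht.1, ht.2.trans hb⟩).mono (Icc_subset_Icc ha hb))
  · have := (hF t (Ioo_subset_Icc_self ht.1)).scomp t
      (h3 t ⟨⟨ha.trans_lt ht.1.1, ht.1.2.trans_le hb⟩, ht.2⟩)
    exact this
  · refine IntervalIntegrable.mul_continuousOn (h2.mono_set ?_) (by rwa [uIcc_of_le hab])
    rw [uIcc_of_le hab, uIcc_of_le zero_le_one]
    exact Icc_subset_Icc ha hb

/-- The initial point of the arc of `γ₀` in the half-plane `± Im ρ ≥ 0`. -/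
noncomputable def arcStart (s : ℝ) : ℝ := if s = 1 then Γ.right else -Γ.left

/-- The curve `γ₀` crosses the real axis at the parameters `t₁ < t₂`. In between, it runs through
the half-plane `σ Im ρ > 0` in the counterclockwise direction. -/
structure IsCrossing (t₁ t₂ σ : ℝ) : Prop where
  sign : σ = 1 ∨ σ = -1
  nonneg : 0 ≤ t₁
  lt : t₁ < t₂
  lt_one : t₂ < 1
  left_eq : Γ.c t₁ = Γ.arcStart σ
  right_eq : Γ.c t₂ = Γ.arcStart (-σ)
  inner : ∀ t ∈ Ioo t₁ t₂, Γ.c t ∈ halfPlane σ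
  outer : ∀ t ∈ Ioo 0 t₁ ∪ Ioo t₂ 1, Γ.c t ∈ halfPlane (-σ)

lemma ne_zero {t : ℝ} (ht : t ∈ Icc (0 : ℝ) 1) : Γ.c t ≠ 0 := by
  intro h
  have : Γ.c t ∈ {z ∈ Γ.c '' Icc 0 1 | z.im = 0} := ⟨⟨t, ht, rfl⟩, by rw [h]; rfl⟩
  rw [Γ.meets_real, h] at this
  have hl := Γ.left_pos
  have hr := Γ.right_pos
  rcases this with h | h
  · have := congrArg Complex.re h
    simp at this; linarith
  · have := congrArg Complex.re (mem_singleton_iff.1 h)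
    simp at this; linarith

/-- The logarithm with branch cut outside the half-plane `± Im z ≥ 0` yields the change of argument
along an arc of `γ₀`. -/
lemma integral_inv_arc {s a b : ℝ} (hs : IsSign s) (ha : 0 ≤ a) (hab : a ≤ b) (hb : b ≤ 1)
    (h : ∀ t ∈ Icc a b, Γ.c t ∈ closedHalfPlane s) :
    ∫ t in a..b, deriv Γ.c t * (Γ.c t)⁻¹ = log (-(s : ℂ) * I * Γ.c b) -
      log (-(s : ℂ) * I * Γ.c a) := by
  have hsub : ∀ t ∈ Icc a b, t ∈ Icc (0 : ℝ) 1 := fun t ht => ⟨ha.trans ht.1, ht.2.trans hb⟩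
  have hs0 : (s : ℂ) ≠ 0 := by
    rcases hs with rfl | rfl <;> simp
  refine Γ.ftc (F := fun z => log (-(s : ℂ) * I * z)) (F' := fun z => z⁻¹) ha hab hb
    (fun t ht => ?_) ?_
  · have h0 := Γ.ne_zero (hsub t ht)
    have hm : -(s : ℂ) * I * Γ.c t ∈ slitPlane := by
      have h1 : 0 ≤ s * (Γ.c t).im := h t ht
      rw [Complex.mem_slitPlane_iff]
      have hre : (-(s : ℂ) * I * Γ.c t).re = s * (Γ.c t).im := by simp
      have him : (-(s : ℂ) * I * Γ.c t).im = -(s * (Γ.c t).re) := by simp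
      rw [hre, him]
      rcases h1.lt_or_eq with h1 | h1
      · exact Or.inl h1
      · refine Or.inr fun h2 => h0 (Complex.ext ?_ ?_)
        · rcases hs with rfl | rfl <;> simpa using h2
        · rcases hs with rfl | rfl <;> simpa using h1.symm
    refine (((hasDerivAt_id (Γ.c t)).const_mul (-(s : ℂ) * I)).clog hm).congr_deriv ?_
    simp only [id, mul_one]
    field_simp
  · exact (Γ.piecewiseC1.regular.1.mono (Icc_subset_Icc ha hb)).inv₀ fun t ht =>
      Γ.ne_zero (hsub t ht)

lemma mem_closedHalfPlane {s a b : ℝ} (ha : 0 ≤ a) (hab : a ≤ b) (hb : b ≤ 1)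
    (hpos : ∀ t ∈ Ioo a b, Γ.c t ∈ halfPlane s) (hdeg : a = b → (Γ.c a).im = 0) :
    ∀ t ∈ Icc a b, Γ.c t ∈ closedHalfPlane s := by
  rcases hab.eq_or_lt with rfl | hlt
  · intro t ht
    rw [Icc_self, mem_singleton_iff] at ht
    change 0 ≤ s * (Γ.c t).im
    rw [ht, hdeg rfl, mul_zero]
  · intro t ht
    have hcont : ContinuousOn Γ.c (closure (Ioo a b)) := by
      rw [closure_Ioo hlt.ne]
      exact Γ.piecewiseC1.regular.1.mono (Icc_subset_Icc ha hb)
    have h2 : Γ.c t ∈ closure (Γ.c '' Ioo a b) :=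
      hcont.image_closure ⟨t, by rwa [closure_Ioo hlt.ne], rfl⟩
    refine closure_minimal ?_ (isClosed_closedHalfPlane s) h2
    rintro _ ⟨u, hu, rfl⟩
    exact halfPlane_subset_closed s (hpos u hu)

/-- The winding number fixes the orientation of the two arcs. -/
lemma isCrossing_of_times {t₁ t₂ e r₁ r₂ : ℝ} (h0 : 0 ≤ t₁) (h12 : t₁ < t₂) (h1 : t₂ < 1)
    (hz : ∀ t ∈ Ico (0 : ℝ) 1, (Γ.c t).im = 0 → t = t₁ ∨ t = t₂) (he : IsSign e)
    (hr₁ : 0 < r₁) (hr₂ : 0 < r₂) (e₁ : Γ.c t₁ = ((e * r₁ : ℝ) : ℂ))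
    (e₂ : Γ.c t₂ = ((-e * r₂ : ℝ) : ℂ)) (hst : e * r₁ = Γ.arcStart e ∧ -e * r₂ = Γ.arcStart (-e)) :
    Γ.IsCrossing t₁ t₂ e := by
  have h02 := h0.trans h12.le
  have h01 := h12.le.trans h1.le
  obtain ⟨hc, hi, -⟩ := Γ.piecewiseC1.regular
  have him : ContinuousOn (fun t => (Γ.c t).im) (Icc 0 1) := continuous_im.comp_continuousOn hc
  have him₁ : (Γ.c t₁).im = 0 := by rw [e₁]; exact ofReal_im _
  have him₂ : (Γ.c t₂).im = 0 := by rw [e₂]; exact ofReal_im _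
  -- the imaginary part has a constant sign on each arc
  obtain ⟨s₁, hs₁, hp₁⟩ := exists_sign_of_ne_zero (S := Ioo t₁ t₂) isPreconnected_Ioo
    (him.mono fun t ht => ⟨h0.trans ht.1.le, ht.2.le.trans h1.le⟩) fun t ht h =>
      (hz t ⟨h0.trans ht.1.le, ht.2.trans h1⟩ h).elim ht.1.ne' ht.2.ne
  obtain ⟨s₀, hs₀, hp₀⟩ : ∃ s, IsSign s ∧
      ∀ t ∈ Ioo 0 t₁ ∪ Ioo t₂ 1, 0 < s * (Γ.c t).im := by
    rcases h0.eq_or_lt with h0' | h0'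
    · obtain ⟨s, hs, hp⟩ := exists_sign_of_ne_zero (S := Ioo t₂ 1) isPreconnected_Ioo
        (him.mono fun t ht => ⟨h02.trans ht.1.le, ht.2.le⟩) fun t ht h =>
          (hz t ⟨h02.trans ht.1.le, ht.2⟩ h).elim (h12.trans ht.1).ne' ht.1.ne'
      refine ⟨s, hs, fun t ht => ht.elim (fun h => ?_) fun h => hp t h⟩
      rw [← h0', Ioo_self] at h
      exact absurd h (notMem_empty t)
    · have hne : ∀ t ∈ Ico 0 t₁, (Γ.c t).im ≠ 0 := fun t ht h =>
        (hz t ⟨ht.1, ht.2.trans (h12.trans h1)⟩ h).elim ht.2.ne (ht.2.trans h12).ne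
      obtain ⟨s, hs, hp⟩ := exists_sign_of_ne_zero (S := Ico 0 t₁) isPreconnected_Ico
        (him.mono fun t ht => ⟨ht.1, (ht.2.trans (h12.trans h1)).le⟩) hne
      obtain ⟨s', hs', hp'⟩ := exists_sign_of_ne_zero (S := Ioc t₂ 1) isPreconnected_Ioc
        (him.mono fun t ht => ⟨h02.trans ht.1.le, ht.2⟩) fun t ht h => by
          rcases ht.2.lt_or_eq with h' | h'
          · exact (hz t ⟨h02.trans ht.1.le, h'⟩ h).elim (h12.trans ht.1).ne' ht.1.ne'
          · rw [h', ← Γ.closed] at h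
            exact hne 0 ⟨le_rfl, h0'⟩ h
      have hss : s = s' := by
        have q1 := hp 0 ⟨le_rfl, h0'⟩
        have q2 := hp' 1 ⟨h1, le_rfl⟩
        rw [Γ.closed] at q1
        rcases hs with rfl | rfl <;> rcases hs' with rfl | rfl <;> first | rfl | linarith
      subst hss
      exact ⟨s, hs, fun t ht => ht.elim (fun h => hp t ⟨h.1.le, h.2⟩) fun h => hp' t ⟨h.1, h.2.le⟩⟩
  have hw : ∫ t in (0 : ℝ)..1, deriv Γ.c t * (Γ.c t)⁻¹ = 2 * π * I := by
    have := Γ.winding_zero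
    rw [windingNum] at this
    simp only [sub_zero, div_eq_mul_inv] at this
    have h2 : (2 * π * I : ℂ) ≠ 0 := by simp [Real.pi_ne_zero]
    rw [inv_mul_eq_iff_eq_mul₀ h2, mul_one] at this
    exact this
  have hint : IntervalIntegrable (fun t => deriv Γ.c t * (Γ.c t)⁻¹) volume 0 1 := by
    refine hi.mul_continuousOn ?_
    rw [uIcc_of_le zero_le_one]
    exact hc.inv₀ fun t ht => Γ.ne_zero ht
  have hsub : ∀ {a b : ℝ}, 0 ≤ a → a ≤ b → b ≤ 1 →
      IntervalIntegrable (fun t => deriv Γ.c t * (Γ.c t)⁻¹) volume a b := fun ha hab hb =>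
    hint.mono_set (by rw [uIcc_of_le hab, uIcc_of_le zero_le_one]; exact Icc_subset_Icc ha hb)
  rw [← integral_add_adjacent_intervals (hsub le_rfl h0 h01)
      (hsub h0 h01 le_rfl),
    ← integral_add_adjacent_intervals (hsub h0 h12.le h1.le) (hsub h02 h1.le le_rfl),
    Γ.integral_inv_arc hs₀ le_rfl h0 h01 (Γ.mem_closedHalfPlane le_rfl h0 h01
      (fun t ht => hp₀ t (.inl ht)) fun h => by have := him₁; rwa [← h] at this),
    Γ.integral_inv_arc hs₁ h0 h12.le h1.le (Γ.mem_closedHalfPlane h0 h12.le h1.le hp₁ fun h =>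
      absurd h h12.ne),
    Γ.integral_inv_arc hs₀ h02 h1.le le_rfl (Γ.mem_closedHalfPlane h02 h1.le le_rfl
      (fun t ht => hp₀ t (.inr ht)) fun h => absurd h h1.ne), Γ.closed, e₁, e₂] at hw
  have he' : -e = 1 ∨ -e = -1 := by rcases he with rfl | rfl <;> simp
  rw [log_rotated hs₀ he hr₁, log_rotated hs₁ he hr₁, log_rotated hs₀ he' hr₂,
    log_rotated hs₁ he' hr₂] at hw
  -- the winding number decides between the two orientations
  have hw' := congrArg Complex.im hw
  simp at hw'
  have hπ := pi_pos
  have hse : s₁ = e ∧ s₀ = -e := by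
    rcases hs₀ with rfl | rfl <;> rcases hs₁ with rfl | rfl <;> rcases he with rfl | rfl <;>
      norm_num at hw' ⊢ <;> linarith
  rw [hse.1] at hp₁
  rw [hse.2] at hp₀
  exact ⟨he, h0, h12, h1, by rw [e₁, hst.1], by rw [e₂, hst.2], hp₁, hp₀⟩

theorem exists_isCrossing : ∃ t₁ t₂ σ, Γ.IsCrossing t₁ t₂ σ := by
  have hex : ∀ x : ℂ, x ∈ ({-(Γ.left : ℂ), (Γ.right : ℂ)} : Set ℂ) →
      ∃ t ∈ Ico (0 : ℝ) 1, Γ.c t = x := by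
    intro x hx
    rw [← Γ.meets_real] at hx
    obtain ⟨⟨t, ht, rfl⟩, -⟩ := hx
    rcases ht.2.lt_or_eq with h | h
    · exact ⟨t, ⟨ht.1, h⟩, rfl⟩
    · exact ⟨0, ⟨le_rfl, zero_lt_one⟩, by rw [h, Γ.closed]⟩
  obtain ⟨tl, htl, hl⟩ := hex (-(Γ.left : ℂ)) (.inl rfl)
  obtain ⟨tr, htr, hr⟩ := hex (Γ.right : ℂ) (.inr rfl)
  have hz : ∀ t ∈ Ico (0 : ℝ) 1, (Γ.c t).im = 0 → t = tl ∨ t = tr := by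
    intro t ht h
    have : Γ.c t ∈ {z ∈ Γ.c '' Icc 0 1 | z.im = 0} := ⟨⟨t, Ico_subset_Icc_self ht, rfl⟩, h⟩
    rw [Γ.meets_real] at this
    rcases this with h | h
    · exact Or.inl (Γ.simple ht htl (by rw [h, hl]))
    · exact Or.inr (Γ.simple ht htr (by rw [mem_singleton_iff.1 h, hr]))
  have hlp := Γ.left_pos
  have hrp := Γ.right_pos
  have hne : (-1 : ℝ) ≠ 1 := by norm_num
  rcases lt_trichotomy tl tr with h | h | h
  · exact ⟨tl, tr, -1, Γ.isCrossing_of_times htl.1 h htr.2 hz (.inr rfl) hlp hrp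
      (by rw [hl]; simp) (by rw [hr]; simp) (by simp [arcStart, hne])⟩
  · rw [h, hr] at hl
    have := congrArg Complex.re hl
    simp at this
    linarith
  · exact ⟨tr, tl, 1, Γ.isCrossing_of_times htr.1 h htl.2 (fun t ht h => (hz t ht h).symm)
      (.inl rfl) hrp hlp (by rw [hr]; simp) (by rw [hl]; simp) (by simp [arcStart, hne])⟩

end CutContour

/-! ### Deformation of the cut contour -/

namespace CutContour

open QuadPencil

variable {E : Type*} [NormedAddCommGroup E] [NormedSpace ℂ E]

/-- The integral along the half circle `|z| = R`, `± Im z ≥ 0`, counterclockwise. -/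
noncomputable def halfCircle (s R : ℝ) (f : ℂ → E) : E :=
  ∫ τ in (0 : ℝ)..Real.pi, ((s * R : ℝ) * (exp (τ * I) * I) : ℂ) •
    f ((s * R : ℝ) * exp (τ * I))

lemma halfCircle_add {R : ℝ} (hR : 0 ≤ R) {f : ℂ → E} (hf : ContinuousOn f (Metric.sphere 0 R)) :
    halfCircle 1 R f + halfCircle (-1) R f = ∮ z in C(0, R), f z := by
  have hc : Continuous fun τ : ℝ => deriv (circleMap 0 R) τ • f (circleMap 0 R τ) := by
    have h1 : Continuous fun τ : ℝ => f (circleMap 0 R τ) :=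
      hf.comp_continuous (continuous_circleMap 0 R) fun τ => circleMap_mem_sphere 0 hR τ
    have h2 : Continuous (deriv (circleMap 0 R)) := by
      have : deriv (circleMap 0 R) = fun τ => circleMap 0 R τ * I := by
        ext τ; simp
      rw [this]
      exact (continuous_circleMap 0 R).mul continuous_const
    exact h2.smul h1
  rw [circleIntegral, ← integral_add_adjacent_intervals (b := π)
    (hc.intervalIntegrable _ _) (hc.intervalIntegrable _ _)]
  congr 1
  · refine integral_congr fun τ _ => ?_
    simp [circleMap, mul_assoc]
  · have h := intervalIntegral.integral_comp_add_right (a := 0) (b := π)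
      (fun τ : ℝ => deriv (circleMap 0 R) τ • f (circleMap 0 R τ)) π
    rw [zero_add, ← two_mul] at h
    rw [← h]
    refine integral_congr fun τ _ => ?_
    simp [circleMap, add_mul, exp_add, mul_assoc]

variable (Γ : CutContour) {t₁ t₂ σ s R : ℝ}

/-- The integral over the parts of the cuts in the disc of radius `R`, from left to right. -/
noncomputable def cutIntegral (R : ℝ) (f : ℂ → E) : E :=
  (∫ x in (-R)..(-Γ.left), f x) + ∫ x in Γ.right..R, f x

/-- The integral over the arc of `γ₀` in the half-plane `± Im z ≥ 0`. -/
noncomputable def arcIntegral (t₁ t₂ σ s : ℝ) (f : ℂ → E) : E :=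
  (∫ t in (if s = σ then t₁ else 0)..(if s = σ then t₂ else t₁), deriv Γ.c t • f (Γ.c t)) +
    ∫ t in t₂..(if s = σ then t₂ else 1), deriv Γ.c t • f (Γ.c t)

variable {Γ}

lemma IsCrossing.eq_or (h : Γ.IsCrossing t₁ t₂ σ) (hs : IsSign s) :
    s = σ ∨ (s = -σ ∧ s ≠ σ) := by
  rcases h.sign with rfl | rfl <;> rcases hs with rfl | rfl <;> norm_num

/-- The parameter intervals of the arcs of `γ₀` in the half-plane `± Im z ≥ 0`. -/
lemma IsCrossing.arc_bounds (h : Γ.IsCrossing t₁ t₂ σ) (s : ℝ) :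
    (0 ≤ (if s = σ then t₁ else 0) ∧ (if s = σ then t₁ else 0) ≤ (if s = σ then t₂ else t₁) ∧
      (if s = σ then t₂ else t₁) ≤ 1) ∧
    0 ≤ t₂ ∧ t₂ ≤ (if s = σ then t₂ else 1) ∧ (if s = σ then t₂ else 1) ≤ 1 := by
  have h1 := h.nonneg
  have h2 := h.lt
  have h3 := h.lt_one
  split_ifs <;> grind

/-- The curve `γ₀` lies in the disc of radius `R`. -/
abbrev Within (Γ : CutContour) (R : ℝ) : Prop := ∀ t ∈ Icc (0 : ℝ) 1, ‖Γ.c t‖ < R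

lemma norm_lt_of_arcStart (hR : Γ.Within R) : Γ.left < R ∧ Γ.right < R := by
  have hex : ∀ x : ℂ, x ∈ ({-(Γ.left : ℂ), (Γ.right : ℂ)} : Set ℂ) → ‖x‖ < R := by
    intro x hx
    rw [← Γ.meets_real] at hx
    obtain ⟨⟨t, ht, rfl⟩, -⟩ := hx
    exact hR t ht
  have h1 := hex _ (.inl rfl)
  have h2 := hex _ (.inr rfl)
  rw [norm_neg, norm_real, norm_of_nonneg Γ.left_pos.le] at h1
  rw [norm_real, norm_of_nonneg Γ.right_pos.le] at h2
  exact ⟨h1, h2⟩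

/-- The closed chain which consists of the arc of `γ₀` in a closed half-plane, of the parts of the
cuts in the disc of radius `R`, and of the half circle of radius `R`. -/
noncomputable def halfChain (h : Γ.IsCrossing t₁ t₂ σ) (hs : IsSign s)
    (hR : Γ.Within R) : ClosedChain 5 where
  k := ![1, 1, -s, -s, -1]
  a := ![if s = σ then t₁ else 0, t₂, -R, Γ.right, 0]
  b := ![if s = σ then t₂ else t₁, if s = σ then t₂ else 1, -Γ.left, R, π]
  c := ![Γ.c, Γ.c, fun x => x, fun x => x, fun τ => (s * R : ℝ) * exp (τ * I)]
  v := ![deriv Γ.c, deriv Γ.c, fun _ => 1, fun _ => 1,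
    fun τ => (s * R : ℝ) * (exp (τ * I) * I)]
  le i := by
    have := norm_lt_of_arcStart hR
    have hb := h.arc_bounds s
    fin_cases i
    · exact hb.1.2.1
    · exact hb.2.2.1
    · simp; linarith
    · simp; linarith
    · exact pi_pos.le
  cont i := by
    have hb := h.arc_bounds s
    have hc := Γ.piecewiseC1.regular.1
    fin_cases i
    · exact hc.mono (Icc_subset_Icc hb.1.1 hb.1.2.2)
    · exact hc.mono (Icc_subset_Icc hb.2.1 hb.2.2.2)
    · exact continuous_ofReal.continuousOn
    · exact continuous_ofReal.continuousOn
    · refine Continuous.continuousOn ?_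
      change Continuous fun τ : ℝ => ((s * R : ℝ) * exp (τ * I) : ℂ)
      fun_prop
  hasDerivAt i := by
    have hb := h.arc_bounds s
    obtain ⟨-, -, S, hS, hd⟩ := Γ.piecewiseC1.regular
    fin_cases i
    · exact ⟨S, hS, fun t ht => hd t ⟨Ioo_subset_Ioo hb.1.1 hb.1.2.2 ht.1, ht.2⟩⟩
    · exact ⟨S, hS, fun t ht => hd t ⟨Ioo_subset_Ioo hb.2.1 hb.2.2.2 ht.1, ht.2⟩⟩
    · exact ⟨∅, countable_empty, fun t _ => (hasDerivAt_id t).ofReal_comp⟩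
    · exact ⟨∅, countable_empty, fun t _ => (hasDerivAt_id t).ofReal_comp⟩
    · refine ⟨∅, countable_empty, fun t _ => ?_⟩
      have h1 : HasDerivAt (fun τ : ℝ => (τ : ℂ) * I) I t := by
        simpa using ((hasDerivAt_id t).ofReal_comp).mul_const I
      exact h1.cexp.const_mul _
  integrable i := by
    obtain ⟨⟨b1, b2, b3⟩, b4, b5, b6⟩ := h.arc_bounds s
    have hi := Γ.piecewiseC1.regular.2.1
    have hsub : ∀ {a b : ℝ}, 0 ≤ a → a ≤ b → b ≤ 1 →
        IntervalIntegrable (deriv Γ.c) volume a b := fun h1 h2 h3 => hi.mono_set (by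
      rw [uIcc_of_le h2, uIcc_of_le zero_le_one]
      exact Icc_subset_Icc h1 h3)
    fin_cases i
    · exact hsub b1 b2 b3
    · exact hsub b4 b5 b6
    · exact intervalIntegrable_const
    · exact intervalIntegrable_const
    · refine Continuous.intervalIntegrable ?_ _ _
      change Continuous fun τ : ℝ => ((s * R : ℝ) * (exp (τ * I) * I) : ℂ)
      fun_prop
  closed F := by
    have hne : (-1 : ℝ) ≠ 1 := by norm_num
    have e1 := h.left_eq
    have e2 := h.right_eq
    have e3 := Γ.closed
    have hr : σ = 1 ∨ σ = -1 := h.sign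
    rcases h.eq_or hs with rfl | ⟨h1, h2⟩
    · rcases hr with rfl | rfl <;>
        simp [Fin.sum_univ_five, e1, e2, arcStart, hne, Complex.exp_pi_mul_I]
    · rcases hr with rfl | rfl <;>
        simp [Fin.sum_univ_five, e1, e2, e3, arcStart, hne, Complex.exp_pi_mul_I, h1, hne.symm]

lemma halfChain_integral [CompleteSpace E] (h : Γ.IsCrossing t₁ t₂ σ) (hs : IsSign s)
    (hR : Γ.Within R) (f : ℂ → E) :
    (halfChain h hs hR).integral f =
      Γ.arcIntegral t₁ t₂ σ s f - (s : ℂ) • Γ.cutIntegral R f - halfCircle s R f := by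
  simp only [ClosedChain.integral, halfChain, Fin.sum_univ_five, arcIntegral, cutIntegral,
    halfCircle]
  simp
  abel

/-- The curve `γ₀` as a closed chain. -/
noncomputable def loopChain (Γ : CutContour) : ClosedChain 1 where
  k := fun _ => 1
  a := fun _ => 0
  b := fun _ => 1
  c := fun _ => Γ.c
  v := fun _ => deriv Γ.c
  le _ := zero_le_one
  cont _ := Γ.piecewiseC1.regular.1
  hasDerivAt _ := Γ.piecewiseC1.regular.2.2
  integrable _ := Γ.piecewiseC1.regular.2.1
  closed F := by simp [Γ.closed]

lemma carrier_loopChain : Γ.loopChain.carrier = Γ.c '' Icc 0 1 := by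
  simp only [ClosedChain.carrier, loopChain]
  exact iUnion_const _

lemma mem_interior_iff {w : ℂ} : w ∈ Γ.interior ↔
    w ∉ Γ.loopChain.carrier ∧ Γ.loopChain.winding w = 2 * π * I := by
  have h2 : (2 * π * I : ℂ) ≠ 0 := by simp [Real.pi_ne_zero]
  have e : windingNum Γ.c w = (2 * π * I)⁻¹ * Γ.loopChain.winding w := by
    simp [windingNum, ClosedChain.winding, ClosedChain.integral, loopChain, div_eq_mul_inv]
  rw [CutContour.interior, mem_ofPred_eq, carrier_loopChain, e, inv_mul_eq_iff_eq_mul₀ h2, mul_one]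

lemma isOpen_interior : IsOpen Γ.interior := by
  rw [isOpen_iff_mem_nhds]
  intro w hw
  obtain ⟨h1, h2⟩ := mem_interior_iff.1 hw
  filter_upwards [Γ.loopChain.eventually_winding_eq h1,
    Γ.loopChain.isCompact_carrier.isClosed.isOpen_compl.mem_nhds h1] with z hz hz'
  exact mem_interior_iff.2 ⟨hz', hz.trans h2⟩

lemma loop_winding_eq_zero {w : ℂ} (hw : Γ.Within ‖w‖) :
    Γ.loopChain.winding w = 0 := by
  refine Γ.loopChain.winding_eq_zero_of_norm_lt fun z hz => ?_
  rw [carrier_loopChain] at hz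
  obtain ⟨t, ht, rfl⟩ := hz
  exact hw t ht

lemma notMem_interior_of_winding {w : ℂ} (h : Γ.loopChain.winding w = 0) : w ∉ Γ.interior :=
  fun hw => by
    have := (mem_interior_iff.1 hw).2
    rw [h] at this
    simp [Real.pi_ne_zero] at this

lemma norm_lt_of_mem_interior (hR : Γ.Within R) {w : ℂ}
    (hw : w ∈ Γ.interior) : ‖w‖ < R := by
  by_contra! h
  exact notMem_interior_of_winding (loop_winding_eq_zero fun t ht => (hR t ht).trans_le h) hw

/-- The cuts lie outside the curve `γ₀`. -/
lemma notMem_interior_of_mem_cut {x : ℝ} (hx : x ∈ Γ.cut) : (x : ℂ) ∉ Γ.interior := by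
  by_cases hxc : (x : ℂ) ∈ Γ.c '' Icc 0 1
  · exact fun h => h.1 hxc
  obtain ⟨R, hR0, hR⟩ := Γ.loopChain.exists_norm_lt
  have hreal : ∀ y : ℝ, (y : ℂ) ∈ Γ.loopChain.carrier → y = -Γ.left ∨ y = Γ.right := fun y hy => by
    rw [carrier_loopChain] at hy
    have : (y : ℂ) ∈ {z ∈ Γ.c '' Icc 0 1 | z.im = 0} := ⟨hy, ofReal_im y⟩
    rw [Γ.meets_real] at this
    rcases this with h | h
    · exact Or.inl (by exact_mod_cast h)
    · exact Or.inr (by exact_mod_cast mem_singleton_iff.1 h)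
  -- the winding number is constant along a ray outside the curve
  have hconst : ∀ S : Set ℝ, IsOpen S → IsPreconnected S →
      (∀ y ∈ S, y ≠ -Γ.left ∧ y ≠ Γ.right) → ∀ y ∈ S, ∀ z ∈ S,
      Γ.loopChain.winding y = Γ.loopChain.winding z := by
    intro S hS hS' hne y hy z hz
    have hd : ∀ u ∈ S, HasDerivAt (fun u : ℝ => Γ.loopChain.winding u) 0 u := fun u hu => by
      have hu' : (u : ℂ) ∉ Γ.loopChain.carrier := fun h =>
        (hreal u h).elim (hne u hu).1 (hne u hu).2
      exact (hasDerivAt_const u _).congr_of_eventuallyEq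
        (continuous_ofReal.continuousAt.eventually (Γ.loopChain.eventually_winding_eq hu'))
    exact hS.is_const_of_deriv_eq_zero hS'
      (fun u hu => (hd u hu).differentiableAt.differentiableWithinAt)
      (fun u hu => (hd u hu).deriv) hy hz
  have hlp := Γ.left_pos
  have hrp := Γ.right_pos
  have hcar : Γ.Within R := fun t ht =>
    hR _ (by rw [carrier_loopChain]; exact ⟨t, ht, rfl⟩)
  obtain ⟨hl, hr⟩ := norm_lt_of_arcStart hcar
  have hxe : ∀ y : ℝ, (y = -Γ.left ∨ y = Γ.right) → (y : ℂ) ∈ Γ.c '' Icc 0 1 := fun y hy => by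
    have : (y : ℂ) ∈ {z ∈ Γ.c '' Icc 0 1 | z.im = 0} := by
      rw [Γ.meets_real]
      rcases hy with rfl | rfl <;> simp
    exact this.1
  refine notMem_interior_of_winding ?_
  rcases hx with hx | hx
  · have hlt : x < -Γ.left := lt_of_le_of_ne hx fun h => hxc (hxe x (.inl h))
    rw [hconst (Iio (-Γ.left)) isOpen_Iio isPreconnected_Iio (fun y hy => ⟨(mem_Iio.1 hy).ne,
      ((mem_Iio.1 hy).trans (by linarith)).ne⟩) x hlt (-R) (by rw [mem_Iio]; linarith)]
    refine loop_winding_eq_zero fun t ht => (hcar t ht).trans_eq ?_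
    rw [norm_real, norm_neg, norm_of_nonneg hR0.le]
  · have hlt : Γ.right < x := lt_of_le_of_ne hx fun h => hxc (hxe x (.inr h.symm))
    rw [hconst (Ioi Γ.right) isOpen_Ioi isPreconnected_Ioi (fun y hy => ⟨
      ((by linarith : -Γ.left < Γ.right).trans (mem_Ioi.1 hy)).ne', (mem_Ioi.1 hy).ne'⟩) x hlt R hr]
    refine loop_winding_eq_zero fun t ht => (hcar t ht).trans_eq ?_
    rw [norm_real, norm_of_nonneg hR0.le]

/-- The points of the chain lie in the closed half-plane, outside the interior of `γ₀`. -/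
lemma halfChain_carrier (h : Γ.IsCrossing t₁ t₂ σ) (hs : IsSign s)
    (hR : Γ.Within R) :
    (halfChain h hs hR).carrier ⊆ closedHalfPlane s \ Γ.interior := by
  have h1 := h.nonneg
  have h2 := h.lt
  have h3 := h.lt_one
  have im1 : (Γ.c t₁).im = 0 := by rw [h.left_eq]; exact ofReal_im _
  have im2 : (Γ.c t₂).im = 0 := by rw [h.right_eq]; exact ofReal_im _
  have hR0 : 0 ≤ R := (norm_nonneg _).trans (hR 0 ⟨le_rfl, zero_le_one⟩).le
  have hint : ∀ t ∈ Icc (0 : ℝ) 1, Γ.c t ∉ Γ.interior := fun t ht hi => hi.1 ⟨t, ht, rfl⟩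
  have hreal : ∀ y : ℝ, (y : ℂ) ∈ closedHalfPlane s := fun y => by simp [closedHalfPlane]
  refine iUnion_subset fun i => ?_
  rintro _ ⟨t, ht, rfl⟩
  fin_cases i
  · rcases h.eq_or hs with rfl | ⟨rfl, hne⟩
    · have ht' : t ∈ Icc t₁ t₂ := by simpa [halfChain] using ht
      exact ⟨Γ.mem_closedHalfPlane h1 h2.le h3.le h.inner (fun e => im1) t ht',
        hint t ⟨h1.trans ht'.1, ht'.2.trans h3.le⟩⟩
    · have ht' : t ∈ Icc 0 t₁ := by simpa [halfChain, hne] using ht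
      exact ⟨Γ.mem_closedHalfPlane le_rfl h1 (h2.le.trans h3.le)
        (fun u hu => h.outer u (.inl hu)) (fun e => by have := im1; rwa [← e] at this) t ht',
        hint t ⟨ht'.1, ht'.2.trans (h2.le.trans h3.le)⟩⟩
  · rcases h.eq_or hs with rfl | ⟨rfl, hne⟩
    · have ht' : t = t₂ := by simpa [halfChain] using ht
      subst ht'
      refine ⟨?_, hint t ⟨h1.trans h2.le, h3.le⟩⟩
      change 0 ≤ s * (Γ.c t).im
      rw [im2, mul_zero]
    · have ht' : t ∈ Icc t₂ 1 := by simpa [halfChain, hne] using ht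
      exact ⟨Γ.mem_closedHalfPlane (h1.trans h2.le) h3.le le_rfl
        (fun u hu => h.outer u (.inr hu)) (fun e => im2) t ht',
        hint t ⟨h1.trans (h2.le.trans ht'.1), ht'.2⟩⟩
  · have ht' : t ∈ Icc (-R) (-Γ.left) := by simpa [halfChain] using ht
    exact ⟨hreal t, notMem_interior_of_mem_cut (.inl ht'.2)⟩
  · have ht' : t ∈ Icc Γ.right R := by simpa [halfChain] using ht
    exact ⟨hreal t, notMem_interior_of_mem_cut (.inr ht'.1)⟩
  · have ht' : t ∈ Icc 0 π := by simpa [halfChain] using ht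
    change ((s * R : ℝ) * exp (t * I) : ℂ) ∈ _
    constructor
    · change 0 ≤ s * _
      rw [im_ofReal_mul, Complex.exp_ofReal_mul_I_im, ← mul_assoc, ← mul_assoc,
        sign_mul_self hs, one_mul]
      exact mul_nonneg hR0 (Real.sin_nonneg_of_mem_Icc ht')
    · intro hi
      have := norm_lt_of_mem_interior hR hi
      rw [norm_mul, Complex.norm_exp_ofReal_mul_I, mul_one, norm_real, norm_mul,
        norm_of_nonneg hR0] at this
      rcases hs with rfl | rfl <;> simp at this

end CutContour

namespace CutContour

open QuadPencil

variable {E : Type*} [NormedAddCommGroup E] [NormedSpace ℂ E] {Γ : CutContour} {t₁ t₂ σ s R : ℝ}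
  (h : Γ.IsCrossing t₁ t₂ σ)

/-- The integral along `γ₀` is the sum of the integrals along the two arcs. -/
lemma arcIntegral_add [CompleteSpace E] (hR : Γ.Within R) {f : ℝ → ℂ → E} {F : ℂ → E}
    (hF : ∀ s, IsSign s → ∀ z ∈ halfPlane s, z ∉ Γ.interior → F z = f s z)
    (hf : ∀ (s : ℝ) (hs : IsSign s), ContinuousOn (f s) (halfChain h hs hR).carrier) :
    IntervalIntegrable (fun t => deriv Γ.c t • F (Γ.c t)) volume 0 1 ∧
      ∫ t in (0 : ℝ)..1, deriv Γ.c t • F (Γ.c t) =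
        Γ.arcIntegral t₁ t₂ σ 1 (f 1) + Γ.arcIntegral t₁ t₂ σ (-1) (f (-1)) := by
  have h1 := h.nonneg
  have h2 := h.lt
  have h3 := h.lt_one
  have hint : ∀ t ∈ Icc (0 : ℝ) 1, Γ.c t ∉ Γ.interior := fun t ht hi => hi.1 ⟨t, ht, rfl⟩
  have hσ' : -σ = 1 ∨ -σ = -1 := by rcases h.sign with e | e <;> simp [e]
  have hne : -σ ≠ σ := by rcases h.sign with e | e <;> norm_num [e]
  have i0 := (halfChain h hσ' hR).intervalIntegrable_smul (hf _ hσ') 0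
  have i1 := (halfChain h h.sign hR).intervalIntegrable_smul (hf _ h.sign) 0
  have i2 := (halfChain h hσ' hR).intervalIntegrable_smul (hf _ hσ') 1
  simp [halfChain, hne] at i0 i1 i2
  have e0 : EqOn (fun t => deriv Γ.c t • f (-σ) (Γ.c t)) (fun t => deriv Γ.c t • F (Γ.c t))
      (Ioo 0 t₁) := fun t ht => by
    simp only [hF _ hσ' _ (h.outer t (.inl ht)) (hint t ⟨ht.1.le, by linarith [ht.2]⟩)]
  have e1 : EqOn (fun t => deriv Γ.c t • f σ (Γ.c t)) (fun t => deriv Γ.c t • F (Γ.c t))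
      (Ioo t₁ t₂) := fun t ht => by
    simp only [hF _ h.sign _ (h.inner t ht) (hint t ⟨by linarith [ht.1], by linarith [ht.2]⟩)]
  have e2 : EqOn (fun t => deriv Γ.c t • f (-σ) (Γ.c t)) (fun t => deriv Γ.c t • F (Γ.c t))
      (Ioo t₂ 1) := fun t ht => by
    simp only [hF _ hσ' _ (h.outer t (.inr ht)) (hint t ⟨by linarith [ht.1], ht.2.le⟩)]
  have key : ∀ {a b : ℝ} {g₁ g₂ : ℝ → E}, a ≤ b → EqOn g₁ g₂ (Ioo a b) →
      IntervalIntegrable g₁ volume a b →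
      IntervalIntegrable g₂ volume a b ∧ ∫ t in a..b, g₂ t = ∫ t in a..b, g₁ t := by
    intro a b g₁ g₂ hab he hi
    have hae : ∀ᵐ t, t ∈ uIoc a b → g₁ t = g₂ t := by
      rw [uIoc_of_le hab]
      have : ∀ᵐ t : ℝ, t ≠ b := by simp [ae_iff, measure_singleton]
      filter_upwards [this] with t ht ht'
      exact he ⟨ht'.1, lt_of_le_of_ne ht'.2 ht⟩
    exact ⟨hi.congr_ae ((ae_restrict_iff' measurableSet_uIoc).2 hae),
      (intervalIntegral.integral_congr_ae hae).symm⟩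
  obtain ⟨j0, k0⟩ := key h1 e0 i0
  obtain ⟨j1, k1⟩ := key h2.le e1 i1
  obtain ⟨j2, k2⟩ := key h3.le e2 i2
  refine ⟨(j0.trans j1).trans j2, ?_⟩
  rw [← integral_add_adjacent_intervals (j0.trans j1) j2,
    ← integral_add_adjacent_intervals j0 j1, k0, k1, k2]
  have hcomm : Γ.arcIntegral t₁ t₂ σ 1 (f 1) + Γ.arcIntegral t₁ t₂ σ (-1) (f (-1)) =
      Γ.arcIntegral t₁ t₂ σ σ (f σ) + Γ.arcIntegral t₁ t₂ σ (-σ) (f (-σ)) := by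
    rcases h.sign with rfl | rfl
    · rfl
    · rw [neg_neg, add_comm]
  rw [hcomm, arcIntegral, arcIntegral]
  simp only [if_true, if_neg hne, integral_same, add_zero]
  abel

variable (hs : IsSign s) (hR : Γ.Within R)

lemma halfChain_winding_opposite {w : ℂ} (hw : s * w.im < 0) :
    (halfChain h hs hR).winding w = 0 := by
  set X := halfChain h hs hR
  obtain ⟨r, hr0, hr⟩ := X.exists_norm_lt
  have hopen : IsOpen {z : ℂ | s * z.im < 0} :=
    isOpen_lt (continuous_const.mul continuous_im) continuous_const
  have hconv : Convex ℝ {z : ℂ | s * z.im < 0} := by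
    intro z hz z' hz' a b ha hb hab
    simp only [mem_ofPred_eq, add_im, Complex.real_smul, im_ofReal_mul] at hz hz' ⊢
    rcases ha.eq_or_lt with rfl | ha
    · have : b = 1 := by linarith
      subst this; simpa using hz'
    · nlinarith
  have hd : ∀ z ∈ {z : ℂ | s * z.im < 0}, HasDerivAt X.winding 0 z := fun z hz =>
    (hasDerivAt_const z _).congr_of_eventuallyEq (X.eventually_winding_eq fun hX =>
      absurd (halfChain_carrier h hs hR hX).1 fun hle : 0 ≤ s * z.im => not_le.2 hz hle)
  have hmem : (-(s * r) : ℝ) * I ∈ {z : ℂ | s * z.im < 0} := by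
    simp only [mem_ofPred_eq, im_ofReal_mul, I_im]
    have := sign_mul_self hs
    nlinarith
  rw [hopen.is_const_of_deriv_eq_zero hconv.isPreconnected
    (fun z hz => (hd z hz).differentiableAt.differentiableWithinAt) (fun z hz => (hd z hz).deriv)
    hw hmem]
  refine X.winding_eq_zero_of_norm_lt fun z hz => (hr z hz).trans_eq ?_
  rw [norm_mul, norm_I, mul_one, norm_real, norm_neg, norm_mul,
    norm_of_nonneg hr0.le]
  rcases hs with rfl | rfl <;> simp

lemma notMem_halfChain {w : ℂ} (him : w.im ≠ 0) (hwR : ‖w‖ < R)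
    (hc : w ∉ Γ.loopChain.carrier) : w ∉ (halfChain h hs hR).carrier := by
  intro hX
  obtain ⟨i, t, ht, e⟩ := mem_iUnion.1 hX
  have hsub : ∀ t ∈ Icc (0 : ℝ) 1, Γ.c t ≠ w := fun t ht e => hc (by
    rw [carrier_loopChain]; exact ⟨t, ht, e⟩)
  have hb := h.arc_bounds s
  fin_cases i
  · exact hsub t ⟨hb.1.1.trans ht.1, ht.2.trans hb.1.2.2⟩ e
  · exact hsub t ⟨hb.2.1.trans ht.1, ht.2.trans hb.2.2.2⟩ e
  · exact him (by rw [← e]; exact ofReal_im t)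
  · exact him (by rw [← e]; exact ofReal_im t)
  · have hR0 : 0 < R := (norm_nonneg w).trans_lt hwR
    have e' : ((s * R : ℝ) * exp (t * I) : ℂ) = w := e
    rw [← e', norm_mul, Complex.norm_exp_ofReal_mul_I, mul_one, norm_real, norm_mul,
      norm_of_nonneg hR0.le] at hwR
    rcases hs with rfl | rfl <;> simp at hwR

lemma halfChain_winding {w : ℂ} (hw : w ∈ halfPlane s) (hwR : ‖w‖ < R)
    (hc : w ∉ Γ.loopChain.carrier) :
    (halfChain h hs hR).winding w = Γ.loopChain.winding w - 2 * π * I := by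
  have hs' : -s = 1 ∨ -s = -1 := by rcases hs with e | e <;> simp [e]
  have hw0 : 0 < s * w.im := hw
  have him := im_ne_zero_of_mem hw
  have hR0 : 0 < R := (norm_nonneg w).trans_lt hwR
  have hopp : (halfChain h hs' hR).winding w = 0 :=
    halfChain_winding_opposite h hs' hR (by linarith)
  have hcar := fun (u : ℝ) (hu : IsSign u) => notMem_halfChain h hu hR him hwR hc
  have hsum : (halfChain h (.inl rfl) hR).winding w + (halfChain h (.inr rfl) hR).winding w =
      Γ.loopChain.winding w - 2 * π * I := by
    have hsph : ContinuousOn (fun z => (z - w)⁻¹) (Metric.sphere (0 : ℂ) R) :=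
      (continuousOn_id.sub continuousOn_const).inv₀ fun z hz => sub_ne_zero.2 fun (e : z = w) => by
        rw [mem_sphere_zero_iff_norm, e] at hz
        exact hwR.ne hz
    have hcirc := halfCircle_add hR0.le hsph
    rw [circleIntegral.integral_sub_inv_of_mem_ball (by simpa using hwR)] at hcirc
    have harc := (arcIntegral_add h hR (f := fun _ z => (z - w)⁻¹) (F := fun z => (z - w)⁻¹)
      (fun _ _ _ _ _ => rfl) fun u hu => ClosedChain.continuousOn_inv_sub _ (hcar u hu)).2
    have hloop : Γ.loopChain.winding w = ∫ t in (0 : ℝ)..1, deriv Γ.c t • (Γ.c t - w)⁻¹ := by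
      simp [ClosedChain.winding, ClosedChain.integral, loopChain]
    rw [ClosedChain.winding, ClosedChain.winding, halfChain_integral, halfChain_integral, hloop,
      harc, ← hcirc]
    simp only [Complex.ofReal_one, Complex.ofReal_neg, one_smul, neg_smul]
    ring
  rcases hs with rfl | rfl
  · rw [← hsum, left_eq_add]; exact hopp
  · rw [← hsum, right_eq_add]
    simp only [neg_neg] at hopp
    exact hopp

lemma halfChain_winding_interior {w : ℂ} (hw : w ∈ Γ.interior) :
    (halfChain h hs hR).winding w = 0 := by
  rcases lt_trichotomy (s * w.im) 0 with hlt | heq | hgt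
  · exact halfChain_winding_opposite h hs hR hlt
  · have hwX : w ∉ (halfChain h hs hR).carrier := fun hX => (halfChain_carrier h hs hR hX).2 hw
    -- approximate a real point from the opposite half-plane
    have ht : Tendsto (fun δ : ℝ => w - (s * δ : ℝ) * I) (𝓝[>] 0) (𝓝 w) := by
      have : Continuous fun δ : ℝ => w - (s * δ : ℝ) * I := by fun_prop
      have h2 := this.tendsto 0
      simp only [mul_zero, ofReal_zero, zero_mul, sub_zero] at h2
      exact h2.mono_left nhdsWithin_le_nhds
    obtain ⟨δ, hδ, hδ0⟩ := ((ht.eventually ((halfChain h hs hR).eventually_winding_eq hwX)).and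
      self_mem_nhdsWithin).exists
    rw [← hδ]
    refine halfChain_winding_opposite h hs hR ?_
    have h3 : (w - (s * δ : ℝ) * I).im = w.im - s * δ := by simp
    rw [h3, mul_sub, heq, ← mul_assoc, sign_mul_self hs]
    have : 0 < δ := hδ0
    linarith
  · obtain ⟨h1, h2⟩ := mem_interior_iff.1 hw
    rw [halfChain_winding h hs hR hgt (norm_lt_of_mem_interior hR hw) h1, h2, sub_self]

/-- Cauchy's theorem in a closed half-plane for functions which are continuous up to the boundary.
The proof applies it to the functions `f (· ± i ε)`. -/
theorem halfChain_integral_eq_zero [CompleteSpace E] {K : Set ℂ} (hK : IsClosed K)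
    (hKi : K ∩ closedHalfPlane s ⊆ Γ.interior) {f : ℂ → E}
    (hfc : ContinuousOn f (closedHalfPlane s \ K)) (hfd : DifferentiableOn ℂ f (halfPlane s \ K)) :
    (halfChain h hs hR).integral f = 0 := by
  set X := halfChain h hs hR with hX
  have hXs := halfChain_carrier h hs hR
  set K' := K ∩ closedHalfPlane s with hK'
  have hK'c : IsClosed K' := hK.inter (isClosed_closedHalfPlane s)
  have hK'k : IsCompact K' := by
    refine Metric.isCompact_of_isClosed_isBounded hK'c
      ((Metric.isBounded_closedBall (x := (0 : ℂ)) (r := R)).subset fun w hw => ?_)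
    rw [mem_closedBall_zero_iff]
    exact (norm_lt_of_mem_interior hR (hKi hw)).le
  obtain ⟨δ₁, hδ₁, hth₁⟩ := hK'k.exists_thickening_subset_open isOpen_interior hKi
  obtain ⟨δ₂, hδ₂, hth₂⟩ := X.isCompact_carrier.exists_thickening_subset_open hK'c.isOpen_compl
    fun z hz hz' => (hXs hz).2 (hKi hz')
  set sh : ℝ → ℂ → ℂ := fun ε z => z + (s * ε : ℝ) * I with hsh
  have him : ∀ ε z, s * (sh ε z).im = s * z.im + ε := fun ε z => by
    simp only [hsh, add_im, im_ofReal_mul, I_im, mul_one]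
    rw [mul_add, ← mul_assoc, sign_mul_self hs, one_mul]
  have hdist : ∀ ε z, 0 ≤ ε → dist (sh ε z) z = ε := fun ε z hε => by
    rw [dist_eq_norm]
    simp only [hsh, add_sub_cancel_left, norm_mul, norm_I, mul_one, norm_real]
    rw [norm_of_nonneg hε]
    rcases hs with rfl | rfl <;> simp
  set δ := min δ₁ δ₂ with hδ
  have hδ0 : 0 < δ := lt_min hδ₁ hδ₂
  have hmem : ∀ z ∈ X.carrier, ∀ ε, 0 ≤ ε → ε < δ → sh ε z ∈ closedHalfPlane s \ K := by
    intro z hz ε h0 h1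
    have hc : sh ε z ∈ closedHalfPlane s := by
      change 0 ≤ s * _
      rw [him]
      have : 0 ≤ s * z.im := (hXs hz).1
      linarith
    refine ⟨hc, fun hK => ?_⟩
    refine hth₂ (Metric.mem_thickening_iff.2 ⟨z, hz, ?_⟩ : sh ε z ∈ _) ⟨hK, hc⟩
    rw [hdist _ _ h0]
    exact h1.trans_le (min_le_right _ _)
  have hzero : ∀ ε, 0 < ε → ε < δ → X.integral (fun z => f (sh ε z)) = 0 := by
    intro ε h0 h1
    have hshc : Continuous (sh ε) := by fun_prop
    have hopen : IsOpen (sh ε ⁻¹' (halfPlane s \ K)) :=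
      ((isOpen_halfPlane s).sdiff hK).preimage hshc
    refine X.integral_eq_zero hopen (fun z hz => ?_) (fun w hw => ?_)
      (hfd.comp (by fun_prop) fun z hz => hz)
    · refine ⟨?_, (hmem z hz ε h0.le h1).2⟩
      change 0 < s * _
      rw [him]
      have : 0 ≤ s * z.im := (hXs hz).1
      linarith
    · by_cases hw1 : sh ε w ∈ halfPlane s
      · have hwK : sh ε w ∈ K := by
          by_contra hc
          exact hw ⟨hw1, hc⟩
        refine halfChain_winding_interior h hs hR (hth₁ (Metric.mem_thickening_iff.2
          ⟨sh ε w, ⟨hwK, halfPlane_subset_closed s hw1⟩, ?_⟩))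
        rw [dist_comm, hdist _ _ h0.le]
        exact h1.trans_le (min_le_left _ _)
      · refine halfChain_winding_opposite h hs hR ?_
        have : ¬ 0 < s * (sh ε w).im := hw1
        rw [him] at this
        linarith
  -- a compact tube around the chain
  have htube : IsCompact ((fun p : ℝ × ℂ => sh p.1 p.2) '' (Icc 0 (δ / 2) ×ˢ X.carrier)) := by
    refine (isCompact_Icc.prod X.isCompact_carrier).image ?_
    simp only [hsh]
    fun_prop
  obtain ⟨B, hB⟩ := htube.exists_bound_of_continuousOn (hfc.mono (by
    rintro _ ⟨p, hp, rfl⟩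
    exact hmem _ hp.2 _ hp.1.1 (by linarith [hp.1.2])))
  have hB' : ∀ z ∈ X.carrier, ∀ ε, 0 ≤ ε → ε ≤ δ / 2 → ‖f (sh ε z)‖ ≤ B := fun z hz ε h0 h1 =>
    hB _ ⟨(ε, z), ⟨⟨h0, h1⟩, hz⟩, rfl⟩
  have hsmall : ∀ᶠ ε in 𝓝[>] (0 : ℝ), 0 < ε ∧ ε ≤ δ / 2 := by
    filter_upwards [self_mem_nhdsWithin, nhdsWithin_le_nhds (Iic_mem_nhds (half_pos hδ0))]
      with ε h0 h1 using ⟨h0, h1⟩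
  have hlim : Tendsto (fun ε => X.integral fun z => f (sh ε z)) (𝓝[>] 0) (𝓝 (X.integral f)) := by
    refine tendsto_finsetSum _ fun i _ => Tendsto.const_smul ?_ _
    refine intervalIntegral.tendsto_integral_filter_of_dominated_convergence
      (fun t => ‖X.v i t‖ * B) ?_ ?_ ((X.integrable i).norm.mul_const B) ?_
    · filter_upwards [hsmall] with ε hε
      have hc : ContinuousOn (fun z => f (sh ε z)) X.carrier :=
        hfc.comp (by fun_prop) fun z hz => hmem z hz ε hε.1.le (by linarith [hε.2])
      exact (intervalIntegrable_iff.1 (X.intervalIntegrable_smul hc i)).aestronglyMeasurable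
    · filter_upwards [hsmall] with ε hε
      refine ae_of_all _ fun t ht => ?_
      rw [uIoc_of_le (X.le i)] at ht
      rw [norm_smul]
      exact mul_le_mul_of_nonneg_left (hB' _ (X.mem_carrier (Ioc_subset_Icc_self ht)) ε hε.1.le
        hε.2)
        (norm_nonneg _)
    · refine ae_of_all _ fun t ht => Tendsto.const_smul ?_ _
      rw [uIoc_of_le (X.le i)] at ht
      have hz := X.mem_carrier (Ioc_subset_Icc_self ht)
      have h0 : sh 0 (X.c i t) = X.c i t := by simp [hsh]
      have hz0 := hmem _ hz 0 le_rfl hδ0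
      rw [h0] at hz0
      refine (hfc _ hz0).tendsto.comp (tendsto_nhdsWithin_iff.2 ⟨?_, ?_⟩)
      · have hcont : Continuous fun ε => sh ε (X.c i t) := by simp only [hsh]; fun_prop
        have := hcont.tendsto 0
        rw [h0] at this
        exact this.mono_left nhdsWithin_le_nhds
      · filter_upwards [hsmall] with ε hε
        exact hmem _ hz ε hε.1.le (by linarith [hε.2])
  refine tendsto_nhds_unique hlim (tendsto_const_nhds.congr' ?_)
  filter_upwards [hsmall] with ε hε
  exact (hzero ε hε.1 (by linarith [hε.2])).symm

/-- Cauchy's formula in a closed half-plane, at a point between `γ₀` and the circle. -/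
theorem halfChain_integral_cauchy [CompleteSpace E] {K : Set ℂ} (hK : IsClosed K)
    (hKi : K ∩ closedHalfPlane s ⊆ Γ.interior) {f : ℂ → E}
    (hfc : ContinuousOn f (closedHalfPlane s \ K)) (hfd : DifferentiableOn ℂ f (halfPlane s \ K))
    {ρ : ℂ} (hρ : ρ ∈ halfPlane s) (hρR : ‖ρ‖ < R)
    (hρ0 : Γ.Within ‖ρ‖) :
    (halfChain h hs hR).integral (fun z => (z - ρ)⁻¹ • f z) = -(2 * π * I) • f ρ ∧
      ρ ∉ (halfChain h hs hR).carrier := by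
  set X := halfChain h hs hR
  have hρi : ρ ∉ Γ.interior := notMem_interior_of_winding (loop_winding_eq_zero hρ0)
  have hρK : ρ ∉ K := fun hk => hρi (hKi ⟨hk, halfPlane_subset_closed s hρ⟩)
  have hρl : ρ ∉ Γ.loopChain.carrier := fun hc => by
    rw [carrier_loopChain] at hc
    obtain ⟨t, ht, e⟩ := hc
    have := hρ0 t ht
    rw [e] at this
    exact lt_irrefl _ this
  have hw : X.winding ρ = -(2 * π * I) := by
    rw [halfChain_winding h hs hR hρ hρR hρl, loop_winding_eq_zero hρ0, zero_sub]
  have hρX : ρ ∉ X.carrier := notMem_halfChain h hs hR (im_ne_zero_of_mem hρ) hρR hρl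
  refine ⟨?_, hρX⟩
  have hnhds : halfPlane s \ K ∈ 𝓝 ρ := ((isOpen_halfPlane s).sdiff hK).mem_nhds ⟨hρ, hρK⟩
  have hsubset : halfPlane s \ K ⊆ closedHalfPlane s \ K :=
    sdiff_subset_sdiff_left (halfPlane_subset_closed s)
  have hz := halfChain_integral_eq_zero h hs hR hK hKi (f := dslope f ρ)
    ((continuousOn_dslope (mem_of_superset hnhds hsubset)).2
      ⟨hfc, (hfd ρ ⟨hρ, hρK⟩).differentiableAt hnhds⟩)
    ((differentiableOn_dslope hnhds).2 hfd)
  have hXsub : X.carrier ⊆ closedHalfPlane s \ K := fun z hz => by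
    obtain ⟨h1, h2⟩ := halfChain_carrier h hs hR hz
    exact ⟨h1, fun hk => h2 (hKi ⟨hk, h1⟩)⟩
  have hi := X.continuousOn_inv_sub hρX
  have c1 : ContinuousOn (fun z => (z - ρ)⁻¹ • f z) X.carrier := hi.smul (hfc.mono hXsub)
  have c2 : ContinuousOn (fun z => (z - ρ)⁻¹ • f ρ) X.carrier := hi.smul continuousOn_const
  have e : EqOn (dslope f ρ) (fun z => (z - ρ)⁻¹ • f z - (z - ρ)⁻¹ • f ρ) X.carrier :=
    fun z hz => by
      rw [dslope_of_ne _ fun (h : z = ρ) => hρX (h ▸ hz), slope, vsub_eq_sub, smul_sub]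
  rw [X.integral_congr e, X.integral_sub c1 c2, X.integral_smul_const, ← ClosedChain.winding, hw,
    sub_eq_zero] at hz
  exact hz

end CutContour

/-! ### The solutions at a fixed point as functions of the spectral parameter -/

namespace QuadPencil

/-- The solution `S*` of the adjoint equation with `S*(0) = 0`, `S*'(0) = I`. -/
noncomputable def sineStar (L : QuadPencil m) (ρ : ℂ) : (ℝ → CMat m) × (ℝ → CMat m) :=
  (fun x => ((L.transpose.sine ρ).1 x).transpose, fun x => ((L.transpose.sine ρ).2 x).transpose)

/-- The values at a point `x` of the solutions `φ, S, φ*, S*` and of their derivatives, and the Weyl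
matrices `M_±`, as functions of the spectral parameter. -/
structure Frame (m : ℕ) where
  p : ℂ → CMat m
  p' : ℂ → CMat m
  q : ℂ → CMat m
  q' : ℂ → CMat m
  ps : ℂ → CMat m
  ps' : ℂ → CMat m
  qs : ℂ → CMat m
  qs' : ℂ → CMat m
  M : ℝ → ℂ → CMat m

namespace Frame

/-- The Weyl solution `Φ = S + φ M`. -/
def w (W : Frame m) (s : ℝ) (ρ : ℂ) : CMat m := W.q ρ + W.p ρ * W.M s ρ

/-- The derivative of the Weyl solution. -/
def w' (W : Frame m) (s : ℝ) (ρ : ℂ) : CMat m := W.q' ρ + W.p' ρ * W.M s ρ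

/-- The Weyl solution `Φ* = S* + M φ*` of the adjoint equation. -/
def ws (W : Frame m) (s : ℝ) (ρ : ℂ) : CMat m := W.qs ρ + W.M s ρ * W.ps ρ

/-- The derivative of `Φ*`. -/
def ws' (W : Frame m) (s : ℝ) (ρ : ℂ) : CMat m := W.qs' ρ + W.M s ρ * W.ps' ρ

/-- The growth of `φ` and `φ*`. -/
structure GrowthBound (W : Frame m) (x R : ℝ) (ρ : ℂ) : Prop where
  p : ‖W.p ρ‖ ≤ R * Real.exp (|ρ.im| * x)
  p' : ‖W.p' ρ‖ ≤ R * ‖ρ‖ * Real.exp (|ρ.im| * x)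
  ps : ‖W.ps ρ‖ ≤ R * Real.exp (|ρ.im| * x)
  ps' : ‖W.ps' ρ‖ ≤ R * ‖ρ‖ * Real.exp (|ρ.im| * x)

/-- The decay of the Weyl solutions. -/
structure DecayBound (W : Frame m) (x R s : ℝ) (ρ : ℂ) : Prop where
  w : ‖W.w s ρ‖ ≤ R / ‖ρ‖ / Real.exp (|ρ.im| * x)
  w' : ‖W.w' s ρ‖ ≤ R / Real.exp (|ρ.im| * x)
  ws : ‖W.ws s ρ‖ ≤ R / ‖ρ‖ / Real.exp (|ρ.im| * x)
  ws' : ‖W.ws' s ρ‖ ≤ R / Real.exp (|ρ.im| * x)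

lemma GrowthBound.mono {W : Frame m} {x R R' : ℝ} {ρ : ℂ} (h : W.GrowthBound x R ρ) (hR : R ≤ R') :
    W.GrowthBound x R' ρ :=
  ⟨h.p.trans (by gcongr), h.p'.trans (by gcongr), h.ps.trans (by gcongr), h.ps'.trans (by gcongr)⟩

lemma DecayBound.mono {W : Frame m} {x R R' s : ℝ} {ρ : ℂ} (h : W.DecayBound x R s ρ)
    (hR : R ≤ R') : W.DecayBound x R' s ρ :=
  ⟨h.w.trans (by gcongr), h.w'.trans (by gcongr), h.ws.trans (by gcongr), h.ws'.trans (by gcongr)⟩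

/-- The algebraic and analytic properties of the values at `x` of the solutions: the solutions are
entire in the spectral parameter, their Wronskians are known, `M_±` is regular outside the compact
set `K`, and for `|ρ| ≥ R` the growth is that of the exponentials. The number `R` serves also as the
constant in these bounds. -/
structure IsRegular (W : Frame m) (x : ℝ) (K : Set ℂ) (R : ℝ) : Prop where
  dp : Differentiable ℂ W.p
  dp' : Differentiable ℂ W.p'
  dq : Differentiable ℂ W.q
  dq' : Differentiable ℂ W.q'
  dps : Differentiable ℂ W.ps
  dps' : Differentiable ℂ W.ps'
  dqs : Differentiable ℂ W.qs
  dqs' : Differentiable ℂ W.qs'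
  wr_pp : ∀ ρ, W.ps' ρ * W.p ρ - W.ps ρ * W.p' ρ = 0
  wr_pq : ∀ ρ, W.ps' ρ * W.q ρ - W.ps ρ * W.q' ρ = -1
  wr_qp : ∀ ρ, W.qs' ρ * W.p ρ - W.qs ρ * W.p' ρ = 1
  wr_qq : ∀ ρ, W.qs' ρ * W.q ρ - W.qs ρ * W.q' ρ = 0
  closed : IsClosed K
  contM : ∀ s, IsSign s → ContinuousOn (W.M s) (closedHalfPlane s \ K)
  diffM : ∀ s, IsSign s → DifferentiableOn ℂ (W.M s) (halfPlane s \ K)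
  one_le : 1 ≤ R
  growth : ∀ ρ, R ≤ ‖ρ‖ → W.GrowthBound x R ρ
  decay : ∀ s, IsSign s → ∀ ρ ∈ closedHalfPlane s, R ≤ ‖ρ‖ → W.DecayBound x R s ρ

end Frame

/-- The solutions of the pencil `L` at the point `x`. -/
noncomputable def frame (L : QuadPencil m) (M : ℝ → ℂ → CMat m) (x : ℝ) : Frame m where
  p ρ := (L.phi ρ).1 x
  p' ρ := (L.phi ρ).2 x
  q ρ := (L.sine ρ).1 x
  q' ρ := (L.sine ρ).2 x
  ps ρ := (L.phiStar ρ).1 x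
  ps' ρ := (L.phiStar ρ).2 x
  qs ρ := (L.sineStar ρ).1 x
  qs' ρ := (L.sineStar ρ).2 x
  M := M

lemma sign_mul_im {s : ℝ} (hs : IsSign s) {ρ : ℂ} (hρ : ρ ∈ closedHalfPlane s) :
    s * ρ.im = |ρ.im| := by
  have h : 0 ≤ s * ρ.im := hρ
  rw [← abs_of_nonneg h, abs_mul]
  rcases hs with rfl | rfl <;> simp

lemma exists_mem_closedHalfPlane (ρ : ℂ) : ∃ s, IsSign s ∧ ρ ∈ closedHalfPlane s := by
  rcases le_total 0 ρ.im with h | h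
  · exact ⟨1, Or.inl rfl, by simpa [closedHalfPlane] using h⟩
  · exact ⟨-1, Or.inr rfl, by simpa [closedHalfPlane] using h⟩

lemma norm_exp_lam {s : ℝ} (hs : IsSign s) {ρ : ℂ} (hρ : ρ ∈ closedHalfPlane s) (x : ℝ) :
    ‖exp (((s : ℂ) * I * ρ) * x)‖ = (Real.exp (|ρ.im| * x))⁻¹ := by
  rw [norm_exp_eq, re_lam, sign_mul_im hs hρ, neg_mul, Real.exp_neg]

lemma norm_exp_neg_lam {s : ℝ} (hs : IsSign s) {ρ : ℂ} (hρ : ρ ∈ closedHalfPlane s) (x : ℝ) :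
    ‖exp (-((s : ℂ) * I * ρ) * x)‖ = Real.exp (|ρ.im| * x) := by
  rw [norm_exp_eq, Complex.neg_re, re_lam, sign_mul_im hs hρ, neg_neg]

lemma phi_deriv_zero (hL : L.ClassV) {s : ℝ} (hs : IsSign s) (ρ : ℂ) :
    (L.phi ρ).2 0 = ((s : ℂ) * I * ρ) • (-((s : ℂ) • L.h1)) + -L.h0 := by
  rw [(hL.phi_spec ρ).2.2, bc, neg_add, smul_neg, smul_smul, sign_mul_lam hs ρ,
    mul_comm ((s : ℂ) * I * ρ)]

/-- A statement which is monotone in a constant holds with the same constant for both signs. -/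
lemma exists_forall_isSign {p : ℝ → ℝ → Prop} (hp : ∀ s a b, a ≤ b → p s a → p s b)
    (h : ∀ s, IsSign s → ∃ C, p s C) : ∃ C, ∀ s, IsSign s → p s C := by
  obtain ⟨a, ha⟩ := h 1 (.inl rfl)
  obtain ⟨b, hb⟩ := h (-1) (.inr rfl)
  refine ⟨max a b, ?_⟩
  rintro s (rfl | rfl)
  · exact hp _ _ _ (le_max_left a b) ha
  · exact hp _ _ _ (le_max_right a b) hb

lemma subset_union_of_isSign (A : ℝ → Set ℂ) {s : ℝ} (hs : IsSign s) : A s ⊆ A 1 ∪ A (-1) := by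
  rcases hs with rfl | rfl
  · exact subset_union_left
  · exact subset_union_right

lemma ClassV.exists_phi_bound (hL : L.ClassV) {x : ℝ} (hx : 0 ≤ x) : ∃ C, ∀ ρ : ℂ,
    1 ≤ ‖ρ‖ → ‖(L.phi ρ).1 x‖ ≤ C * Real.exp (|ρ.im| * x) ∧
      ‖(L.phi ρ).2 x‖ ≤ C * ‖ρ‖ * Real.exp (|ρ.im| * x) := by
  obtain ⟨C, h⟩ := exists_forall_isSign (p := fun s C => ∀ ρ ∈ closedHalfPlane s, 1 ≤ ‖ρ‖ →
      ‖(L.phi ρ).1 x‖ ≤ C * Real.exp (|ρ.im| * x) ∧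
        ‖(L.phi ρ).2 x‖ ≤ C * ‖ρ‖ * Real.exp (|ρ.im| * x)) (fun s a b hab h ρ hρ h1 =>
      ⟨(h ρ hρ h1).1.trans (by gcongr), (h ρ hρ h1).2.trans (by gcongr)⟩) fun s hs => by
    obtain ⟨C, -, hb⟩ := (hL.potential s).exists_growth_bound 1 (-((s : ℂ) • L.h1)) (-L.h0) hx
    refine ⟨C, fun ρ hρ h1 => ?_⟩
    obtain ⟨b1, b2⟩ := hb ((s : ℂ) * I * ρ) (L.phi ρ).1 (L.phi ρ).2
      (by rwa [norm_lam hs]) (by rw [re_lam]; exact neg_nonpos.2 hρ)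
      ((hL.isSol_iff (sign_sq hs)).1 (hL.phi_spec ρ).1) (hL.phi_spec ρ).2.1
      (phi_deriv_zero hL hs ρ)
    have hE := exp_pos (|ρ.im| * x)
    have hρ0 : 0 < ‖ρ‖ := zero_lt_one.trans_le h1
    rw [norm_smul, norm_exp_lam hs hρ, inv_mul_le_iff₀ hE, mul_comm] at b1
    rw [norm_smul, norm_smul, norm_inv, norm_lam hs, norm_exp_lam hs hρ, inv_mul_le_iff₀ hE,
      inv_mul_le_iff₀ hρ0] at b2
    exact ⟨b1, b2.trans_eq (by ring)⟩
  refine ⟨C, fun ρ hρ => ?_⟩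
  obtain ⟨s, hs, hm⟩ := exists_mem_closedHalfPlane ρ
  exact h s hs ρ hm hρ

lemma exists_of_eventually_farFilter {s : ℝ} {p : ℂ → Prop} (h : ∀ᶠ ρ in farFilter s, p ρ) :
    ∃ R : ℝ, 1 ≤ R ∧ ∀ ρ ∈ closedHalfPlane s, R ≤ ‖ρ‖ → p ρ := by
  rw [farFilter, eventually_inf_principal] at h
  rw [← comap_norm_atTop, eventually_comap] at h
  obtain ⟨R, hR⟩ := eventually_atTop.1 h
  exact ⟨max R 1, le_max_right _ _, fun ρ hρ hn => hR ‖ρ‖ ((le_max_left _ _).trans hn) ρ rfl hρ⟩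

lemma IsWeylFunction.exists_bound {s : ℝ} (hs : IsSign s) {M : ℂ → CMat m} {K : Set ℂ}
    (hM : L.IsWeylFunction s M K) {x : ℝ} (hx : 0 ≤ x) : ∃ C, ∀ᶠ ρ in farFilter s,
      ‖L.weylComb M x ρ‖ ≤ C / ‖ρ‖ / Real.exp (|ρ.im| * x) ∧
      ‖L.weylComb' M x ρ‖ ≤ C / Real.exp (|ρ.im| * x) := by
  obtain ⟨h1, h2⟩ := hM.asymp x hx
  refine ⟨‖L.P (-s) x * (1 + (s : ℂ) • L.h1)⁻¹‖ + 1, ?_⟩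
  filter_upwards [h1.norm.eventually (gt_mem_nhds (lt_add_one _)),
    h2.norm.eventually (gt_mem_nhds (lt_add_one _)), eventually_farFilter s] with ρ b1 b2 ⟨hρ, hn⟩
  have hE := exp_pos (|ρ.im| * x)
  rw [norm_smul, norm_exp_neg_lam hs hρ] at b1 b2
  rw [norm_smul, norm_lam hs] at b1
  rw [le_div_iff₀ hE, le_div_iff₀ (by linarith), le_div_iff₀ hE]
  constructor <;> linarith

/-- Far out, the Weyl matrix of the transposed pencil is the transposed Weyl matrix. -/
lemma IsWeylFunction.eventually_transpose_eq (hL : L.ClassV) {s : ℝ} (hs : IsSign s)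
    {M N : ℂ → CMat m} {K J : Set ℂ} (hM : L.IsWeylFunction s M K)
    (hN : L.transpose.IsWeylFunction s N J) : ∀ᶠ ρ in farFilter s, (N ρ).transpose = M ρ := by
  obtain ⟨R, hR, hb⟩ := exists_of_eventually_farFilter
    (hM.eventually_notMem.and hN.eventually_notMem)
  filter_upwards [eventually_farFilter s,
    (tendsto_norm_farFilter s).eventually_gt_atTop R] with ρ hρ hn
  obtain ⟨hK, hJ⟩ := hb ρ hρ.1 hn.le
  have hne := neBot_nhdsWithin_halfPlane hs hρ.1
  have hle : ∀ {A : Set ℂ}, IsClosed A → ρ ∉ A → 𝓝[halfPlane s] ρ ≤ 𝓝[closedHalfPlane s \ A] ρ :=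
    fun hA hρA => by
      refine nhdsWithin_le_iff.2 ?_
      filter_upwards [self_mem_nhdsWithin,
        mem_nhdsWithin_of_mem_nhds (hA.isOpen_compl.mem_nhds hρA)] with z hz hz'
      exact ⟨halfPlane_subset_closed s hz, hz'⟩
  have t1 := (hM.continuousOn ρ ⟨hρ.1, hK⟩).mono_left (hle hM.isClosed hK)
  have t2 := (hN.continuousOn ρ ⟨hρ.1, hJ⟩).mono_left (hle hN.isClosed hJ)
  refine tendsto_nhds_unique (tendsto_transpose t2) (t1.congr' ?_)
  filter_upwards [self_mem_nhdsWithin,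
    mem_nhdsWithin_of_mem_nhds (hM.isClosed.isOpen_compl.mem_nhds hK),
    mem_nhdsWithin_of_mem_nhds (hN.isClosed.isOpen_compl.mem_nhds hJ)] with z hz hzK hzJ
  exact (hM.transpose_eq hL hN hz hzK hzJ).symm

lemma differentiable_transpose {F : ℂ → CMat m} (hF : Differentiable ℂ F) :
    Differentiable ℂ fun ρ => (F ρ).transpose := by
  have : IsBoundedLinearMap ℂ (Matrix.transpose : CMat m → CMat m) :=
    { map_add := transpose_add
      map_smul := fun c A => transpose_smul c A
      bound := ⟨1, one_pos, fun A => by rw [frobenius_norm_transpose, one_mul]⟩ }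
  exact this.differentiable.comp hF

/-- The values at `x` of the solutions of a pencil of class `𝒱` form a regular frame. -/
theorem ClassV.exists_frame_isRegular (hL : L.ClassV) (hreg : L.Regular) {M : ℝ → ℂ → CMat m}
    {K : ℝ → Set ℂ} (hM : ∀ s, IsSign s → L.IsWeylFunction s (M s) (K s)) {x : ℝ}
    (hx : 0 ≤ x) : ∃ R, (L.frame M x).IsRegular x (K 1 ∪ K (-1)) R := by
  obtain ⟨C₁, b₁⟩ := hL.exists_phi_bound hx
  obtain ⟨C₂, b₂⟩ := hL.transpose.exists_phi_bound hx
  obtain ⟨C, hC⟩ := exists_forall_isSign (p := fun s R => ∀ ρ ∈ closedHalfPlane s, R ≤ ‖ρ‖ →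
      (L.frame M x).DecayBound x R s ρ)
      (fun s a b hab h ρ hρ hn => (h ρ hρ (hab.trans hn)).mono hab) fun s hs => by
    obtain ⟨N, J, hN⟩ := hL.transpose.exists_isWeylFunction hreg.transpose hs
    obtain ⟨C, hC⟩ := (hM s hs).exists_bound hs hx
    obtain ⟨C', hC'⟩ := hN.exists_bound hs hx
    obtain ⟨R, -, hR⟩ := exists_of_eventually_farFilter (hC.and (hC'.and
      ((hM s hs).eventually_transpose_eq hL hs hN)))
    refine ⟨max (max C C') R, fun ρ hρ hn => Frame.DecayBound.mono (R := max C C') ?_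
      (le_max_left _ _)⟩
    obtain ⟨⟨a1, a2⟩, ⟨a3, a4⟩, e⟩ := hR ρ hρ ((le_max_right _ _).trans hn)
    have e1 : (L.frame M x).ws s ρ = (L.transpose.weylComb N x ρ).transpose := by
      rw [weylComb, transpose_add, transpose_mul, e, Frame.ws]
      simp only [frame, sineStar, (hL.phiStar_eq ρ hx).1]
    have e2 : (L.frame M x).ws' s ρ = (L.transpose.weylComb' N x ρ).transpose := by
      rw [weylComb', transpose_add, transpose_mul, e, Frame.ws']
      simp only [frame, sineStar, (hL.phiStar_eq ρ hx).2]
    have hE := exp_pos (|ρ.im| * x)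
    constructor
    · exact a1.trans (by gcongr; exact le_max_left _ _)
    · exact a2.trans (by gcongr; exact le_max_left _ _)
    · rw [e1, frobenius_norm_transpose]
      exact a3.trans (by gcongr; exact le_max_right _ _)
    · rw [e2, frobenius_norm_transpose]
      exact a4.trans (by gcongr; exact le_max_right _ _)
  set R := max 1 (max C (max C₁ C₂))
  have hR1 : 1 ≤ R := le_max_left _ _
  have hCR : C ≤ R := (le_max_left _ _).trans (le_max_right _ _)
  have h1R : C₁ ≤ R := ((le_max_left _ _).trans (le_max_right _ _)).trans (le_max_right _ _)
  have h2R : C₂ ≤ R := ((le_max_right _ _).trans (le_max_right _ _)).trans (le_max_right _ _)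
  refine ⟨R, (hL.differentiable_phi hx).1, (hL.differentiable_phi hx).2,
    (hL.differentiable_sine hx).1, (hL.differentiable_sine hx).2, ?_, ?_,
    differentiable_transpose (hL.transpose.differentiable_sine hx).1,
    differentiable_transpose (hL.transpose.differentiable_sine hx).2, fun ρ => ?_, fun ρ => ?_,
    fun ρ => ?_, fun ρ => ?_, (hM 1 (.inl rfl)).isClosed.union (hM (-1) (.inr rfl)).isClosed,
    fun s hs => (hM s hs).continuousOn.mono
      (sdiff_subset_sdiff_right (subset_union_of_isSign K hs)),
    fun s hs => (hM s hs).differentiableOn.mono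
      (sdiff_subset_sdiff_right (subset_union_of_isSign K hs)), hR1, fun ρ hρ => ?_,
    fun s hs ρ hρ hn => (hC s hs ρ hρ (hCR.trans hn)).mono hCR⟩
  · simp only [frame, fun ρ => (hL.phiStar_eq ρ hx).1]
    exact differentiable_transpose (hL.transpose.differentiable_phi hx).1
  · simp only [frame, fun ρ => (hL.phiStar_eq ρ hx).2]
    exact differentiable_transpose (hL.transpose.differentiable_phi hx).2
  · exact (wronskian_eq hL (hL.phiStar_spec ρ).1 (hL.phi_spec ρ).1 hx).trans (by
      simp [(hL.phiStar_spec ρ).2, (hL.phi_spec ρ).2])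
  · exact (wronskian_eq hL (hL.phiStar_spec ρ).1 (hL.sine_spec ρ).1 hx).trans (by
      simp [(hL.phiStar_spec ρ).2, (hL.sine_spec ρ).2])
  · exact (wronskian_eq hL (hL.isSolStar_sine ρ) (hL.phi_spec ρ).1 hx).trans (by
      simp [(hL.transpose.sine_spec ρ).2, (hL.phi_spec ρ).2])
  · exact (wronskian_eq hL (hL.isSolStar_sine ρ) (hL.sine_spec ρ).1 hx).trans (by
      simp [(hL.transpose.sine_spec ρ).2, (hL.sine_spec ρ).2])
  · have h := b₁ ρ (hR1.trans hρ)
    have h' := b₂ ρ (hR1.trans hρ)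
    rw [← frobenius_norm_transpose, ← (hL.phiStar_eq ρ hx).1,
      ← frobenius_norm_transpose ((L.transpose.phi ρ).2 x), ← (hL.phiStar_eq ρ hx).2] at h'
    exact ⟨h.1.trans (by gcongr), h.2.trans (by gcongr), h'.1.trans (by gcongr),
      h'.2.trans (by gcongr)⟩

end QuadPencil

/-! ### Comparison of a pencil with a model pencil -/

namespace QuadPencil

lemma tendsto_farFilter {ι : Type*} {l : Filter ι} {s : ℝ} (hs : IsSign s) {ρ : ι → ℂ}
    (hρ : Tendsto (fun i => s * (ρ i).im) l atTop) : Tendsto ρ l (farFilter s) := by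
  refine tendsto_inf.2 ⟨?_, tendsto_principal.2 ?_⟩
  · rw [← tendsto_norm_atTop_iff_cobounded]
    refine tendsto_atTop_mono (fun i => ?_) hρ
    refine (le_abs_self _).trans ?_
    rw [abs_mul]
    have : |s| = 1 := by rcases hs with rfl | rfl <;> simp
    rw [this, one_mul]
    exact abs_im_le_norm _
  · filter_upwards [hρ.eventually_ge_atTop 0] with i hi using hi

section Limits

variable {ι : Type*} {l : Filter ι} {s : ℝ} {ρ : ι → ℂ}

lemma ClassV.tendsto_phi (hL : L.ClassV) (hs : IsSign s)
    (hρ : Tendsto (fun i => s * (ρ i).im) l atTop) {x : ℝ} (hx : 0 < x) :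
    Tendsto (fun i => exp (((s : ℂ) * I * ρ i) * x) • (L.phi (ρ i)).1 x) l
        (𝓝 (L.P s x * ((1 / 2 : ℂ) • (1 + (s : ℂ) • L.h1)))) ∧
      Tendsto (fun i => exp (((s : ℂ) * I * ρ i) * x) •
          (((s : ℂ) * I * ρ i)⁻¹ • (L.phi (ρ i)).2 x)) l
        (𝓝 (-(L.P s x * ((1 / 2 : ℂ) • (1 + (s : ℂ) • L.h1))))) := by
  have h := (hL.potential s).tendsto_regular (hL.P_spec s).1 (hL.P_spec s).2 hx (l := l)
    (a := 1) (b₁ := -((s : ℂ) • L.h1)) (b₀ := -L.h0) (lam := fun i => (s : ℂ) * I * ρ i)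
    (y := fun i => (L.phi (ρ i)).1) (y' := fun i => (L.phi (ρ i)).2) (by
      simp only [re_lam]
      exact tendsto_neg_atTop_atBot.comp hρ)
    (fun i => (hL.isSol_iff (sign_sq hs)).1 (hL.phi_spec (ρ i)).1)
    (fun i => (hL.phi_spec (ρ i)).2.1) (fun i => phi_deriv_zero hL hs (ρ i))
  rw [sub_neg_eq_add] at h
  exact h

lemma ClassV.tendsto_phiStar_deriv (hL : L.ClassV) (hs : IsSign s)
    (hρ : Tendsto (fun i => s * (ρ i).im) l atTop) {x : ℝ} (hx : 0 < x) :
    Tendsto (fun i => exp (((s : ℂ) * I * ρ i) * x) •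
          (((s : ℂ) * I * ρ i)⁻¹ • (L.phiStar (ρ i)).2 x)) l
        (𝓝 (-(((1 / 2 : ℂ) • (1 + (s : ℂ) • L.h1)) * L.PStar s x))) := by
  have h := tendsto_transpose (hL.transpose.tendsto_phi hs hρ hx).2
  have e : (-(L.transpose.P s x * ((1 / 2 : ℂ) • (1 + (s : ℂ) • L.transpose.h1)))).transpose =
      -(((1 / 2 : ℂ) • (1 + (s : ℂ) • L.h1)) * L.PStar s x) := by
    rw [hL.PStar_eq s hx.le, Matrix.transpose_neg, transpose_mul, transpose_smul,
      transpose_add, transpose_smul, transpose_one]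
    rfl
  rw [e] at h
  refine h.congr fun i => ?_
  rw [(hL.phiStar_eq _ hx.le).2, transpose_smul, transpose_smul]

lemma ClassV.tendsto_weylStar_deriv (hL : L.ClassV) (hreg : L.Regular) (hs : IsSign s)
    {M : ℝ → ℂ → CMat m} {K : Set ℂ} (hM : L.IsWeylFunction s (M s) K)
    {x : ℝ} (hx : 0 ≤ x) :
    Tendsto (fun ρ => exp (-((s : ℂ) * I * ρ) * x) • (L.frame M x).ws' s ρ)
      (farFilter s) (𝓝 ((1 + (s : ℂ) • L.h1)⁻¹ * L.PStar (-s) x)) := by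
  obtain ⟨N, J, hN⟩ := hL.transpose.exists_isWeylFunction hreg.transpose hs
  have h := tendsto_transpose (hN.asymp x hx).2
  have e : (L.transpose.P (-s) x * (1 + (s : ℂ) • L.transpose.h1)⁻¹).transpose =
      (1 + (s : ℂ) • L.h1)⁻¹ * L.PStar (-s) x := by
    rw [hL.PStar_eq (-s) hx, transpose_mul, Matrix.transpose_nonsing_inv,
      transpose_add, transpose_smul, transpose_one]
    rfl
  rw [e] at h
  refine h.congr' ?_
  filter_upwards [hM.eventually_transpose_eq hL hs hN] with ρ hρ
  rw [transpose_smul, weylComb', transpose_add, transpose_mul, hρ, Frame.ws']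
  simp only [frame, sineStar, (hL.phiStar_eq ρ hx).2]

lemma Omega_eq (hs : IsSign s) (x : ℝ) : Omega L Lt x =
    (1 / 2 : ℂ) • (L.P s x * Lt.PStar (-s) x + L.P (-s) x * Lt.PStar s x) := by
  rcases hs with rfl | rfl
  · rw [Omega, add_comm]
  · rw [Omega, neg_neg]

/-- The function `φ Φ̃*' - Φ φ̃*'` tends to `Ω(x)` deep inside the half-planes. -/
theorem tendsto_omega (hL : L.ClassV) (hLt : Lt.ClassV) (hLreg : L.Regular) (hLtreg : Lt.Regular)
    (hh : L.h1 = Lt.h1) (hs : IsSign s) {M Mt : ℝ → ℂ → CMat m} {K Kt : Set ℂ}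
    (hM : L.IsWeylFunction s (M s) K) (hMt : Lt.IsWeylFunction s (Mt s) Kt)
    (hρ : Tendsto (fun i => s * (ρ i).im) l atTop) {x : ℝ} (hx : 0 ≤ x) :
    Tendsto (fun i => (L.frame M x).p (ρ i) * (Lt.frame Mt x).ws' s (ρ i) -
      (L.frame M x).w s (ρ i) * (Lt.frame Mt x).ps' (ρ i)) l (𝓝 (Omega L Lt x)) := by
  have hfar := tendsto_farFilter hs hρ
  have hne : ∀ᶠ i in l, (s : ℂ) * I * ρ i ≠ 0 := by
    filter_upwards [hfar.eventually (eventually_farFilter s)] with i hi h0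
    have := hi.2
    rw [← norm_lam hs, h0, norm_zero] at this
    linarith
  have hu : IsUnit (1 + (s : ℂ) • L.h1).det := isUnit_iff_ne_zero.2 (hLreg.det_ne_zero hs)
  have hul : IsUnit (1 + (s : ℂ) • Lt.h1).det := isUnit_iff_ne_zero.2 (hLtreg.det_ne_zero hs)
  rcases hx.eq_or_lt with rfl | hx0
  · -- at the origin the solutions are known explicitly
    have hone : ∀ u : ℝ, L.P u 0 = 1 ∧ Lt.PStar u 0 = 1 := fun u =>
      ⟨(hL.P_spec u).2, (hLt.PStar_spec u).2⟩
    have hΩ : Omega L Lt 0 = 1 := by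
      rw [Omega, (hone 1).1, (hone (-1)).1, (hone 1).2, (hone (-1)).2, mul_one, ← two_smul ℂ,
        smul_smul]
      norm_num
    have t1 := ((hM.asymp 0 le_rfl).1.comp hfar).sub ((hMt.asymp 0 le_rfl).1.comp hfar)
    have t2 := (Lt.tendsto_bc hs).comp hfar
    have h1 := (t1.mul t2).const_add (1 : CMat m)
    rw [(hL.P_spec (-s)).2, (hLt.P_spec (-s)).2, hh, sub_self, zero_mul, add_zero] at h1
    rw [hΩ]
    refine h1.congr' ?_
    filter_upwards [hne] with i hi
    have e1 := (hL.phi_spec (ρ i)).2.1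
    have e2 := (hLt.phiStar_spec (ρ i)).2.2
    have e3 := (hL.sine_spec (ρ i)).2.1
    have e4 : (Lt.sineStar (ρ i)).2 0 = 1 := by
      simp [sineStar, (hLt.transpose.sine_spec (ρ i)).2.2]
    simp only [Function.comp, (hL.weylComb_zero (M s) (ρ i)).1,
      (hLt.weylComb_zero (Mt s) (ρ i)).1, Frame.ws', Frame.w, frame, e1, e2, e3, e4,
      ofReal_zero, mul_zero, exp_zero, one_smul, one_mul, zero_add]
    rw [← smul_sub, smul_mul_smul_comm, mul_inv_cancel₀ hi, one_smul, Matrix.sub_mul]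
    rw [Matrix.mul_neg, Matrix.mul_neg]
    abel
  · obtain ⟨a1, -⟩ := hL.tendsto_phi hs hρ hx0
    have a2 := hLt.tendsto_phiStar_deriv hs hρ hx0
    have a3 := ((hM.asymp x hx).1).comp hfar
    have a4 := (hLt.tendsto_weylStar_deriv hLtreg hs hMt hx).comp hfar
    have h1 := (a1.mul a4).sub (a3.mul a2)
    have e : L.P s x * ((1 / 2 : ℂ) • (1 + (s : ℂ) • L.h1)) *
        ((1 + (s : ℂ) • Lt.h1)⁻¹ * Lt.PStar (-s) x) - L.P (-s) x * (1 + (s : ℂ) • L.h1)⁻¹ *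
        -(((1 / 2 : ℂ) • (1 + (s : ℂ) • Lt.h1)) * Lt.PStar s x) = Omega L Lt x := by
      rw [Omega_eq hs, ← hh, smul_mul_assoc, mul_smul_comm, mul_neg, sub_neg_eq_add, mul_smul_comm,
        smul_mul_assoc, ← smul_add]
      congr 2
      · rw [mul_assoc, ← mul_assoc (1 + (s : ℂ) • L.h1), mul_nonsing_inv _ hu,
          one_mul]
      · rw [mul_assoc, ← mul_assoc _ (1 + (s : ℂ) • L.h1),
          Matrix.nonsing_inv_mul _ hu, one_mul]
    rw [e] at h1
    refine h1.congr' ?_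
    filter_upwards [hne] with i hi
    have hexp : exp (((s : ℂ) * I * ρ i) * x) *
        exp (-((s : ℂ) * I * ρ i) * x) = 1 := by
      rw [← exp_add]; simp
    have hexp' : exp (-((s : ℂ) * I * ρ i) * x) *
        exp (((s : ℂ) * I * ρ i) * x) = 1 := by
      rw [mul_comm, hexp]
    simp only [Function.comp]
    rw [smul_mul_smul_comm, hexp, one_smul, smul_mul_smul_comm, hexp', one_smul,
      smul_mul_smul_comm, mul_inv_cancel₀ hi, one_smul]
    rfl

end Limits

lemma norm_le_rowSumNorm (A : CMat m) : ‖A‖ ≤ m * rowSumNorm A := by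
  refine (norm_le_sum_entries A).trans ?_
  refine (Finset.sum_le_card_nsmul _ _ (rowSumNorm A) fun j _ =>
    le_ciSup (f := fun j => ∑ k, ‖A j k‖) (finite_range _).bddAbove j).trans_eq ?_
  simp

/-- The leading coefficients of the Weyl matrices of a pencil and of a model pencil agree. -/
theorem IsModel.h1_eq (hmodel : IsModel L Lt) (hLreg : L.Regular) (hLtreg : Lt.Regular)
    (hL : L.ClassV) (hLt : Lt.ClassV) {M Mt : ℂ → CMat m} {K Kt : Set ℂ}
    (hM : L.IsWeylFunction 1 M K) (hMt : Lt.IsWeylFunction 1 Mt Kt) : L.h1 = Lt.h1 := by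
  obtain ⟨R, hR, hint⟩ := hmodel
  set D := (1 + L.h1)⁻¹ - (1 + Lt.h1)⁻¹ with hD
  -- otherwise `|M̂₊(ρ)|² ρ⁴` would be bounded below for large `ρ`
  have hD0 : D = 0 := by
    by_contra hne
    have hfar : Tendsto (fun t : ℝ => (t : ℂ)) atTop (farFilter 1) := by
      refine tendsto_inf.2 ⟨?_, tendsto_principal.2 (Eventually.of_forall fun t => ?_)⟩
      · rw [← tendsto_norm_atTop_iff_cobounded]
        exact tendsto_atTop_mono (fun t => by
          rw [norm_real]; exact le_abs_self t) tendsto_id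
      · simp [closedHalfPlane]
    have t1 := ((hM.asymp 0 le_rfl).1.comp hfar).sub ((hMt.asymp 0 le_rfl).1.comp hfar)
    simp only [Function.comp_def, (hL.weylComb_zero M _).1, (hLt.weylComb_zero Mt _).1,
      (hL.P_spec (-1)).2, (hLt.P_spec (-1)).2, ofReal_zero, mul_zero, exp_zero,
      one_smul, one_mul, Complex.ofReal_one, ← smul_sub, ← hD] at t1
    have t2 := t1.norm
    simp only [norm_smul, norm_mul, norm_I, one_mul, norm_real] at t2
    set c := ‖D‖ / 2
    have hc : 0 < c := half_pos (norm_pos_iff.2 hne)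
    have h4 : ∀ᶠ t : ℝ in atTop,
        c ^ 2 ≤ (m : ℝ) ^ 2 * (rowSumNorm (MhatSide L Lt 1 t) ^ 2 * t ^ 4) := by
      filter_upwards [t2.eventually (lt_mem_nhds (half_lt_self (norm_pos_iff.2 hne))),
        hfar.eventually hM.eventually_notMem, hfar.eventually hMt.eventually_notMem,
        eventually_ge_atTop 1] with t ht hK hKt ht1
      rw [MhatSide, hM.weylSide_eq t hK, hMt.weylSide_eq t hKt]
      rw [norm_of_nonneg (zero_le_one.trans ht1)] at ht
      have h6 : c ≤ t ^ 2 * (m * rowSumNorm (M t - Mt t)) := by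
        have h8 : t ≤ t ^ 2 := by nlinarith
        calc c ≤ t * ‖M t - Mt t‖ := ht.le
          _ ≤ _ := by gcongr; exact norm_le_rowSumNorm _
      calc c ^ 2 ≤ (t ^ 2 * (m * rowSumNorm (M t - Mt t))) ^ 2 := by gcongr
        _ = _ := by ring
    obtain ⟨T, hT⟩ := eventually_atTop.1 h4
    have hTi : IntegrableOn (fun _ : ℝ => c ^ 2) (Ioi (max R T)) := by
      have h5 := (hint 1 (.inl rfl)).mono_set (s := Ioi (max R T)) fun t ht =>
        ((le_max_left R T).trans_lt ht).trans_le (le_abs_self t)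
      refine Integrable.mono' (h5.const_mul ((m : ℝ) ^ 2)) aestronglyMeasurable_const ?_
      filter_upwards [ae_restrict_mem measurableSet_Ioi] with t ht
      rw [norm_of_nonneg (sq_nonneg c)]
      exact hT t ((le_max_right R T).trans (le_of_lt ht))
    rw [integrableOn_const_iff] at hTi
    rcases hTi with h | h
    · simp at h; linarith
    · simp at h
  have hu : IsUnit (1 + L.h1).det := isUnit_iff_ne_zero.2 hLreg.1
  have hul : IsUnit (1 + Lt.h1).det := isUnit_iff_ne_zero.2 hLtreg.1
  have h1 := sub_eq_zero.1 hD0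
  have h2 := congrArg (fun A => A⁻¹) h1
  simp only [Matrix.nonsing_inv_nonsing_inv _ hu, Matrix.nonsing_inv_nonsing_inv _ hul] at h2
  exact add_left_cancel h2

/-- By the Cauchy–Schwarz inequality, `M̂(θ) (1 + |θ|)` is integrable on the cuts. -/
theorem IsModel.integrableOn_cut (hmodel : IsModel L Lt) (Γ : CutContour) {s : ℝ}
    (hs : IsSign s) {M Mt : ℂ → CMat m} {K Kt : Set ℂ} (hM : L.IsWeylFunction s M K)
    (hMt : Lt.IsWeylFunction s Mt Kt) (hK : K ⊆ Γ.interior) (hKt : Kt ⊆ Γ.interior) :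
    IntegrableOn (fun θ : ℝ => ‖M θ - Mt θ‖ * (1 + |θ|)) Γ.cut := by
  obtain ⟨R, hR, hint⟩ := hmodel
  have hnK : ∀ θ ∈ Γ.cut, (θ : ℂ) ∉ K ∧ (θ : ℂ) ∉ Kt := fun θ hθ =>
    ⟨fun h => CutContour.notMem_interior_of_mem_cut hθ (hK h),
      fun h => CutContour.notMem_interior_of_mem_cut hθ (hKt h)⟩
  have hreal : ∀ y : ℝ, (y : ℂ) ∈ closedHalfPlane s := fun y => by simp [closedHalfPlane]
  have hc : ContinuousOn (fun θ : ℝ => ‖M θ - Mt θ‖ * (1 + |θ|)) Γ.cut := by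
    refine ContinuousOn.mul (ContinuousOn.norm (ContinuousOn.sub ?_ ?_)) (by fun_prop)
    · exact hM.continuousOn.comp continuous_ofReal.continuousOn fun θ hθ =>
        ⟨hreal θ, (hnK θ hθ).1⟩
    · exact hMt.continuousOn.comp continuous_ofReal.continuousOn fun θ hθ =>
        ⟨hreal θ, (hnK θ hθ).2⟩
  have hclosed : IsClosed Γ.cut := isClosed_Iic.union isClosed_Ici
  set T := max R 1 with hT
  have hsplit : Γ.cut = (Γ.cut ∩ Icc (-T) T) ∪ (Γ.cut ∩ (Icc (-T) T)ᶜ) :=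
    (inter_union_compl _ _).symm
  rw [hsplit]
  refine IntegrableOn.union ?_ ?_
  · exact (hc.mono inter_subset_left).integrableOn_compact (isCompact_Icc.inter_left hclosed)
  · have hmeas : MeasurableSet (Γ.cut ∩ (Icc (-T) T)ᶜ) :=
      hclosed.measurableSet.inter measurableSet_Icc.compl
    have hsub : Γ.cut ∩ (Icc (-T) T)ᶜ ⊆ {θ : ℝ | R < |θ|} := fun θ hθ => by
      have h1 : ¬ |θ| ≤ T := fun h => hθ.2 (abs_le.1 h)
      exact (le_max_left R 1).trans_lt (not_le.1 h1)
    have hg : IntegrableOn (fun θ : ℝ =>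
        (m : ℝ) ^ 2 * (rowSumNorm (MhatSide L Lt s θ) ^ 2 * θ ^ 4) +
        2 * (1 + θ ^ 2)⁻¹) (Γ.cut ∩ (Icc (-T) T)ᶜ) :=
      (((hint s hs).mono_set hsub).const_mul _).add
        ((integrable_inv_one_add_sq.const_mul 2).integrableOn)
    refine Integrable.mono' hg ((hc.mono inter_subset_left).aestronglyMeasurable hmeas) ?_
    filter_upwards [ae_restrict_mem hmeas] with θ hθ
    have h1 : T < |θ| := not_le.1 fun h => hθ.2 (abs_le.1 h)
    have h2 : 1 < |θ| := (le_max_right R 1).trans_lt h1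
    obtain ⟨k1, k2⟩ := hnK θ hθ.1
    rw [MhatSide, hM.weylSide_eq θ k1, hMt.weylSide_eq θ k2]
    have h3 := norm_le_rowSumNorm (M θ - Mt θ)
    set r := rowSumNorm (M θ - Mt θ)
    set u := ‖M θ - Mt θ‖ with hu
    have hu0 : 0 ≤ u := norm_nonneg _
    have hθ2 : θ ^ 2 = |θ| ^ 2 := (sq_abs θ).symm
    have hθ4 : θ ^ 4 = |θ| ^ 4 := by
      rw [show θ ^ 4 = (θ ^ 2) ^ 2 by ring, hθ2]; ring
    rw [norm_of_nonneg (by positivity), hθ2, hθ4]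
    set b := |θ|
    have h4 : u ^ 2 * b ^ 4 ≤ (m : ℝ) ^ 2 * (r ^ 2 * b ^ 4) := by
      have : u ^ 2 ≤ (m * r) ^ 2 := by gcongr
      calc u ^ 2 * b ^ 4 ≤ (m * r) ^ 2 * b ^ 4 := by gcongr
        _ = _ := by ring
    have h5 : (b ^ 2)⁻¹ ≤ 2 * (1 + b ^ 2)⁻¹ := by
      rw [← div_eq_mul_inv, inv_eq_one_div, div_le_div_iff₀ (by positivity) (by positivity)]
      nlinarith
    have h6 : u * (1 + b) ≤ u ^ 2 * b ^ 4 + (b ^ 2)⁻¹ := by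
      have hb0 : b ≠ 0 := by positivity
      have h7 : u * (1 + b) ≤ 2 * (u * b) := by nlinarith
      have h8 : u * b = (u * b ^ 2) * b⁻¹ := by field_simp
      have h9 : (b ^ 2)⁻¹ = b⁻¹ ^ 2 := by rw [inv_pow]
      rw [h9]
      rw [h8] at h7
      nlinarith [sq_nonneg (u * b ^ 2 - b⁻¹)]
    linarith

end QuadPencil

/-! ### Cauchy integrals with a matrix weight -/

namespace QuadPencil

lemma norm_vecMul_le (u : Fin m → ℂ) (A : CMat m) : ‖vecMul u A‖ ≤ m * ‖u‖ * ‖A‖ := by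
  refine (pi_norm_le_iff_of_nonneg (by positivity)).2 fun k => ?_
  rw [vecMul, dotProduct]
  refine (norm_sum_le _ _).trans ((Finset.sum_le_card_nsmul _ _ (‖u‖ * ‖A‖) fun j _ => ?_).trans_eq
    (by simp [mul_assoc]))
  rw [norm_mul]
  exact mul_le_mul (norm_le_pi_norm u j) (norm_entry_le A j k) (norm_nonneg _) (norm_nonneg _)

/-- The product of a row vector and a matrix as a continuous bilinear map. -/
noncomputable def vecMulCLM (m : ℕ) : (Fin m → ℂ) →L[ℂ] CMat m →L[ℂ] (Fin m → ℂ) :=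
  LinearMap.mkContinuous₂ (LinearMap.mk₂ ℂ (fun u (A : CMat m) => vecMul u A)
    (fun u v A => Matrix.add_vecMul A u v) (fun c u A => smul_vecMul c u A)
    (fun u A B => Matrix.vecMul_add A B u) fun c u A => vecMul_smul u c A) m
    fun u A => norm_vecMul_le u A

lemma differentiable_vecMul {u : ℂ → Fin m → ℂ} {A : ℂ → CMat m} {U : Set ℂ}
    (hu : DifferentiableOn ℂ u U) (hA : DifferentiableOn ℂ A U) :
    DifferentiableOn ℂ (fun ρ => vecMul (u ρ) (A ρ)) U := by
  have : DifferentiableOn ℂ (fun ρ => vecMulCLM m (u ρ) (A ρ)) U :=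
    ((vecMulCLM m).differentiable.comp_differentiableOn hu).clm_apply hA
  exact this

lemma _root_.Differentiable.vecMul {u : ℂ → Fin m → ℂ} {A : ℂ → CMat m} (hu : Differentiable ℂ u)
    (hA : Differentiable ℂ A) : Differentiable ℂ fun ρ => vecMul (u ρ) (A ρ) :=
  differentiableOn_univ.1 (differentiable_vecMul hu.differentiableOn hA.differentiableOn)

lemma continuousOn_vecMul {X : Type*} [TopologicalSpace X] {u : X → Fin m → ℂ} {A : X → CMat m}
    {U : Set X} (hu : ContinuousOn u U) (hA : ContinuousOn A U) :
    ContinuousOn (fun ρ => vecMul (u ρ) (A ρ)) U := by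
  have : ContinuousOn (fun ρ => vecMulCLM m (u ρ) (A ρ)) U :=
    ((vecMulCLM m).continuous.comp_continuousOn hu).clm_apply hA
  exact this

lemma tendsto_vecMul {ι : Type*} {l : Filter ι} {u : ι → Fin m → ℂ} {A : ι → CMat m}
    {u₀ : Fin m → ℂ} {A₀ : CMat m} (hu : Tendsto u l (𝓝 u₀)) (hA : Tendsto A l (𝓝 A₀)) :
    Tendsto (fun i => vecMul (u i) (A i)) l (𝓝 (vecMul u₀ A₀)) := by
  have : Tendsto (fun i => vecMulCLM m (u i) (A i)) l (𝓝 (vecMulCLM m u₀ A₀)) :=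
    (((continuous_fst.clm_apply continuous_snd).tendsto (vecMulCLM m u₀, A₀)).comp
      ((((vecMulCLM m).continuous.tendsto u₀).comp hu).prodMk_nhds hA))
  exact this

lemma aestronglyMeasurable_vecMul {α : Type*} [MeasurableSpace α] {μ : Measure α}
    {u : α → Fin m → ℂ} {A : α → CMat m} (hu : AEStronglyMeasurable u μ)
    (hA : AEStronglyMeasurable A μ) : AEStronglyMeasurable (fun a => vecMul (u a) (A a)) μ := by
  have : AEStronglyMeasurable (fun a => vecMulCLM m (u a) (A a)) μ :=
    (vecMulCLM m).aestronglyMeasurable_comp₂ hu hA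
  exact this

namespace Frame

variable (W : Frame m)

/-- The numerator `⟨φ*(θ), φ(ρ)⟩` of `D(x, ρ, θ)`. -/
def num (ρ θ : ℂ) : CMat m := W.ps' θ * W.p ρ - W.ps θ * W.p' ρ

/-- The function `D(x, ρ, θ)` with the removable singularity at `ρ = θ` removed. -/
noncomputable def dreg (ρ θ : ℂ) : CMat m := dslope (fun z => W.num z θ) θ ρ

variable {W} {x R : ℝ} {K : Set ℂ}

lemma IsRegular.dreg_eq (h : W.IsRegular x K R) {ρ θ : ℂ} (hne : θ ≠ ρ) :
    W.dreg ρ θ = (ρ - θ)⁻¹ • W.num ρ θ := by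
  have h0 : W.num θ θ = 0 := h.wr_pp θ
  rw [dreg, dslope_of_ne _ hne.symm, slope, vsub_eq_sub, h0, sub_zero]

lemma IsRegular.differentiable_num (h : W.IsRegular x K R) (θ : ℂ) :
    Differentiable ℂ fun z => W.num z θ :=
  ((differentiable_const _).mul h.dp).sub ((differentiable_const _).mul h.dp')

lemma IsRegular.differentiable_dreg (h : W.IsRegular x K R) (θ : ℂ) :
    Differentiable ℂ fun ρ => W.dreg ρ θ := by
  rw [← differentiableOn_univ]
  exact (differentiableOn_dslope univ_mem).2 (h.differentiable_num θ).differentiableOn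

lemma IsRegular.stronglyMeasurable_dreg (h : W.IsRegular x K R) (ρ : ℂ) :
    StronglyMeasurable fun θ => W.dreg ρ θ := by
  classical
  have e : (fun θ => W.dreg ρ θ) = fun θ => if θ = ρ then W.dreg ρ ρ else
      (ρ - θ)⁻¹ • W.num ρ θ := by
    ext1 θ
    split_ifs with hθ
    · rw [hθ]
    · exact h.dreg_eq hθ
  rw [e]
  refine StronglyMeasurable.ite (measurableSet_singleton ρ) stronglyMeasurable_const ?_
  have h1 : Measurable fun θ : ℂ => (ρ - θ)⁻¹ := (measurable_const.sub measurable_id).inv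
  have h2 : Continuous fun θ => W.num ρ θ :=
    (h.dps'.continuous.mul continuous_const).sub (h.dps.continuous.mul continuous_const)
  exact h1.stronglyMeasurable.smul h2.stronglyMeasurable

/-- The growth of the solutions in strips. -/
lemma IsRegular.exists_strip_bound (h : W.IsRegular x K R) (hx : 0 ≤ x) (H : ℝ) :
    ∃ B, 0 ≤ B ∧ ∀ ρ : ℂ, |ρ.im| ≤ H → ‖W.p ρ‖ ≤ B ∧ ‖W.ps ρ‖ ≤ B ∧
      ‖W.p' ρ‖ ≤ B * (1 + ‖ρ‖) ∧ ‖W.ps' ρ‖ ≤ B * (1 + ‖ρ‖) := by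
  obtain ⟨B1, h1⟩ := (isCompact_closedBall (0 : ℂ) R).exists_bound_of_continuousOn
    (f := fun ρ => ((W.p ρ, W.ps ρ), W.p' ρ, W.ps' ρ)) ((h.dp.continuous.prodMk
      h.dps.continuous).prodMk (h.dp'.continuous.prodMk h.dps'.continuous)).continuousOn
  have hR0 := zero_le_one.trans h.one_le
  set B := max (R * Real.exp (H * x)) B1
  have hB0 : 0 ≤ B := le_trans (by positivity) (le_max_left _ _)
  refine ⟨B, hB0, fun ρ hρ => ?_⟩
  have hn := norm_nonneg ρ
  rcases le_total R ‖ρ‖ with hR | hR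
  · have hE : R * Real.exp (|ρ.im| * x) ≤ B := le_trans (by gcongr) (le_max_left _ _)
    have hE' : R * ‖ρ‖ * Real.exp (|ρ.im| * x) ≤ B * (1 + ‖ρ‖) := by
      rw [mul_right_comm]
      exact mul_le_mul hE (by linarith) hn hB0
    obtain ⟨a, a', b, b'⟩ := h.growth ρ hR
    exact ⟨a.trans hE, b.trans hE, a'.trans hE', b'.trans hE'⟩
  · have := (h1 ρ (mem_closedBall_zero_iff.2 hR)).trans (le_max_right _ _ : _ ≤ B)
    simp only [Prod.norm_def, max_le_iff] at this
    obtain ⟨⟨a, b⟩, a', b'⟩ := this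
    have hle : B ≤ B * (1 + ‖ρ‖) := le_mul_of_one_le_right hB0 (by linarith)
    exact ⟨a, b, a'.trans hle, b'.trans hle⟩

/-- `D(x, ρ, θ) = O(1 + |θ|)` uniformly for `ρ` and `θ` in a strip. -/
lemma IsRegular.exists_dreg_bound (h : W.IsRegular x K R) (hx : 0 ≤ x) (H : ℝ) :
    ∃ B, 0 ≤ B ∧ ∀ ρ θ : ℂ, |ρ.im| ≤ H → |θ.im| ≤ H → ‖W.dreg ρ θ‖ ≤ B * (1 + ‖θ‖) := by
  obtain ⟨B, hB, hb⟩ := h.exists_strip_bound hx (H + 1)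
  have hnum : ∀ ρ θ : ℂ, |ρ.im| ≤ H + 1 → |θ.im| ≤ H + 1 →
      ‖W.num ρ θ‖ ≤ B ^ 2 * (2 + ‖θ‖ + ‖ρ‖) := by
    intro ρ θ hρ hθ
    obtain ⟨p1, -, p3, -⟩ := hb ρ hρ
    obtain ⟨-, q2, -, q4⟩ := hb θ hθ
    calc ‖W.num ρ θ‖ ≤ ‖W.ps' θ * W.p ρ‖ + ‖W.ps θ * W.p' ρ‖ := norm_sub_le _ _
      _ ≤ ‖W.ps' θ‖ * ‖W.p ρ‖ + ‖W.ps θ‖ * ‖W.p' ρ‖ := add_le_add (norm_mul_le _ _)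
          (norm_mul_le _ _)
      _ ≤ B * (1 + ‖θ‖) * B + B * (B * (1 + ‖ρ‖)) := by gcongr
      _ = _ := by ring
  refine ⟨8 * B ^ 2, by positivity, fun ρ θ hρ hθ => ?_⟩
  have hn := norm_nonneg θ
  rcases le_or_gt 1 ‖ρ - θ‖ with hd | hd
  · have hne : θ ≠ ρ := fun e => by rw [e, sub_self, norm_zero] at hd; linarith
    rw [h.dreg_eq hne, norm_smul, norm_inv, inv_mul_le_iff₀ (by linarith)]
    refine (hnum ρ θ (by linarith) (by linarith)).trans ?_
    have h1 : ‖ρ‖ ≤ ‖θ‖ + ‖ρ - θ‖ := by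
      have := norm_add_le θ (ρ - θ)
      rwa [add_sub_cancel] at this
    have h2 : 2 + ‖θ‖ + ‖ρ‖ ≤ ‖ρ - θ‖ * (8 * (1 + ‖θ‖)) := by nlinarith
    calc B ^ 2 * (2 + ‖θ‖ + ‖ρ‖) ≤ B ^ 2 * (‖ρ - θ‖ * (8 * (1 + ‖θ‖))) := by gcongr
      _ = _ := by ring
  · have key : ∀ ζ ∈ closedBall θ 1, ‖W.num ζ θ‖ ≤ B ^ 2 * (3 + 2 * ‖θ‖) := by
      intro ζ hζ
      rw [mem_closedBall_iff_norm] at hζ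
      have h1 : ‖ζ‖ ≤ ‖θ‖ + 1 := by
        have := norm_add_le θ (ζ - θ)
        rw [add_sub_cancel] at this
        linarith
      have h2 : |ζ.im| ≤ H + 1 := by
        have h3 := (abs_im_le_norm (ζ - θ)).trans hζ
        rw [sub_im] at h3
        have := abs_add_le (ζ.im - θ.im) θ.im
        rw [sub_add_cancel] at this
        linarith
      exact (hnum ζ θ h2 (by linarith)).trans
        (mul_le_mul_of_nonneg_left (by linarith) (sq_nonneg B))
    refine (norm_dslope_le one_pos (h.differentiable_num θ).differentiableOn key
      (key ρ (by rw [mem_closedBall_iff_norm]; exact hd.le))).trans ?_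
    rw [div_one]
    nlinarith [sq_nonneg B, mul_nonneg (sq_nonneg B) hn]

end Frame

/-- A curve in a strip of the plane, parametrized by a measure space, with a matrix weight which is
integrable together with its product with the position. -/
structure WeightedCurve (α : Type*) [MeasurableSpace α] (m : ℕ) where
  μ : Measure α
  c : α → ℂ
  κ : α → CMat m
  H : ℝ
  measurable_c : AEStronglyMeasurable c μ
  measurable_κ : AEStronglyMeasurable κ μ
  integrable : Integrable (fun a => (1 + ‖c a‖) * ‖κ a‖) μ
  strip : ∀ᵐ a ∂μ, |(c a).im| ≤ H

namespace WeightedCurve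

variable {α : Type*} [MeasurableSpace α] (X : WeightedCurve α m) {W : Frame m} {x R : ℝ}
  {K : Set ℂ}

lemma measurable_comp {E : Type*} [TopologicalSpace E] {F : ℂ → E} (hF : StronglyMeasurable F) :
    AEStronglyMeasurable (fun a => F (X.c a)) X.μ :=
  (hF.comp_measurable X.measurable_c.stronglyMeasurable_mk.measurable).aestronglyMeasurable.congr
    (X.measurable_c.ae_eq_mk.mono fun a ha => by simp only [Function.comp, ← ha])

/-- The integral `∫ u κ D(x, ρ, ·)` along the curve. -/
noncomputable def transform (W : Frame m) (u : α → Fin m → ℂ) (ρ : ℂ) : Fin m → ℂ :=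
  ∫ a, vecMul (u a) (X.κ a * W.dreg ρ (X.c a)) ∂X.μ

/-- A bounded measurable function on the parameter space. -/
structure IsBounded (u : α → Fin m → ℂ) (B : ℝ) : Prop where
  measurable : AEStronglyMeasurable u X.μ
  bound : ∀ᵐ a ∂X.μ, ‖u a‖ ≤ B

variable {X} {f : ℂ → CMat m} {u : α → Fin m → ℂ} {b B δ : ℝ} {ρ : ℂ}

lemma measurable_transform (h : W.IsRegular x K R) (hu : X.IsBounded u B) (ρ : ℂ) :
    AEStronglyMeasurable (fun a => vecMul (u a) (X.κ a * W.dreg ρ (X.c a))) X.μ :=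
  aestronglyMeasurable_vecMul hu.measurable
    (X.measurable_κ.mul (X.measurable_comp (h.stronglyMeasurable_dreg ρ)))

/-- The integrands are dominated uniformly in strips. -/
lemma exists_transform_dominated (h : W.IsRegular x K R) (hx : 0 ≤ x) (H : ℝ) :
    ∃ b, 0 ≤ b ∧ ∀ (u : α → Fin m → ℂ) (B : ℝ), X.IsBounded u B → ∀ᵐ a ∂X.μ, ∀ ρ : ℂ, |ρ.im| ≤ H →
      ‖vecMul (u a) (X.κ a * W.dreg ρ (X.c a))‖ ≤ b * B * ((1 + ‖X.c a‖) * ‖X.κ a‖) := by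
  obtain ⟨b, hb0, hb⟩ := h.exists_dreg_bound hx (max H X.H)
  refine ⟨m * b, by positivity, fun u B hu => ?_⟩
  filter_upwards [hu.bound, X.strip] with a ha hs ρ hρ
  have h1 := hb ρ (X.c a) (hρ.trans (le_max_left _ _)) (hs.trans (le_max_right _ _))
  calc ‖vecMul (u a) (X.κ a * W.dreg ρ (X.c a))‖
      ≤ m * ‖u a‖ * ‖X.κ a * W.dreg ρ (X.c a)‖ := norm_vecMul_le _ _
    _ ≤ m * B * (‖X.κ a‖ * (b * (1 + ‖X.c a‖))) := by
        refine mul_le_mul (by gcongr) ((norm_mul_le _ _).trans (by gcongr)) (norm_nonneg _) ?_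
        exact mul_nonneg (Nat.cast_nonneg m) ((norm_nonneg _).trans ha)
    _ = _ := by ring

lemma integrable_transform (h : W.IsRegular x K R) (hx : 0 ≤ x) (hu : X.IsBounded u B) (ρ : ℂ) :
    Integrable (fun a => vecMul (u a) (X.κ a * W.dreg ρ (X.c a))) X.μ := by
  obtain ⟨b, -, hb⟩ := X.exists_transform_dominated h hx |ρ.im|
  exact (X.integrable.const_mul (b * B)).mono' (measurable_transform h hu ρ)
    ((hb u B hu).mono fun a ha => ha ρ le_rfl)

lemma exists_norm_transform_le (h : W.IsRegular x K R) (hx : 0 ≤ x) (H : ℝ) :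
    ∃ b, 0 ≤ b ∧ ∀ (u : α → Fin m → ℂ) (B : ℝ), X.IsBounded u B → ∀ ρ : ℂ, |ρ.im| ≤ H →
      ‖X.transform W u ρ‖ ≤ b * B := by
  obtain ⟨b, hb0, hb⟩ := X.exists_transform_dominated h hx H
  refine ⟨b * ∫ a, (1 + ‖X.c a‖) * ‖X.κ a‖ ∂X.μ, mul_nonneg hb0 (integral_nonneg fun a => by
    positivity), fun u B hu ρ hρ => ?_⟩
  refine (norm_integral_le_of_norm_le (X.integrable.const_mul (b * B))
    ((hb u B hu).mono fun a ha => ha ρ hρ)).trans_eq ?_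
  rw [integral_const_mul]
  ring

lemma differentiable_transform (h : W.IsRegular x K R) (hx : 0 ≤ x) (hu : X.IsBounded u B) :
    Differentiable ℂ (X.transform W u) := by
  intro ρ
  have hopen : IsOpen {z : ℂ | |z.im| < |ρ.im| + 1} :=
    isOpen_lt (continuous_abs.comp continuous_im) continuous_const
  obtain ⟨b, -, hb⟩ := X.exists_transform_dominated h hx (|ρ.im| + 1)
  refine (differentiableOn_integral_of_dominated hopen (fun z _ => measurable_transform h hu z)
    (ae_of_all _ fun a => ?_) ?_ (X.integrable.const_mul (b * B))).differentiableAt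
    (hopen.mem_nhds (by simp))
  · exact differentiable_vecMul (differentiableOn_const _)
      ((differentiableOn_const _).mul (h.differentiable_dreg _).differentiableOn)
  · exact (hb u B hu).mono fun a ha z hz => ha z (le_of_lt hz)

variable (X)

/-- The Cauchy integral of `u κ f` along the curve. -/
noncomputable def cauchy (f : ℂ → CMat m) (u : α → Fin m → ℂ) (ρ : ℂ) : Fin m → ℂ :=
  ∫ a, (X.c a - ρ)⁻¹ • vecMul (u a) (X.κ a * f (X.c a)) ∂X.μ

variable {X}

lemma norm_density_le {k : ℂ → ℝ}
    (hf : ∀ θ : ℂ, |θ.im| ≤ X.H → ‖f θ‖ ≤ b * k θ) (hu : X.IsBounded u B) : ∀ᵐ a ∂X.μ,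
      ‖vecMul (u a) (X.κ a * f (X.c a))‖ ≤ m * b * B * (k (X.c a) * ‖X.κ a‖) := by
  filter_upwards [hu.bound, X.strip] with a ha hs
  calc ‖vecMul (u a) (X.κ a * f (X.c a))‖
      ≤ m * ‖u a‖ * ‖X.κ a * f (X.c a)‖ := norm_vecMul_le _ _
    _ ≤ m * B * (‖X.κ a‖ * (b * k (X.c a))) := by
        refine mul_le_mul (by gcongr) ((norm_mul_le _ _).trans ?_) (norm_nonneg _) ?_
        · gcongr
          exact hf _ hs
        · exact mul_nonneg (Nat.cast_nonneg m) ((norm_nonneg _).trans ha)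
    _ = _ := by ring

lemma norm_cauchy_integrand_le (hf : ∀ θ : ℂ, |θ.im| ≤ X.H → ‖f θ‖ ≤ b * (1 + ‖θ‖))
    (hu : X.IsBounded u B) (hδ : 0 < δ) : ∀ᵐ a ∂X.μ, ∀ ρ, δ ≤ ‖X.c a - ρ‖ →
      ‖(X.c a - ρ)⁻¹ • vecMul (u a) (X.κ a * f (X.c a))‖ ≤
        δ⁻¹ * (m * b * B) * ((1 + ‖X.c a‖) * ‖X.κ a‖) := by
  filter_upwards [norm_density_le hf hu] with a ha ρ hρ
  rw [norm_smul, norm_inv, mul_assoc]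
  gcongr

lemma integrable_density {f : ℂ → CMat m} (hfc : Continuous f)
    (hf : ∀ θ : ℂ, |θ.im| ≤ X.H → ‖f θ‖ ≤ b * (1 + ‖θ‖)) (hu : X.IsBounded u B) :
    Integrable (fun a => vecMul (u a) (X.κ a * f (X.c a))) X.μ :=
  (X.integrable.const_mul (m * b * B)).mono' (aestronglyMeasurable_vecMul hu.measurable
    (X.measurable_κ.mul (X.measurable_comp hfc.stronglyMeasurable))) (norm_density_le hf hu)

lemma integrable_cauchy {f : ℂ → CMat m} (hfc : Continuous f)
    (hf : ∀ θ : ℂ, |θ.im| ≤ X.H → ‖f θ‖ ≤ b * (1 + ‖θ‖)) (hu : X.IsBounded u B) (hδ : 0 < δ)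
    (hρ : ∀ᵐ a ∂X.μ, δ ≤ ‖X.c a - ρ‖) :
    Integrable (fun a => (X.c a - ρ)⁻¹ • vecMul (u a) (X.κ a * f (X.c a))) X.μ := by
  have h1 : Measurable fun θ : ℂ => (θ - ρ)⁻¹ := (measurable_id.sub measurable_const).inv
  refine (integrable_density hfc hf hu).bdd_smul δ⁻¹ (X.measurable_comp h1.stronglyMeasurable) ?_
  filter_upwards [hρ] with a ha
  rw [norm_inv]
  exact inv_anti₀ hδ ha

lemma norm_cauchy_le (hf : ∀ θ : ℂ, |θ.im| ≤ X.H → ‖f θ‖ ≤ b * (1 + ‖θ‖)) (hu : X.IsBounded u B)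
    (hδ : 0 < δ) (hρ : ∀ᵐ a ∂X.μ, δ ≤ ‖X.c a - ρ‖) :
    ‖X.cauchy f u ρ‖ ≤ δ⁻¹ * (m * b * B * ∫ a, (1 + ‖X.c a‖) * ‖X.κ a‖ ∂X.μ) := by
  refine (norm_integral_le_of_norm_le (X.integrable.const_mul (δ⁻¹ * (m * b * B))) ?_).trans_eq ?_
  · filter_upwards [hρ, norm_cauchy_integrand_le hf hu hδ] with a h1 h2 using h2 ρ h1
  · rw [integral_const_mul, mul_assoc]

/-- A bounded factor gains a power of `ρ`: `ρ / (θ - ρ) = θ / (θ - ρ) - 1`. -/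
lemma norm_cauchy_le_div (hf : ∀ θ : ℂ, |θ.im| ≤ X.H → ‖f θ‖ ≤ b) (hu : X.IsBounded u B)
    (hδ : 0 < δ) (hρ : ∀ᵐ a ∂X.μ, δ ≤ ‖X.c a - ρ‖)
    (hρ0 : ρ ≠ 0) :
    ‖X.cauchy f u ρ‖ ≤ (1 + δ⁻¹) / ‖ρ‖ * (m * b * B * ∫ a, (1 + ‖X.c a‖) * ‖X.κ a‖ ∂X.μ) := by
  have hn : 0 < ‖ρ‖ := norm_pos_iff.2 hρ0
  refine (norm_integral_le_of_norm_le
    (X.integrable.const_mul ((1 + δ⁻¹) / ‖ρ‖ * (m * b * B))) ?_).trans_eq ?_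
  · filter_upwards [hρ, norm_density_le (k := fun _ => 1) (by simpa using hf) hu] with a h1 h2
    have h0 : X.c a - ρ ≠ 0 := norm_pos_iff.1 (hδ.trans_le h1)
    have h3 : ‖(X.c a - ρ)⁻¹‖ ≤ (1 + δ⁻¹) / ‖ρ‖ * (1 + ‖X.c a‖) := by
      rw [div_mul_eq_mul_div, le_div_iff₀ hn, ← norm_mul]
      have e : (X.c a - ρ)⁻¹ * ρ = (X.c a - ρ)⁻¹ * X.c a - 1 := by
        field_simp
        ring
      have h4 : ‖(X.c a - ρ)⁻¹‖ ≤ δ⁻¹ := by rw [norm_inv]; gcongr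
      have h5 : 0 ≤ δ⁻¹ := by positivity
      rw [e]
      calc ‖(X.c a - ρ)⁻¹ * X.c a - 1‖ ≤ ‖(X.c a - ρ)⁻¹‖ * ‖X.c a‖ + 1 :=
            (norm_sub_le _ _).trans (by rw [norm_mul, norm_one])
        _ ≤ δ⁻¹ * ‖X.c a‖ + 1 := by gcongr
        _ ≤ (1 + δ⁻¹) * (1 + ‖X.c a‖) := by nlinarith [norm_nonneg (X.c a)]
    rw [norm_smul]
    have h6 : 0 ≤ (m : ℝ) * b * B * (1 * ‖X.κ a‖) := (norm_nonneg _).trans h2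
    calc ‖(X.c a - ρ)⁻¹‖ * _ ≤ ((1 + δ⁻¹) / ‖ρ‖ * (1 + ‖X.c a‖)) *
          (m * b * B * (1 * ‖X.κ a‖)) := by gcongr
      _ = _ := by ring
  · rw [integral_const_mul, mul_assoc]

/-- Off the curve, the transform is a combination of Cauchy integrals. -/
lemma transform_eq (h : W.IsRegular x K R) (hx : 0 ≤ x) (hu : X.IsBounded u B) (hδ : 0 < δ)
    (hρ : ∀ᵐ a ∂X.μ, δ ≤ ‖X.c a - ρ‖) :
    X.transform W u ρ = -(vecMul (X.cauchy W.ps' u ρ) (W.p ρ) -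
      vecMul (X.cauchy W.ps u ρ) (W.p' ρ)) := by
  obtain ⟨b, hb0, hb⟩ := h.exists_strip_bound hx X.H
  have i1 := integrable_cauchy h.dps'.continuous (fun θ hθ => (hb θ hθ).2.2.2) hu hδ hρ
  have i2 := integrable_cauchy h.dps.continuous (b := b) (fun θ hθ => (hb θ hθ).2.1.trans
    (le_mul_of_one_le_right hb0 (by linarith [norm_nonneg θ]))) hu hδ hρ
  have e1 : ∀ (f : ℂ → CMat m) (A : CMat m), Integrable (fun a => (X.c a - ρ)⁻¹ •
      vecMul (u a) (X.κ a * f (X.c a))) X.μ →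
      Integrable (fun a => vecMul ((X.c a - ρ)⁻¹ •
        vecMul (u a) (X.κ a * f (X.c a))) A) X.μ ∧
      vecMul (X.cauchy f u ρ) A = ∫ a, vecMul ((X.c a - ρ)⁻¹ •
        vecMul (u a) (X.κ a * f (X.c a))) A ∂X.μ := by
    intro f A hi
    set T : (Fin m → ℂ) →L[ℂ] (Fin m → ℂ) := (vecMulCLM m).flip A
    exact ⟨T.integrable_comp hi, (T.integral_comp_comm hi).symm⟩
  obtain ⟨j1, k1⟩ := e1 W.ps' (W.p ρ) i1
  obtain ⟨j2, k2⟩ := e1 W.ps (W.p' ρ) i2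
  rw [k1, k2, ← integral_sub j1 j2, ← integral_neg, transform]
  refine integral_congr_ae ?_
  filter_upwards [hρ] with a ha
  have h0 : X.c a - ρ ≠ 0 := norm_pos_iff.1 (hδ.trans_le ha)
  have e : (ρ - X.c a)⁻¹ = -(X.c a - ρ)⁻¹ := by rw [← neg_sub, inv_neg]
  rw [h.dreg_eq (sub_ne_zero.1 h0), e, Frame.num, mul_smul_comm, vecMul_smul, neg_smul,
    smul_vecMul, smul_vecMul, Matrix.vecMul_vecMul, Matrix.vecMul_vecMul,
    ← smul_sub, ← Matrix.vecMul_sub, mul_assoc, mul_assoc, ← Matrix.mul_sub]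

end WeightedCurve

end QuadPencil

/-! ### Cauchy integrals along the cut contour -/

namespace CutContour

open QuadPencil

variable {E : Type*} [NormedAddCommGroup E] [NormedSpace ℂ E] {Γ : CutContour} {R : ℝ}

lemma measurableSet_cut (Γ : CutContour) : MeasurableSet Γ.cut :=
  (isClosed_Iic.union isClosed_Ici).measurableSet

lemma setIntegral_cut {g : ℝ → E} (hg : IntegrableOn g Γ.cut) (hl : Γ.left < R) (hr : Γ.right < R) :
    ∫ θ in Γ.cut, g θ = (∫ θ in (-R)..(-Γ.left), g θ) + (∫ θ in Γ.right..R, g θ) +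
      ∫ θ in Γ.cut \ Icc (-R) R, g θ := by
  have h1 := Γ.left_pos
  have h2 := Γ.right_pos
  rw [← integral_inter_add_sdiff (s := Γ.cut) (t := Icc (-R) R) measurableSet_Icc hg]
  congr 1
  have e : Γ.cut ∩ Icc (-R) R = Icc (-R) (-Γ.left) ∪ Icc Γ.right R := by
    ext y
    simp only [cut, mem_inter_iff, mem_union, mem_Iic, mem_Ici, mem_Icc]
    grind
  have hs : Γ.cut ∩ Icc (-R) R ⊆ Γ.cut := inter_subset_left
  rw [e] at hs
  rw [e, setIntegral_union (disjoint_left.2 fun y hy hy' => by linarith [hy.2, hy'.1])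
    measurableSet_Icc (hg.mono_set (subset_union_left.trans hs))
    (hg.mono_set (subset_union_right.trans hs)), integral_of_le (by linarith),
    integral_of_le hr.le, integral_Icc_eq_integral_Ioc,
    integral_Icc_eq_integral_Ioc]

/-- The part of the cuts outside the disc of radius `R` remains when the contour is deformed. -/
noncomputable def outerPart (Γ : CutContour) (R : ℝ) (f : ℝ → ℂ → E) : E :=
  halfCircle 1 R (f 1) + halfCircle (-1) R (f (-1)) +
    ∫ θ : ℝ in Γ.cut \ Icc (-R) R, (f (-1) θ - f 1 θ)

lemma integral_eq [CompleteSpace E] {t₁ t₂ σ : ℝ} (h : Γ.IsCrossing t₁ t₂ σ)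
    (hR : Γ.Within R) {f : ℝ → ℂ → E} {F : ℂ → E}
    (hF : ∀ s, IsSign s → ∀ z ∈ halfPlane s, z ∉ Γ.interior → F z = f s z)
    (hf : ∀ (s : ℝ) (hs : IsSign s), ContinuousOn (f s) (halfChain h hs hR).carrier)
    (hi : ∀ s, IsSign s → IntegrableOn (fun θ : ℝ => f s θ) Γ.cut) :
    Γ.integral F (fun θ => f 1 θ) (fun θ => f (-1) θ) =
      (halfChain h (.inl rfl) hR).integral (f 1) +
        (halfChain h (.inr rfl) hR).integral (f (-1)) + Γ.outerPart R f := by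
  obtain ⟨hl, hr⟩ := norm_lt_of_arcStart hR
  have i1 := hi 1 (.inl rfl)
  have i2 := hi (-1) (.inr rfl)
  rw [integral, (arcIntegral_add h hR hF hf).2, setIntegral_cut i1 hl hr, setIntegral_cut i2 hl hr,
    halfChain_integral, halfChain_integral, outerPart,
    integral_sub (i2.mono_set sdiff_subset) (i1.mono_set sdiff_subset), cutIntegral, cutIntegral]
  simp
  abel

/-- The density `g` of a Cauchy integral along the contour: `g 1` and `g (-1)` are holomorphic in
the half-planes, off a closed set `K` inside `γ₀`, and continuous up to the real axis. On `γ₀` both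
are joined to `G`. -/
structure Density (Γ : CutContour) (K : Set ℂ) (g : ℝ → ℂ → E) (G : ℂ → E) : Prop where
  closed : IsClosed K
  subset : K ⊆ Γ.interior
  cont : ∀ s, IsSign s → ContinuousOn (g s) (closedHalfPlane s \ K)
  diff : ∀ s, IsSign s → DifferentiableOn ℂ (g s) (halfPlane s \ K)
  integrable : ∀ s, IsSign s → IntegrableOn (fun θ : ℝ => g s θ) Γ.cut
  glue : ∀ s, IsSign s → ∀ z ∈ halfPlane s, z ∉ Γ.interior → G z = g s z

/-- The Cauchy integral `∫ (z - ρ)⁻¹ g(z) dz`. -/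
noncomputable def cauchyIntegral (Γ : CutContour) (g : ℝ → ℂ → E) (G : ℂ → E) (ρ : ℂ) : E :=
  Γ.integral (fun z => (z - ρ)⁻¹ • G z) (fun θ => ((θ : ℂ) - ρ)⁻¹ • g 1 θ)
    fun θ => ((θ : ℂ) - ρ)⁻¹ • g (-1) θ

/-- Cauchy integrals are holomorphic off the curve. -/
lemma differentiableOn_cauchy_ball {α : Type*} [MeasurableSpace α] {μ : Measure α} {c : α → ℂ}
    {φ : α → E} (hc : AEStronglyMeasurable c μ) (hφ : Integrable φ μ) (hR : ∀ᵐ a ∂μ, R ≤ ‖c a‖) :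
    DifferentiableOn ℂ (fun ρ => ∫ a, (c a - ρ)⁻¹ • φ a ∂μ) (ball 0 R) := by
  intro ρ₀ hρ₀
  rw [mem_ball_zero_iff] at hρ₀
  obtain ⟨r, h1, h2⟩ := exists_between hρ₀
  have hr : 0 < R - r := sub_pos.2 h2
  have hd : ∀ᵐ a ∂μ, ∀ ρ ∈ ball (0 : ℂ) r, R - r ≤ ‖c a - ρ‖ := by
    filter_upwards [hR] with a ha ρ hρ
    rw [mem_ball_zero_iff] at hρ
    linarith [norm_sub_norm_le (c a) ρ]
  refine ((differentiableOn_integral_of_dominated isOpen_ball (fun ρ _ => ?_) ?_ ?_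
    (hφ.norm.const_mul (R - r)⁻¹)).differentiableAt
    (isOpen_ball.mem_nhds (mem_ball_zero_iff.2 h1))).differentiableWithinAt
  · exact ((hc.aemeasurable.sub aemeasurable_const).inv.aestronglyMeasurable).smul hφ.1
  · filter_upwards [hd] with a ha
    refine ((differentiableOn_const _).sub differentiableOn_id).inv (fun ρ hρ => ?_) |>.smul
      (differentiableOn_const _)
    exact norm_pos_iff.1 (hr.trans_le (ha ρ hρ))
  · filter_upwards [hd] with a ha ρ hρ
    rw [norm_smul, norm_inv]
    gcongr
    exact ha ρ hρ

variable {K : Set ℂ} {g : ℝ → ℂ → E} {G : ℂ → E}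

lemma halfCircle_point {s τ : ℝ} (hs : IsSign s) (hR : 0 ≤ R) (hτ : τ ∈ Icc 0 π) :
    ((s * R : ℝ) : ℂ) * exp (τ * I) ∈ closedHalfPlane s ∧
      ‖((s * R : ℝ) : ℂ) * exp (τ * I)‖ = R ∧
      s * (((s * R : ℝ) : ℂ) * exp (τ * I)).im = R * Real.sin τ := by
  have e : s * (((s * R : ℝ) : ℂ) * exp (τ * I)).im = R * Real.sin τ := by
    rw [im_ofReal_mul, Complex.exp_ofReal_mul_I_im, ← mul_assoc, ← mul_assoc,
      sign_mul_self hs, one_mul]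
  refine ⟨?_, ?_, e⟩
  · change 0 ≤ s * _
    rw [e]
    exact mul_nonneg hR (Real.sin_nonneg_of_mem_Icc hτ)
  · rw [norm_mul, Complex.norm_exp_ofReal_mul_I, mul_one, norm_real, norm_mul,
      norm_of_nonneg hR]
    rcases hs with rfl | rfl <;> simp

lemma continuousOn_halfCircle {s : ℝ} (hs : IsSign s) (hR : 0 ≤ R) {f : ℂ → E}
    (hf : ContinuousOn f {z | z ∈ closedHalfPlane s ∧ ‖z‖ = R}) :
    ContinuousOn (fun τ : ℝ => ((s * R : ℝ) * (exp (τ * I) * I) : ℂ) •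
      f ((s * R : ℝ) * exp (τ * I))) (Icc 0 π) := by
  refine ContinuousOn.smul (by fun_prop) (hf.comp (by fun_prop) fun τ hτ => ?_)
  exact ⟨(halfCircle_point hs hR hτ).1, (halfCircle_point hs hR hτ).2.1⟩

namespace Density

lemma notMem (d : Γ.Density K g G) (hR : Γ.Within R) {z : ℂ} (hz : R ≤ ‖z‖) :
    z ∉ K := fun h => (norm_lt_of_mem_interior hR (d.subset h)).not_ge hz

lemma integrable_inv_smul (d : Γ.Density K g G) {ρ : ℂ} (hρ : ∀ θ ∈ Γ.cut, (θ : ℂ) ≠ ρ) {s : ℝ}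
    (hs : IsSign s) : IntegrableOn (fun θ : ℝ => ((θ : ℂ) - ρ)⁻¹ • g s θ) Γ.cut := by
  have hclosed : IsClosed ((fun θ : ℝ => (θ : ℂ)) '' Γ.cut) :=
    Complex.isometry_ofReal.isClosedEmbedding.isClosedMap _ (isClosed_Iic.union isClosed_Ici)
  have hmem : ((fun θ : ℝ => (θ : ℂ)) '' Γ.cut)ᶜ ∈ 𝓝 ρ :=
    hclosed.isOpen_compl.mem_nhds fun ⟨θ, h1, h2⟩ => hρ θ h1 h2
  obtain ⟨δ, hδ, hb⟩ := Metric.mem_nhds_iff.1 hmem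
  refine (d.integrable s hs).bdd_smul δ⁻¹ ?_ ?_
  · exact ((continuous_ofReal.measurable.sub measurable_const).inv).aestronglyMeasurable
  · filter_upwards [ae_restrict_mem Γ.measurableSet_cut] with θ hθ
    rw [norm_inv]
    refine inv_anti₀ hδ (not_lt.1 fun hlt => hb ?_ ⟨θ, hθ, rfl⟩)
    rwa [mem_ball, dist_eq_norm]

lemma differentiableOn_outerPart (d : Γ.Density K g G) (hR : Γ.Within R) :
    DifferentiableOn ℂ (fun ρ => Γ.outerPart R fun s z => (z - ρ)⁻¹ • g s z) (ball 0 R) := by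
  have hR0 : 0 ≤ R := (norm_nonneg _).trans (hR 0 ⟨le_rfl, zero_le_one⟩).le
  have key : ∀ s, IsSign s → DifferentiableOn ℂ
      (fun ρ => halfCircle s R fun z => (z - ρ)⁻¹ • g s z) (ball 0 R) := by
    intro s hs
    have hc := continuousOn_halfCircle hs hR0 (f := g s) ((d.cont s hs).mono fun z hz =>
      ⟨hz.1, d.notMem hR hz.2.ge⟩)
    have := differentiableOn_cauchy_ball (R := R) (μ := volume.restrict (Ioc 0 π))
      (c := fun τ : ℝ => ((s * R : ℝ) : ℂ) * exp (τ * I))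
      (by fun_prop) ((hc.integrableOn_Icc).mono_set Ioc_subset_Icc_self)
      (by filter_upwards [ae_restrict_mem measurableSet_Ioc] with τ hτ
          exact (halfCircle_point hs hR0 ⟨hτ.1.le, hτ.2⟩).2.1.ge)
    refine this.congr fun ρ _ => ?_
    rw [halfCircle, integral_of_le pi_pos.le]
    simp only [smul_comm ((_ - ρ)⁻¹)]
  refine ((key 1 (.inl rfl)).add (key (-1) (.inr rfl))).add ?_
  have := differentiableOn_cauchy_ball (R := R) (μ := volume.restrict (Γ.cut \ Icc (-R) R))
    (c := fun θ : ℝ => (θ : ℂ)) (by fun_prop)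
    (((d.integrable (-1) (.inr rfl)).sub (d.integrable 1 (.inl rfl))).mono_set sdiff_subset)
    (by filter_upwards [ae_restrict_mem (Γ.measurableSet_cut.diff measurableSet_Icc)] with θ hθ
        rw [norm_real, norm_eq_abs]
        exact (not_le.1 fun h => hθ.2 (abs_le.1 h)).le)
  exact this.congr fun ρ _ => by simp only [Pi.sub_apply, smul_sub]

/-- Outside `γ₀`, the Cauchy integral differs from the remaining outer part by the residue. -/
lemma outerPart_eq [CompleteSpace E] (d : Γ.Density K g G)
    (hR : Γ.Within R) {s : ℝ} (hs : IsSign s) {ρ : ℂ}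
    (hρ : ρ ∈ halfPlane s) (hρR : ‖ρ‖ < R) (hρ0 : Γ.Within ‖ρ‖) :
    Γ.outerPart R (fun s z => (z - ρ)⁻¹ • g s z) =
      Γ.cauchyIntegral g G ρ + (2 * π * I) • g s ρ := by
  obtain ⟨t₁, t₂, σ, h⟩ := Γ.exists_isCrossing
  have him := im_ne_zero_of_mem hρ
  -- the two half-planes: that of `ρ`, and the opposite one
  have key : ∀ (s' : ℝ) (hs' : IsSign s'),
      ContinuousOn (fun z => (z - ρ)⁻¹ • g s' z) (halfChain h hs' hR).carrier ∧
      (halfChain h hs' hR).integral (fun z => (z - ρ)⁻¹ • g s' z) =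
        if s' = s then -(2 * π * I) • g s ρ else 0 := by
    intro s' hs'
    have hsub : (halfChain h hs' hR).carrier ⊆ closedHalfPlane s' \ K := fun z hz =>
      ⟨(halfChain_carrier h hs' hR hz).1, fun hk => (halfChain_carrier h hs' hR hz).2 (d.subset hk)⟩
    split_ifs with hss
    · subst hss
      obtain ⟨h1, h2⟩ := halfChain_integral_cauchy h hs' hR d.closed
        (inter_subset_left.trans d.subset) (d.cont s' hs') (d.diff s' hs') hρ hρR hρ0
      exact ⟨(ClosedChain.continuousOn_inv_sub _ h2).smul ((d.cont s' hs').mono hsub), h1⟩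
    · have hne : ∀ z ∈ closedHalfPlane s', z - ρ ≠ 0 := fun z hz e => by
        have h1 : 0 < s * ρ.im := hρ
        have h2 : 0 ≤ s' * z.im := hz
        rw [sub_eq_zero.1 e] at h2
        rcases hs with rfl | rfl <;> rcases hs' with rfl | rfl <;> first | exact hss rfl | linarith
      have hc : ContinuousOn (fun z => (z - ρ)⁻¹ • g s' z) (closedHalfPlane s' \ K) :=
        ((continuousOn_id.sub continuousOn_const).inv₀ fun z hz => hne z hz.1).smul (d.cont s' hs')
      refine ⟨hc.mono hsub, halfChain_integral_eq_zero h hs' hR d.closed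
        (inter_subset_left.trans d.subset) hc ?_⟩
      exact ((differentiableOn_id.sub (differentiableOn_const _)).inv fun z hz =>
        hne z (halfPlane_subset_closed s' hz.1)).smul (d.diff s' hs')
  have hI := integral_eq h hR (F := fun z => (z - ρ)⁻¹ • G z) (f := fun s z => (z - ρ)⁻¹ • g s z)
    (fun s hs z hz hi => by simp only [d.glue s hs z hz hi]) (fun s hs => (key s hs).1)
    fun s hs => d.integrable_inv_smul (fun θ _ e => him (by rw [← e]; exact ofReal_im θ)) hs
  rw [cauchyIntegral, hI, (key 1 (.inl rfl)).2, (key (-1) (.inr rfl)).2]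
  rcases hs with rfl | rfl <;> norm_num

/-- Both boundary values of the Cauchy integral belong to one entire function, up to the density. -/
theorem exists_entire [CompleteSpace E] (d : Γ.Density K g G)
    (hR : Γ.Within R) : ∃ F : ℂ → E, Differentiable ℂ F ∧
      ∀ s, IsSign s → ∀ ρ ∈ halfPlane s, R ≤ ‖ρ‖ →
        F ρ = (2 * π * I)⁻¹ • Γ.cauchyIntegral g G ρ + g s ρ := by
  have hR0 : 0 < R := (norm_nonneg _).trans_lt (hR 0 ⟨le_rfl, zero_le_one⟩)
  set T : ℝ → ℂ → E := fun r ρ => Γ.outerPart r fun s z => (z - ρ)⁻¹ • g s z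
  have hlt : ∀ r, R ≤ r → Γ.Within r := fun r hr t ht =>
    (hR t ht).trans_le hr
  have hT : ∀ r, R ≤ r → AnalyticOnNhd ℂ (T r) (ball 0 r) := fun r hr =>
    (d.differentiableOn_outerPart (hlt r hr)).analyticOnNhd isOpen_ball
  -- near a point of the upper half-plane, the outer parts for all radii agree
  have hmono : ∀ r r', R < r → r ≤ r' → EqOn (T r) (T r') (ball 0 r) := by
    intro r r' h1 h2
    obtain ⟨y, hy1, hy2⟩ := exists_between h1
    have hy : ‖(y * I : ℂ)‖ = y := by simp [abs_of_pos (hR0.trans hy1)]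
    refine (hT r h1.le).eqOn_of_preconnected_of_eventuallyEq
      ((hT r' (h1.le.trans h2)).mono (Metric.ball_subset_ball h2))
      (convex_ball _ _).isPreconnected (z₀ := y * I) (by rwa [mem_ball_zero_iff, hy]) ?_
    have o1 : ∀ᶠ z : ℂ in 𝓝 (y * I), R < ‖z‖ ∧ ‖z‖ < r :=
      (continuous_norm.tendsto _).eventually (Ioo_mem_nhds (by rwa [hy]) (by rwa [hy]))
    have o2 : ∀ᶠ z : ℂ in 𝓝 (y * I), z ∈ halfPlane 1 :=
      (isOpen_halfPlane 1).mem_nhds (by simpa [halfPlane] using hR0.trans hy1)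
    filter_upwards [o1, o2] with z hz hz'
    have hz0 := hlt ‖z‖ hz.1.le
    exact (d.outerPart_eq (hlt r h1.le) (.inl rfl) hz' hz.2 hz0).trans
      (d.outerPart_eq (hlt r' (h1.le.trans h2)) (.inl rfl) hz' (hz.2.trans_le h2) hz0).symm
  refine ⟨fun ρ => (2 * π * I : ℂ)⁻¹ • T (‖ρ‖ + R + 1) ρ, fun ρ₀ => ?_,
    fun s hs ρ hρ hn => ?_⟩
  · set r := ‖ρ₀‖ + R + 1
    have hr : ‖ρ₀‖ < r := by simp only [r]; linarith
    have hm : ball (0 : ℂ) r ∈ 𝓝 ρ₀ :=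
      isOpen_ball.mem_nhds (mem_ball_zero_iff.2 hr)
    refine DifferentiableAt.const_smul (DifferentiableAt.congr_of_eventuallyEq
      ((hT r (by simp only [r]; linarith [norm_nonneg ρ₀])) ρ₀
        (mem_of_mem_nhds hm)).differentiableAt
      ?_) _
    filter_upwards [hm] with ρ hρ
    have h0 := norm_nonneg ρ
    rw [mem_ball_zero_iff] at hρ
    rcases le_total (‖ρ‖ + R + 1) r with h | h
    · exact hmono _ _ (by linarith) h (mem_ball_zero_iff.2 (by linarith))
    · exact (hmono _ _ (by simp only [r]; linarith [norm_nonneg ρ₀]) h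
        (mem_ball_zero_iff.2 hρ)).symm
  · have := d.outerPart_eq (hlt (‖ρ‖ + R + 1) (by linarith [norm_nonneg ρ])) hs hρ (by linarith)
      (hlt _ hn)
    have h2 : (2 * π * I : ℂ) ≠ 0 := Complex.two_pi_I_ne_zero
    change (2 * π * I : ℂ)⁻¹ • Γ.outerPart _ _ = _
    rw [this, smul_add, smul_smul, inv_mul_cancel₀ h2, one_smul]

/-- If the density is the difference of an entire function and of functions which are bounded and
tend to zero deep in the half-planes, then inside `γ₀` its Cauchy integral is that entire function,
up to the factor `2 π i`. -/
theorem cauchyIntegral_eq [CompleteSpace E] (d : Γ.Density K g G)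
    (hR : Γ.Within R) {ρ : ℂ} (hρ : ρ ∈ Γ.interior) {F : ℂ → E}
    (hF : Differentiable ℂ F) {e : ℝ → ℂ → E} {B : ℝ} (hge : ∀ s, IsSign s →
      ∀ z ∈ closedHalfPlane s, R ≤ ‖z‖ → g s z = F z - e s z ∧ ‖e s z‖ ≤ B)
    (hlim : ∀ s, IsSign s → Tendsto (e s) (comap (fun z => s * z.im) atTop) (𝓝 0)) :
    Γ.cauchyIntegral g G ρ = (2 * π * I) • F ρ := by
  obtain ⟨t₁, t₂, σ, h⟩ := Γ.exists_isCrossing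
  have hρR := norm_lt_of_mem_interior hR hρ
  have hR0 : 0 < R := (norm_nonneg _).trans_lt hρR
  set f : ℝ → ℂ → E := fun s z => (z - ρ)⁻¹ • g s z with hf
  have hfi : ∀ s, IsSign s → IntegrableOn (fun θ : ℝ => f s θ) Γ.cut := fun s hs =>
    d.integrable_inv_smul (fun θ hθ e => notMem_interior_of_mem_cut hθ (e ▸ hρ)) hs
  have hne : ∀ z, z ∉ insert ρ K → z - ρ ≠ 0 := fun z hz e => hz (.inl (sub_eq_zero.1 e))
  have hfc : ∀ s, IsSign s → ContinuousOn (f s) (closedHalfPlane s \ insert ρ K) :=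
    fun s hs => ((continuousOn_id.sub continuousOn_const).inv₀ fun z hz => hne z hz.2).smul
      ((d.cont s hs).mono (sdiff_subset_sdiff_right (subset_insert _ _)))
  have hfd : ∀ s, IsSign s → DifferentiableOn ℂ (f s) (halfPlane s \ insert ρ K) :=
    fun s hs => ((differentiableOn_id.sub (differentiableOn_const _)).inv fun z hz =>
      hne z hz.2).smul
      ((d.diff s hs).mono (sdiff_subset_sdiff_right (subset_insert _ _)))
  have hK' : insert ρ K ⊆ Γ.interior := insert_subset hρ d.subset
  -- only the half-circles and the cuts beyond them remain
  have hI : ∀ r, R ≤ r → Γ.cauchyIntegral g G ρ = Γ.outerPart r f := by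
    intro r hr
    have hr' : Γ.Within r := fun t ht => (hR t ht).trans_le hr
    have hz : ∀ (s : ℝ) (hs : IsSign s), (halfChain h hs hr').integral (f s) = 0 :=
      fun s hs => halfChain_integral_eq_zero h hs hr' (isClosed_singleton.union d.closed)
        (inter_subset_left.trans hK') (hfc s hs) (hfd s hs)
    have := integral_eq h hr' (F := fun z => (z - ρ)⁻¹ • G z) (f := f)
      (fun s hs z hz hi => by simp only [hf, d.glue s hs z hz hi])
      (fun s hs => (hfc s hs).mono fun z hz => ⟨(halfChain_carrier h hs hr' hz).1,
        fun hk => (halfChain_carrier h hs hr' hz).2 (hK' hk)⟩) hfi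
    rw [hz, hz, add_zero, zero_add] at this
    exact this
  -- `q` contributes a full circle integral, and the contribution of `k` vanishes in the limit
  set q : ℂ → E := fun z => (z - ρ)⁻¹ • F z
  set k : ℝ → ℂ → E := fun s z => q z - f s z
  have hfar : ∀ r, R ≤ r → ∀ z : ℂ, ‖z‖ = r → z ∉ insert ρ K := fun r hr z hz hk =>
    (norm_lt_of_mem_interior hR (hK' hk)).not_ge (hr.trans hz.ge)
  have hqc : ∀ r, R ≤ r → ContinuousOn q {z | ‖z‖ = r} := fun r hr =>
    ((continuousOn_id.sub continuousOn_const).inv₀ fun z hz => hne z (hfar r hr z hz)).smul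
      hF.continuous.continuousOn
  have hsplit : ∀ r, R ≤ r → Γ.cauchyIntegral g G ρ = (2 * π * I : ℂ) • F ρ -
      (halfCircle 1 r (k 1) + halfCircle (-1) r (k (-1))) +
      ∫ θ : ℝ in Γ.cut \ Icc (-r) r, (f (-1) θ - f 1 θ) := by
    intro r hr
    have hr0 : 0 ≤ r := hR0.le.trans hr
    have hs : ∀ s, IsSign s →
        halfCircle s r (k s) = halfCircle s r q - halfCircle s r (f s) := by
      intro s hs
      have c1 := continuousOn_halfCircle hs hr0 ((hqc r hr).mono fun z hz => hz.2)
      have c2 := continuousOn_halfCircle hs hr0 ((hfc s hs).mono fun z hz =>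
        ⟨hz.1, hfar r hr z hz.2⟩)
      rw [halfCircle, halfCircle, halfCircle, ← intervalIntegral.integral_sub
        (c1.intervalIntegrable_of_Icc pi_pos.le) (c2.intervalIntegrable_of_Icc pi_pos.le)]
      simp only [k, smul_sub]
    have hq : halfCircle 1 r q + halfCircle (-1) r q = (2 * π * I : ℂ) • F ρ := by
      rw [halfCircle_add hr0 ((hqc r hr).mono fun z hz => mem_sphere_zero_iff_norm.1 hz)]
      exact hF.diffContOnCl.circleIntegral_sub_inv_smul
        (mem_ball_zero_iff.2 (hρR.trans_le hr))
    rw [hI r hr, outerPart, hs 1 (.inl rfl), hs (-1) (.inr rfl), ← hq]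
    abel
  have htail : Tendsto (fun r : ℝ => ∫ θ : ℝ in Γ.cut \ Icc (-r) r, (f (-1) θ - f 1 θ)) atTop
      (𝓝 0) := by
    have := tendsto_setIntegral_of_antitone (μ := volume)
      (s := fun r : ℝ => Γ.cut \ Icc (-r) r) (f := fun θ : ℝ => f (-1) θ - f 1 θ)
      (fun r => Γ.measurableSet_cut.diff measurableSet_Icc)
      (fun r r' h => sdiff_subset_sdiff_right (Icc_subset_Icc (neg_le_neg h) h))
      ⟨0, ((hfi _ (.inr rfl)).sub (hfi _ (.inl rfl))).mono_set sdiff_subset⟩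
    have hempty : ⋂ r : ℝ, Γ.cut \ Icc (-r) r = ∅ := eq_empty_of_forall_notMem fun θ hθ =>
      (mem_iInter.1 hθ |θ|).2 ⟨neg_abs_le θ, le_abs_self θ⟩
    rwa [hempty, setIntegral_empty] at this
  have hhc : ∀ s, IsSign s → Tendsto (fun r => halfCircle s r (k s)) atTop (𝓝 0) := by
    intro s hs
    have hke : ∀ z ∈ closedHalfPlane s, R ≤ ‖z‖ → k s z = (z - ρ)⁻¹ • e s z := fun z hz hn => by
      simp only [k, q, f, (hge s hs z hz hn).1, smul_sub, sub_sub_cancel]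
    have hbound : ∀ r, 2 * R ≤ r → ∀ τ ∈ Icc 0 π,
        ‖((s * r : ℝ) * (exp (τ * I) * I) : ℂ) •
          k s ((s * r : ℝ) * exp (τ * I))‖ ≤
          2 * ‖e s ((s * r : ℝ) * exp (τ * I))‖ := by
      intro r hr τ hτ
      have hr0 : 0 < r := by linarith
      obtain ⟨h1, h2, -⟩ := halfCircle_point hs hr0.le hτ
      rw [hke _ h1 (by linarith), ← mul_assoc, norm_smul, norm_smul, norm_mul, h2, norm_inv,
        norm_I, mul_one, ← mul_assoc]
      refine mul_le_mul_of_nonneg_right ?_ (norm_nonneg _)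
      have h3 := norm_sub_norm_le (((s * r : ℝ) : ℂ) * exp (τ * I)) ρ
      rw [h2] at h3
      rw [← div_eq_mul_inv, div_le_iff₀ (by linarith)]
      linarith
    have h0 : (0 : E) = ∫ _ in (0 : ℝ)..Real.pi, (0 : E) := by simp
    rw [h0]
    refine intervalIntegral.tendsto_integral_filter_of_dominated_convergence (fun _ => 2 * B)
      ?_ ?_ intervalIntegrable_const ?_
    · filter_upwards [eventually_ge_atTop R] with r hr
      rw [uIoc_of_le pi_pos.le]
      refine ((continuousOn_halfCircle hs (hR0.le.trans hr) (((hqc r hr).mono fun z hz => hz.2).sub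
        ((hfc s hs).mono fun z hz => ⟨hz.1, hfar r hr z hz.2⟩))).mono
        Ioc_subset_Icc_self).aestronglyMeasurable measurableSet_Ioc
    · filter_upwards [eventually_ge_atTop (2 * R)] with r hr
      refine ae_of_all _ fun τ hτ => ?_
      rw [uIoc_of_le pi_pos.le] at hτ
      obtain ⟨h1, h2, -⟩ := halfCircle_point (R := r) hs (by linarith) ⟨hτ.1.le, hτ.2⟩
      exact (hbound r hr τ ⟨hτ.1.le, hτ.2⟩).trans
        (mul_le_mul_of_nonneg_left (hge s hs _ h1 (by linarith)).2 two_pos.le)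
    · have hpi : ∀ᵐ τ : ℝ, τ ≠ π := by simp [ae_iff, measure_singleton]
      filter_upwards [hpi] with τ hτne hτ
      rw [uIoc_of_le pi_pos.le] at hτ
      have hsin := Real.sin_pos_of_pos_of_lt_pi hτ.1 (lt_of_le_of_ne hτ.2 hτne)
      have hz : Tendsto (fun r : ℝ => e s ((s * r : ℝ) * exp (τ * I))) atTop
          (𝓝 0) := by
        refine (hlim s hs).comp (tendsto_comap_iff.2 ?_)
        refine (tendsto_id.atTop_mul_const hsin).congr' ?_
        filter_upwards [eventually_ge_atTop 0] with r hr
        exact (halfCircle_point hs hr ⟨hτ.1.le, hτ.2⟩).2.2.symm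
      refine squeeze_zero_norm' ?_ (by simpa only [norm_zero, mul_zero] using hz.norm.const_mul 2)
      filter_upwards [eventually_ge_atTop (2 * R)] with r hr using hbound r hr τ ⟨hτ.1.le, hτ.2⟩
  have hfin := (tendsto_const_nhds (x := (2 * π * I : ℂ) • F ρ)).sub
    ((hhc 1 (.inl rfl)).add (hhc (-1) (.inr rfl))) |>.add htail
  simp only [add_zero, sub_zero] at hfin
  refine tendsto_nhds_unique (tendsto_const_nhds.congr' ?_) hfin
  filter_upwards [eventually_ge_atTop R] with r hr using hsplit r hr

end Density

end CutContour

/-! ### The weighted contour of a pair of pencils -/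

namespace CutContour

open QuadPencil
section Parametrization

variable (Γ : CutContour)

/-- The parameter measure of `γ₀` (index `0`) and of the two sides of the cuts. -/
noncomputable def paramMeasure (i : Fin 3) : Measure ℝ :=
  ![volume.restrict (Ioc 0 1), volume.restrict Γ.cut, volume.restrict Γ.cut] i

/-- The measure which parametrizes the contour. -/
noncomputable def contourMeasure : Measure (Fin 3 × ℝ) :=
  Measure.sum fun i => (Γ.paramMeasure i).map (Prod.mk i)

variable {Γ} {F : Type*} [NormedAddCommGroup F]

lemma ae_contour {p : Fin 3 × ℝ → Prop} :
    (∀ᵐ a ∂Γ.contourMeasure, p a) ↔ ∀ i, ∀ᵐ t ∂Γ.paramMeasure i, p (i, t) :=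
  Measure.ae_sum_iff.trans (forall_congr' fun i => (measurableEmbedding_prodMk_left i).ae_map_iff)

lemma aestronglyMeasurable_contour {f : Fin 3 × ℝ → F} :
    AEStronglyMeasurable f Γ.contourMeasure ↔
      ∀ i, AEStronglyMeasurable (fun t => f (i, t)) (Γ.paramMeasure i) :=
  aestronglyMeasurable_sum_measure_iff.trans (forall_congr' fun i =>
    (measurableEmbedding_prodMk_left i).aestronglyMeasurable_map_iff)

lemma integrable_contour {f : Fin 3 × ℝ → F} : Integrable f Γ.contourMeasure ↔
    ∀ i, Integrable (fun t => f (i, t)) (Γ.paramMeasure i) :=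
  (integrable_sum_measure_iff.trans (and_iff_left (summable_of_hasFiniteSupport
    (toFinite _)))).trans (forall_congr' fun i =>
      (measurableEmbedding_prodMk_left i).integrable_map_iff)

lemma integral_contour [NormedSpace ℝ F] {f : Fin 3 × ℝ → F}
    (hf : Integrable f Γ.contourMeasure) : ∫ a, f a ∂Γ.contourMeasure =
      (∫ t in Ioc (0 : ℝ) 1, f (0, t)) + (∫ t in Γ.cut, f (1, t)) + ∫ t in Γ.cut, f (2, t) := by
  rw [contourMeasure, integral_sum_measure hf, tsum_fintype, Fin.sum_univ_three]
  simp only [(measurableEmbedding_prodMk_left _).integral_map]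
  rfl

/-- The point of the contour with the given parameter. -/
noncomputable def point (Γ : CutContour) (a : Fin 3 × ℝ) : ℂ := if a.1 = 0 then Γ.c a.2 else a.2

lemma ae_param {p : Fin 3 → ℝ → Prop} (h0 : ∀ t ∈ Ioc (0 : ℝ) 1, p 0 t)
    (h1 : ∀ t ∈ Γ.cut, p 1 t ∧ p 2 t) (i : Fin 3) : ∀ᵐ t ∂Γ.paramMeasure i, p i t := by
  fin_cases i
  · exact (ae_restrict_mem measurableSet_Ioc).mono h0
  · exact (ae_restrict_mem Γ.measurableSet_cut).mono fun t ht => (h1 t ht).1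
  · exact (ae_restrict_mem Γ.measurableSet_cut).mono fun t ht => (h1 t ht).2

lemma ae_point {p : ℂ → Prop} (hp : ∀ z ∈ Γ.carrier, p z) : ∀ᵐ a ∂Γ.contourMeasure, p (Γ.point a) :=
  ae_contour.2 (ae_param (fun t ht => hp _ (.inl ⟨t, ⟨ht.1.le, ht.2⟩, rfl⟩))
    fun t ht => ⟨hp _ (.inr ⟨t, ht, rfl⟩), hp _ (.inr ⟨t, ht, rfl⟩)⟩)

/-- The contour keeps the distance `δ` from `ρ`. -/
abbrev Far (Γ : CutContour) (δ : ℝ) (ρ : ℂ) : Prop := ∀ z ∈ Γ.carrier, δ ≤ ‖z - ρ‖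

lemma Far.ae {δ : ℝ} {ρ : ℂ} (h : Γ.Far δ ρ) : ∀ᵐ a ∂Γ.contourMeasure, δ ≤ ‖Γ.point a - ρ‖ :=
  ae_point (p := fun z => δ ≤ ‖z - ρ‖) h

lemma measurable_point_comp {f : ℂ → F} (hf : ContinuousOn f Γ.carrier) :
    AEStronglyMeasurable (fun a => f (Γ.point a)) Γ.contourMeasure := by
  have h1 : ContinuousOn (fun t : ℝ => f t) Γ.cut :=
    hf.comp continuous_ofReal.continuousOn fun t ht => Or.inr ⟨t, ht, rfl⟩
  refine aestronglyMeasurable_contour.2 fun i => ?_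
  fin_cases i
  · exact ((hf.comp Γ.piecewiseC1.regular.1 fun t ht => Or.inl ⟨t, ht, rfl⟩).mono
      Ioc_subset_Icc_self).aestronglyMeasurable measurableSet_Ioc
  · exact h1.aestronglyMeasurable Γ.measurableSet_cut
  · exact h1.aestronglyMeasurable Γ.measurableSet_cut

/-- Almost all points of `γ₀` are different from a given point and do not lie on the real axis. -/
lemma ae_curve (ρ : ℂ) : ∀ᵐ t ∂volume.restrict (Ioc (0 : ℝ) 1), Γ.c t ≠ ρ ∧ (Γ.c t).im ≠ 0 := by
  have key : ∀ z : ℂ, ∀ᵐ t ∂volume.restrict (Ioc (0 : ℝ) 1), Γ.c t ≠ z := by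
    intro z
    have hs : (insert 1 {t | t ∈ Ico (0 : ℝ) 1 ∧ Γ.c t = z}).Countable :=
      (Subsingleton.countable fun t ht u hu => Γ.simple ht.1 hu.1 (ht.2.trans hu.2.symm)).insert 1
    rw [ae_restrict_iff' measurableSet_Ioc]
    filter_upwards [hs.ae_notMem volume] with t ht hm hz
    exact ht (hm.2.eq_or_lt.imp id fun h => ⟨⟨hm.1.le, h⟩, hz⟩)
  filter_upwards [key ρ, key (-(Γ.left : ℂ)), key Γ.right, ae_restrict_mem measurableSet_Ioc]
    with t h1 h2 h3 ht
  refine ⟨h1, fun him => ?_⟩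
  have : Γ.c t ∈ {z ∈ Γ.c '' Icc 0 1 | z.im = 0} := ⟨⟨t, ⟨ht.1.le, ht.2⟩, rfl⟩, him⟩
  rw [Γ.meets_real] at this
  exact this.elim h2 h3

lemma norm_im_lt {R : ℝ} (hR : Γ.Within R) {z : ℂ} (hz : z ∈ Γ.carrier) :
    |z.im| ≤ R := by
  rcases hz with ⟨t, ht, rfl⟩ | ⟨t, -, rfl⟩
  · exact (abs_im_le_norm _).trans (hR t ht).le
  · simpa using (norm_nonneg _).trans (hR 0 ⟨le_rfl, zero_le_one⟩).le

end Parametrization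

variable {Γ : CutContour} {W V : Frame m} {x R : ℝ} {Om : CMat m} {K : Set ℂ}

/-- The difference of the Weyl matrices. -/
def hat (W V : Frame m) (s : ℝ) (z : ℂ) : CMat m := W.M s z - V.M s z

/-- The difference of the Weyl matrices off the real axis. -/
noncomputable def glued (W V : Frame m) (z : ℂ) : CMat m :=
  if 0 < z.im then hat W V 1 z else hat W V (-1) z

lemma glued_eq {s : ℝ} (hs : IsSign s) {z : ℂ} (hz : z ∈ halfPlane s) :
    glued W V z = hat W V s z := by
  have h : 0 < s * z.im := hz
  rcases hs with rfl | rfl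
  · exact if_pos (by linarith)
  · exact if_neg (by linarith)

/-- The properties of the solutions of a pencil and of a model pencil at the point `x` which
determine the null space of the operator. -/
structure ModelPair (Γ : CutContour) (W V : Frame m) (x : ℝ) (Om : CMat m) (K : Set ℂ) (R : ℝ) :
    Prop where
  nonneg : 0 ≤ x
  left : W.IsRegular x K R
  right : V.IsRegular x K R
  subset : K ⊆ Γ.interior
  lt : Γ.Within R
  integrable : ∀ s, IsSign s →
    IntegrableOn (fun θ : ℝ => ‖hat W V s θ‖ * (1 + |θ|)) Γ.cut
  lim : ∀ s, IsSign s → Tendsto (fun ρ => W.p ρ * V.ws' s ρ - W.w s ρ * V.ps' ρ)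
    (comap (fun ρ => s * ρ.im) atTop) (𝓝 Om)
  inj : ∀ w, (∀ ρ, vecMul w (W.p ρ) = 0) → w = 0

namespace ModelPair

lemma continuousOn_hat (P : ModelPair Γ W V x Om K R) {s : ℝ} (hs : IsSign s) :
    ContinuousOn (hat W V s) (closedHalfPlane s \ K) :=
  (P.left.contM s hs).sub (P.right.contM s hs)

lemma measurable_hat (P : ModelPair Γ W V x Om K R) {s : ℝ} (hs : IsSign s) :
    AEStronglyMeasurable (fun θ : ℝ => hat W V s θ) (volume.restrict Γ.cut) :=
  ((P.continuousOn_hat hs).comp continuous_ofReal.continuousOn fun θ hθ =>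
    ⟨by simp [closedHalfPlane], fun h => notMem_interior_of_mem_cut hθ (P.subset h)⟩
    ).aestronglyMeasurable Γ.measurableSet_cut

lemma integrable_glued (P : ModelPair Γ W V x Om K R) :
    IntegrableOn (fun t => deriv Γ.c t • glued W V (Γ.c t)) (Ioc 0 1) := by
  obtain ⟨t₁, t₂, σ, h⟩ := Γ.exists_isCrossing
  exact (intervalIntegrable_iff_integrableOn_Ioc_of_le zero_le_one).1
    (arcIntegral_add h P.lt (f := hat W V) (fun s hs z hz _ => glued_eq hs hz) fun s hs =>
      (P.continuousOn_hat hs).mono fun z hz => ⟨(halfChain_carrier h hs P.lt hz).1, fun hk =>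
        (halfChain_carrier h hs P.lt hz).2 (P.subset hk)⟩).1

/-- The weight `M̂(θ) dθ` in terms of the parameter. -/
noncomputable def weight (Γ : CutContour) (W V : Frame m) (a : Fin 3 × ℝ) : CMat m :=
  if a.1 = 0 then deriv Γ.c a.2 • glued W V (Γ.c a.2) else
    if a.1 = 1 then (-1 : ℂ) • hat W V 1 a.2 else hat W V (-1) a.2

lemma integrable_weight (P : ModelPair Γ W V x Om K R) :
    AEStronglyMeasurable (weight Γ W V) Γ.contourMeasure ∧
      Integrable (fun a => (1 + ‖Γ.point a‖) * ‖weight Γ W V a‖) Γ.contourMeasure := by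
  have e1 : ∀ t : ℝ, weight Γ W V (1, t) = (-1 : ℂ) • hat W V 1 t := fun t => by simp [weight]
  have e2 : ∀ t : ℝ, weight Γ W V (2, t) = hat W V (-1) t := fun t => by simp [weight]
  constructor
  · refine aestronglyMeasurable_contour.2 fun i => ?_
    fin_cases i
    · exact P.integrable_glued.1
    · exact ((P.measurable_hat (.inl rfl)).const_smul (-1 : ℂ)).congr
        (ae_of_all _ fun t => (e1 t).symm)
    · exact (P.measurable_hat (.inr rfl)).congr (ae_of_all _ fun t => (e2 t).symm)
  · refine integrable_contour.2 fun i => ?_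
    fin_cases i
    · have hc : AEStronglyMeasurable (fun t => 1 + ‖Γ.c t‖) (volume.restrict (Ioc 0 1)) :=
        ((continuousOn_const.add Γ.piecewiseC1.regular.1.norm).mono
          Ioc_subset_Icc_self).aestronglyMeasurable measurableSet_Ioc
      refine P.integrable_glued.norm.bdd_mul hc (c := 1 + R) ?_
      filter_upwards [ae_restrict_mem measurableSet_Ioc] with t ht
      rw [norm_of_nonneg (by positivity)]
      exact add_le_add le_rfl (P.lt t ⟨ht.1.le, ht.2⟩).le
    · refine (P.integrable 1 (.inl rfl)).congr (ae_of_all _ fun θ => ?_)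
      change _ = (1 + ‖(θ : ℂ)‖) * ‖weight Γ W V (1, θ)‖
      rw [e1, neg_one_smul, norm_neg, norm_real, norm_eq_abs, mul_comm]
    · refine (P.integrable (-1) (.inr rfl)).congr (ae_of_all _ fun θ => ?_)
      change _ = (1 + ‖(θ : ℂ)‖) * ‖weight Γ W V (2, θ)‖
      rw [e2, norm_real, norm_eq_abs, mul_comm]

/-- The contour with the weight `M̂(θ) dθ`. -/
noncomputable def curve (P : ModelPair Γ W V x Om K R) : WeightedCurve (Fin 3 × ℝ) m where
  μ := Γ.contourMeasure
  c := Γ.point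
  κ := weight Γ W V
  H := R
  measurable_c := measurable_point_comp (f := fun z => z) continuousOn_id
  measurable_κ := P.integrable_weight.1
  integrable := P.integrable_weight.2
  strip := ae_point (p := fun z => |z.im| ≤ R) fun _ hz => norm_im_lt P.lt hz

/-- The integral transform of a function on the contour. -/
noncomputable def transform (P : ModelPair Γ W V x Om K R) (u : ℂ → Fin m → ℂ) (ρ : ℂ) :
    Fin m → ℂ := P.curve.transform V (fun a => u (P.curve.c a)) ρ

/-- Integrals with respect to the weight are integrals along the contour. -/
lemma integral_curve (P : ModelPair Γ W V x Om K R) {T : ℂ → CMat m → Fin m → ℂ}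
    (hT : ∀ z (a : ℂ) A, T z (a • A) = a • T z A)
    (hi : Integrable (fun a => T (P.curve.c a) (P.curve.κ a)) P.curve.μ) :
    Γ.IntegrableAlong (fun z => T z (glued W V z)) (fun θ => T θ (hat W V 1 θ))
      (fun θ => T θ (hat W V (-1) θ)) ∧
    ∫ a, T (P.curve.c a) (P.curve.κ a) ∂P.curve.μ = Γ.integral (fun z => T z (glued W V z))
      (fun θ => T θ (hat W V 1 θ)) fun θ => T θ (hat W V (-1) θ) := by
  have h := integrable_contour.1 hi
  have e0 : ∀ t, T (P.curve.c (0, t)) (P.curve.κ (0, t)) =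
    deriv Γ.c t • T (Γ.c t) (glued W V (Γ.c t)) := fun t => hT _ _ _
  have e1 : ∀ t : ℝ, T (P.curve.c (1, t)) (P.curve.κ (1, t)) = -T t (hat W V 1 t) := fun t => by
    rw [← neg_one_smul ℂ, ← hT]
    simp [curve, weight, point]
  have e2 : ∀ t : ℝ, T (P.curve.c (2, t)) (P.curve.κ (2, t)) = T t (hat W V (-1) t) := fun t => by
    simp [curve, weight, point]
  have h0 := h 0
  have h1 := h 1
  have h2 := h 2
  simp only [e0, e1, e2] at h0 h1 h2
  refine ⟨⟨(intervalIntegrable_iff_integrableOn_Ioc_of_le zero_le_one).2 h0,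
    (integrable_neg_iff.1 h1 :), h2⟩, (integral_contour hi).trans ?_⟩
  simp only [e0, e1, e2, integral_neg]
  rw [CutContour.integral, integral_of_le zero_le_one]
  abel

lemma isBounded (P : ModelPair Γ W V x Om K R) {u : ℂ → Fin m → ℂ} (hu : ContinuousOn u Γ.carrier)
    {B : ℝ} (hB : ∀ z ∈ Γ.carrier, ‖u z‖ ≤ B) : P.curve.IsBounded (fun a => u (P.curve.c a)) B :=
  ⟨measurable_point_comp hu, ae_point (p := fun z => ‖u z‖ ≤ B) hB⟩

/-- The solution `Y` as a density against an entire matrix function of moderate growth. -/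
lemma density (P : ModelPair Γ W V x Om K R) {u : ℂ → Fin m → ℂ} (hu : Differentiable ℂ u)
    {B : ℝ} (hB : ∀ z ∈ Γ.carrier, ‖u z‖ ≤ B) {f : ℂ → CMat m} (hf : Differentiable ℂ f) {b : ℝ}
    (hb : ∀ z : ℂ, |z.im| ≤ R → ‖f z‖ ≤ b * (1 + ‖z‖)) :
    Γ.Density K (fun s z => vecMul (u z) (hat W V s z * f z))
      (fun z => vecMul (u z) (glued W V z * f z)) := by
  have hi := (P.integral_curve (T := fun z A => vecMul (u z) (A * f z))
    (fun z a A => by rw [smul_mul_assoc, vecMul_smul])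
    (WeightedCurve.integrable_density hf.continuous hb
      (P.isBounded hu.continuous.continuousOn hB))).1
  refine ⟨P.left.closed, P.subset, fun s hs => ?_, fun s hs => ?_, ?_, fun s hs z hz _ => ?_⟩
  · exact continuousOn_vecMul hu.continuous.continuousOn
      ((P.continuousOn_hat hs).mul hf.continuous.continuousOn)
  · exact differentiable_vecMul hu.differentiableOn
      (((P.left.diffM s hs).sub (P.right.diffM s hs)).mul hf.differentiableOn)
  · rintro s (rfl | rfl)
    · exact hi.2.1
    · exact hi.2.2
  · rw [glued_eq hs hz]

lemma cauchy_eq (P : ModelPair Γ W V x Om K R) {u : ℂ → Fin m → ℂ} (hu : Continuous u)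
    {B : ℝ} (hB : ∀ z ∈ Γ.carrier, ‖u z‖ ≤ B) {f : ℂ → CMat m} (hf : Continuous f) {b : ℝ}
    (hb : ∀ z : ℂ, |z.im| ≤ R → ‖f z‖ ≤ b * (1 + ‖z‖)) {ρ : ℂ} {δ : ℝ} (hδ : 0 < δ)
    (hρ : Γ.Far δ ρ) :
    P.curve.cauchy f (fun a => u (P.curve.c a)) ρ =
      Γ.cauchyIntegral (fun s z => vecMul (u z) (hat W V s z * f z))
        (fun z => vecMul (u z) (glued W V z * f z)) ρ :=
  (P.integral_curve (T := fun z A => (z - ρ)⁻¹ • vecMul (u z) (A * f z))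
    (fun z a A => by rw [smul_mul_assoc, vecMul_smul, smul_comm])
    (WeightedCurve.integrable_cauchy hf hb (P.isBounded hu.continuousOn hB) hδ hρ.ae)).2

end ModelPair

end CutContour

/-! ### The null space in terms of the limit matrix -/

/-- An entire function which is bounded up to a factor `1 + 1 / |Im z|` is constant. -/
lemma exists_eq_const_of_norm_le {E : Type*} [NormedAddCommGroup E] [NormedSpace ℂ E] {f : ℂ → E}
    (hf : Differentiable ℂ f) {c R : ℝ} (hc : 0 ≤ c)
    (h : ∀ z : ℂ, R ≤ ‖z‖ → z.im ≠ 0 → ‖f z‖ ≤ c * (1 + |z.im|⁻¹)) : ∀ z, f z = f 0 := by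
  refine fun z => hf.apply_eq_apply_of_bounded (isBounded_iff_forall_norm_le.2 ⟨6 * c, ?_⟩) z 0
  rintro _ ⟨z, rfl⟩
  set r := max (2 * ‖z‖) (max R 1)
  have h1 : 2 * ‖z‖ ≤ r := le_max_left _ _
  have h2 : R ≤ r := (le_max_left _ _).trans (le_max_right _ _)
  have h3 : 1 ≤ r := (le_max_right _ _).trans (le_max_right _ _)
  have hr : r ≠ 0 := by linarith
  -- the factor `ζ² - r²` vanishes at the real points of the circle of radius `r`
  have key := Complex.norm_le_of_forall_mem_frontier_norm_le (f := fun ζ : ℂ =>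
    (ζ ^ 2 - (r : ℂ) ^ 2) • f ζ)
    (U := ball 0 r) Metric.isBounded_ball
    (((differentiable_id.pow 2).sub_const _).smul hf).diffContOnCl (C := 4 * r ^ 2 * c) ?_
    (subset_closure (mem_ball_zero_iff.2 (by linarith [norm_nonneg z])) : z ∈ _)
  · have h4 : 3 / 4 * r ^ 2 ≤ ‖z ^ 2 - (r : ℂ) ^ 2‖ := by
      have := norm_sub_norm_le ((r : ℂ) ^ 2) (z ^ 2)
      rw [norm_sub_rev, norm_pow, norm_pow, norm_real, norm_eq_abs, sq_abs] at this
      nlinarith [norm_nonneg z]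
    rw [norm_smul] at key
    have h5 : 3 / 4 * r ^ 2 * ‖f z‖ ≤ 4 * r ^ 2 * c :=
      (mul_le_mul_of_nonneg_right h4 (norm_nonneg _)).trans key
    have h6 : 0 < r ^ 2 := by positivity
    by_contra! h7
    nlinarith
  · intro ζ hζ
    rw [frontier_ball _ hr, mem_sphere_zero_iff_norm] at hζ
    have e : ζ ^ 2 - (r : ℂ) ^ 2 = 2 * ζ * ζ.im * I := by
      have h5 : (r : ℂ) ^ 2 = ζ * (starRingEnd ℂ) ζ := by
        rw [Complex.mul_conj, Complex.normSq_eq_norm_sq, hζ]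
        push_cast
        rfl
      have h6 := Complex.sub_conj ζ
      rw [h5]
      push_cast at h6
      linear_combination ζ * h6
    have hi : |ζ.im| ≤ r := hζ ▸ abs_im_le_norm ζ
    rw [norm_smul, e, norm_mul, norm_mul, norm_mul, hζ, norm_I, norm_real,
      Complex.norm_two, norm_eq_abs, mul_one]
    by_cases h0 : ζ.im = 0
    · rw [h0, abs_zero, mul_zero, zero_mul]
      positivity
    · have h5 := abs_pos.2 h0
      calc 2 * r * |ζ.im| * ‖f ζ‖ ≤ 2 * r * |ζ.im| * (c * (1 + |ζ.im|⁻¹)) := by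
            gcongr
            exact h ζ (h2.trans hζ.ge) h0
        _ = 2 * r * c * (|ζ.im| + 1) := by field_simp
        _ ≤ 2 * r * c * (r + r) := by gcongr
        _ = _ := by ring

namespace QuadPencil.Frame

variable {A B : Frame m} {x R : ℝ} {K : Set ℂ}

/-- A left inverse of a square matrix is a right inverse. -/
lemma IsRegular.reversed (h : B.IsRegular x K R) (s : ℝ) (ρ : ℂ) :
    B.p ρ * B.ws' s ρ - B.w s ρ * B.ps' ρ = 1 ∧ B.p' ρ * B.ws' s ρ - B.w' s ρ * B.ps' ρ = 0 := by
  have e : Matrix.fromBlocks (B.qs' ρ) (-B.qs ρ) (-B.ps' ρ) (B.ps ρ) *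
      Matrix.fromBlocks (B.p ρ) (B.q ρ) (B.p' ρ) (B.q' ρ) = 1 := by
    rw [Matrix.fromBlocks_multiply, ← Matrix.fromBlocks_one, Matrix.fromBlocks_inj]
    have h1 := h.wr_pp ρ
    have h2 := h.wr_pq ρ
    refine ⟨?_, ?_, ?_, ?_⟩
    · rw [neg_mul, ← sub_eq_add_neg, h.wr_qp]
    · rw [neg_mul, ← sub_eq_add_neg, h.wr_qq]
    · rw [neg_mul, neg_add_eq_sub, ← neg_sub, h1, neg_zero]
    · rw [neg_mul, neg_add_eq_sub, ← neg_sub, h2, neg_neg]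
  rw [mul_eq_one_comm, Matrix.fromBlocks_multiply, ← Matrix.fromBlocks_one,
    Matrix.fromBlocks_inj] at e
  obtain ⟨e1, -, e2, -⟩ := e
  rw [mul_neg, ← sub_eq_add_neg] at e1 e2
  constructor
  · rw [← e1, ws', w]; noncomm_ring
  · rw [← e2, ws', w']; noncomm_ring

/-- In the mixed Wronskian-like products, the exponentials cancel. -/
lemma IsRegular.cross_bounds (h : A.IsRegular x K R) (h' : B.IsRegular x K R) {s : ℝ}
    (hs : IsSign s) {ρ : ℂ} (hρ : ρ ∈ closedHalfPlane s) (hn : R ≤ ‖ρ‖) :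
    ‖A.p ρ * B.ws' s ρ - A.w s ρ * B.ps' ρ‖ ≤ 2 * R ^ 2 ∧
    ‖A.p ρ * B.ws s ρ - A.w s ρ * B.ps ρ‖ ≤ 2 * R ^ 2 / ‖ρ‖ ∧
    ‖A.p' ρ * B.ws' s ρ - A.w' s ρ * B.ps' ρ‖ ≤ 2 * R ^ 2 * ‖ρ‖ ∧
    ‖A.p' ρ * B.ws s ρ - A.w' s ρ * B.ps ρ‖ ≤ 2 * R ^ 2 := by
  have hE := exp_pos (|ρ.im| * x)
  set E := Real.exp (|ρ.im| * x)
  have hρ0 : 0 < ‖ρ‖ := zero_lt_one.trans_le (h.one_le.trans hn)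
  have hC : 0 ≤ R := zero_le_one.trans h.one_le
  obtain ⟨p, p', -, -⟩ := h.growth ρ hn
  obtain ⟨-, -, ps, ps'⟩ := h'.growth ρ hn
  obtain ⟨w, w', -, -⟩ := h.decay s hs ρ hρ hn
  obtain ⟨-, -, ws, ws'⟩ := h'.decay s hs ρ hρ hn
  have key : ∀ {X Y X' Y' : CMat m} {a b a' b' c : ℝ}, ‖X‖ ≤ a → ‖Y‖ ≤ b → ‖X'‖ ≤ a' → ‖Y'‖ ≤ b' →
      0 ≤ a → 0 ≤ a' → a * b + a' * b' = c → ‖X * Y - X' * Y'‖ ≤ c := by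
    intro X Y X' Y' a b a' b' c h1 h2 h3 h4 h5 h6 h7
    rw [← h7]
    exact (norm_sub_le _ _).trans (add_le_add
      ((norm_mul_le _ _).trans (mul_le_mul h1 h2 (norm_nonneg _) h5))
      ((norm_mul_le _ _).trans (mul_le_mul h3 h4 (norm_nonneg _) h6)))
  refine ⟨key p ws' w ps' ?_ ?_ ?_, key p ws w ps ?_ ?_ ?_, key p' ws' w' ps' ?_ ?_ ?_,
    key p' ws w' ps ?_ ?_ ?_⟩
  all_goals first | positivity | (field_simp; ring)

end QuadPencil.Frame

namespace CutContour.ModelPair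

open QuadPencil Matrix
variable {Γ : CutContour} {W V : Frame m} {x R : ℝ} {Om : CMat m} {K : Set ℂ}

lemma exists_mem_halfPlane {ρ : ℂ} (h : ρ.im ≠ 0) : ∃ s, IsSign s ∧ ρ ∈ halfPlane s := by
  rcases h.lt_or_gt with h | h
  · exact ⟨-1, Or.inr rfl, by simpa [halfPlane] using h⟩
  · exact ⟨1, Or.inl rfl, by simpa [halfPlane] using h⟩

lemma zero_mem_interior (Γ : CutContour) : (0 : ℂ) ∈ Γ.interior :=
  ⟨fun ⟨_, ht, e⟩ => Γ.ne_zero ht e, Γ.winding_zero⟩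

lemma notMem_interior {z : ℂ} (hz : z ∈ Γ.carrier) : z ∉ Γ.interior := by
  rcases hz with h | ⟨t, ht, rfl⟩
  · exact fun hi => hi.1 h
  · exact notMem_interior_of_mem_cut ht

lemma exists_norm_vecMul_le (P : ModelPair Γ W V x Om K R) (w : Fin m → ℂ) :
    ∃ B, 0 ≤ B ∧ ∀ z ∈ Γ.carrier, ‖w ᵥ* W.p z‖ ≤ B := by
  obtain ⟨b, hb0, hb⟩ := P.left.exists_strip_bound P.nonneg R
  refine ⟨m * ‖w‖ * b, by positivity, fun z hz => (norm_vecMul_le _ _).trans ?_⟩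
  gcongr
  exact (hb z (norm_im_lt P.lt hz)).1

/-- The growth on the contour of the two factors of the kernel. -/
lemma exists_factor_bound (P : ModelPair Γ W V x Om K R) : ∃ b, 0 ≤ b ∧
    (∀ z : ℂ, |z.im| ≤ R → ‖V.ps' z‖ ≤ b * (1 + ‖z‖)) ∧ (∀ z : ℂ, |z.im| ≤ R → ‖V.ps z‖ ≤ b) ∧
      ∀ z : ℂ, |z.im| ≤ R → ‖V.ps z‖ ≤ b * (1 + ‖z‖) := by
  obtain ⟨b, hb0, hb⟩ := P.right.exists_strip_bound P.nonneg R
  exact ⟨b, hb0, fun z hz => (hb z hz).2.2.2, fun z hz => (hb z hz).2.1, fun z hz =>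
    (hb z hz).2.1.trans (le_mul_of_one_le_right hb0 (by linarith [norm_nonneg z]))⟩

/-- The functions `w φ` with `w Ω = 0` solve the homogeneous equation. -/
theorem transform_vecMul (P : ModelPair Γ W V x Om K R) {w : Fin m → ℂ} (hw : w ᵥ* Om = 0) (ρ : ℂ) :
    P.transform (fun z => w ᵥ* W.p z) ρ =
      -(2 * π * I) • (w ᵥ* W.p ρ) := by
  obtain ⟨B, -, hB⟩ := P.exists_norm_vecMul_le w
  obtain ⟨b, -, hb1, -, hb2⟩ := P.exists_factor_bound
  have hu : Differentiable ℂ fun z => w ᵥ* W.p z := (differentiable_const w).vecMul P.left.dp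
  have hbd := P.isBounded hu.continuous.continuousOn hB
  obtain ⟨r, hr, hball⟩ := Metric.isOpen_iff.1 isOpen_interior 0 (zero_mem_interior Γ)
  -- by the identity theorem, it suffices to consider `ρ` near `0`
  have hnhds : ∀ᶠ z : ℂ in 𝓝 0, P.transform (fun z => w ᵥ* W.p z) z =
      -(2 * π * I) • (w ᵥ* W.p z) := by
    filter_upwards [isOpen_ball.mem_nhds (Metric.mem_ball_self (half_pos hr))] with ρ hρ
    have hρi : ρ ∈ Γ.interior := hball (Metric.ball_subset_ball (by linarith) hρ)
    rw [mem_ball_zero_iff] at hρ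
    have hδ : Γ.Far (r / 2) ρ := fun z hz => by
      have : r ≤ ‖z‖ := not_lt.1 fun h => notMem_interior hz (hball (mem_ball_zero_iff.2 h))
      linarith [norm_sub_norm_le z ρ]
    have key : ∀ (f g : ℂ → CMat m) (B' : ℝ), Differentiable ℂ f → Differentiable ℂ g →
        (∀ z : ℂ, |z.im| ≤ R → ‖f z‖ ≤ b * (1 + ‖z‖)) →
        (∀ s, IsSign s → (∀ z ∈ closedHalfPlane s, R ≤ ‖z‖ →
          ‖W.p z * (g z + V.M s z * f z) - W.w s z * f z‖ ≤ B') ∧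
          Tendsto (fun z => w ᵥ* (W.p z * (g z + V.M s z * f z) - W.w s z * f z))
            (comap (fun z => s * z.im) atTop) (𝓝 0)) →
        P.curve.cauchy f (fun a => w ᵥ* W.p (P.curve.c a)) ρ =
          (2 * π * I) • (w ᵥ* (W.p ρ * g ρ - W.q ρ * f ρ)) := by
      intro f g B' hf hg hfb h
      rw [P.cauchy_eq hu.continuous hB hf.continuous hfb (half_pos hr) hδ]
      refine (P.density hu hB hf hfb).cauchyIntegral_eq P.lt hρi
        (F := fun z => w ᵥ* (W.p z * g z - W.q z * f z))
        ((differentiable_const w).vecMul ((P.left.dp.mul hg).sub (P.left.dq.mul hf)))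
          (B := m * ‖w‖ * B') ?_ fun s hs => (h s hs).2
      refine fun s hs z hz hn => ⟨?_, (norm_vecMul_le _ _).trans ?_⟩
      · rw [vecMul_vecMul, ← vecMul_sub]
        congr 1
        rw [hat, Frame.w]
        noncomm_ring
      · gcongr
        exact (h s hs).1 z hz hn
    have e1 := key V.ps' V.qs' (2 * R ^ 2) P.right.dps' P.right.dqs' hb1 fun s hs =>
      ⟨fun z hz hn => (P.left.cross_bounds P.right hs hz hn).1, by
        have := tendsto_vecMul (tendsto_const_nhds (x := w)) (P.lim s hs)
        rwa [hw] at this⟩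
    have e2 := key V.ps V.qs (2 * R ^ 2) P.right.dps P.right.dqs hb2 fun s hs => by
      have hc := fun z hz hn => (P.left.cross_bounds P.right hs (ρ := z) hz hn).2.1
      refine ⟨fun z hz hn => (hc z hz hn).trans (div_le_self (by positivity)
        (P.left.one_le.trans hn)), ?_⟩
      have him : ∀ z : ℂ, s * z.im ≤ ‖z‖ := fun z => by
        refine le_trans ?_ (abs_im_le_norm z)
        rcases hs with rfl | rfl
        · rw [one_mul]; exact le_abs_self _
        · rw [neg_one_mul]; exact neg_le_abs _
      have ht : Tendsto (fun z : ℂ => ‖z‖) (comap (fun z => s * z.im) atTop) atTop :=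
        tendsto_atTop_mono him tendsto_comap
      have h0 : Tendsto (fun z : ℂ => m * ‖w‖ * (2 * R ^ 2 / ‖z‖))
          (comap (fun z => s * z.im) atTop) (𝓝 0) := by
        simpa using (ht.const_div_atTop (2 * R ^ 2)).const_mul (m * ‖w‖)
      refine squeeze_zero_norm' ?_ h0
      filter_upwards [tendsto_comap.eventually_ge_atTop 0, ht.eventually_ge_atTop R] with z h1 h2
      refine (norm_vecMul_le _ _).trans ?_
      gcongr
      exact hc z h1 h2
    rw [transform, WeightedCurve.transform_eq P.right P.nonneg hbd (half_pos hr) hδ.ae, e1, e2,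
      smul_vecMul, smul_vecMul, ← smul_sub, vecMul_vecMul, vecMul_vecMul, ← vecMul_sub, neg_smul]
    congr 3
    rw [show (W.p ρ * V.qs' ρ - W.q ρ * V.ps' ρ) * V.p ρ -
        (W.p ρ * V.qs ρ - W.q ρ * V.ps ρ) * V.p' ρ = W.p ρ * (V.qs' ρ * V.p ρ - V.qs ρ * V.p' ρ) -
        W.q ρ * (V.ps' ρ * V.p ρ - V.ps ρ * V.p' ρ) by noncomm_ring,
      P.right.wr_qp, P.right.wr_pp, mul_one, mul_zero, sub_zero]
  have han : ∀ {f : ℂ → Fin m → ℂ}, Differentiable ℂ f → AnalyticOnNhd ℂ f univ := fun hf z _ =>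
    hf.analyticAt z
  exact congrFun ((han (WeightedCurve.differentiable_transform P.right P.nonneg hbd)
    ).eq_of_eventuallyEq (g := fun z => -(2 * π * I : ℂ) • (w ᵥ* W.p z))
    (han (hu.fun_const_smul _)) hnhds) ρ

/-- The entire companion `N` of a solution `Z`, and the Cauchy integrals `I₁` and `I₂` which express
both. -/
lemma exists_companion (P : ModelPair Γ W V x Om K R) {Z : ℂ → Fin m → ℂ}
    (hZ : Differentiable ℂ Z) {B : ℝ} (hB0 : 0 ≤ B) (hB : ∀ z ∈ Γ.carrier, ‖Z z‖ ≤ B)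
    (h : ∀ ρ, P.transform Z ρ = -(2 * π * I) • Z ρ) :
    ∃ (N I₁ I₂ : ℂ → Fin m → ℂ) (c : ℝ), 0 ≤ c ∧ Differentiable ℂ N ∧
      (∀ s, IsSign s → ∀ ρ ∈ halfPlane s, R ≤ ‖ρ‖ → ∀ δ > 0,
        Γ.Far δ ρ → Z ρ = I₁ ρ ᵥ* V.p ρ - I₂ ρ ᵥ* V.p' ρ ∧
        N ρ + Z ρ ᵥ* W.M s ρ = I₁ ρ ᵥ* V.w s ρ - I₂ ρ ᵥ* V.w' s ρ) ∧
      ∀ ρ ≠ 0, ∀ δ > 0, Γ.Far δ ρ →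
        ‖I₁ ρ‖ ≤ δ⁻¹ * c ∧ ‖I₂ ρ‖ ≤ (1 + δ⁻¹) / ‖ρ‖ * c := by
  obtain ⟨b, hb0, hb1, hb2, hb3⟩ := P.exists_factor_bound
  have hbd := P.isBounded hZ.continuous.continuousOn hB
  have hpi := Complex.two_pi_I_ne_zero
  obtain ⟨F, hF, hFe⟩ := (P.density hZ hB P.right.dps' hb1).exists_entire P.lt
  obtain ⟨G, hG, hGe⟩ := (P.density hZ hB P.right.dps hb3).exists_entire P.lt
  set I₁ : ℂ → Fin m → ℂ := fun ρ => (2 * π * I : ℂ)⁻¹ •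
    P.curve.cauchy V.ps' (fun a => Z (P.curve.c a)) ρ with hI₁
  set I₂ : ℂ → Fin m → ℂ := fun ρ => (2 * π * I : ℂ)⁻¹ •
    P.curve.cauchy V.ps (fun a => Z (P.curve.c a)) ρ with hI₂
  set N : ℂ → Fin m → ℂ := fun ρ => F ρ ᵥ* V.q ρ - G ρ ᵥ* V.q' ρ with hN
  have hNd : Differentiable ℂ N := (hF.vecMul P.right.dq).sub (hG.vecMul P.right.dq')
  have hpin : ‖(2 * π * I : ℂ)⁻¹‖ ≤ 1 := by
    rw [norm_inv]
    refine inv_le_one_of_one_le₀ ?_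
    simp only [norm_mul, Complex.norm_two, norm_I, norm_real, mul_one,
      norm_of_nonneg pi_pos.le]
    linarith [Real.pi_gt_three]
  have hsm : ∀ {v : Fin m → ℂ} {d : ℝ}, ‖v‖ ≤ d → ‖(2 * π * I : ℂ)⁻¹ • v‖ ≤ d :=
    fun hv => (norm_smul_le _ _).trans ((mul_le_of_le_one_left (norm_nonneg _) hpin).trans hv)
  refine ⟨N, I₁, I₂, m * b * B * ∫ a, (1 + ‖P.curve.c a‖) * ‖P.curve.κ a‖ ∂P.curve.μ,
    mul_nonneg (by positivity) (integral_nonneg fun a => by positivity), hNd, ?_,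
    fun ρ hρ0 δ hδ hd => ⟨hsm (WeightedCurve.norm_cauchy_le hb1 hbd hδ hd.ae),
      hsm (WeightedCurve.norm_cauchy_le_div hb2 hbd hδ hd.ae hρ0)⟩⟩
  intro s hs ρ hρ hn δ hδ hd
  have hz : Z ρ = I₁ ρ ᵥ* V.p ρ - I₂ ρ ᵥ* V.p' ρ := by
    have := h ρ
    rw [transform, WeightedCurve.transform_eq P.right P.nonneg hbd hδ hd.ae, neg_smul,
      neg_inj] at this
    rw [hI₁, hI₂, smul_vecMul, smul_vecMul, ← smul_sub, this, smul_smul, inv_mul_cancel₀ hpi,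
      one_smul]
  refine ⟨hz, ?_⟩
  have f1 := hFe s hs ρ hρ hn
  have f2 := hGe s hs ρ hρ hn
  rw [← P.cauchy_eq hZ.continuous hB P.right.dps'.continuous hb1 hδ hd] at f1
  rw [← P.cauchy_eq hZ.continuous hB P.right.dps.continuous hb3 hδ hd] at f2
  have f3 : Z ρ ᵥ* (hat W V s ρ * V.ps' ρ) ᵥ* V.q ρ - Z ρ ᵥ* (hat W V s ρ * V.ps ρ) ᵥ* V.q' ρ =
      -(Z ρ ᵥ* hat W V s ρ) := by
    rw [vecMul_vecMul, vecMul_vecMul, ← vecMul_sub, mul_assoc, mul_assoc, ← mul_sub,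
      P.right.wr_pq, mul_neg_one, vecMul_neg]
  have f4 : N ρ = I₁ ρ ᵥ* V.q ρ - I₂ ρ ᵥ* V.q' ρ - Z ρ ᵥ* hat W V s ρ := by
    rw [hN, sub_eq_add_neg (_ - _), ← f3]
    simp only [f1, f2, add_vecMul]
    abel
  have f5 : Z ρ ᵥ* V.M s ρ = I₁ ρ ᵥ* (V.p ρ * V.M s ρ) - I₂ ρ ᵥ* (V.p' ρ * V.M s ρ) := by
    rw [← vecMul_vecMul, ← vecMul_vecMul, ← sub_vecMul, ← hz]
  rw [f4, hat, Frame.w, Frame.w', vecMul_sub, vecMul_add, vecMul_add, f5]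
  abel

/-- The solutions of the homogeneous equation are the functions `w φ` with `w Ω = 0`. The entire
functions `Z` and `N` are such that `Z S*' - N φ*'` and `ρ (Z S* - N φ*)` do not grow; by
Liouville's theorem the first is a constant `w` and the second is zero. -/
theorem exists_eq_vecMul (P : ModelPair Γ W V x Om K R) {Z : ℂ → Fin m → ℂ}
    (hZ : Differentiable ℂ Z) {B : ℝ} (hB0 : 0 ≤ B) (hB : ∀ z ∈ Γ.carrier, ‖Z z‖ ≤ B)
    (h : ∀ ρ, P.transform Z ρ = -(2 * π * I) • Z ρ) :
    ∃ w, w ᵥ* Om = 0 ∧ ∀ ρ ≠ 0, Z ρ = w ᵥ* W.p ρ := by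
  obtain ⟨N, I₁, I₂, c, hc0, hNd, hrel, hI⟩ := P.exists_companion hZ hB0 hB h
  have hR1 := P.left.one_le
  -- the combinations which do not grow
  have hcomb : ∀ s, IsSign s → ∀ ρ ∈ halfPlane s, R ≤ ‖ρ‖ → ∀ δ > 0,
      Γ.Far δ ρ → ∀ f g : CMat m, Z ρ ᵥ* g - N ρ ᵥ* f =
        I₁ ρ ᵥ* (V.p ρ * (g + W.M s ρ * f) - V.w s ρ * f) -
          I₂ ρ ᵥ* (V.p' ρ * (g + W.M s ρ * f) - V.w' s ρ * f) := by
    intro s hs ρ hρ hn δ hδ hd f g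
    obtain ⟨h1, h2⟩ := hrel s hs ρ hρ hn δ hδ hd
    have h3 : Z ρ ᵥ* g - N ρ ᵥ* f =
        Z ρ ᵥ* (g + W.M s ρ * f) - (N ρ + Z ρ ᵥ* W.M s ρ) ᵥ* f := by
      rw [vecMul_add, add_vecMul, vecMul_vecMul]
      abel
    rw [h3, h2]
    nth_rw 1 [h1]
    simp only [sub_vecMul, vecMul_sub, vecMul_vecMul]
    abel
  have hgrow : ∀ ρ : ℂ, 2 * R ≤ ‖ρ‖ → ρ.im ≠ 0 →
      ‖Z ρ ᵥ* W.qs' ρ - N ρ ᵥ* W.ps' ρ‖ ≤ 8 * m * c * R ^ 2 * (1 + |ρ.im|⁻¹) ∧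
      ‖ρ • (Z ρ ᵥ* W.qs ρ - N ρ ᵥ* W.ps ρ)‖ ≤ 8 * m * c * R ^ 2 * (1 + |ρ.im|⁻¹) := by
    intro ρ hn him
    obtain ⟨s, hs, hρ⟩ := exists_mem_halfPlane him
    have hρ0 : 0 < ‖ρ‖ := by linarith
    have hi := abs_pos.2 him
    have hδ : 0 < min 1 |ρ.im| := lt_min one_pos hi
    have hd : Γ.Far (min 1 |ρ.im|) ρ := by
      rintro _ (⟨t, ht, rfl⟩ | ⟨t, -, rfl⟩)
      · have := norm_sub_norm_le ρ (Γ.c t)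
        rw [norm_sub_rev] at this
        exact (min_le_left _ _).trans (by linarith [P.lt t ht])
      · refine (min_le_right _ _).trans ?_
        simpa using abs_im_le_norm ((t : ℂ) - ρ)
    set T := 1 + |ρ.im|⁻¹ with hT
    have hT' : (min 1 |ρ.im|)⁻¹ ≤ T := by
      rcases min_choice 1 |ρ.im| with e | e <;> rw [e, hT]
      · rw [inv_one]; linarith [inv_pos.2 hi]
      · linarith
    have hT1 : 1 ≤ T := by rw [hT]; linarith [inv_pos.2 hi]
    have n1 : ‖I₁ ρ‖ ≤ 2 * c * T := (hI ρ (norm_pos_iff.1 hρ0) _ hδ hd).1.trans (by nlinarith)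
    have n2 : ‖I₂ ρ‖ ≤ 2 * c * T / ‖ρ‖ := (hI ρ (norm_pos_iff.1 hρ0) _ hδ hd).2.trans (by
        rw [div_mul_eq_mul_div]
        exact div_le_div_of_nonneg_right (by nlinarith) hρ0.le)
    obtain ⟨b1, b2, b3, b4⟩ := P.right.cross_bounds P.left hs (halfPlane_subset_closed s hρ)
      (by linarith : R ≤ ‖ρ‖)
    have hm : (0 : ℝ) ≤ m := Nat.cast_nonneg m
    have hvm : ∀ {u : Fin m → ℂ} {A : CMat m} {p q : ℝ}, ‖u‖ ≤ p → ‖A‖ ≤ q → 0 ≤ p →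
        ‖u ᵥ* A‖ ≤ m * p * q := fun h1 h2 h3 => (norm_vecMul_le _ _).trans
      (mul_le_mul (mul_le_mul_of_nonneg_left h1 hm) h2 (norm_nonneg _) (by positivity))
    have p1 : 0 ≤ 2 * c * T := by positivity
    have p2 : 0 ≤ 2 * c * T / ‖ρ‖ := by positivity
    constructor
    · rw [hcomb s hs ρ hρ (by linarith) _ hδ hd]
      refine (norm_sub_le _ _).trans ((add_le_add (hvm n1 b1 p1) (hvm n2 b3 p2)).trans_eq ?_)
      field_simp
      ring
    · rw [hcomb s hs ρ hρ (by linarith) _ hδ hd, norm_smul]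
      refine (mul_le_mul_of_nonneg_left ((norm_sub_le _ _).trans
        (add_le_add (hvm n1 b2 p1) (hvm n2 b4 p2))) hρ0.le).trans_eq ?_
      field_simp
      ring
  have hk : 0 ≤ 8 * m * c * R ^ 2 := by positivity
  have da : Differentiable ℂ fun ρ => Z ρ ᵥ* W.qs' ρ - N ρ ᵥ* W.ps' ρ :=
    (hZ.vecMul P.left.dqs').fun_sub (hNd.vecMul P.left.dps')
  have db : Differentiable ℂ fun ρ : ℂ => ρ • (Z ρ ᵥ* W.qs ρ - N ρ ᵥ* W.ps ρ) :=
    differentiable_id.fun_smul ((hZ.vecMul P.left.dqs).fun_sub (hNd.vecMul P.left.dps))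
  have ha := exists_eq_const_of_norm_le da hk fun ρ h1 h2 => (hgrow ρ h1 h2).1
  have hb := exists_eq_const_of_norm_le db hk fun ρ h1 h2 => (hgrow ρ h1 h2).2
  obtain ⟨w, hw⟩ : ∃ w, ∀ ρ, Z ρ ᵥ* W.qs' ρ - N ρ ᵥ* W.ps' ρ = w := ⟨_, ha⟩
  have hb' : ∀ ρ ≠ 0, Z ρ ᵥ* W.qs ρ - N ρ ᵥ* W.ps ρ = 0 := fun ρ hρ => by
    have := hb ρ
    rw [zero_smul, smul_eq_zero] at this
    exact this.resolve_left hρ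
  have hmul : ∀ ρ ≠ 0, ∀ f g : CMat m, w ᵥ* f = Z ρ ᵥ* (W.qs' ρ * f - W.qs ρ * g) -
      N ρ ᵥ* (W.ps' ρ * f - W.ps ρ * g) := by
    intro ρ hρ f g
    have h1 : w ᵥ* f = (Z ρ ᵥ* W.qs' ρ - N ρ ᵥ* W.ps' ρ) ᵥ* f -
        (Z ρ ᵥ* W.qs ρ - N ρ ᵥ* W.ps ρ) ᵥ* g := by
      rw [hw, hb' ρ hρ, zero_vecMul, sub_zero]
    rw [h1]
    simp only [sub_vecMul, vecMul_sub, vecMul_vecMul]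
    abel
  have hZw : ∀ ρ ≠ 0, Z ρ = w ᵥ* W.p ρ := fun ρ hρ => by
    rw [hmul ρ hρ (W.p ρ) (W.p' ρ), P.left.wr_qp, P.left.wr_pp, vecMul_one, vecMul_zero, sub_zero]
  have hNw : ∀ ρ ≠ 0, N ρ = w ᵥ* W.q ρ := fun ρ hρ => by
    rw [hmul ρ hρ (W.q ρ) (W.q' ρ), P.left.wr_qq, P.left.wr_pq, vecMul_neg, vecMul_one, vecMul_zero,
      zero_sub, neg_neg]
  refine ⟨w, ?_, hZw⟩
  -- on the imaginary axis the first Cauchy integral tends to zero, and to `w Ω`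
  have hd : ∀ y : ℝ, Γ.Far (y - R) (y * I) := by
    intro y z hz
    have h1 := abs_im_le_norm (z - y * I)
    have h2 := norm_im_lt P.lt hz
    have h3 : (z - y * I).im = z.im - y := by simp
    rw [h3] at h1
    linarith [neg_abs_le (z.im - y), le_abs_self z.im]
  have hI0 : Tendsto (fun y : ℝ => I₁ (y * I)) atTop (𝓝 0) := by
    have ht : Tendsto (fun y : ℝ => (y - R)⁻¹ * c) atTop (𝓝 0) := by
      simpa [sub_eq_add_neg] using (tendsto_inv_atTop_zero.comp
        (tendsto_atTop_add_const_right atTop (-R)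
        tendsto_id)).mul_const c
    refine squeeze_zero_norm' ?_ ht
    filter_upwards [eventually_gt_atTop R] with y hy
    refine (hI _ (norm_pos_iff.1 ?_) _ (sub_pos.2 hy) (hd y)).1
    rw [norm_mul, norm_I, mul_one, norm_real]
    exact norm_pos_iff.2 (by linarith)
  have him : Tendsto (fun y : ℝ => (y * I : ℂ)) atTop
      (comap (fun ρ : ℂ => 1 * ρ.im) atTop) :=
    tendsto_comap_iff.2 (tendsto_id.congr fun y => by simp)
  have hl := tendsto_vecMul (tendsto_const_nhds (x := w)) ((P.lim 1 (.inl rfl)).comp him)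
  refine tendsto_nhds_unique hl (hI0.congr' ?_)
  filter_upwards [eventually_gt_atTop R] with y hy
  have hy0 : 0 < y := by linarith
  have hyn : ‖(y * I : ℂ)‖ = y := by simp [abs_of_pos hy0]
  have hne : (y * I : ℂ) ≠ 0 := norm_pos_iff.1 (hyn.symm ▸ hy0)
  obtain ⟨r1, r2⟩ := hrel 1 (.inl rfl) (y * I) (by simpa [halfPlane] using hy0)
    (by rw [hyn]; exact hy.le) _ (sub_pos.2 hy) (hd y)
  obtain ⟨v1, v2⟩ := P.right.reversed 1 (y * I)
  set ρ : ℂ := y * I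
  calc I₁ ρ = I₁ ρ ᵥ* (V.p ρ * V.ws' 1 ρ - V.w 1 ρ * V.ps' ρ) -
        I₂ ρ ᵥ* (V.p' ρ * V.ws' 1 ρ - V.w' 1 ρ * V.ps' ρ) := by
        rw [v1, v2, vecMul_one, vecMul_zero, sub_zero]
    _ = Z ρ ᵥ* V.ws' 1 ρ - (N ρ + Z ρ ᵥ* W.M 1 ρ) ᵥ* V.ps' ρ := by
        rw [r2, r1]
        simp only [sub_vecMul, vecMul_sub, vecMul_vecMul]
        abel
    _ = w ᵥ* (W.p ρ * V.ws' 1 ρ - W.w 1 ρ * V.ps' ρ) := by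
        rw [hZw ρ hne, hNw ρ hne, Frame.w]
        simp only [vecMul_sub, add_vecMul, vecMul_vecMul, add_mul, vecMul_add]

end CutContour.ModelPair

/-! ### The operator and its null space -/

namespace QuadPencil

lemma Frame.IsRegular.mono {W : Frame m} {x R R' : ℝ} {K K' : Set ℂ} (h : W.IsRegular x K R)
    (hK : K ⊆ K') (hK' : IsClosed K') (hR : R ≤ R') : W.IsRegular x K' R' where
  __ := h
  closed := hK'
  contM s hs := (h.contM s hs).mono (sdiff_subset_sdiff_right hK)
  diffM s hs := (h.diffM s hs).mono (sdiff_subset_sdiff_right hK)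
  one_le := h.one_le.trans hR
  growth ρ hρ := (h.growth ρ (hR.trans hρ)).mono hR
  decay s hs ρ hs' hρ := (h.decay s hs ρ hs' (hR.trans hρ)).mono hR

/-- The rows of `φ(x, ·)` are linearly independent functions. -/
lemma ClassV.eq_zero_of_vecMul_phi (hL : L.ClassV) (hreg : L.Regular) {x : ℝ} (hx : 0 ≤ x)
    {w : Fin m → ℂ} (hw : ∀ ρ, vecMul w ((L.phi ρ).1 x) = 0) : w = 0 := by
  rcases hx.eq_or_lt with rfl | hx0
  · simpa [(hL.phi_spec 0).2.1] using hw 0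
  · have ht := tendsto_vecMul (tendsto_const_nhds (x := w))
      (hL.tendsto_phi (.inl rfl) (l := comap (fun ρ : ℂ => 1 * ρ.im) atTop) tendsto_comap hx0).1
    have hne : (comap (fun ρ : ℂ => 1 * ρ.im) atTop).NeBot :=
      comap_neBot fun t ht => by
        obtain ⟨y, hy⟩ := mem_atTop_sets.1 ht
        exact ⟨y * I, by simpa using hy y le_rfl⟩
    simp only [vecMul_smul, hw, smul_zero] at ht
    refine Matrix.eq_zero_of_vecMul_eq_zero ?_ (tendsto_nhds_unique ht tendsto_const_nhds)
    have h1 := congrArg Matrix.det (hL.PStar_mul_P (-1) hx)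
    rw [neg_neg, det_mul, Matrix.det_one] at h1
    rw [det_mul, det_smul]
    exact mul_ne_zero (right_ne_zero_of_mul (h1.trans_ne one_ne_zero))
      (mul_ne_zero (by simp) (hreg.det_ne_zero (.inl rfl)))

end QuadPencil

namespace CutContour

open QuadPencil Matrix
variable {Γ : CutContour}

/-- A pencil and a model pencil give a pair in the sense of `ModelPair`. -/
theorem exists_modelPair (hL : L.ClassV) (hLt : Lt.ClassV) (hLreg : L.Regular)
    (hLtreg : Lt.Regular) (hmodel : IsModel L Lt) (hΓL : Γ.Encloses L) (hΓLt : Γ.Encloses Lt)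
    {x : ℝ} (hx : 0 ≤ x) : ∃ (M Mt : ℝ → ℂ → CMat m) (J Jt : ℝ → Set ℂ) (K : Set ℂ) (R : ℝ),
      ModelPair Γ (L.frame M x) (Lt.frame Mt x) x (Omega L Lt x) K R ∧
      ∀ s, IsSign s → J s ∪ Jt s ⊆ K ∧ L.IsWeylFunction s (M s) (J s) ∧
        Lt.IsWeylFunction s (Mt s) (Jt s) := by
  have hch : ∀ {N : QuadPencil m}, N.ClassV → N.Regular → ∀ s : ℝ, ∃ M K, IsSign s →
      N.IsWeylFunction s M K := fun hN hr s => by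
    by_cases hs : IsSign s
    · obtain ⟨M, K, h⟩ := hN.exists_isWeylFunction hr hs
      exact ⟨M, K, fun _ => h⟩
    · exact ⟨0, ∅, fun h => absurd h hs⟩
  choose M J hM using hch hL hLreg
  choose Mt Jt hMt using hch hLt hLtreg
  have hin : ∀ {N : QuadPencil m}, Γ.Encloses N → ∀ {s : ℝ} {M : ℂ → CMat m} {K : Set ℂ},
      IsSign s → N.IsWeylFunction s M K → K ⊆ Γ.interior := by
    rintro N hN s M K hs h
    refine h.subset.trans (insert_subset (ModelPair.zero_mem_interior Γ) ?_)
    rcases hs with rfl | rfl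
    · exact hN.1
    · exact hN.2
  obtain ⟨R, h1⟩ := hL.exists_frame_isRegular hLreg hM hx
  obtain ⟨Rt, h2⟩ := hLt.exists_frame_isRegular hLtreg hMt hx
  obtain ⟨R₀, -, hR₀⟩ := Γ.loopChain.exists_norm_lt
  rw [carrier_loopChain] at hR₀
  have hcl := h1.closed.union h2.closed
  have hi := fun (s : ℝ) (hs : IsSign s) => hin hΓL hs (hM s hs)
  have hit := fun (s : ℝ) (hs : IsSign s) => hin hΓLt hs (hMt s hs)
  refine ⟨M, Mt, J, Jt, (J 1 ∪ J (-1)) ∪ (Jt 1 ∪ Jt (-1)), max (max R Rt) R₀, ⟨hx,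
    h1.mono subset_union_left hcl ((le_max_left _ _).trans (le_max_left _ _)),
    h2.mono subset_union_right hcl ((le_max_right _ _).trans (le_max_left _ _)),
    union_subset (union_subset (hi 1 (.inl rfl)) (hi (-1) (.inr rfl)))
      (union_subset (hit 1 (.inl rfl)) (hit (-1) (.inr rfl))),
    fun t ht => (hR₀ _ ⟨t, ht, rfl⟩).trans_le (le_max_right _ _), fun s hs =>
      hmodel.integrableOn_cut Γ hs (hM s hs) (hMt s hs) (hi s hs) (hit s hs), fun s hs =>
      tendsto_omega hL hLt hLreg hLtreg (hmodel.h1_eq hLreg hLtreg hL hLt (hM 1 (.inl rfl))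
        (hMt 1 (.inl rfl))) hs (hM s hs) (hMt s hs) tendsto_comap hx,
    fun w hw => hL.eq_zero_of_vecMul_phi hLreg hx hw⟩, fun s hs =>
      ⟨union_subset_union (subset_union_of_isSign J hs)
        (subset_union_of_isSign Jt hs), hM s hs, hMt s hs⟩⟩

lemma val_coe (Y : Γ.Space m) (ρ : Γ.carrier) : val Y (ρ : ℂ) = Y ρ := dif_pos ρ.2

lemma continuousOn_val (Y : Γ.Space m) : ContinuousOn (val Y) Γ.carrier := by
  rw [continuousOn_iff_continuous_domRestrict]
  exact Y.continuous.congr fun ρ => (val_coe Y ρ).symm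

lemma norm_val_le (Y : Γ.Space m) (z : ℂ) (hz : z ∈ Γ.carrier) : ‖val Y z‖ ≤ ‖Y‖ :=
  (congrArg norm (val_coe Y ⟨z, hz⟩)).trans_le (Y.norm_coe_le_norm _)

namespace ModelPair

variable {W V : Frame m} {x R : ℝ} {Om : CMat m} {K : Set ℂ}

lemma isBounded_val (P : ModelPair Γ W V x Om K R) (Y : Γ.Space m) :
    P.curve.IsBounded (fun a => val Y (P.curve.c a)) ‖Y‖ :=
  P.isBounded (continuousOn_val Y) (norm_val_le Y)

/-- The operator `Y ↦ Y + (2 π i)⁻¹ ∫ Y M̂ D̃` is bounded. -/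
lemma exists_operator (P : ModelPair Γ W V x Om K R) : ∃ A : Γ.Space m →L[ℂ] Γ.Space m,
    ∀ Y (ρ : Γ.carrier), A Y ρ = Y ρ + (2 * π * I : ℂ)⁻¹ •
      P.transform (val Y) ρ := by
  obtain ⟨b, hb0, hb⟩ := P.curve.exists_norm_transform_le P.right P.nonneg R
  set k : ℂ := (2 * π * I)⁻¹
  have hbd : ∀ (Y : Γ.Space m) (ρ : Γ.carrier),
    ‖Y ρ + k • P.transform (val Y) ρ‖ ≤ (1 + ‖k‖ * b) * ‖Y‖ := fun Y ρ => by
    refine (norm_add_le _ _).trans ((add_le_add (Y.norm_coe_le_norm ρ) ((norm_smul_le _ _).trans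
      (mul_le_mul_of_nonneg_left (hb _ _ (P.isBounded_val Y) ρ (norm_im_lt P.lt ρ.2))
        (norm_nonneg k)))).trans_eq (by ring))
  have hi := fun (Y : Γ.Space m) (ρ : ℂ) =>
    WeightedCurve.integrable_transform P.right P.nonneg (P.isBounded_val Y) ρ
  have hval : ∀ {Y Y' : Γ.Space m} {z : ℂ}, val (Y + Y') z = val Y z + val Y' z := by
    intro Y Y' z
    by_cases hz : z ∈ Γ.carrier <;> simp [val, hz]
  have hval' : ∀ {a : ℂ} {Y : Γ.Space m} {z : ℂ}, val (a • Y) z = a • val Y z := fun {a Y z} => by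
    by_cases hz : z ∈ Γ.carrier <;> simp [val, hz]
  refine ⟨LinearMap.mkContinuous
    { toFun := fun Y => BoundedContinuousFunction.ofNormedAddCommGroup
        (fun ρ : Γ.carrier => Y ρ + k • P.transform (val Y) ρ)
        (Y.continuous.add (((WeightedCurve.differentiable_transform P.right P.nonneg
          (P.isBounded_val Y)).continuous.comp continuous_subtype_val).const_smul k)) _ (hbd Y)
      map_add' := fun Y Y' => by
        ext1 ρ
        have : P.transform (val (Y + Y')) ρ = P.transform (val Y) ρ + P.transform (val Y') ρ := by
          simp only [ModelPair.transform, WeightedCurve.transform, hval, add_vecMul]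
          exact integral_add (hi Y ρ) (hi Y' ρ)
        change (Y ρ + Y' ρ) + k • _ = (Y ρ + k • _) + (Y' ρ + k • _)
        rw [this, smul_add]
        abel
      map_smul' := fun a Y => by
        ext1 ρ
        have : P.transform (val (a • Y)) ρ = a • P.transform (val Y) ρ := by
          simp only [ModelPair.transform, WeightedCurve.transform, hval', smul_vecMul]
          exact integral_smul a _
        change a • Y ρ + k • _ = a • (Y ρ + k • _)
        rw [this, smul_add, smul_comm k a] }
    (1 + ‖k‖ * b) fun Y => BoundedContinuousFunction.norm_ofNormedAddCommGroup_le _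
      (by positivity) (hbd Y), fun Y ρ => rfl⟩

/-- The null space of the operator is the space of the functions `w φ`, `w Ω = 0`. -/
lemma exists_ker_eq (P : ModelPair Γ W V x Om K R) {A : Γ.Space m →L[ℂ] Γ.Space m}
    (hA : ∀ Y (ρ : Γ.carrier), A Y ρ = Y ρ + (2 * π * I : ℂ)⁻¹ •
      P.transform (val Y) ρ) :
    ∃ T : (Fin m → ℂ) →ₗ[ℂ] Γ.Space m, Function.Injective T ∧
      LinearMap.ker (A : Γ.Space m →ₗ[ℂ] Γ.Space m) = (LinearMap.ker Om.vecMulLinear).map T := by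
  have hpi := Complex.two_pi_I_ne_zero
  choose B hB0 hB using P.exists_norm_vecMul_le
  have hd : ∀ w : Fin m → ℂ, Differentiable ℂ fun z => w ᵥ* W.p z := fun w =>
    (differentiable_const w).vecMul P.left.dp
  set T : (Fin m → ℂ) →ₗ[ℂ] Γ.Space m :=
    { toFun := fun w => BoundedContinuousFunction.ofNormedAddCommGroup
        (fun ρ : Γ.carrier => w ᵥ* W.p ρ) ((hd w).continuous.comp continuous_subtype_val) (B w)
        fun ρ => hB w ρ ρ.2
      map_add' := fun w w' => BoundedContinuousFunction.ext fun ρ =>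
        add_vecMul (W.p ρ) w w'
      map_smul' := fun a w => BoundedContinuousFunction.ext fun ρ =>
        smul_vecMul a w (W.p ρ) }
  have hT : ∀ w (ρ : Γ.carrier), T w ρ = w ᵥ* W.p ρ := fun w ρ => rfl
  refine ⟨T, (injective_iff_map_eq_zero T).2 fun w hw => P.inj w ?_, ?_⟩
  · -- the real axis far out belongs to the contour, so the identity theorem applies
    have hz : ∀ θ : ℝ, Γ.right ≤ θ → w ᵥ* W.p θ = 0 := fun θ hθ =>
      (hT w ⟨θ, Or.inr ⟨θ, Or.inr hθ, rfl⟩⟩).symm.trans (by rw [hw]; rfl)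
    have hf : ∃ᶠ z in 𝓝[≠] ((Γ.right + 1 : ℝ) : ℂ), w ᵥ* W.p z = 0 := by
      have ht : Tendsto (fun θ : ℝ => (θ : ℂ)) (𝓝[>] (Γ.right + 1))
          (𝓝[≠] ((Γ.right + 1 : ℝ) : ℂ)) :=
        tendsto_nhdsWithin_iff.2 ⟨(continuous_ofReal.tendsto _).mono_left
          nhdsWithin_le_nhds, by
            filter_upwards [self_mem_nhdsWithin] with θ hθ e
            exact (ne_of_gt hθ) (Complex.ofReal_injective e)⟩
      refine ht.frequently (Eventually.frequently ?_)
      filter_upwards [self_mem_nhdsWithin] with θ hθ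
      exact hz θ (by linarith [mem_Ioi.1 hθ])
    have := AnalyticOnNhd.eq_of_frequently_eq (f := fun z => w ᵥ* W.p z) (g := fun _ => 0)
      (fun z _ => (hd w).analyticAt z) (fun z _ => analyticAt_const) hf
    exact congrFun this
  · have hcongr : ∀ (Y : Γ.Space m) (u : ℂ → Fin m → ℂ), (∀ ρ : Γ.carrier, Y ρ = u ρ) → ∀ ρ,
        P.transform (val Y) ρ =
          P.transform u ρ := fun Y u h ρ => by
      refine integral_congr_ae ((ae_point (p := fun z => val Y z = u z) fun z hz =>
        (val_coe Y ⟨z, hz⟩).trans (h ⟨z, hz⟩)).mono fun a ha => ?_)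
      have ha' : val Y (P.curve.c a) = u (P.curve.c a) := ha
      simp only [ha']
    ext Y
    rw [LinearMap.mem_ker, Submodule.mem_map]
    constructor
    · intro hY
      set Z : ℂ → Fin m → ℂ := fun ρ => -((2 * π * I : ℂ)⁻¹ •
        P.transform (val Y) ρ) with hZ
      have hYZ : ∀ ρ : Γ.carrier, Y ρ = Z ρ := fun ρ =>
        eq_neg_of_add_eq_zero_left ((hA Y ρ).symm.trans (by
          have : A Y = 0 := hY
          rw [this]; rfl))
      obtain ⟨w, hw, hZw⟩ := P.exists_eq_vecMul (Z := Z)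
        ((WeightedCurve.differentiable_transform P.right P.nonneg
          (P.isBounded_val Y)).fun_const_smul _).fun_neg (norm_nonneg Y)
        (fun z hz => by rw [← hYZ ⟨z, hz⟩]; exact Y.norm_coe_le_norm _) fun ρ => by
          rw [← hcongr Y Z hYZ, hZ, neg_smul, smul_neg, neg_neg, smul_smul, mul_inv_cancel₀ hpi,
            one_smul]
      refine ⟨w, hw, BoundedContinuousFunction.ext fun ρ => ?_⟩
      rw [hT, hYZ, hZw]
      exact fun e => notMem_interior ρ.2 (e ▸ zero_mem_interior Γ)
    · rintro ⟨w, hw, rfl⟩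
      refine BoundedContinuousFunction.ext fun ρ => (hA _ ρ).trans ?_
      rw [hcongr _ (fun z => w ᵥ* W.p z) (hT w), P.transform_vecMul hw, smul_smul, mul_neg,
        inv_mul_cancel₀ hpi,
        neg_one_smul, hT, add_neg_cancel]
      rfl

end ModelPair

/-- The integral with the weight is the integral in the definition of the operator: the value of `D`
at the removable singularity and the real points of `γ₀` do not matter. -/
lemma isModelOperator {M Mt : ℝ → ℂ → CMat m} {J Jt : ℝ → Set ℂ} {K : Set ℂ} {x R : ℝ} {Om : CMat m}
    (P : ModelPair Γ (L.frame M x) (Lt.frame Mt x) x Om K R)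
    (hJ : ∀ s, IsSign s → J s ∪ Jt s ⊆ K ∧ L.IsWeylFunction s (M s) (J s) ∧
      Lt.IsWeylFunction s (Mt s) (Jt s)) {A : Γ.Space m →L[ℂ] Γ.Space m}
    (hA : ∀ Y (ρ : Γ.carrier), A Y ρ = Y ρ + (2 * π * I : ℂ)⁻¹ •
      P.transform (val Y) ρ) :
    Γ.IsModelOperator L Lt x A := by
  intro Y ρ
  set W := L.frame M x
  set V := Lt.frame Mt x
  obtain ⟨⟨i0, i1, i2⟩, hI⟩ := P.integral_curve
    (T := fun z A => val Y z ᵥ* (A * V.dreg ρ z))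
    (fun z a A => by rw [smul_mul_assoc, vecMul_smul])
    (WeightedCurve.integrable_transform P.right P.nonneg (P.isBounded_val Y) ρ)
  have hK : ∀ z ∈ Γ.carrier, ∀ s, IsSign s → z ∉ J s ∧ z ∉ Jt s := fun z hz s hs =>
    ⟨fun h => ModelPair.notMem_interior hz (P.subset ((hJ s hs).1 (.inl h))),
      fun h => ModelPair.notMem_interior hz (P.subset ((hJ s hs).1 (.inr h)))⟩
  have e0 : ∀ᵐ t ∂volume.restrict (Ioc (0 : ℝ) 1),
      deriv Γ.c t • (val Y (Γ.c t) ᵥ* (glued W V (Γ.c t) * V.dreg ρ (Γ.c t))) =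
        deriv Γ.c t • kernel L Lt x Y ρ (Γ.c t) := by
    filter_upwards [ae_curve ρ, ae_restrict_mem measurableSet_Ioc] with t ht ht'
    obtain ⟨s, hs, hm⟩ := ModelPair.exists_mem_halfPlane ht.2
    obtain ⟨k1, k2⟩ := hK (Γ.c t) (.inl ⟨t, ⟨ht'.1.le, ht'.2⟩, rfl⟩) s hs
    rw [kernel, glued_eq hs hm, P.right.dreg_eq ht.1, Mhat, (hJ s hs).2.1.weyl_eq _ ⟨hm, k1⟩,
      (hJ s hs).2.2.weyl_eq _ ⟨hm, k2⟩]
    rfl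
  have es : ∀ s, IsSign s → ∀ᵐ θ : ℝ ∂volume.restrict Γ.cut,
      val Y θ ᵥ* (hat W V s θ * V.dreg ρ θ) = kernelSide L Lt s x Y ρ θ := by
    intro s hs
    have hne : ∀ᵐ θ : ℝ ∂volume.restrict Γ.cut, (θ : ℂ) ≠ ρ :=
      ae_restrict_of_ae ((Set.Countable.ae_notMem (Subsingleton.countable
        (s := {θ : ℝ | (θ : ℂ) = ρ}) fun a ha b hb => Complex.ofReal_injective
          (ha.trans hb.symm)) volume).mono fun θ h => h)
    filter_upwards [hne, ae_restrict_mem Γ.measurableSet_cut] with θ h1 h2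
    obtain ⟨k1, k2⟩ := hK θ (.inr ⟨θ, h2, rfl⟩) s hs
    rw [kernelSide, P.right.dreg_eq h1, MhatSide, (hJ s hs).2.1.weylSide_eq _ k1,
      (hJ s hs).2.2.weylSide_eq _ k2]
    rfl
  refine ⟨⟨?_, i1.congr (es 1 (.inl rfl)), i2.congr (es (-1) (.inr rfl))⟩, ?_⟩
  · rw [intervalIntegrable_iff_integrableOn_Ioc_of_le zero_le_one] at i0 ⊢
    exact i0.congr e0
  · rw [hA, ModelPair.transform, WeightedCurve.transform, hI, CutContour.integral,
      CutContour.integral,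
      integral_of_le zero_le_one, integral_of_le zero_le_one,
      integral_congr_ae e0, integral_congr_ae (es 1 (.inl rfl)),
      integral_congr_ae (es (-1) (.inr rfl))]

end CutContour

theorem mainTheorem3 (m : ℕ) (L Lt : QuadPencil m) (hL : L.ClassV) (hLt : Lt.ClassV)
    (hLreg : L.Regular) (hLtreg : Lt.Regular) (hmodel : QuadPencil.IsModel L Lt)
    (Γ : CutContour) (hΓL : Γ.Encloses L) (hΓLt : Γ.Encloses Lt) (x : ℝ) (hx : 0 ≤ x) :
    ∃ A : Γ.Space m →L[ℂ] Γ.Space m, Γ.IsModelOperator L Lt x A ∧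
      Module.Finite ℂ (LinearMap.ker (A : Γ.Space m →ₗ[ℂ] Γ.Space m)) ∧
      Module.finrank ℂ (LinearMap.ker (A : Γ.Space m →ₗ[ℂ] Γ.Space m))
        = m - (QuadPencil.Omega L Lt x).rank ∧
      ((QuadPencil.Omega L Lt x).det ≠ 0 → ∀ Y : Γ.Space m, A Y = 0 → Y = 0) := by
  obtain ⟨M, Mt, J, Jt, K, R, P, hJ⟩ :=
    CutContour.exists_modelPair hL hLt hLreg hLtreg hmodel hΓL hΓLt hx
  obtain ⟨A, hA⟩ := P.exists_operator
  obtain ⟨T, hT, hker⟩ := P.exists_ker_eq hA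
  refine ⟨A, CutContour.isModelOperator P hJ hA, ?_, ?_, fun hdet Y hY => ?_⟩
  · rw [hker]
    infer_instance
  · rw [hker, ← (Submodule.equivMapOfInjective T hT _).finrank_eq, ← Matrix.rank_transpose,
      Matrix.rank, Matrix.mulVecLin_transpose]
    have := (QuadPencil.Omega L Lt x).vecMulLinear.finrank_range_add_finrank_ker
    rw [Module.finrank_fin_fun] at this
    omega
  · have hm : Y ∈ LinearMap.ker (A : Γ.Space m →ₗ[ℂ] Γ.Space m) := hY
    rw [hker] at hm
    obtain ⟨w, hw, rfl⟩ := hm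
    rw [Matrix.eq_zero_of_vecMul_eq_zero hdet hw, map_zero]
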